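/- Let $\widehat{\mathfrak g}$ be an affine Lie algebra of one of the types $A_n^{(1)}$ ($n\ge 1$), $B_n^{(1)}$ ($n\ge3$), $C_n^{(1)}$ ($n\ge2$), $D_n^{(1)}$ ($n\ge4$), $E_6^{(1)},E_7^{(1)},E_8^{(1)},F_4^{(1)},G_2^{(1)}$, $A_{2n}^{(2)}$ ($n\ge1$), $A_{2n-1}^{(2)}$ ($n\ge3$), $D_{n+1}^{(2)}$ ($n\ge2$), $E_6^{(2)}$, $D_4^{(3)}$, with Cartan matrix $(a_{j,k})_{0\le j,k\le n}$, $a_{j,k}=\langle h_j,\alpha_k\rangle$, and null root $\delta=d_0\alpha_0+\dots+d_n\alpha_n$, where $d_0=1$, except that $d_0=2$ in type $A_{2n}^{(2)}$. Let $\mathfrak g$ be the simple Lie algebra obtained by deleting vertex $0$, and put $\theta=\frac1{d_0}(d_1\alpha_1+\dots+d_n\alpha_n)$. Let $\Lambda$ be the set of weights of the simple module of highest weight $\theta$, i.e. the smallest set that contains $\theta$ and contains, with each $\mu$ and each $j\in\{1,\dots,n\}$, all $\mu-k\alpha_j$ with $k$ an integer between $0$ and $\langle h_j,\mu\rangle$.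 Let $\Lambda^+$ be the set of nonzero elements of $\Lambda$ that have nonnegative coefficients in $\alpha_1,\dots,\alpha_n$. The crystal $\mathcal B(\theta)$ (without $0$-arrows) has vertices $x_{\alpha},x_{-\alpha}$ ($\alpha\in\Lambda^+$), of weights $\alpha,-\alpha$, and $y_j$ ($\alpha_j\in\Lambda^+$), of weight $0$. Its arrows of colour $j\in\{1,\dots,n\}$ are $x_\mu\to x_{\mu-\alpha_j}$ (whenever both are vertices) and $x_{\alpha_j}\to y_j\to x_{-\alpha_j}$ (if $\alpha_j\in\Lambda^+$). An arrow $b\to b'$ of colour $j$ means $\tilde f_jb=b'$ and $\tilde e_jb'=b$, and all other values of $\tilde f_j,\tilde e_j$ are $0$; $\varepsilon_j(b)$ and $\varphi_j(b)$ are the largest $k\ge 0$ with $\tilde e_j^kb\ne0$ and $\tilde f_j^kb\neq0$, respectively. On $\mathcal B(\theta)\otimes\mathcal B(\theta)$ weights add, $\tilde e_j(b_1\otimes b_2)$ is $\tilde e_jb_1\otimes b_2$ if $\varphi_j(b_1)\ge\varepsilon_j(b_2)$ and $b_1\otimes\tilde e_jb_2$ otherwise, and $\tilde f_j(b_1\otimes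 b_2)$ is $\tilde f_jb_1\otimes b_2$ if $\varphi_j(b_1)>\varepsilon_j(b_2)$ and $b_1\otimes\tilde f_jb_2$ otherwise. Let $\mathcal C(b)$ denote the connected component of $b$ in the crystal graph $\mathcal B(\theta)\otimes\mathcal B(\theta)$. **Proposition.** Let $i\in\{1,\dots,n\}$ be a vertex that is joined to vertex $0$ in the Dynkin diagram of $\widehat{\mathfrak g}$ and satisfies $\alpha_i\in\Lambda^+$. Then there is an isomorphism of crystals $\Psi:\mathcal B(\theta)\to\mathcal C(x_\theta\otimes y_i)$ (a bijection that preserves weights, $\varepsilon_j$ and $\varphi_j$, and commutes with $\tilde e_j$ and $\tilde f_j$ for $j=1,\dots,n$), given by the following formulas. In all types, if $\gamma\in\Lambda^+$ and $\Psi(x_\gamma)=b\otimes c$, then $\Psi(x_{-\gamma})=c^*\otimes b^*$, where $x_\mu^*=x_{-\mu}$ and $y_j^*=y_j$. (1) Suppose the type is neither $A_n^{(1)}$ nor $C_n^{(1)}$. For each $\gamma\in\Lambda^+$ the coefficient of $\alpha_i$ in $\gamma$ is $0$, $1$ or $2$; it is $2$ exactly when $\gamma=\theta$; and - $\Psi(x_\theta)=x_\theta\otimes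 y_i$; - if the coefficient is $1$, then $\Psi(x_\gamma)=x_\theta\otimes x_{-\beta}$ with $\beta=\theta-\gamma$; - if the coefficient is $0$, then there is a path $j_1,\dots,j_s=i$ (without repeated vertices) in the Dynkin diagram of $\mathfrak g$ that avoids the support of $\gamma$ and whose first vertex is joined to a vertex of the support of $\gamma$; and for every such path $\Psi(x_\gamma)=x_{\theta-\alpha}\otimes x_{-\beta}$ with $\alpha=\alpha_{j_1}+\dots+\alpha_{j_s}$ and $\beta=\theta-\gamma-\alpha$; - if $\alpha_j\in\Lambda^+$, then there is a path from $i$ to $j$ in the Dynkin diagram of $\mathfrak g$, and $\Psi(y_j)=x_{\theta-\alpha}\otimes x_{-\theta+\alpha}$ with $\alpha$ the sum of the simple roots along any such path (for $j=i$, $\alpha=\alpha_i$). Write $\alpha_{j,k}=\alpha_j+\alpha_{j+1}+\dots+\alpha_k$ for $1\le j\le k\le n$. (2) Suppose the type is $A_n^{(1)}$, with vertices $0,1,\dots,n$ numbered in cyclic order (so $i=1$ or $i=n$). If $i=1$, then $\Psi(x_{\alpha_{j,k}})=x_{\alpha_{1,k}}\otimes x_{-\alpha_{1,j-1}}$ for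 $2\le j\le k\le n$, $\Psi(x_{\alpha_{1,k}})=x_{\alpha_{1,k}}\otimes y_1$ for $1\le k\le n$, $\Psi(y_j)=x_{\alpha_{1,j-1}}\otimes x_{-\alpha_{1,j-1}}$ for $2\le j\le n$, and $\Psi(y_1)=y_1\otimes y_1$. If $i=n$, then $\Psi(x_{\alpha_{j,k}})=x_{\alpha_{j,n}}\otimes x_{-\alpha_{k+1,n}}$ for $1\le j\le k\le n-1$, $\Psi(x_{\alpha_{j,n}})=x_{\alpha_{j,n}}\otimes y_n$ for $1\le j\le n$, $\Psi(y_j)=x_{\alpha_{j+1,n}}\otimes x_{-\alpha_{j+1,n}}$ for $1\le j\le n-1$, and $\Psi(y_n)=y_n\otimes y_n$. (3) Suppose the type is $C_n^{(1)}$, with vertices numbered so that $0$ and $n$ are the end vertices of the diagram and $\alpha_0,\alpha_n$ are the long simple roots (so $i=1$). Put $\gamma_{j,k}=\alpha_j+\dots+\alpha_{k-1}+2\alpha_k+\dots+2\alpha_{n-1}+\alpha_n$ for $1\le j\le k\le n-1$. Then $\Psi(x_{\gamma_{j,k}})=x_{\gamma_{1,k}}\otimes x_{-\alpha_{1,j-1}}$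 for $2\le j\le k\le n-1$, $\Psi(x_{\gamma_{1,k}})=x_{\gamma_{1,k}}\otimes y_1$ for $1\le k\le n-1$, $\Psi(x_{\alpha_{j,k}})=x_{\alpha_{1,k}}\otimes x_{-\alpha_{1,j-1}}$ for $2\le j\le k\le n$, $\Psi(x_{\alpha_{1,k}})=x_{\alpha_{1,k}}\otimes y_1$ for $1\le k\le n$, $\Psi(y_j)=x_{\alpha_{1,j-1}}\otimes x_{-\alpha_{1,j-1}}$ for $2\le j\le n$, and $\Psi(y_1)=y_1\otimes y_1$. Moreover, the map $\mathfrak m:\mathcal B(\theta)\otimes\mathcal B(\theta)\to\mathcal B(\theta)\cup\{0\}$ that equals $\Psi^{-1}$ on $\mathcal C(x_\theta\otimes y_i)$ and $0$ on all other components is a strict morphism of crystals: it commutes with all $\tilde e_j,\tilde f_j$ (where $\mathfrak m(0)=0$) and preserves weights, $\varepsilon_j$ and $\varphi_j$ on all elements that it does not send to $0$. -/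

import Mathlib

/-! ### Crystal graphs, tensor products, components, morphisms -/

/-- The combinatorial data of a crystal with index set `I`, weights in `P` and vertex set `B`.
The Kashiwara operators take the value `none` where the crystal literature writes `0`. -/
structure Crystal (I P B : Type) where
  e : I → B → Option B
  f : I → B → Option B
  wt : B → P

namespace Crystal

variable {I P B B' : Type}

/-- `ε_i(b) = max {k ≥ 0 | e_i^k b ≠ 0}`. -/
noncomputable def eps (C : Crystal I P B) (i : I) (b : B) : ℕ :=
  sSup {k : ℕ | (fun o : Option B => o.bind (C.e i))^[k] (some b) ≠ none}

/-- `φ_i(b) = max {k ≥ 0 | f_i^k b ≠ 0}`. -/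
noncomputable def phi (C : Crystal I P B) (i : I) (b : B) : ℕ :=
  sSup {k : ℕ | (fun o : Option B => o.bind (C.f i))^[k] (some b) ≠ none}

/-- The tensor product of crystals; the pair `(b₁, b₂)` is `b₁ ⊗ b₂`. -/
noncomputable def tensor [Add P] (C : Crystal I P B) (D : Crystal I P B') :
    Crystal I P (B × B') where
  e i b :=
    if D.eps i b.2 ≤ C.phi i b.1 then (C.e i b.1).map (fun c => (c, b.2))
    else (D.e i b.2).map (fun c => (b.1, c))
  f i b :=
    if D.eps i b.2 < C.phi i b.1 then (C.f i b.1).map (fun c => (c, b.2))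
    else (D.f i b.2).map (fun c => (b.1, c))
  wt b := C.wt b.1 + D.wt b.2

open Classical in
/-- The full subgraph of a crystal on a set `S` of vertices; arrows leaving `S` are deleted. -/
noncomputable def restrict (C : Crystal I P B) (S : Set B) : Crystal I P S where
  e i b := (C.e i b).bind (fun c => if h : c ∈ S then some ⟨c, h⟩ else none)
  f i b := (C.f i b).bind (fun c => if h : c ∈ S then some ⟨c, h⟩ else none)
  wt b := C.wt b

/-- The vertices of the connected component of `b` in the (undirected) crystal graph. -/
def component (C : Crystal I P B) (b : B) : Set B :=
  {c | Relation.EqvGen (fun a a' => ∃ i, C.f i a = some a') b c}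

/-- The connected component of `b`, as a crystal. -/
noncomputable def componentCrystal (C : Crystal I P B) (b : B) :
    Crystal I P (C.component b) :=
  C.restrict (C.component b)

/-- Isomorphisms of crystals. -/
structure Iso (C : Crystal I P B) (D : Crystal I P B') extends B ≃ B' where
  wt_eq : ∀ b, D.wt (toFun b) = C.wt b
  eps_eq : ∀ i b, D.eps i (toFun b) = C.eps i b
  phi_eq : ∀ i b, D.phi i (toFun b) = C.phi i b
  e_comm : ∀ i b, D.e i (toFun b) = (C.e i b).map toFun
  f_comm : ∀ i b, D.f i (toFun b) = (C.f i b).map toFun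

/-- Strict morphisms of crystals `B ∪ {0} → B' ∪ {0}`: they send `0` to `0`, preserve `wt`, `ε_i`
and `φ_i` on the vertices not sent to `0`, and commute with all `e_i` and `f_i`. -/
structure IsStrictMorphism (C : Crystal I P B) (D : Crystal I P B') (m : B → Option B') :
    Prop where
  wt_eq : ∀ b c, m b = some c → D.wt c = C.wt b
  eps_eq : ∀ i b c, m b = some c → D.eps i c = C.eps i b
  phi_eq : ∀ i b c, m b = some c → D.phi i c = C.phi i b
  e_comm : ∀ i b, (C.e i b).bind m = (m b).bind (D.e i)
  f_comm : ∀ i b, (C.f i b).bind m = (m b).bind (D.f i)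

open Classical in
/-- The inverse of an isomorphism from `C` onto the component of `b₀` in `D`, extended by `0` to
the other components of `D`. -/
noncomputable def Iso.inverseByZero {C : Crystal I P B} {D : Crystal I P B'} {b₀ : B'}
    (Ψ : Iso C (D.componentCrystal b₀)) (b : B') : Option B :=
  if h : b ∈ D.component b₀ then some (Ψ.toEquiv.symm ⟨b, h⟩) else none

end Crystal

/-! ### Affine Cartan matrices -/

/-- The affine types: `X_n^{(1)}` for `A, …, G2`, then `A_{2n}^{(2)}`, `A_{2n-1}^{(2)}`,
`D_{n+1}^{(2)}`, `E_6^{(2)}` and `D_4^{(3)}`. -/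
inductive AffineType : Type
  | A (n : ℕ) (hn : 1 ≤ n)
  | B (n : ℕ) (hn : 3 ≤ n)
  | C (n : ℕ) (hn : 2 ≤ n)
  | D (n : ℕ) (hn : 4 ≤ n)
  | E6
  | E7
  | E8
  | F4
  | G2
  | A2Even (n : ℕ) (hn : 1 ≤ n)
  | A2Odd (n : ℕ) (hn : 3 ≤ n)
  | D2 (n : ℕ) (hn : 2 ≤ n)
  | E62
  | D43

/-- Cartan matrix entries of a chain `0 - 1 - 2 - ⋯` of simple edges. -/
def chainEntry (i j : ℕ) : ℤ :=
  if i = j then 2 else if i + 1 = j ∨ j + 1 = i then -1 else 0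

/-- Cartan matrix entries of a chain `1 - 2 - 3 - ⋯` of simple edges, with `0` joined to `2`. -/
def forkEntry (i j : ℕ) : ℤ :=
  if i = j then 2
  else if (i = 0 ∧ j = 2) ∨ (i = 2 ∧ j = 0) then -1
  else if (1 ≤ i ∧ i + 1 = j) ∨ (1 ≤ j ∧ j + 1 = i) then -1
  else 0

/-- Cartan matrix entries of a simply laced diagram with the given edges. -/
def edgeEntry (edges : List (ℕ × ℕ)) (i j : ℕ) : ℤ :=
  if i = j then 2 else if (i, j) ∈ edges ∨ (j, i) ∈ edges then -1 else 0

namespace AffineType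

/-- The number `n`; the vertices of the affine diagram are `0, 1, …, n`. -/
def rank : AffineType → ℕ
  | A n _ => n
  | B n _ => n
  | C n _ => n
  | D n _ => n
  | E6 => 6
  | E7 => 7
  | E8 => 8
  | F4 => 4
  | G2 => 2
  | A2Even n _ => n
  | A2Odd n _ => n
  | D2 n _ => n
  | E62 => 4
  | D43 => 2

/-- The entries `a_{i,j} = ⟨h_i, α_j⟩` (`0 ≤ i, j ≤ n`) of the affine Cartan matrix. -/
def entry : AffineType → ℕ → ℕ → ℤ
  | A n _, i, j =>
      if n = 1 then (if i = j then 2 else -2)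
      else if (i = 0 ∧ j = n) ∨ (i = n ∧ j = 0) then -1
      else chainEntry i j
  | B n _, i, j => if i = n ∧ j + 1 = n then -2 else forkEntry i j
  | C n _, i, j => if (i = 1 ∧ j = 0) ∨ (i + 1 = n ∧ j = n) then -2 else chainEntry i j
  | D n _, i, j =>
      if i = j then 2
      else if (i = n ∧ j + 2 = n) ∨ (j = n ∧ i + 2 = n) then -1
      else if i = n ∨ j = n then 0
      else forkEntry i j
  | E6, i, j => edgeEntry [(1, 2), (2, 3), (3, 4), (4, 5), (3, 6), (6, 0)] i j
  | E7, i, j => edgeEntry [(0, 1), (1, 2), (2, 3), (3, 4), (4, 5), (5, 6), (3, 7)] i j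
  | E8, i, j => edgeEntry [(0, 1), (1, 2), (2, 3), (3, 4), (4, 5), (5, 6), (6, 7), (5, 8)] i j
  | F4, i, j => if i = 3 ∧ j = 2 then -2 else chainEntry i j
  | G2, i, j => if i = 2 ∧ j = 1 then -3 else chainEntry i j
  | A2Even n _, i, j =>
      if n = 1 then (if i = 0 ∧ j = 1 then -4 else chainEntry i j)
      else if (i = 0 ∧ j = 1) ∨ (i + 1 = n ∧ j = n) then -2
      else chainEntry i j
  | A2Odd n _, i, j => if i + 1 = n ∧ j = n then -2 else forkEntry i j
  | D2 n _, i, j => if (i = 0 ∧ j = 1) ∨ (i = n ∧ j + 1 = n) then -2 else chainEntry i j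
  | E62, i, j => if i = 2 ∧ j = 3 then -2 else chainEntry i j
  | D43, i, j => if i = 1 ∧ j = 2 then -3 else chainEntry i j

/-- The coefficients `d_0, …, d_n` of the null root `δ = d_0 α_0 + ⋯ + d_n α_n`. -/
def mark : AffineType → ℕ → ℕ
  | A _ _, _ => 1
  | B _ _, k => if k ≤ 1 then 1 else 2
  | C n _, k => if k = 0 ∨ k = n then 1 else 2
  | D n _, k => if k ≤ 1 ∨ k + 1 = n ∨ k = n then 1 else 2
  | E6, k => [1, 1, 2, 3, 2, 1, 2].getD k 1
  | E7, k => [1, 2, 3, 4, 3, 2, 1, 2].getD k 1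
  | E8, k => [1, 2, 3, 4, 5, 6, 4, 2, 3].getD k 1
  | F4, k => [1, 2, 3, 4, 2].getD k 1
  | G2, k => [1, 2, 3].getD k 1
  | A2Even n _, k => if k = n then 1 else 2
  | A2Odd n _, k => if k ≤ 1 ∨ k = n then 1 else 2
  | D2 _ _, _ => 1
  | E62, k => [1, 2, 3, 2, 1].getD k 1
  | D43, k => [1, 2, 1].getD k 1

/-- The affine Cartan matrix. -/
def cartan (t : AffineType) : Matrix (Fin (t.rank + 1)) (Fin (t.rank + 1)) ℤ :=
  Matrix.of fun i j => t.entry i j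

/-! ### The weights of the simple module with highest weight `θ`

Weights of the finite-dimensional algebra are written in the basis of its simple roots
`α_1, …, α_n`; the index `i : Fin t.rank` stands for the vertex `i + 1` of the affine diagram. -/

/-- The rational span of the simple roots `α_1, …, α_n`. -/
abbrev Weight (t : AffineType) : Type := Fin t.rank → ℚ

def simpleRoot (t : AffineType) (i : Fin t.rank) : t.Weight := Pi.single i 1

/-- `⟨h_i, μ⟩` for a vertex `i ≠ 0`. -/
def pairing (t : AffineType) (i : Fin t.rank) (μ : t.Weight) : ℚ :=
  ∑ k, (t.cartan i.succ k.succ : ℚ) * μ k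

/-- `θ = d_1 α_1 + ⋯ + d_n α_n`, halved in type `A_{2n}^{(2)}`, the only type with `d_0 = 2`. -/
def theta (t : AffineType) : t.Weight := fun k => (t.mark (k + 1) : ℚ) / (t.mark 0 : ℚ)

/-- The set `Λ` of weights of the simple module with highest weight `θ`: the smallest
saturated set containing `θ`. -/
inductive IsWeight (t : AffineType) : t.Weight → Prop
  | highest : IsWeight t t.theta
  | string (μ : t.Weight) (i : Fin t.rank) (k : ℤ) (hμ : IsWeight t μ)
      (hk : (0 ≤ k ∧ (k : ℚ) ≤ t.pairing i μ) ∨ (k ≤ 0 ∧ t.pairing i μ ≤ (k : ℚ))) :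
      IsWeight t (μ - (k : ℚ) • t.simpleRoot i)

/-- `Λ⁺`: the nonzero weights in `Λ` with nonnegative coefficients. -/
def positiveWeights (t : AffineType) : Set t.Weight :=
  {μ | t.IsWeight μ ∧ μ ≠ 0 ∧ 0 ≤ μ}

/-! ### The crystal `B(θ)`, without `0`-arrows -/

/-- The symbols `x_μ` and `y_i`. -/
inductive Label (t : AffineType) : Type
  | x (μ : t.Weight)
  | y (i : Fin t.rank)

/-- The vertices of `B(θ)`: `x_α` and `x_{-α}` for `α ∈ Λ⁺`, and `y_i` for `α_i ∈ Λ⁺`. -/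
def vertices (t : AffineType) : Set t.Label :=
  {b | match b with
    | .x μ => μ ∈ t.positiveWeights ∨ -μ ∈ t.positiveWeights
    | .y i => t.simpleRoot i ∈ t.positiveWeights}

/-- The arrows `x_μ → x_{μ - α_i}` and `x_{α_i} → y_i → x_{-α_i}` of colour `i` on all symbols. -/
def labelCrystal (t : AffineType) : Crystal (Fin t.rank) t.Weight t.Label where
  f i b := match b with
    | .x μ => if μ = t.simpleRoot i then some (.y i) else some (.x (μ - t.simpleRoot i))
    | .y j => if j = i then some (.x (-t.simpleRoot i)) else none
  e i b := match b with
    | .x μ => if μ = -t.simpleRoot i then some (.y i) else some (.x (μ + t.simpleRoot i))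
    | .y j => if j = i then some (.x (t.simpleRoot i)) else none
  wt b := match b with
    | .x μ => μ
    | .y _ => 0

/-- The crystal `B(θ)`. -/
noncomputable def thetaCrystal (t : AffineType) :
    Crystal (Fin t.rank) t.Weight t.vertices :=
  t.labelCrystal.restrict t.vertices

theorem rank_pos (t : AffineType) : 0 < t.rank := by
  cases t <;> simp only [rank] <;> omega

theorem theta_mem_positiveWeights (t : AffineType) : t.theta ∈ t.positiveWeights := by
  refine ⟨.highest, fun h => ?_, fun k => by simp only [theta, Pi.zero_apply]; positivity⟩
  have h1 := congrFun h ⟨0, t.rank_pos⟩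
  have h2 : t.mark 1 ≠ 0 := by
    cases t <;> simp only [mark] <;> first | decide | (split_ifs <;> decide)
  have h3 : t.mark 0 ≠ 0 := by
    cases t <;> simp only [mark] <;> first | decide | (split_ifs <;> decide)
  simp [theta, h2, h3] at h1

/-- The vertex `x_θ`. -/
def xTheta (t : AffineType) : t.vertices := ⟨.x t.theta, Or.inl t.theta_mem_positiveWeights⟩

/-- The vertex `y_i`. -/
def yVertex (t : AffineType) (i : Fin t.rank) (hi : t.simpleRoot i ∈ t.positiveWeights) :
    t.vertices := ⟨.y i, hi⟩

/-! ### The explicit formulas -/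

/-- `Φ` sends the vertex with label `b` (which exists) to `c.1 ⊗ c.2`. -/
def Sends {t : AffineType} (Φ : t.vertices → t.vertices × t.vertices) (b : t.Label)
    (c : t.Label × t.Label) : Prop :=
  ∃ v : t.vertices, (v : t.Label) = b ∧ (((Φ v).1 : t.Label), ((Φ v).2 : t.Label)) = c

/-- The involution `x_μ ↦ x_{-μ}`, `y_i ↦ y_i`. -/
def Label.dual {t : AffineType} : t.Label → t.Label
  | .x μ => .x (-μ)
  | .y i => .y i

/-- If `x_γ ↦ b ⊗ c` with `γ ∈ Λ⁺`, then `x_{-γ} ↦ c* ⊗ b*`. -/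
def NegativeFormula (t : AffineType) (Φ : t.vertices → t.vertices × t.vertices) : Prop :=
  ∀ γ ∈ t.positiveWeights, ∀ b c : t.Label,
    Sends Φ (.x γ) (b, c) → Sends Φ (.x (-γ)) (c.dual, b.dual)

/-- The Dynkin diagram of the finite-dimensional algebra, as a graph on the vertices `1, …, n`. -/
def diagram (t : AffineType) : SimpleGraph (Fin t.rank) :=
  SimpleGraph.fromRel fun j k => t.cartan j.succ k.succ ≠ 0

/-- `α` is the sum of the simple roots along a path of the diagram from `j` to `k`. -/
def IsPathSum (t : AffineType) (j k : Fin t.rank) (α : t.Weight) : Prop :=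
  ∃ p : t.diagram.Walk j k, p.IsPath ∧ α = (p.support.map t.simpleRoot).sum

/-- `α = α_{j_1} + ⋯ + α_{j_s}` for a path `j_1, …, j_s = i` outside the support of `γ` whose
first vertex is joined to the support of `γ`. -/
def IsLinkingSum (t : AffineType) (i : Fin t.rank) (γ α : t.Weight) : Prop :=
  ∃ (j : Fin t.rank) (p : t.diagram.Walk j i), p.IsPath ∧ (∀ v ∈ p.support, γ v = 0) ∧
    (∃ k, γ k ≠ 0 ∧ t.diagram.Adj k j) ∧ α = (p.support.map t.simpleRoot).sum

/-- The formulas in terms of the grading of `Λ⁺` by the coefficient of `α_i`. -/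
structure GradedFormula (t : AffineType) (i : Fin t.rank)
    (Φ : t.vertices → t.vertices × t.vertices) : Prop where
  grading : ∀ γ ∈ t.positiveWeights, γ i = 0 ∨ γ i = 1 ∨ γ i = 2
  degree_two : ∀ γ ∈ t.positiveWeights, γ i = 2 ↔ γ = t.theta
  x_theta : Sends Φ (.x t.theta) (.x t.theta, .y i)
  x_one : ∀ γ ∈ t.positiveWeights, γ i = 1 →
    Sends Φ (.x γ) (.x t.theta, .x (-(t.theta - γ)))
  exists_linking : ∀ γ ∈ t.positiveWeights, γ i = 0 → ∃ α, t.IsLinkingSum i γ α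
  x_zero : ∀ γ ∈ t.positiveWeights, γ i = 0 → ∀ α, t.IsLinkingSum i γ α →
    Sends Φ (.x γ) (.x (t.theta - α), .x (-(t.theta - γ - α)))
  exists_path : ∀ j, t.simpleRoot j ∈ t.positiveWeights → ∃ α, t.IsPathSum i j α
  y : ∀ j, t.simpleRoot j ∈ t.positiveWeights → ∀ α, t.IsPathSum i j α →
    Sends Φ (.y j) (.x (t.theta - α), .x (-(t.theta - α)))
  negative : t.NegativeFormula Φ

/-- `α_j + α_{j+1} + ⋯ + α_k`, where `1 ≤ j, k ≤ n` are vertices of the affine diagram; zero if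
`k < j`. -/
def seg (t : AffineType) (j k : ℕ) : t.Weight :=
  fun l => if j ≤ (l : ℕ) + 1 ∧ (l : ℕ) + 1 ≤ k then 1 else 0

/-- The formulas for type `A_n^{(1)}` with `i = 1` (in which case `i` has index `0`). -/
structure TypeAFirstFormula (t : AffineType) (i : Fin t.rank)
    (Φ : t.vertices → t.vertices × t.vertices) : Prop where
  x : ∀ j k, 2 ≤ j → j ≤ k → k ≤ t.rank →
    Sends Φ (.x (t.seg j k)) (.x (t.seg 1 k), .x (-t.seg 1 (j - 1)))
  x_first : ∀ k, 1 ≤ k → k ≤ t.rank → Sends Φ (.x (t.seg 1 k)) (.x (t.seg 1 k), .y i)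
  y : ∀ j : Fin t.rank, j ≠ i → Sends Φ (.y j) (.x (t.seg 1 j), .x (-t.seg 1 j))
  y_first : Sends Φ (.y i) (.y i, .y i)
  negative : t.NegativeFormula Φ

/-- The formulas for type `A_n^{(1)}` with `i = n`. -/
structure TypeALastFormula (t : AffineType) (i : Fin t.rank)
    (Φ : t.vertices → t.vertices × t.vertices) : Prop where
  x : ∀ j k, 1 ≤ j → j ≤ k → k + 1 ≤ t.rank →
    Sends Φ (.x (t.seg j k)) (.x (t.seg j t.rank), .x (-t.seg (k + 1) t.rank))
  x_last : ∀ j, 1 ≤ j → j ≤ t.rank →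
    Sends Φ (.x (t.seg j t.rank)) (.x (t.seg j t.rank), .y i)
  y : ∀ j : Fin t.rank, j ≠ i →
    Sends Φ (.y j) (.x (t.seg (j + 2) t.rank), .x (-t.seg (j + 2) t.rank))
  y_last : Sends Φ (.y i) (.y i, .y i)
  negative : t.NegativeFormula Φ

/-- `α_j + ⋯ + α_{k-1} + 2 α_k + ⋯ + 2 α_{n-1} + α_n`. -/
def doubleSeg (t : AffineType) (j k : ℕ) : t.Weight :=
  t.seg j (k - 1) + (2 : ℚ) • t.seg k (t.rank - 1) + t.seg t.rank t.rank

/-- The formulas for type `C_n^{(1)}`, where `i = 1`. -/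
structure TypeCFormula (t : AffineType) (i : Fin t.rank)
    (Φ : t.vertices → t.vertices × t.vertices) : Prop where
  x_double : ∀ j k, 2 ≤ j → j ≤ k → k + 1 ≤ t.rank →
    Sends Φ (.x (t.doubleSeg j k)) (.x (t.doubleSeg 1 k), .x (-t.seg 1 (j - 1)))
  x_double_first : ∀ k, 1 ≤ k → k + 1 ≤ t.rank →
    Sends Φ (.x (t.doubleSeg 1 k)) (.x (t.doubleSeg 1 k), .y i)
  x : ∀ j k, 2 ≤ j → j ≤ k → k ≤ t.rank →
    Sends Φ (.x (t.seg j k)) (.x (t.seg 1 k), .x (-t.seg 1 (j - 1)))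
  x_first : ∀ k, 1 ≤ k → k ≤ t.rank → Sends Φ (.x (t.seg 1 k)) (.x (t.seg 1 k), .y i)
  y : ∀ j : Fin t.rank, j ≠ i → Sends Φ (.y j) (.x (t.seg 1 j), .x (-t.seg 1 j))
  y_first : Sends Φ (.y i) (.y i, .y i)
  negative : t.NegativeFormula Φ

def IsTypeA : AffineType → Prop
  | A _ _ => True
  | _ => False

def IsTypeC : AffineType → Prop
  | C _ _ => True
  | _ => False

/-- The explicit description of the isomorphism in all types. -/
structure ExplicitFormula (t : AffineType) (i : Fin t.rank)
    (Φ : t.vertices → t.vertices × t.vertices) : Prop where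
  graded : ¬ t.IsTypeA → ¬ t.IsTypeC → t.GradedFormula i Φ
  typeA_first : t.IsTypeA → (i : ℕ) + 1 = 1 → t.TypeAFirstFormula i Φ
  typeA_last : t.IsTypeA → (i : ℕ) + 1 = t.rank → t.TypeALastFormula i Φ
  typeC : t.IsTypeC → t.TypeCFormula i Φ

end AffineType

/-! The formulas define a relation between vertices `b` of nonnegative weight and pairs `c₁ ⊗ c₂`.
The involution `x_μ ↦ x_{-μ}`, `y_j ↦ y_j` reverses all arrows of `B(θ)`, and `b ⊗ c ↦ c* ⊗ b*`
reverses those of the tensor square, so the relation extends to all vertices by duality (`FullRel`).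
Suppose that the extended relation is functional, total and weight preserving, and that each
operator either sends related elements to related elements or kills both (`CrystalRel`). Then it is
the graph of a map commuting with all operators. The map is injective, because nonzero weights
separate the `x_μ` and `e_j` separates `y_j` from the other `y_k`. Its image is a full component,
because `B(θ)` is connected and an arrow with one end in the image has both ends there. Since `ε`
and `φ` are lengths of strings, they are preserved automatically, and the inverse extended by zero
is strict because no arrow joins the image to its complement.

The substance is the check of the arrows. On `x_μ` one has `φ_j - ε_j = ⟨h_j, μ⟩` (`phi_sub_eps_x`).
So in a tensor product it is usually enough to see that one of `φ`, `ε` vanishes on each factor;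
pairings then decide which factor moves.

In the graded types `θ` pairs to `1` with `h_i` and to `0` with the other coroots. Hence the
coefficient at `α_i` is the form with `θ` up to a factor, and `μ ↦ θ - μ` is an isometry on degree
one. No weight has a disconnected support. For `γ` of degree zero and a path that links its support
to `i`, the first vertex of the path pairs to `-1` with `γ` and the other vertices pair to `0`
(`pairing_linked`, `pairing_linked_zero`). It follows that the path sum `α` depends only on `γ`
(`linked_unique`), and the weights around `γ` can be compared with those around `γ + α`. The case
distinction in a step is the position of the colour relative to the path and to the support of `γ`.

In types `A` and `C` the diagram is a chain starting at `i`. If the support of `γ` starts at `m ≠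
i`, the image is obtained by splitting off the sum of the simple roots before `m`; if it starts at
`i`, the second factor is `y_i`. Here the inputs are that supports have no gaps and that the first
simple root of a support can be removed.

The set `Λ` is determined without a classification of roots. The form is positive definite because
`θ` is a positive dominant vector (`form_self_eq`). If integral vectors no longer than `θ` have
coefficients of one sign, and `θ` satisfies one inequality, then `Λ` consists of exactly these
vectors (`isWeight_iff`). Sign coherence holds because the positive and negative parts of a mixed
vector each have squared length at least `2` and contribute with the same sign, which is too long.
In type `C` length is too coarse once `n ≥ 4` (`ε₁ + ε₂ + ε₃ + ε₄` is as long as `2ε₁`), and the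
`ℓ¹`-norm takes its place. In types `A_{2n}^{(2)}` and `D_{n+1}^{(2)}` no vertex joined to `0`
satisfies the hypothesis on `α_i`. -/

namespace Crystal

variable {I P B B' : Type}

/-! ### Lengths of strings -/

/-- The largest number of times that the partial map `g` can be applied to `b`. -/
noncomputable def stringLength (g : B → Option B) (b : B) : ℕ :=
  sSup {k : ℕ | (fun o : Option B => o.bind g)^[k] (some b) ≠ none}

/-- The partial map `g` can be applied to each element only a bounded number of times. -/
def FiniteStrings (g : B → Option B) : Prop :=
  ∀ b, BddAbove {k : ℕ | (fun o : Option B => o.bind g)^[k] (some b) ≠ none}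

theorem iterate_bind_none (g : B → Option B) (k : ℕ) :
    (fun o : Option B => o.bind g)^[k] none = none := by
  induction k with
  | zero => rfl
  | succ k ih => rw [Function.iterate_succ_apply]; exact ih

theorem stringLength_eq_zero {g : B → Option B} {b : B} (h : g b = none) :
    stringLength g b = 0 := by
  have : {k : ℕ | (fun o : Option B => o.bind g)^[k] (some b) ≠ none} = {0} := by
    ext k
    cases k with
    | zero => simp
    | succ k => simp [Function.iterate_succ_apply, h, iterate_bind_none]
  rw [stringLength, this, csSup_singleton]

/-- Boundedness matters: `sSup` of an unbounded set of naturals is `0`, so an infinite string would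
have length `0` at each of its elements and the recursion would fail. -/
theorem stringLength_eq_succ {g : B → Option B} (hg : FiniteStrings g) {b c : B}
    (h : g b = some c) : stringLength g b = stringLength g c + 1 := by
  have hc : stringLength g c ∈ {k : ℕ | (fun o : Option B => o.bind g)^[k] (some c) ≠ none} :=
    Nat.sSup_mem ⟨0, by simp⟩ (hg c)
  refine IsGreatest.csSup_eq ⟨?_, ?_⟩
  · simpa [Function.iterate_succ_apply, h] using hc
  · rintro (_ | k) hk
    · exact Nat.zero_le _
    · refine Nat.succ_le_succ (le_csSup (hg c) ?_)
      simpa [Function.iterate_succ_apply, h] using hk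

/-- The iterates of the two partial maps correspond under `Φ`, and `Option.map` neither creates nor
destroys `none`; injectivity of `Φ` plays no role. This is the only source for the preservation of
`ε` and `φ`, also under duality. -/
theorem stringLength_map {g : B → Option B} {g' : B' → Option B'} {Φ : B → B'}
    (h : ∀ b, g' (Φ b) = (g b).map Φ) (b : B) : stringLength g' (Φ b) = stringLength g b := by
  have key : ∀ k : ℕ, (fun o : Option B' => o.bind g')^[k] (some (Φ b)) =
      ((fun o : Option B => o.bind g)^[k] (some b)).map Φ := by
    intro k
    induction k with
    | zero => rfl
    | succ k ih =>
      rw [Function.iterate_succ_apply', Function.iterate_succ_apply', ih]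
      cases (fun o : Option B => o.bind g)^[k] (some b) <;> simp [h]
  simp [stringLength, key]

/-! ### Regular crystals -/

/-- The operators `e_i` and `f_i` are mutually inverse and have finite strings. -/
structure Regular (C : Crystal I P B) : Prop where
  inv : ∀ i b c, C.f i b = some c ↔ C.e i c = some b
  finite_f : ∀ i, FiniteStrings (C.f i)
  finite_e : ∀ i, FiniteStrings (C.e i)

theorem phi_eq_zero {C : Crystal I P B} {i : I} {b : B} (h : C.f i b = none) : C.phi i b = 0 :=
  stringLength_eq_zero h

theorem eps_eq_zero {C : Crystal I P B} {i : I} {b : B} (h : C.e i b = none) : C.eps i b = 0 :=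
  stringLength_eq_zero h

namespace Regular

variable {C : Crystal I P B} {D : Crystal I P B'} {i : I} {b c : B}

theorem phi_eq (hC : C.Regular) (h : C.f i b = some c) : C.phi i b = C.phi i c + 1 :=
  stringLength_eq_succ (hC.finite_f i) h

theorem eps_eq (hC : C.Regular) (h : C.e i b = some c) : C.eps i b = C.eps i c + 1 :=
  stringLength_eq_succ (hC.finite_e i) h

theorem eq_none_of_phi (hC : C.Regular) (h : C.phi i b = 0) : C.f i b = none := by
  cases hb : C.f i b with
  | none => rfl
  | some c => have := hC.phi_eq hb; omega

theorem eq_none_of_eps (hC : C.Regular) (h : C.eps i b = 0) : C.e i b = none := by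
  cases hb : C.e i b with
  | none => rfl
  | some c => have := hC.eps_eq hb; omega

theorem exists_of_phi (h : C.phi i b ≠ 0) : ∃ c, C.f i b = some c := by
  cases hb : C.f i b with
  | none => exact absurd (phi_eq_zero hb) h
  | some c => exact ⟨c, rfl⟩

/-- An arrow `f` on the left factor lowers `φ` by one and so turns the strict inequality of the rule
for `f` into the weak one of the rule for `e`. An arrow on the right factor raises `ε` by one and
turns the failure of the strict inequality into the failure of the weak one. -/
theorem tensor_inv [Add P] (hC : C.Regular) (hD : D.Regular) (i : I) (b c : B × B') :
    (C.tensor D).f i b = some c ↔ (C.tensor D).e i c = some b := by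
  obtain ⟨b₁, b₂⟩ := b
  obtain ⟨c₁, c₂⟩ := c
  simp only [tensor]
  constructor
  · intro h
    split_ifs at h with h1
    · obtain ⟨d, hd, he⟩ := Option.map_eq_some_iff.1 h
      obtain ⟨rfl, rfl⟩ := Prod.mk.inj he
      have := hC.phi_eq hd
      rw [if_pos (by omega), (hC.inv _ _ _).1 hd]; rfl
    · obtain ⟨d, hd, he⟩ := Option.map_eq_some_iff.1 h
      obtain ⟨rfl, rfl⟩ := Prod.mk.inj he
      have := hD.eps_eq ((hD.inv _ _ _).1 hd)
      rw [if_neg (by omega), (hD.inv _ _ _).1 hd]; rfl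
  · intro h
    split_ifs at h with h1
    · obtain ⟨d, hd, he⟩ := Option.map_eq_some_iff.1 h
      obtain ⟨rfl, rfl⟩ := Prod.mk.inj he
      have := hC.phi_eq ((hC.inv _ _ _).2 hd)
      rw [if_pos (by omega), (hC.inv _ _ _).2 hd]; rfl
    · obtain ⟨d, hd, he⟩ := Option.map_eq_some_iff.1 h
      obtain ⟨rfl, rfl⟩ := Prod.mk.inj he
      have := hD.eps_eq hd
      rw [if_neg (by omega), (hD.inv _ _ _).2 hd]; rfl

end Regular

section TensorRules

variable [Add P] {C : Crystal I P B} {D : Crystal I P B'} {i : I} {b : B} {b' : B'}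

/-- The value enters as an equation `ho`, so that after rewriting with a known `none` or `some` the
`Option.map` reduces by `rfl`. -/
theorem tensor_f_left {o : Option B} (h : D.eps i b' < C.phi i b) (ho : C.f i b = o) :
    (C.tensor D).f i (b, b') = o.map fun c => (c, b') := by
  subst ho; exact if_pos h

theorem tensor_f_right {o : Option B'} (h : C.phi i b ≤ D.eps i b') (ho : D.f i b' = o) :
    (C.tensor D).f i (b, b') = o.map fun c => (b, c) := by
  subst ho; exact if_neg (not_lt.2 h)

theorem tensor_e_left {o : Option B} (h : D.eps i b' ≤ C.phi i b) (ho : C.e i b = o) :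
    (C.tensor D).e i (b, b') = o.map fun c => (c, b') := by
  subst ho; exact if_pos h

theorem tensor_e_right {o : Option B'} (h : C.phi i b < D.eps i b') (ho : D.e i b' = o) :
    (C.tensor D).e i (b, b') = o.map fun c => (b, c) := by
  subst ho; exact if_neg (not_le.2 h)

end TensorRules

/-! ### Embeddings onto a connected component -/

/-- Connectedness puts the range inside the component. Conversely, an arrow leaving a point of the
range is the image of an arrow, and by `hD` the same holds for an arrow entering it, so the range is
a union of components. -/
theorem range_eq_component {C : Crystal I P B} {D : Crystal I P B'} {Φ : B → B'}
    (hD : ∀ i b c, D.f i b = some c ↔ D.e i c = some b)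
    (hf : ∀ i b, D.f i (Φ b) = (C.f i b).map Φ) (he : ∀ i b, D.e i (Φ b) = (C.e i b).map Φ)
    (b₀ : B) (hconn : ∀ b, b ∈ C.component b₀) : Set.range Φ = D.component (Φ b₀) := by
  apply Set.Subset.antisymm
  · rintro _ ⟨b, rfl⟩
    have h : Relation.EqvGen (fun a a' => ∃ i, C.f i a = some a') b₀ b := hconn b
    clear hconn
    change Relation.EqvGen (fun a a' => ∃ i, D.f i a = some a') (Φ b₀) (Φ b)
    induction h with
    | rel x y hxy =>
      obtain ⟨i, hi⟩ := hxy
      exact .rel _ _ ⟨i, by rw [hf, hi]; rfl⟩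
    | refl x => exact .refl _
    | symm x y _ ih => exact .symm _ _ ih
    | trans x y z _ _ ih ih' => exact .trans _ _ _ ih ih'
  · intro c hc
    have h : Relation.EqvGen (fun a a' => ∃ i, D.f i a = some a') (Φ b₀) c := hc
    have key : ∀ x y, Relation.EqvGen (fun a a' => ∃ i, D.f i a = some a') x y →
        (x ∈ Set.range Φ ↔ y ∈ Set.range Φ) := by
      intro x y hxy
      induction hxy with
      | rel x y hxy =>
        obtain ⟨i, hi⟩ := hxy
        constructor
        · rintro ⟨b, rfl⟩
          rw [hf] at hi
          obtain ⟨d, -, hd⟩ := Option.map_eq_some_iff.1 hi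
          exact ⟨d, hd⟩
        · rintro ⟨b, rfl⟩
          rw [hD, he] at hi
          obtain ⟨d, -, hd⟩ := Option.map_eq_some_iff.1 hi
          exact ⟨d, hd⟩
      | refl x => exact Iff.rfl
      | symm x y _ ih => exact ih.symm
      | trans x y z _ _ ih ih' => exact ih.trans ih'
    exact (key _ _ h).1 ⟨b₀, rfl⟩

/-- The base point `d₀` is a variable tied to `Φ b₀` by an equation, so that the target can be the
component of `x_θ ⊗ y_i` itself while `Φ` is only known through its relation. -/
theorem exists_iso_component {C : Crystal I P B} {D : Crystal I P B'} {Φ : B → B'}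
    (hinj : Function.Injective Φ) (hD : ∀ i b c, D.f i b = some c ↔ D.e i c = some b)
    (hwt : ∀ b, D.wt (Φ b) = C.wt b)
    (hf : ∀ i b, D.f i (Φ b) = (C.f i b).map Φ) (he : ∀ i b, D.e i (Φ b) = (C.e i b).map Φ)
    (b₀ : B) (hconn : ∀ b, b ∈ C.component b₀) {d₀ : B'} (hd₀ : Φ b₀ = d₀) :
    ∃ Ψ : Iso C (D.componentCrystal d₀), (∀ b, (Ψ.toEquiv b : B') = Φ b) ∧
      IsStrictMorphism D C Ψ.inverseByZero := by
  subst hd₀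
  have hrange := range_eq_component hD hf he b₀ hconn
  let E : B ≃ D.component (Φ b₀) := (Equiv.ofInjective Φ hinj).trans (Equiv.setCongr hrange)
  have hE : ∀ b, (E b : B') = Φ b := fun b => rfl
  have hE' : ∀ b (h : Φ b ∈ D.component (Φ b₀)), (⟨Φ b, h⟩ : D.component (Φ b₀)) = E b :=
    fun b h => Subtype.ext rfl
  have hrf : ∀ i b, (D.componentCrystal (Φ b₀)).f i (E b) = (C.f i b).map E := by
    intro i b
    simp only [componentCrystal, restrict, hE, hf]
    cases C.f i b with
    | none => rfl
    | some c =>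
      have hc : Φ c ∈ D.component (Φ b₀) := hrange ▸ ⟨c, rfl⟩
      simp [hc, hE']
  have hre : ∀ i b, (D.componentCrystal (Φ b₀)).e i (E b) = (C.e i b).map E := by
    intro i b
    simp only [componentCrystal, restrict, hE, he]
    cases C.e i b with
    | none => rfl
    | some c =>
      have hc : Φ c ∈ D.component (Φ b₀) := hrange ▸ ⟨c, rfl⟩
      simp [hc, hE']
  let Ψ : Iso C (D.componentCrystal (Φ b₀)) :=
    { toEquiv := E
      wt_eq := fun b => hwt b
      eps_eq := fun i b => stringLength_map (hre i) b
      phi_eq := fun i b => stringLength_map (hrf i) b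
      e_comm := hre
      f_comm := hrf }
  have hm : ∀ b, Ψ.inverseByZero (Φ b) = some b := by
    intro b
    have hb : Φ b ∈ D.component (Φ b₀) := hrange ▸ ⟨b, rfl⟩
    simp only [Iso.inverseByZero, dif_pos hb, hE']
    exact congrArg some (E.symm_apply_apply b)
  have hm' : ∀ c, c ∉ Set.range Φ → Ψ.inverseByZero c = none := by
    intro c hc
    rw [hrange] at hc
    simp only [Iso.inverseByZero, dif_neg hc]
  have hms : ∀ b c, Ψ.inverseByZero b = some c → b = Φ c := by
    intro b c h
    by_cases hb : b ∈ Set.range Φ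
    · obtain ⟨d, rfl⟩ := hb
      rw [hm] at h
      rw [Option.some.inj h]
    · rw [hm' b hb] at h; cases h
  refine ⟨Ψ, fun b => rfl, ?_⟩
  constructor
  · intro b c h
    rw [hms b c h, hwt]
  · intro i b c h
    rw [hms b c h]
    exact (stringLength_map (he i) c).symm
  · intro i b c h
    rw [hms b c h]
    exact (stringLength_map (hf i) c).symm
  · intro i b
    by_cases hb : b ∈ Set.range Φ
    · obtain ⟨d, rfl⟩ := hb
      rw [he, hm, Option.bind_some]
      cases C.e i d with
      | none => rfl
      | some c => exact hm c
    -- Outside the range the right side is zero. An arrow from there into the range, reversed by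
    -- `hD`, would be an arrow out of the range and hence stay inside it.
    · rw [hm' b hb]
      cases h : D.e i b with
      | none => rfl
      | some c =>
        refine hm' c ?_
        rintro ⟨d, rfl⟩
        rw [← hD, hf] at h
        obtain ⟨d', -, hd'⟩ := Option.map_eq_some_iff.1 h
        exact hb ⟨d', hd'⟩
  · intro i b
    by_cases hb : b ∈ Set.range Φ
    · obtain ⟨d, rfl⟩ := hb
      rw [hf, hm, Option.bind_some]
      cases C.f i d with
      | none => rfl
      | some c => exact hm c
    · rw [hm' b hb]
      cases h : D.f i b with
      | none => rfl
      | some c =>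
        refine hm' c ?_
        rintro ⟨d, rfl⟩
        rw [hD, he] at h
        obtain ⟨d', -, hd'⟩ := Option.map_eq_some_iff.1 h
        exact hb ⟨d', hd'⟩

/-- A relation that is functional and compatible with all arrows is the graph of a map that
commutes with the crystal operators. -/
theorem exists_map_of_rel {C : Crystal I P B} {D : Crystal I P B'} (R : B → B' → Prop)
    (htotal : ∀ b, ∃ c, R b c) (huniq : ∀ b c c', R b c → R b c' → c = c')
    (hf : ∀ i b c, R b c → Option.Rel R (C.f i b) (D.f i c))
    (he : ∀ i b c, R b c → Option.Rel R (C.e i b) (D.e i c)) :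
    ∃ Φ : B → B', (∀ b, R b (Φ b)) ∧ (∀ i b, D.f i (Φ b) = (C.f i b).map Φ) ∧
      ∀ i b, D.e i (Φ b) = (C.e i b).map Φ := by
  choose Φ hΦ using htotal
  have key : ∀ o o', Option.Rel R o o' → o' = o.map Φ := by
    intro o o' h
    cases h with
    | none => rfl
    | some h => exact congrArg some (huniq _ _ _ h (hΦ _))
  exact ⟨Φ, hΦ, fun i b => key _ _ (hf i b _ (hΦ b)), fun i b => key _ _ (he i b _ (hΦ b))⟩

end Crystal


namespace AffineType

variable {t : AffineType}

/-! ### Pairings -/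

/-- The Cartan matrix of the finite-dimensional algebra. -/
def finCartan (t : AffineType) (j k : Fin t.rank) : ℤ := t.cartan j.succ k.succ

theorem pairing_eq (j : Fin t.rank) (μ : t.Weight) :
    t.pairing j μ = ∑ k, (t.finCartan j k : ℚ) * μ k := rfl

theorem pairing_add (j : Fin t.rank) (μ ν : t.Weight) :
    t.pairing j (μ + ν) = t.pairing j μ + t.pairing j ν := by
  simp [pairing, mul_add, Finset.sum_add_distrib]

theorem pairing_neg (j : Fin t.rank) (μ : t.Weight) : t.pairing j (-μ) = -t.pairing j μ := by
  simp [pairing]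

theorem pairing_sub (j : Fin t.rank) (μ ν : t.Weight) :
    t.pairing j (μ - ν) = t.pairing j μ - t.pairing j ν := by
  rw [sub_eq_add_neg, pairing_add, pairing_neg, ← sub_eq_add_neg]

theorem pairing_smul (j : Fin t.rank) (c : ℚ) (μ : t.Weight) :
    t.pairing j (c • μ) = c * t.pairing j μ := by
  simp only [pairing, Pi.smul_apply, smul_eq_mul, Finset.mul_sum]
  exact Finset.sum_congr rfl fun k _ => by ring

theorem pairing_simpleRoot (j k : Fin t.rank) :
    t.pairing j (t.simpleRoot k) = t.finCartan j k := by
  simp [pairing, simpleRoot, finCartan, Pi.single_apply]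

theorem simpleRoot_self (j : Fin t.rank) : t.simpleRoot j j = 1 := by simp [simpleRoot]

theorem simpleRoot_of_ne {j k : Fin t.rank} (h : k ≠ j) : t.simpleRoot j k = 0 := by
  simp [simpleRoot, h]

theorem simpleRoot_nonneg (j : Fin t.rank) : 0 ≤ t.simpleRoot j := by
  intro k
  by_cases h : k = j
  · subst h; simp [simpleRoot_self]
  · simp [simpleRoot_of_ne h]

/-- All coefficients are integers. -/
def Integral (μ : t.Weight) : Prop := ∀ k, ∃ z : ℤ, μ k = z

theorem Integral.add {μ ν : t.Weight} (hμ : Integral μ) (hν : Integral ν) : Integral (μ + ν) := by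
  intro k
  obtain ⟨a, ha⟩ := hμ k
  obtain ⟨b, hb⟩ := hν k
  exact ⟨a + b, by simp [ha, hb]⟩

theorem Integral.neg {μ : t.Weight} (hμ : Integral μ) : Integral (-μ) := by
  intro k
  obtain ⟨a, ha⟩ := hμ k
  exact ⟨-a, by simp [ha]⟩

theorem Integral.sub {μ ν : t.Weight} (hμ : Integral μ) (hν : Integral ν) : Integral (μ - ν) := by
  rw [sub_eq_add_neg]; exact hμ.add hν.neg

theorem integral_simpleRoot (j : Fin t.rank) : Integral (t.simpleRoot j) := by
  intro k
  by_cases h : k = j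
  · subst h; exact ⟨1, by simp [simpleRoot_self]⟩
  · exact ⟨0, by simp [simpleRoot_of_ne h]⟩

theorem Integral.zsmul {μ : t.Weight} (hμ : Integral μ) (z : ℤ) : Integral ((z : ℚ) • μ) := by
  intro k
  obtain ⟨a, ha⟩ := hμ k
  exact ⟨z * a, by simp [ha]⟩

theorem Integral.pairing {μ : t.Weight} (hμ : Integral μ) (j : Fin t.rank) :
    ∃ z : ℤ, t.pairing j μ = z := by
  choose a ha using hμ
  exact ⟨∑ k, t.finCartan j k * a k, by simp [pairing_eq, ha]⟩

theorem Integral.one_le_pairing {μ : t.Weight} (hμ : Integral μ) {j : Fin t.rank}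
    (h : 0 < t.pairing j μ) : 1 ≤ t.pairing j μ := by
  obtain ⟨z, hz⟩ := hμ.pairing j
  rw [hz] at h ⊢
  exact_mod_cast h

theorem Integral.pairing_le_neg_one {μ : t.Weight} (hμ : Integral μ) {j : Fin t.rank}
    (h : t.pairing j μ < 0) : t.pairing j μ ≤ -1 := by
  have := hμ.neg.one_le_pairing (j := j) (by rw [pairing_neg]; linarith)
  rw [pairing_neg] at this; linarith

theorem Integral.one_le {μ : t.Weight} (hμ : Integral μ) {j : Fin t.rank}
    (h : 0 < μ j) : 1 ≤ μ j := by
  obtain ⟨z, hz⟩ := hμ j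
  rw [hz] at h ⊢
  exact_mod_cast h

/-! ### Strings of weights -/

theorem IsWeight.sub_smul {μ : t.Weight} (h : t.IsWeight μ) {j : Fin t.rank} (k : ℕ)
    (hk : (k : ℚ) ≤ t.pairing j μ) : t.IsWeight (μ - (k : ℚ) • t.simpleRoot j) := by
  simpa using IsWeight.string μ j k h (Or.inl ⟨by positivity, by simpa using hk⟩)

theorem IsWeight.add_smul {μ : t.Weight} (h : t.IsWeight μ) {j : Fin t.rank} (k : ℕ)
    (hk : t.pairing j μ ≤ -(k : ℚ)) : t.IsWeight (μ + (k : ℚ) • t.simpleRoot j) := by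
  have := IsWeight.string μ j (-(k : ℤ)) h (Or.inr ⟨by simp, by simpa using hk⟩)
  simpa using this

theorem IsWeight.sub {μ : t.Weight} (h : t.IsWeight μ) {j : Fin t.rank}
    (hk : 1 ≤ t.pairing j μ) : t.IsWeight (μ - t.simpleRoot j) := by
  simpa using h.sub_smul 1 (by simpa using hk)

theorem IsWeight.add {μ : t.Weight} (h : t.IsWeight μ) {j : Fin t.rank}
    (hk : t.pairing j μ ≤ -1) : t.IsWeight (μ + t.simpleRoot j) := by
  simpa using h.add_smul 1 (by simpa using hk)

theorem IsWeight.integral (hθ : Integral t.theta) {μ : t.Weight} (h : t.IsWeight μ) :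
    Integral μ := by
  induction h with
  | highest => exact hθ
  | string μ j k _ _ ih => exact ih.sub ((integral_simpleRoot j).zsmul k)

/-! ### The invariant form -/

/-- The bilinear form `(α_j, α_k) = s_j a_{j,k}`. -/
def form (s : Fin t.rank → ℤ) (μ ν : t.Weight) : ℚ := ∑ j, (s j : ℚ) * μ j * t.pairing j ν

theorem form_add_left (s : Fin t.rank → ℤ) (μ μ' ν : t.Weight) :
    form s (μ + μ') ν = form s μ ν + form s μ' ν := by
  simp [form, mul_add, add_mul, Finset.sum_add_distrib]

theorem form_smul_left (s : Fin t.rank → ℤ) (c : ℚ) (μ ν : t.Weight) :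
    form s (c • μ) ν = c * form s μ ν := by
  simp only [form, Pi.smul_apply, smul_eq_mul, Finset.mul_sum]
  exact Finset.sum_congr rfl fun k _ => by ring

theorem form_simpleRoot_left (s : Fin t.rank → ℤ) (j : Fin t.rank) (ν : t.Weight) :
    form s (t.simpleRoot j) ν = s j * t.pairing j ν := by
  simp [form, simpleRoot, Pi.single_apply]

/-- Data showing that the finite Cartan matrix is symmetrizable and positive definite. -/
structure FormData (t : AffineType) (i : Fin t.rank) (s : Fin t.rank → ℤ) : Prop where
  s_pos : ∀ j, 0 < s j
  diag : ∀ j, t.finCartan j j = 2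
  nonpos : ∀ j k, j ≠ k → t.finCartan j k ≤ 0
  symm : ∀ j k, s j * t.finCartan j k = s k * t.finCartan k j
  theta_pos : ∀ j, 0 < t.theta j
  theta_integral : Integral t.theta
  theta_dominant : ∀ j, 0 ≤ t.pairing j t.theta
  theta_i : 0 < t.pairing i t.theta
  connected : ∃ d : Fin t.rank → ℕ, ∀ k, k ≠ i → ∃ j, j ≠ k ∧ t.finCartan k j ≠ 0 ∧ d j < d k

namespace FormData

variable {i : Fin t.rank} {s : Fin t.rank → ℤ}

theorem form_comm (D : FormData t i s) (μ ν : t.Weight) : form s μ ν = form s ν μ := by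
  simp only [form, pairing_eq, Finset.mul_sum]
  rw [Finset.sum_comm]
  refine Finset.sum_congr rfl fun k _ => Finset.sum_congr rfl fun j _ => ?_
  have h : (s j : ℚ) * t.finCartan j k = s k * t.finCartan k j := by exact_mod_cast D.symm j k
  linear_combination (μ j * ν k) * h

theorem form_add_right (D : FormData t i s) (μ ν ν' : t.Weight) :
    form s μ (ν + ν') = form s μ ν + form s μ ν' := by
  rw [D.form_comm, form_add_left, D.form_comm ν, D.form_comm ν']

theorem form_smul_right (D : FormData t i s) (c : ℚ) (μ ν : t.Weight) :
    form s μ (c • ν) = c * form s μ ν := by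
  rw [D.form_comm, form_smul_left, D.form_comm ν]

theorem form_add_self (D : FormData t i s) (μ ν : t.Weight) :
    form s (μ + ν) (μ + ν) = form s μ μ + 2 * form s μ ν + form s ν ν := by
  rw [form_add_left, D.form_add_right, D.form_add_right, D.form_comm ν μ]; ring

theorem form_sub_self (D : FormData t i s) (μ ν : t.Weight) :
    form s (μ - ν) (μ - ν) = form s μ μ - 2 * form s μ ν + form s ν ν := by
  have h : μ - ν = μ + (-1 : ℚ) • ν := by simp [sub_eq_add_neg]
  rw [h, D.form_add_self, D.form_smul_right, D.form_smul_right, form_smul_left]; ring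

theorem form_neg_self (D : FormData t i s) (μ : t.Weight) : form s (-μ) (-μ) = form s μ μ := by
  have h : -μ = (-1 : ℚ) • μ := by simp
  rw [h, D.form_smul_right, form_smul_left]; ring

theorem form_simpleRoot_right (D : FormData t i s) (j : Fin t.rank) (μ : t.Weight) :
    form s μ (t.simpleRoot j) = s j * t.pairing j μ := by
  rw [D.form_comm, form_simpleRoot_left]

theorem pairing_simpleRoot_self (D : FormData t i s) (j : Fin t.rank) :
    t.pairing j (t.simpleRoot j) = 2 := by
  rw [pairing_simpleRoot, D.diag]; norm_num

theorem form_string (D : FormData t i s) (μ : t.Weight) (j : Fin t.rank) (c : ℚ) :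
    form s (μ - c • t.simpleRoot j) (μ - c • t.simpleRoot j) =
      form s μ μ - 2 * s j * (c * (t.pairing j μ - c)) := by
  rw [D.form_sub_self, D.form_smul_right, D.form_smul_right, form_smul_left,
    D.form_simpleRoot_right, D.form_simpleRoot_right, D.pairing_simpleRoot_self]
  ring

/-- Vinberg's criterion for positive definiteness: in the rescaled coordinates `u_j = μ_j / θ_j` the
form is a quadratic form with off-diagonal coefficients at most `0` and row sums `s_j θ_j ⟨h_j, θ⟩`.
Writing `u_j u_k` as half of `u_j² + u_k² - (u_j - u_k)²` collects the row sums in the squares.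
Symmetry of the form identifies the sums over `u_j²` and `u_k²`. -/
theorem form_self_eq (D : FormData t i s) (μ : t.Weight) :
    form s μ μ = ∑ j, s j * t.pairing j t.theta * t.theta j * (μ j / t.theta j) ^ 2 +
      ∑ j, ∑ k, (-(s j * t.finCartan j k : ℚ) / 2) * t.theta j * t.theta k *
        (μ j / t.theta j - μ k / t.theta k) ^ 2 := by
  have hθ : ∀ j, t.theta j ≠ 0 := fun j => (D.theta_pos j).ne'
  set u : Fin t.rank → ℚ := fun j => μ j / t.theta j with hu
  have hμ : ∀ j, μ j = t.theta j * u j := fun j => by rw [hu]; field_simp [hθ j]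
  have h1 : ∑ j, (s j : ℚ) * t.pairing j t.theta * t.theta j * u j ^ 2 =
      ∑ j, ∑ k, (s j * t.finCartan j k : ℚ) * t.theta j * t.theta k * u j ^ 2 := by
    refine Finset.sum_congr rfl fun j _ => ?_
    rw [pairing_eq, Finset.mul_sum, Finset.sum_mul, Finset.sum_mul]
    exact Finset.sum_congr rfl fun k _ => by ring
  have h2 : ∑ j, ∑ k, (s j * t.finCartan j k : ℚ) * t.theta j * t.theta k * u j ^ 2 =
      ∑ j, ∑ k, (s j * t.finCartan j k : ℚ) * t.theta j * t.theta k * u k ^ 2 := by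
    rw [Finset.sum_comm]
    refine Finset.sum_congr rfl fun k _ => Finset.sum_congr rfl fun j _ => ?_
    have h : (s j : ℚ) * t.finCartan j k = s k * t.finCartan k j := by exact_mod_cast D.symm j k
    linear_combination (t.theta j * t.theta k * u j ^ 2) * h
  have h3 : form s μ μ = ∑ j, ∑ k, (s j * t.finCartan j k : ℚ) * t.theta j * t.theta k *
      (u j * u k) := by
    simp only [form, pairing_eq, Finset.mul_sum]
    refine Finset.sum_congr rfl fun j _ => Finset.sum_congr rfl fun k _ => ?_
    rw [hμ j, hμ k]; ring
  have h4 : ∑ j, ∑ k, (-(s j * t.finCartan j k : ℚ) / 2) * t.theta j * t.theta k *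
      (u j - u k) ^ 2 =
      -(1 / 2) * (∑ j, ∑ k, (s j * t.finCartan j k : ℚ) * t.theta j * t.theta k * u j ^ 2) -
      (1 / 2) * (∑ j, ∑ k, (s j * t.finCartan j k : ℚ) * t.theta j * t.theta k * u k ^ 2) +
      ∑ j, ∑ k, (s j * t.finCartan j k : ℚ) * t.theta j * t.theta k * (u j * u k) := by
    simp only [Finset.mul_sum, ← Finset.sum_add_distrib, ← Finset.sum_sub_distrib]
    exact Finset.sum_congr rfl fun j _ => Finset.sum_congr rfl fun k _ => by ring
  rw [h1, h4, ← h2, h3]; ring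

theorem form_term_nonneg (D : FormData t i s) (μ : t.Weight) (j k : Fin t.rank) :
    0 ≤ (-(s j * t.finCartan j k : ℚ) / 2) * t.theta j * t.theta k *
        (μ j / t.theta j - μ k / t.theta k) ^ 2 := by
  by_cases h : j = k
  · subst h; simp
  · have h1 : (t.finCartan j k : ℚ) ≤ 0 := by exact_mod_cast D.nonpos j k h
    have h2 : (0 : ℚ) < s j := by exact_mod_cast D.s_pos j
    have h3 := D.theta_pos j
    have h4 := D.theta_pos k
    have h5 : 0 ≤ -(s j * t.finCartan j k : ℚ) / 2 := by nlinarith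
    positivity

theorem form_diag_nonneg (D : FormData t i s) (μ : t.Weight) (j : Fin t.rank) :
    0 ≤ (s j : ℚ) * t.pairing j t.theta * t.theta j * (μ j / t.theta j) ^ 2 := by
  have h2 : (0 : ℚ) < s j := by exact_mod_cast D.s_pos j
  have h3 := D.theta_pos j
  have h4 := D.theta_dominant j
  positivity

theorem form_self_nonneg (D : FormData t i s) (μ : t.Weight) : 0 ≤ form s μ μ := by
  rw [D.form_self_eq]
  exact add_nonneg (Finset.sum_nonneg fun j _ => D.form_diag_nonneg μ j)
    (Finset.sum_nonneg fun j _ => Finset.sum_nonneg fun k _ => D.form_term_nonneg μ j k)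

/-- At `i` the diagonal term of `form_self_eq` is positive and bounds `u_i²`. From there the bound
spreads along edges, each of which bounds a difference `(u_k - u_j)²`; the induction is on the
function that decreases towards `i`. Definiteness and the finiteness of heights both follow. -/
theorem exists_sq_le (D : FormData t i s) (k : Fin t.rank) :
    ∃ C : ℚ, 0 ≤ C ∧ ∀ μ : t.Weight, (μ k / t.theta k) ^ 2 ≤ C * form s μ μ := by
  obtain ⟨d, hd⟩ := D.connected
  induction hN : d k using Nat.strong_induction_on generalizing k with
  | _ N ih =>
    by_cases hk : k = i
    · subst hk
      have h2 : (0 : ℚ) < s k := by exact_mod_cast D.s_pos k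
      have h3 := D.theta_pos k
      have h4 := D.theta_i
      have hc : 0 < (s k : ℚ) * t.pairing k t.theta * t.theta k := by positivity
      refine ⟨((s k : ℚ) * t.pairing k t.theta * t.theta k)⁻¹, by positivity, fun μ => ?_⟩
      rw [inv_mul_eq_div, le_div_iff₀ hc, D.form_self_eq, mul_comm]
      refine le_add_of_le_of_nonneg (Finset.single_le_sum
        (f := fun j => (s j : ℚ) * t.pairing j t.theta * t.theta j * (μ j / t.theta j) ^ 2)
        (fun j _ => D.form_diag_nonneg μ j) (Finset.mem_univ k)) ?_
      exact Finset.sum_nonneg fun j _ => Finset.sum_nonneg fun k _ => D.form_term_nonneg μ j k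
    · obtain ⟨j, hjk, ha, hlt⟩ := hd k hk
      obtain ⟨C, hC0, hC⟩ := ih (d j) (hN ▸ hlt) j rfl
      have h1 : (t.finCartan k j : ℚ) < 0 := by
        exact_mod_cast lt_of_le_of_ne (D.nonpos k j hjk.symm) ha
      have h2 : (0 : ℚ) < s k := by exact_mod_cast D.s_pos k
      have h3 := D.theta_pos j
      have h4 := D.theta_pos k
      have h5 : 0 < -(s k * t.finCartan k j : ℚ) / 2 := by nlinarith
      have hc : 0 < (-(s k * t.finCartan k j : ℚ) / 2) * t.theta k * t.theta j := by positivity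
      set c := (-(s k * t.finCartan k j : ℚ) / 2) * t.theta k * t.theta j with hcdef
      -- The constant comes from `x² ≤ 2y² + 2(x - y)²`.
      refine ⟨2 * C + 2 * c⁻¹, by positivity, fun μ => ?_⟩
      have key : (μ k / t.theta k - μ j / t.theta j) ^ 2 ≤ c⁻¹ * form s μ μ := by
        rw [inv_mul_eq_div, le_div_iff₀ hc, D.form_self_eq, mul_comm]
        refine le_add_of_nonneg_of_le
          (Finset.sum_nonneg fun j _ => D.form_diag_nonneg μ j) ?_
        refine le_trans ?_ (Finset.single_le_sum
          (f := fun k => ∑ j, (-(s k * t.finCartan k j : ℚ) / 2) * t.theta k * t.theta j *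
            (μ k / t.theta k - μ j / t.theta j) ^ 2)
          (fun k _ => Finset.sum_nonneg fun j _ => D.form_term_nonneg μ k j) (Finset.mem_univ k))
        exact Finset.single_le_sum
          (f := fun j => (-(s k * t.finCartan k j : ℚ) / 2) * t.theta k * t.theta j *
            (μ k / t.theta k - μ j / t.theta j) ^ 2)
          (fun j _ => D.form_term_nonneg μ k j) (Finset.mem_univ j)
      have := hC μ
      nlinarith [sq_nonneg (μ k / t.theta k - 2 * (μ j / t.theta j))]

theorem form_self_pos (D : FormData t i s) {μ : t.Weight} (h : μ ≠ 0) : 0 < form s μ μ := by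
  refine lt_of_le_of_ne (D.form_self_nonneg μ) fun h0 => h ?_
  funext k
  obtain ⟨C, -, hC⟩ := D.exists_sq_le k
  have h1 := hC μ
  rw [← h0, mul_zero] at h1
  have h2 : μ k / t.theta k = 0 := by
    have := sq_nonneg (μ k / t.theta k)
    exact pow_eq_zero_iff (two_ne_zero) |>.1 (le_antisymm h1 this)
  rcases div_eq_zero_iff.1 h2 with h3 | h3
  · exact h3
  · exact absurd h3 (D.theta_pos k).ne'

/-- Each coordinate is linear in `u_k`, and `u_k ≤ 1 + u_k²` trades it for the bounded square. -/
theorem exists_height_le (D : FormData t i s) (Q : ℚ) :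
    ∃ C : ℚ, ∀ μ : t.Weight, form s μ μ ≤ Q → ∑ k, μ k ≤ C := by
  choose C hC0 hC using D.exists_sq_le
  refine ⟨∑ k, t.theta k * (1 + C k * Q), fun μ hμ => Finset.sum_le_sum fun k _ => ?_⟩
  have h1 := D.theta_pos k
  have h2 := (hC k μ).trans (mul_le_mul_of_nonneg_left hμ (hC0 k))
  have h3 : μ k = t.theta k * (μ k / t.theta k) := by field_simp
  rw [h3]
  refine mul_le_mul_of_nonneg_left ?_ h1.le
  nlinarith [sq_nonneg (μ k / t.theta k - 1)]

/-- Otherwise every term `s_j μ_j ⟨h_j, μ⟩` of the positive number `(μ, μ)` would be at most `0`. -/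
theorem exists_pairing_pos (D : FormData t i s) {μ : t.Weight} (h0 : 0 ≤ μ) (h : μ ≠ 0) :
    ∃ j, 0 < μ j ∧ 0 < t.pairing j μ := by
  by_contra hcon
  push Not at hcon
  refine (D.form_self_pos h).not_ge (Finset.sum_nonpos fun j _ => ?_)
  have hs : (0 : ℚ) < s j := by exact_mod_cast D.s_pos j
  rcases (h0 j).eq_or_lt with h1 | h1
  · simp only [Pi.zero_apply] at h1; simp [← h1]
  · have h2 := hcon j h1
    have h3 : (0 : ℚ) < s j * μ j := mul_pos hs h1
    nlinarith

/-! ### Comparing the weights with a set of vectors -/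

/-- Descent from `θ` towards `μ`. At a weight `ν > μ` there is `j` in the support of `ν - μ` with
`⟨h_j, ν - μ⟩ > 0`. Dominance of `μ` gives `⟨h_j, ν⟩ > 0`, so `ν - α_j` is again a weight, and it is
still at least `μ`. The last weight before `μ` is the required `μ + α_j`. -/
theorem climb_of_dominant (D : FormData t i s) {μ : t.Weight} (hμ : Integral μ)
    (hdom : ∀ j, 0 ≤ t.pairing j μ) (hle : μ ≤ t.theta) (hne : μ ≠ t.theta) :
    ∃ j, t.IsWeight (μ + t.simpleRoot j) := by
  have key : ∀ (N : ℕ) (ν : t.Weight), t.IsWeight ν → μ ≤ ν → μ ≠ ν → ∑ k, (ν - μ) k ≤ N →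
      ∃ j, t.IsWeight (μ + t.simpleRoot j) := by
    intro N
    induction N with
    | zero =>
      intro ν _ hle hne hN
      exfalso
      apply hne
      have h0 : ∀ k ∈ Finset.univ, 0 ≤ (ν - μ) k := fun k _ => sub_nonneg.2 (hle k)
      have h1 := (Finset.sum_eq_zero_iff_of_nonneg h0).1
        (le_antisymm (by simpa using hN) (Finset.sum_nonneg h0))
      funext k
      have := h1 k (Finset.mem_univ k)
      simp only [Pi.sub_apply] at this
      linarith
    | succ N ih =>
      intro ν hν hle hne hN
      have hint : Integral ν := hν.integral D.theta_integral
      obtain ⟨j, hj, hp⟩ := D.exists_pairing_pos (μ := ν - μ) (sub_nonneg.2 hle)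
        (sub_ne_zero.2 hne.symm)
      have hj1 := (hint.sub hμ).one_le hj
      rw [pairing_sub] at hp
      have hp1 : 0 < t.pairing j ν := by linarith [hdom j]
      have hW := hν.sub (hint.one_le_pairing hp1)
      by_cases he : μ = ν - t.simpleRoot j
      · exact ⟨j, by rw [he]; simpa using hν⟩
      · refine ih _ hW (fun k => ?_) he ?_
        · by_cases hk : k = j
          · subst hk
            simp only [Pi.sub_apply, simpleRoot_self] at hj1 ⊢
            linarith
          · simp only [Pi.sub_apply, simpleRoot_of_ne hk]
            linarith [hle k]
        · have h2 : ∑ k, (ν - t.simpleRoot j - μ) k = ∑ k, (ν - μ) k - 1 := by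
            have : ∑ k, t.simpleRoot j k = 1 := by simp [simpleRoot]
            rw [← this, ← Finset.sum_sub_distrib]
            exact Finset.sum_congr rfl fun k _ => by simp only [Pi.sub_apply]; ring
          rw [h2]
          push_cast at hN
          linarith
  obtain ⟨N, hN⟩ := exists_nat_ge (∑ k, (t.theta - μ) k)
  exact key N _ .highest hle hne hN

theorem isWeight_of_dominant (D : FormData t i s) {μ : t.Weight} (hμ : Integral μ)
    (hdom : ∀ j, 0 ≤ t.pairing j μ) (hle : μ ≤ t.theta) : t.IsWeight μ := by
  by_cases hne : μ = t.theta
  · rw [hne]; exact .highest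
  · obtain ⟨j, hj⟩ := D.climb_of_dominant hμ hdom hle hne
    have := hj.sub (j := j) (by
      rw [pairing_add, D.pairing_simpleRoot_self]; linarith [hdom j])
    simpa using this

/-- A reflection at a negative pairing raises the height by at least one, and heights in `S` are
bounded, so repeated reflection ends at a dominant vector. Dominant vectors below `θ` are weights,
and each reflection can be undone inside a string. -/
theorem isWeight_of_closed (D : FormData t i s) {S : t.Weight → Prop}
    (hint : ∀ μ, S μ → Integral μ)
    (hrefl : ∀ μ j, S μ → t.pairing j μ < 0 → S (μ - t.pairing j μ • t.simpleRoot j))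
    (hbdd : ∃ C : ℚ, ∀ μ, S μ → ∑ k, μ k ≤ C)
    (hdom : ∀ μ, S μ → (∀ j, 0 ≤ t.pairing j μ) → μ ≤ t.theta) {μ : t.Weight} (hμ : S μ) :
    t.IsWeight μ ∧ μ ≤ t.theta := by
  obtain ⟨C, hC⟩ := hbdd
  have key : ∀ (N : ℕ) (μ : t.Weight), S μ → C - ∑ k, μ k < N → t.IsWeight μ ∧ μ ≤ t.theta := by
    intro N
    induction N with
    | zero =>
      intro μ hμ hN
      have := hC μ hμ
      simp only [Nat.cast_zero] at hN
      linarith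
    | succ N ih =>
      intro μ hμ hN
      by_cases hd : ∀ j, 0 ≤ t.pairing j μ
      · exact ⟨D.isWeight_of_dominant (hint μ hμ) hd (hdom μ hμ hd), hdom μ hμ hd⟩
      · push Not at hd
        obtain ⟨j, hj⟩ := hd
        have hp := (hint μ hμ).pairing_le_neg_one hj
        obtain ⟨z, hz⟩ := (hint μ hμ).pairing j
        have hsum : ∑ k, (μ - t.pairing j μ • t.simpleRoot j) k = ∑ k, μ k - t.pairing j μ := by
          have h1 : ∑ k, t.simpleRoot j k = 1 := by simp [simpleRoot]
          have h2 : t.pairing j μ = ∑ k, t.pairing j μ * t.simpleRoot j k := by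
            rw [← Finset.mul_sum, h1, mul_one]
          conv_rhs => rw [h2, ← Finset.sum_sub_distrib]
          exact Finset.sum_congr rfl fun k _ => by simp
        obtain ⟨hW, hle⟩ := ih _ (hrefl μ j hμ hj) (by
          rw [hsum]
          push_cast at hN
          linarith)
        constructor
        -- The reflected vector pairs to `-z > 0` with `h_j`, so its string of length `-z` leads
        -- back down to `μ`.
        · have h3 : t.pairing j (μ - t.pairing j μ • t.simpleRoot j) = -t.pairing j μ := by
            rw [pairing_sub, pairing_smul, D.pairing_simpleRoot_self]; ring
          have := IsWeight.string _ j (-z) hW (Or.inl ⟨by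
            rw [hz] at hj
            have : z < 0 := by exact_mod_cast hj
            omega, by rw [h3, hz]; push_cast; exact le_rfl⟩)
          have h4 : μ - t.pairing j μ • t.simpleRoot j - ((-z : ℤ) : ℚ) • t.simpleRoot j = μ := by
            rw [hz]; push_cast; module
          rwa [h4] at this
        · refine le_trans (fun k => ?_) hle
          have := simpleRoot_nonneg (t := t) j k
          simp only [Pi.sub_apply, Pi.smul_apply, smul_eq_mul, Pi.zero_apply] at this ⊢
          nlinarith
  obtain ⟨N, hN⟩ := exists_nat_gt (C - ∑ k, μ k)
  exact key N μ hμ hN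

end FormData

/-- Facts about the set of weights on which the structure of `B(θ)` depends. -/
structure WeightData (t : AffineType) : Prop where
  diag : ∀ j, t.finCartan j j = 2
  nonpos : ∀ j k, j ≠ k → t.finCartan j k ≤ 0
  zero_iff : ∀ j k, t.finCartan j k = 0 ↔ t.finCartan k j = 0
  integral : ∀ μ, t.IsWeight μ → Integral μ
  neg : ∀ μ, t.IsWeight μ → t.IsWeight (-μ)
  sign : ∀ μ, t.IsWeight μ → 0 ≤ μ ∨ μ ≤ 0
  multiple : ∀ (j : Fin t.rank) (c : ℚ), t.IsWeight (c • t.simpleRoot j) → c ≤ 1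
  le_theta : ∀ μ, t.IsWeight μ → μ ≤ t.theta
  climb : ∀ μ, t.IsWeight μ → μ ≠ t.theta → ∃ j, t.IsWeight (μ + t.simpleRoot j)

namespace FormData

variable {i : Fin t.rank} {s : Fin t.rank → ℤ}

theorem zero_iff (D : FormData t i s) (j k : Fin t.rank) :
    t.finCartan j k = 0 ↔ t.finCartan k j = 0 := by
  have h := D.symm j k
  have hj := D.s_pos j
  have hk := D.s_pos k
  constructor <;> intro h0
  · rw [h0, mul_zero] at h
    exact (mul_eq_zero.1 h.symm).resolve_left hk.ne'
  · rw [h0, mul_zero] at h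
    exact (mul_eq_zero.1 h).resolve_left hj.ne'

/-- Climbing needs no further hypothesis: a dominant weight below `θ` is covered by
`climb_of_dominant`, and any other weight has a negative pairing and can be raised in its string. -/
theorem weightData_of (D : FormData t i s)
    (hneg : ∀ μ, t.IsWeight μ → t.IsWeight (-μ))
    (hsign : ∀ μ, t.IsWeight μ → 0 ≤ μ ∨ μ ≤ 0)
    (hmul : ∀ (j : Fin t.rank) (c : ℚ), t.IsWeight (c • t.simpleRoot j) → c ≤ 1)
    (hle : ∀ μ, t.IsWeight μ → μ ≤ t.theta) : WeightData t where
  diag := D.diag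
  nonpos := D.nonpos
  zero_iff := D.zero_iff
  integral _ h := h.integral D.theta_integral
  neg := hneg
  sign := hsign
  multiple := hmul
  le_theta := hle
  climb μ hμ hne := by
    have hint := hμ.integral D.theta_integral
    by_cases hd : ∀ j, 0 ≤ t.pairing j μ
    · exact D.climb_of_dominant hint hd (hle μ hμ) hne
    · push Not at hd
      obtain ⟨j, hj⟩ := hd
      exact ⟨j, hμ.add (hint.pairing_le_neg_one hj)⟩

/-! ### Weights described by the length -/

/-- Along a string the squared length changes by `-2 s_j k (⟨h_j, μ⟩ - k)`, and `k` lies between `0`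
and `⟨h_j, μ⟩`: the points between a vector and its reflection are no longer than the two ends. -/
theorem form_self_le (D : FormData t i s) {μ : t.Weight} (h : t.IsWeight μ) :
    form s μ μ ≤ form s t.theta t.theta := by
  induction h with
  | highest => exact le_rfl
  | string μ j k _ hk ih =>
    rw [D.form_string]
    have hs : (0 : ℚ) < s j := by exact_mod_cast D.s_pos j
    have h1 : 0 ≤ (k : ℚ) * (t.pairing j μ - k) := by
      rcases hk with ⟨h2, h3⟩ | ⟨h2, h3⟩
      · have : (0 : ℚ) ≤ k := by exact_mod_cast h2
        exact mul_nonneg this (by linarith)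
      · have : (k : ℚ) ≤ 0 := by exact_mod_cast h2
        exact mul_nonneg_of_nonpos_of_nonpos this (by linarith)
    nlinarith

/-- Vectors at most as long as `θ` have coefficients of one sign. -/
def SignProperty (t : AffineType) (s : Fin t.rank → ℤ) : Prop :=
  ∀ μ : t.Weight, Integral μ → form s μ μ ≤ form s t.theta t.theta → 0 ≤ μ ∨ μ ≤ 0

/-- The set of integral vectors no longer than `θ` is stable under reflections and has bounded
height, so only its dominant members must be compared with `θ`. For such `μ ≠ 0` one has `(θ, μ) >
0`, and `hhalf` then says that `θ - μ` is no longer than `μ`. By sign coherence `θ` and `μ` are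
comparable. -/
theorem isWeight_and_le (D : FormData t i s) (hsign : SignProperty t s)
    (hhalf : ∀ μ : t.Weight, Integral μ → 0 < form s t.theta μ →
      form s t.theta t.theta ≤ 2 * form s t.theta μ) {μ : t.Weight}
    (h : Integral μ ∧ form s μ μ ≤ form s t.theta t.theta) : t.IsWeight μ ∧ μ ≤ t.theta := by
  refine D.isWeight_of_closed (S := fun μ => Integral μ ∧ form s μ μ ≤ form s t.theta t.theta)
    (fun μ h => h.1) ?_ ?_ ?_ h
  · rintro μ j ⟨hint, hle⟩ -
    refine ⟨?_, ?_⟩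
    · obtain ⟨z, hz⟩ := hint.pairing j
      rw [hz]
      exact hint.sub ((integral_simpleRoot j).zsmul z)
    · rw [D.form_string]; simpa using hle
  · obtain ⟨C, hC⟩ := D.exists_height_le (form s t.theta t.theta)
    exact ⟨C, fun μ h => hC μ h.2⟩
  · rintro μ ⟨hint, hle⟩ hdom
    by_cases h0 : μ = 0
    · rw [h0]; exact fun k => (D.theta_pos k).le
    have hnn : ∀ j ∈ Finset.univ, 0 ≤ (s j : ℚ) * t.theta j * t.pairing j μ := fun j _ => by
      have hs : (0 : ℚ) < s j := by exact_mod_cast D.s_pos j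
      have := D.theta_pos j
      have := hdom j
      positivity
    have hpos : 0 < form s t.theta μ := by
      refine lt_of_le_of_ne (Finset.sum_nonneg hnn) fun h1 => ?_
      have h2 := (Finset.sum_eq_zero_iff_of_nonneg hnn).1 h1.symm
      refine (D.form_self_pos h0).ne' (Finset.sum_eq_zero fun j hj => ?_)
      have h3 := h2 j hj
      have hs : (s j : ℚ) * t.theta j ≠ 0 :=
        (mul_pos (by exact_mod_cast D.s_pos j) (D.theta_pos j)).ne'
      rw [(mul_eq_zero.1 h3).resolve_left hs, mul_zero]
    have h4 : form s (t.theta - μ) (t.theta - μ) ≤ form s t.theta t.theta := by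
      rw [D.form_sub_self]
      linarith [hhalf μ hint hpos]
    rcases hsign _ (D.theta_integral.sub hint) h4 with h5 | h5
    · exact sub_nonneg.1 h5
    -- The other order, `θ ≤ μ`: as `μ` and `θ` are dominant, `(μ, μ) ≥ (θ, μ) ≥ (θ, θ) ≥ (μ, μ)`,
    -- so `μ - θ` has length zero.
    · have h6 : 0 ≤ μ - t.theta := by
        have := neg_nonneg.2 h5; simpa using this
      have hge : ∀ ν : t.Weight, (∀ j, 0 ≤ t.pairing j ν) → 0 ≤ form s (μ - t.theta) ν :=
        fun ν hν => Finset.sum_nonneg fun j _ => by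
          have hs : (0 : ℚ) < s j := by exact_mod_cast D.s_pos j
          have := hν j
          have := h6 j
          simp only [Pi.zero_apply] at this
          positivity
      have h7 := hge μ hdom
      have h8 := hge t.theta D.theta_dominant
      have e1 : form s (μ - t.theta) μ = form s μ μ - form s t.theta μ := by
        have := form_add_left s (μ - t.theta) t.theta μ
        rw [sub_add_cancel] at this; linarith
      have e2 : form s (μ - t.theta) t.theta = form s t.theta μ - form s t.theta t.theta := by
        have := form_add_left s (μ - t.theta) t.theta t.theta
        rw [sub_add_cancel, D.form_comm μ] at this; linarith
      have h9 : μ - t.theta = 0 := by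
        by_contra hne
        have := D.form_self_pos hne
        rw [D.form_sub_self, D.form_comm μ t.theta] at this
        linarith
      rw [sub_eq_zero.1 h9]

theorem isWeight_iff (D : FormData t i s) (hsign : SignProperty t s)
    (hhalf : ∀ μ : t.Weight, Integral μ → 0 < form s t.theta μ →
      form s t.theta t.theta ≤ 2 * form s t.theta μ) (μ : t.Weight) :
    t.IsWeight μ ↔ Integral μ ∧ form s μ μ ≤ form s t.theta t.theta :=
  ⟨fun h => ⟨h.integral D.theta_integral, D.form_self_le h⟩,
    fun h => (D.isWeight_and_le hsign hhalf h).1⟩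

theorem form_nonpos_of_disjoint (D : FormData t i s) {μ ν : t.Weight} (hμ : 0 ≤ μ) (hν : 0 ≤ ν)
    (h : ∀ j, μ j = 0 ∨ ν j = 0) (j k : Fin t.rank) :
    (s j : ℚ) * μ j * (t.finCartan j k * ν k) ≤ 0 := by
  have hs : (0 : ℚ) < s j := by exact_mod_cast D.s_pos j
  have h1 : 0 ≤ (s j : ℚ) * μ j := mul_nonneg hs.le (hμ j)
  have h2 : 0 ≤ ν k := hν k
  by_cases hjk : j = k
  · subst hjk
    rcases h j with h | h <;> simp [h]
  · have h3 : (t.finCartan j k : ℚ) ≤ 0 := by exact_mod_cast D.nonpos j k hjk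
    exact mul_nonpos_of_nonneg_of_nonpos h1 (mul_nonpos_of_nonpos_of_nonneg h3 h2)

theorem form_eq_sum (s : Fin t.rank → ℤ) (μ ν : t.Weight) :
    form s μ ν = ∑ j, ∑ k, (s j : ℚ) * μ j * (t.finCartan j k * ν k) := by
  simp only [form, pairing_eq, Finset.mul_sum]

theorem form_le_zero (D : FormData t i s) {μ ν : t.Weight} (hμ : 0 ≤ μ) (hν : 0 ≤ ν)
    (h : ∀ j, μ j = 0 ∨ ν j = 0) : form s μ ν ≤ 0 := by
  rw [form_eq_sum]
  exact Finset.sum_nonpos fun j _ => Finset.sum_nonpos fun k _ =>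
    D.form_nonpos_of_disjoint hμ hν h j k

theorem form_lt_zero (D : FormData t i s) {μ ν : t.Weight} (hμ : 0 ≤ μ) (hν : 0 ≤ ν)
    (h : ∀ j, μ j = 0 ∨ ν j = 0) {j k : Fin t.rank} (hj : μ j ≠ 0) (hk : ν k ≠ 0)
    (ha : t.finCartan j k ≠ 0) : form s μ ν < 0 := by
  rw [form_eq_sum]
  refine Finset.sum_neg' (fun j _ => Finset.sum_nonpos fun k _ =>
    D.form_nonpos_of_disjoint hμ hν h j k) ⟨j, Finset.mem_univ j, ?_⟩
  refine Finset.sum_neg' (fun k _ => D.form_nonpos_of_disjoint hμ hν h j k)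
    ⟨k, Finset.mem_univ k, lt_of_le_of_ne (D.form_nonpos_of_disjoint hμ hν h j k) ?_⟩
  have hs : (s j : ℚ) ≠ 0 := by exact_mod_cast (D.s_pos j).ne'
  have ha' : (t.finCartan j k : ℚ) ≠ 0 := by exact_mod_cast ha
  positivity

/-- No weight has a disconnected support. -/
theorem not_isWeight_add (D : FormData t i s) (hsign : SignProperty t s) {μ ν : t.Weight}
    (hμ : 0 ≤ μ) (hν : 0 ≤ ν) (hd : ∀ j, μ j = 0 ∨ ν j = 0)
    (ha : ∀ j k, μ j ≠ 0 → ν k ≠ 0 → t.finCartan j k = 0) (hμ0 : μ ≠ 0) (hν0 : ν ≠ 0) :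
    ¬ t.IsWeight (μ + ν) := by
  intro h
  have hint := h.integral D.theta_integral
  have h0 : form s μ ν = 0 := by
    rw [form_eq_sum]
    refine Finset.sum_eq_zero fun j _ => Finset.sum_eq_zero fun k _ => ?_
    by_cases hj : μ j = 0
    · simp [hj]
    · by_cases hk : ν k = 0
      · simp [hk]
      · simp [ha j k hj hk]
  have h1 := D.form_self_le h
  rw [D.form_add_self, h0] at h1
  -- The two parts are orthogonal, so changing the sign of one of them keeps the length; but `μ - ν`
  -- has coefficients of both signs.
  have h2 : form s (μ - ν) (μ - ν) ≤ form s t.theta t.theta := by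
    rw [D.form_sub_self, h0]; linarith
  have h3 : Integral (μ - ν) := by
    intro k
    obtain ⟨z, hz⟩ := hint k
    simp only [Pi.add_apply] at hz
    rcases hd k with hk | hk
    · exact ⟨-z, by simp only [Pi.sub_apply]; push_cast; linarith⟩
    · exact ⟨z, by simp only [Pi.sub_apply]; linarith⟩
  obtain ⟨a, ha⟩ := Function.ne_iff.1 hμ0
  obtain ⟨b, hb⟩ := Function.ne_iff.1 hν0
  rcases hsign _ h3 h2 with h4 | h4
  · have h5 := h4 b
    have h6 := hν b
    rcases hd b with h7 | h7
    · simp only [Pi.zero_apply, Pi.sub_apply] at *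
      exact hb (by linarith)
    · exact hb h7
  · have h5 := h4 a
    have h6 := hμ a
    rcases hd a with h7 | h7
    · exact ha h7
    · simp only [Pi.zero_apply, Pi.sub_apply] at *
      exact ha (by linarith)

/-- The bound `8` excludes multiples of simple roots: `z α_j` with `z ≥ 2` has squared length `2 s_j
z² ≥ 8`. -/
theorem weightData (D : FormData t i s) (hsign : SignProperty t s)
    (hhalf : ∀ μ : t.Weight, Integral μ → 0 < form s t.theta μ →
      form s t.theta t.theta ≤ 2 * form s t.theta μ)
    (hsmall : form s t.theta t.theta < 8) : WeightData t := by
  have hiff := D.isWeight_iff hsign hhalf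
  have hneg : ∀ μ, t.IsWeight μ → t.IsWeight (-μ) := fun μ h => by
    rw [hiff] at h ⊢
    exact ⟨h.1.neg, by rw [D.form_neg_self]; exact h.2⟩
  refine D.weightData_of hneg ?_ ?_ ?_
  · intro μ h
    rw [hiff] at h
    exact hsign μ h.1 h.2
  · intro j c h
    rw [hiff] at h
    obtain ⟨h1, h2⟩ := h
    obtain ⟨z, hz⟩ := h1 j
    simp only [Pi.smul_apply, simpleRoot_self, smul_eq_mul, mul_one] at hz
    subst hz
    rw [D.form_smul_right, form_smul_left, D.form_simpleRoot_right,
      D.pairing_simpleRoot_self] at h2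
    have hs : (1 : ℚ) ≤ s j := by exact_mod_cast D.s_pos j
    by_contra hc
    push Not at hc
    have hz2 : (2 : ℚ) ≤ z := by
      have : (1 : ℤ) < z := by exact_mod_cast hc
      exact_mod_cast this
    have hz4 : (4 : ℚ) ≤ z * z := by nlinarith
    nlinarith
  · exact fun μ h => (D.isWeight_and_le hsign hhalf ((hiff μ).1 h)).2

end FormData

end AffineType


/-! ### Finite strings, and arrows in a full subgraph -/

namespace Crystal

variable {I P B : Type}

theorem finiteStrings_of_measure {g : B → Option B} (h : B → ℕ)
    (hg : ∀ b c, g b = some c → h c < h b) : FiniteStrings g := by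
  have key : ∀ (k : ℕ) (b : B), (fun o : Option B => o.bind g)^[k] (some b) ≠ none → k ≤ h b := by
    intro k
    induction k with
    | zero => intro b _; exact Nat.zero_le _
    | succ k ih =>
      intro b hb
      rw [Function.iterate_succ_apply, Option.bind_some] at hb
      cases hc : g b with
      | none => rw [hc, iterate_bind_none] at hb; exact absurd rfl hb
      | some c =>
        rw [hc] at hb
        have := ih c hb
        have := hg b c hc
        omega
  exact fun b => ⟨h b, fun k hk => key k b hk⟩

theorem restrict_f_eq_some {C : Crystal I P B} {S : Set B} {i : I} {b c : S} :
    (C.restrict S).f i b = some c ↔ C.f i b = some (c : B) := by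
  simp only [restrict]
  cases h : C.f i b with
  | none => simp
  | some d =>
    by_cases hd : d ∈ S
    · simp [hd, Subtype.ext_iff]
    · simp only [Option.bind_some, hd, dite_false, Option.some.injEq, reduceCtorEq, false_iff]
      rintro rfl
      exact hd c.2

theorem restrict_e_eq_some {C : Crystal I P B} {S : Set B} {i : I} {b c : S} :
    (C.restrict S).e i b = some c ↔ C.e i b = some (c : B) := by
  simp only [restrict]
  cases h : C.e i b with
  | none => simp
  | some d =>
    by_cases hd : d ∈ S
    · simp [hd, Subtype.ext_iff]
    · simp only [Option.bind_some, hd, dite_false, Option.some.injEq, reduceCtorEq, false_iff]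
      rintro rfl
      exact hd c.2

end Crystal

/-! ### Duality of `B(θ)` and its strings -/

namespace AffineType

open Crystal

variable {t : AffineType}

theorem labelCrystal_f_x (j : Fin t.rank) (μ : t.Weight) : t.labelCrystal.f j (.x μ) =
    if μ = t.simpleRoot j then some (.y j) else some (.x (μ - t.simpleRoot j)) := rfl

theorem labelCrystal_e_x (j : Fin t.rank) (μ : t.Weight) : t.labelCrystal.e j (.x μ) =
    if μ = -t.simpleRoot j then some (.y j) else some (.x (μ + t.simpleRoot j)) := rfl

theorem labelCrystal_f_y (j k : Fin t.rank) : t.labelCrystal.f j (.y k) =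
    if k = j then some (.x (-t.simpleRoot j)) else none := rfl

theorem labelCrystal_e_y (j k : Fin t.rank) : t.labelCrystal.e j (.y k) =
    if k = j then some (.x (t.simpleRoot j)) else none := rfl

theorem simpleRoot_ne_zero (j : Fin t.rank) : t.simpleRoot j ≠ 0 := fun h => by
  have := congrFun h j
  simp [simpleRoot_self] at this

theorem labelCrystal_f_dual (j : Fin t.rank) (b : t.Label) :
    t.labelCrystal.e j b.dual = (t.labelCrystal.f j b).map Label.dual := by
  cases b with
  | x μ =>
    simp only [Label.dual, labelCrystal_e_x, labelCrystal_f_x, neg_inj]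
    split_ifs
    · rfl
    · simp only [Option.map_some, Label.dual, neg_sub]
      congr 2; abel
  | y k =>
    simp only [Label.dual, labelCrystal_e_y, labelCrystal_f_y]
    split_ifs
    · simp [Label.dual]
    · rfl

theorem Label.dual_dual (b : t.Label) : b.dual.dual = b := by
  cases b <;> simp [Label.dual]

theorem dual_mem_vertices {b : t.Label} (h : b ∈ t.vertices) : b.dual ∈ t.vertices := by
  cases b with
  | x μ =>
    rcases h with h | h
    · exact Or.inr (by simpa using h)
    · exact Or.inl h
  | y k => exact h

/-- The involution of `B(θ)`. -/
def dualVertex (b : t.vertices) : t.vertices := ⟨(b : t.Label).dual, dual_mem_vertices b.2⟩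

theorem dualVertex_dualVertex (b : t.vertices) : dualVertex (dualVertex b) = b :=
  Subtype.ext (Label.dual_dual _)

theorem dualVertex_x {b : t.vertices} {μ : t.Weight} (hb : (b : t.Label) = .x μ) :
    (dualVertex b : t.Label) = .x (-μ) := by
  simp [dualVertex, hb, Label.dual]

theorem dualVertex_y {b : t.vertices} {j : Fin t.rank} (hb : (b : t.Label) = .y j) :
    (dualVertex b : t.Label) = .y j := by
  simp [dualVertex, hb, Label.dual]

theorem e_dualVertex (j : Fin t.rank) (b : t.vertices) :
    t.thetaCrystal.e j (dualVertex b) = (t.thetaCrystal.f j b).map dualVertex := by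
  have key : ∀ b c : t.vertices, t.thetaCrystal.f j b = some c →
      t.thetaCrystal.e j (dualVertex b) = some (dualVertex c) := fun b c h => by
    rw [thetaCrystal, restrict_f_eq_some] at h
    rw [thetaCrystal, restrict_e_eq_some]
    simp [dualVertex, labelCrystal_f_dual, h]
  cases h : t.thetaCrystal.f j b with
  | some c => exact key b c h
  | none =>
    cases h' : t.thetaCrystal.e j (dualVertex b) with
    | none => rfl
    | some c =>
      exfalso
      have h2 : t.thetaCrystal.f j b = some (dualVertex c) := by
        rw [thetaCrystal, restrict_e_eq_some] at h'
        rw [thetaCrystal, restrict_f_eq_some]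
        have h3 := labelCrystal_f_dual j (b : t.Label)
        rw [show (b : t.Label).dual = (dualVertex b : t.Label) from rfl, h'] at h3
        obtain ⟨d, hd, he⟩ := Option.map_eq_some_iff.1 h3.symm
        rw [hd, ← Label.dual_dual d, he]; rfl
      rw [h] at h2; cases h2

theorem f_dualVertex (j : Fin t.rank) (b : t.vertices) :
    t.thetaCrystal.f j (dualVertex b) = (t.thetaCrystal.e j b).map dualVertex := by
  have := e_dualVertex j (dualVertex b)
  rw [dualVertex_dualVertex] at this
  rw [this, Option.map_map]
  cases t.thetaCrystal.f j (dualVertex b) <;> simp [dualVertex_dualVertex]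

theorem eps_dualVertex (j : Fin t.rank) (b : t.vertices) :
    t.thetaCrystal.eps j (dualVertex b) = t.thetaCrystal.phi j b :=
  stringLength_map (e_dualVertex j) b

theorem phi_dualVertex (j : Fin t.rank) (b : t.vertices) :
    t.thetaCrystal.phi j (dualVertex b) = t.thetaCrystal.eps j b :=
  stringLength_map (f_dualVertex j) b

/-- The involution `b ⊗ c ↦ c* ⊗ b*`. -/
def dualPair (p : t.vertices × t.vertices) : t.vertices × t.vertices :=
  (dualVertex p.2, dualVertex p.1)

theorem dualPair_dualPair (p : t.vertices × t.vertices) : dualPair (dualPair p) = p := by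
  simp [dualPair, dualVertex_dualVertex]

/-- Duality exchanges `φ` and `ε` and the two factors. The condition for `e` on the dual pair
becomes `φ(b) ≤ ε(c)`, which is the negation of the condition for `f` on `b ⊗ c`; ties are therefore
broken consistently. -/
theorem tensor_e_dualPair (j : Fin t.rank) (p : t.vertices × t.vertices) :
    (t.thetaCrystal.tensor t.thetaCrystal).e j (dualPair p) =
      ((t.thetaCrystal.tensor t.thetaCrystal).f j p).map dualPair := by
  obtain ⟨b, c⟩ := p
  simp only [tensor, dualPair, eps_dualVertex, phi_dualVertex, e_dualVertex]
  by_cases h : t.thetaCrystal.eps j c < t.thetaCrystal.phi j b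
  · rw [if_neg (not_le.2 h), if_pos h]
    cases t.thetaCrystal.f j b <;> rfl
  · rw [if_pos (not_lt.1 h), if_neg h]
    cases t.thetaCrystal.f j c <;> rfl

theorem tensor_f_dualPair (j : Fin t.rank) (p : t.vertices × t.vertices) :
    (t.thetaCrystal.tensor t.thetaCrystal).f j (dualPair p) =
      ((t.thetaCrystal.tensor t.thetaCrystal).e j p).map dualPair := by
  have := tensor_e_dualPair j (dualPair p)
  rw [dualPair_dualPair] at this
  rw [this, Option.map_map]
  cases (t.thetaCrystal.tensor t.thetaCrystal).f j (dualPair p) <;> simp [dualPair_dualPair]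

namespace WeightData

variable (W : WeightData t)
include W

theorem pairing_simpleRoot_self (j : Fin t.rank) : t.pairing j (t.simpleRoot j) = 2 := by
  rw [pairing_simpleRoot, W.diag]; norm_num

theorem isWeight_zero_of_simpleRoot {j : Fin t.rank} (h : t.IsWeight (t.simpleRoot j)) :
    t.IsWeight 0 := by
  have := h.sub (j := j) (by rw [W.pairing_simpleRoot_self]; norm_num)
  simpa using this

theorem mem_vertices_x {μ : t.Weight} : Label.x μ ∈ t.vertices ↔ t.IsWeight μ ∧ μ ≠ 0 := by
  constructor
  · rintro (h | h)
    · exact ⟨h.1, h.2.1⟩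
    · exact ⟨by simpa using W.neg _ h.1, by simpa using h.2.1⟩
  · rintro ⟨h, h0⟩
    rcases W.sign μ h with h1 | h1
    · exact Or.inl ⟨h, h0, h1⟩
    · exact Or.inr ⟨W.neg _ h, by simpa using h0, by simpa using h1⟩

omit W in
theorem simpleRoot_mem {j : Fin t.rank} :
    t.simpleRoot j ∈ t.positiveWeights ↔ t.IsWeight (t.simpleRoot j) :=
  ⟨fun h => h.1, fun h => ⟨h, simpleRoot_ne_zero j, simpleRoot_nonneg j⟩⟩

omit W in
theorem mem_vertices_y {j : Fin t.rank} : Label.y j ∈ t.vertices ↔ t.IsWeight (t.simpleRoot j) :=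
  simpleRoot_mem

theorem isWeight_of_eq {b : t.vertices} {μ : t.Weight} (hb : (b : t.Label) = .x μ) :
    t.IsWeight μ := (W.mem_vertices_x.1 (hb ▸ b.2)).1

theorem ne_zero_of_eq {b : t.vertices} {μ : t.Weight} (hb : (b : t.Label) = .x μ) : μ ≠ 0 :=
  (W.mem_vertices_x.1 (hb ▸ b.2)).2

omit W in
theorem isWeight_simpleRoot_of_eq {b : t.vertices} {j : Fin t.rank} (hb : (b : t.Label) = .y j) :
    t.IsWeight (t.simpleRoot j) := mem_vertices_y.1 (hb ▸ b.2)

theorem exists_x {μ : t.Weight} (h : t.IsWeight μ) (h0 : μ ≠ 0) :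
    ∃ b : t.vertices, (b : t.Label) = .x μ := ⟨⟨_, W.mem_vertices_x.2 ⟨h, h0⟩⟩, rfl⟩

omit W in
theorem exists_y {j : Fin t.rank} (h : t.IsWeight (t.simpleRoot j)) :
    ∃ b : t.vertices, (b : t.Label) = .y j := ⟨⟨_, mem_vertices_y.2 h⟩, rfl⟩

/-! ### Values of the crystal operators -/

variable {j : Fin t.rank} {b : t.vertices} {μ : t.Weight}

theorem f_simple (hb : (b : t.Label) = .x (t.simpleRoot j)) :
    ∃ c, t.thetaCrystal.f j b = some c ∧ (c : t.Label) = .y j := by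
  obtain ⟨c, hc⟩ := WeightData.exists_y (W.isWeight_of_eq hb)
  exact ⟨c, by rw [thetaCrystal, restrict_f_eq_some, hb, labelCrystal_f_x, if_pos rfl, hc], hc⟩

theorem f_sub (hb : (b : t.Label) = .x μ) (hμ : μ ≠ t.simpleRoot j)
    (h : t.IsWeight (μ - t.simpleRoot j)) :
    ∃ c, t.thetaCrystal.f j b = some c ∧ (c : t.Label) = .x (μ - t.simpleRoot j) := by
  obtain ⟨c, hc⟩ := W.exists_x h (sub_ne_zero.2 hμ)
  exact ⟨c, by rw [thetaCrystal, restrict_f_eq_some, hb, labelCrystal_f_x, if_neg hμ, hc], hc⟩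

theorem f_none (hb : (b : t.Label) = .x μ) (h : ¬ t.IsWeight (μ - t.simpleRoot j)) :
    t.thetaCrystal.f j b = none := by
  cases hc : t.thetaCrystal.f j b with
  | none => rfl
  | some c =>
    exfalso
    rw [thetaCrystal, restrict_f_eq_some, hb, labelCrystal_f_x] at hc
    split_ifs at hc with h1
    · subst h1
      exact h (by simpa using W.isWeight_zero_of_simpleRoot (W.isWeight_of_eq hb))
    · exact h (W.isWeight_of_eq (Option.some.inj hc).symm)

theorem f_y_self (hb : (b : t.Label) = .y j) :
    ∃ c, t.thetaCrystal.f j b = some c ∧ (c : t.Label) = .x (-t.simpleRoot j) := by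
  obtain ⟨c, hc⟩ := W.exists_x (W.neg _ (WeightData.isWeight_simpleRoot_of_eq hb))
    (neg_ne_zero.2 (simpleRoot_ne_zero j))
  exact ⟨c, by rw [thetaCrystal, restrict_f_eq_some, hb, labelCrystal_f_y, if_pos rfl, hc], hc⟩

omit W in
theorem f_y_ne {k : Fin t.rank} (hb : (b : t.Label) = .y k) (h : k ≠ j) :
    t.thetaCrystal.f j b = none := by
  cases hc : t.thetaCrystal.f j b with
  | none => rfl
  | some c =>
    rw [thetaCrystal, restrict_f_eq_some, hb, labelCrystal_f_y, if_neg h] at hc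
    cases hc

theorem e_simple (hb : (b : t.Label) = .x (-t.simpleRoot j)) :
    ∃ c, t.thetaCrystal.e j b = some c ∧ (c : t.Label) = .y j := by
  obtain ⟨c, hc, hc'⟩ := W.f_simple (j := j) (b := dualVertex b) (by
    rw [dualVertex_x hb, neg_neg])
  refine ⟨dualVertex c, ?_, dualVertex_y hc'⟩
  rw [← dualVertex_dualVertex b, e_dualVertex, hc]; rfl

theorem e_add (hb : (b : t.Label) = .x μ) (hμ : μ ≠ -t.simpleRoot j)
    (h : t.IsWeight (μ + t.simpleRoot j)) :
    ∃ c, t.thetaCrystal.e j b = some c ∧ (c : t.Label) = .x (μ + t.simpleRoot j) := by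
  obtain ⟨c, hc⟩ := W.exists_x h (by rwa [Ne, add_eq_zero_iff_eq_neg])
  exact ⟨c, by rw [thetaCrystal, restrict_e_eq_some, hb, labelCrystal_e_x, if_neg hμ, hc], hc⟩

theorem e_none (hb : (b : t.Label) = .x μ) (h : ¬ t.IsWeight (μ + t.simpleRoot j)) :
    t.thetaCrystal.e j b = none := by
  have := W.f_none (j := j) (dualVertex_x hb) (fun h' => h (by
    have := W.neg _ h'
    rwa [neg_sub, sub_neg_eq_add, add_comm] at this))
  rw [← dualVertex_dualVertex b, e_dualVertex, this]; rfl

theorem e_y_self (hb : (b : t.Label) = .y j) :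
    ∃ c, t.thetaCrystal.e j b = some c ∧ (c : t.Label) = .x (t.simpleRoot j) := by
  obtain ⟨c, hc⟩ := W.exists_x (WeightData.isWeight_simpleRoot_of_eq hb) (simpleRoot_ne_zero j)
  exact ⟨c, by rw [thetaCrystal, restrict_e_eq_some, hb, labelCrystal_e_y, if_pos rfl, hc], hc⟩

omit W in
theorem e_y_ne {k : Fin t.rank} (hb : (b : t.Label) = .y k) (h : k ≠ j) :
    t.thetaCrystal.e j b = none := by
  cases hc : t.thetaCrystal.e j b with
  | none => rfl
  | some c =>
    rw [thetaCrystal, restrict_e_eq_some, hb, labelCrystal_e_y, if_neg h] at hc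
    cases hc

/-! ### Regularity -/

theorem f_eq_some_iff (j : Fin t.rank) (b c : t.vertices) :
    t.thetaCrystal.f j b = some c ↔ t.thetaCrystal.e j c = some b := by
  rw [thetaCrystal, restrict_f_eq_some, restrict_e_eq_some]
  obtain ⟨b, hb⟩ := b
  obtain ⟨c, hc⟩ := c
  cases b with
  | x μ =>
    have hμ := (W.mem_vertices_x.1 hb).2
    simp only [labelCrystal_f_x]
    cases c with
    | x ν =>
      have hν := (W.mem_vertices_x.1 hc).2
      simp only [labelCrystal_e_x]
      constructor
      · intro h
        split_ifs at h with h1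
        · simp at h
        · simp only [Option.some.injEq, Label.x.injEq] at h
          subst h
          rw [if_neg (fun h2 => hμ (by simpa using h2))]
          simp
      · intro h
        split_ifs at h with h1
        · simp at h
        · simp only [Option.some.injEq, Label.x.injEq] at h
          subst h
          rw [if_neg (fun h2 => hν (by simpa using h2))]
          simp
    | y k =>
      simp only [labelCrystal_e_y]
      constructor
      · intro h
        split_ifs at h with h1
        · simp only [Option.some.injEq, Label.y.injEq] at h
          rw [if_pos h.symm, h1]
        · simp at h
      · intro h
        split_ifs at h with h1
        · simp only [Option.some.injEq, Label.x.injEq] at h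
          rw [if_pos h.symm, h1]
  | y k =>
    simp only [labelCrystal_f_y]
    cases c with
    | x ν =>
      simp only [labelCrystal_e_x]
      constructor
      · intro h
        split_ifs at h with h1
        simp only [Option.some.injEq, Label.x.injEq] at h
        rw [if_pos h.symm, h1]
      · intro h
        split_ifs at h with h1
        · simp only [Option.some.injEq, Label.y.injEq] at h
          rw [if_pos h.symm, h1]
        · simp at h
    | y l =>
      simp only [labelCrystal_e_y]
      constructor
      · intro h
        split_ifs at h with h1
        simp at h
      · intro h
        split_ifs at h with h1
        simp at h

theorem isWeight_wt (b : t.vertices) : t.IsWeight (t.thetaCrystal.wt b) := by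
  obtain ⟨b, hb⟩ := b
  cases b with
  | x μ => exact (W.mem_vertices_x.1 hb).1
  | y k => exact W.isWeight_zero_of_simpleRoot (mem_vertices_y.1 hb)

omit W in
theorem wt_f {c : t.vertices} (h : t.thetaCrystal.f j b = some c) :
    t.thetaCrystal.wt b = t.thetaCrystal.wt c + t.simpleRoot j := by
  rw [thetaCrystal, restrict_f_eq_some] at h
  obtain ⟨b, hb⟩ := b
  obtain ⟨c, hc⟩ := c
  change t.labelCrystal.wt b = t.labelCrystal.wt c + _
  change t.labelCrystal.f j b = some c at h
  cases b with
  | x μ =>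
    rw [labelCrystal_f_x] at h
    split_ifs at h with h1
    · cases h; simp [labelCrystal, h1]
    · cases h; simp [labelCrystal]
  | y k =>
    rw [labelCrystal_f_y] at h
    split_ifs at h with h1
    cases h; simp [labelCrystal]

/-- An arrow of colour `j` changes the coefficient of the weight at `α_j` by one, and this
coefficient stays between `-θ_j` and `θ_j`. Its distance from the end of this interval, rounded down
to a natural number, bounds the string. -/
theorem regular : t.thetaCrystal.Regular := by
  have hfl : ∀ x : ℚ, 0 ≤ x → ⌊x⌋₊ < ⌊x + 1⌋₊ := fun x hx => by
    rw [Nat.floor_add_one hx]; exact Nat.lt_succ_self _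
  have hlow : ∀ b j, 0 ≤ t.thetaCrystal.wt b j + t.theta j := fun b j => by
    have := W.le_theta _ (W.neg _ (W.isWeight_wt b)) j
    simp only [Pi.neg_apply] at this
    linarith
  have hup : ∀ b j, 0 ≤ t.theta j - t.thetaCrystal.wt b j := fun b j =>
    sub_nonneg.2 (W.le_theta _ (W.isWeight_wt b) j)
  refine ⟨W.f_eq_some_iff, fun j => ?_, fun j => ?_⟩
  · refine finiteStrings_of_measure (fun b => ⌊t.thetaCrystal.wt b j + t.theta j⌋₊)
      fun b c h => ?_
    have h1 := hfl _ (hlow c j)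
    have h2 : t.thetaCrystal.wt b j = t.thetaCrystal.wt c j + 1 := by
      rw [wt_f h]; simp [simpleRoot_self]
    rw [h2]
    convert h1 using 2
    ring
  · refine finiteStrings_of_measure (fun b => ⌊t.theta j - t.thetaCrystal.wt b j⌋₊)
      fun b c h => ?_
    have h1 := hfl _ (hup c j)
    have h2 : t.thetaCrystal.wt c j = t.thetaCrystal.wt b j + 1 := by
      rw [wt_f ((W.f_eq_some_iff j c b).2 h)]; simp [simpleRoot_self]
    rw [h2] at h1 ⊢
    convert h1 using 2
    ring

/-! ### String lengths -/

theorem phi_y (hb : (b : t.Label) = .y j) : t.thetaCrystal.phi j b = 1 := by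
  obtain ⟨c, hc, hc'⟩ := W.f_y_self hb
  rw [W.regular.phi_eq hc, phi_eq_zero (W.f_none hc' fun h => ?_)]
  have := W.multiple j 2 (by
    have := W.neg _ h
    convert this using 1
    module)
  norm_num at this

theorem eps_y (hb : (b : t.Label) = .y j) : t.thetaCrystal.eps j b = 1 := by
  rw [← phi_dualVertex]; exact W.phi_y (dualVertex_y hb)

omit W in
theorem eps_y_ne {k : Fin t.rank} (hb : (b : t.Label) = .y k) (h : k ≠ j) :
    t.thetaCrystal.eps j b = 0 := eps_eq_zero (e_y_ne hb h)

theorem phi_simple (hb : (b : t.Label) = .x (t.simpleRoot j)) : t.thetaCrystal.phi j b = 2 := by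
  obtain ⟨c, hc, hc'⟩ := W.f_simple hb
  rw [W.regular.phi_eq hc, W.phi_y hc']

theorem not_isWeight_simple_add : ¬ t.IsWeight (t.simpleRoot j + t.simpleRoot j) := fun h => by
  have := W.multiple j 2 (by convert h using 1; module)
  norm_num at this

theorem eps_simple (hb : (b : t.Label) = .x (t.simpleRoot j)) : t.thetaCrystal.eps j b = 0 :=
  eps_eq_zero (W.e_none hb W.not_isWeight_simple_add)

theorem eps_neg_simple (hb : (b : t.Label) = .x (-t.simpleRoot j)) :
    t.thetaCrystal.eps j b = 2 := by
  rw [← phi_dualVertex]; exact W.phi_simple (by rw [dualVertex_x hb, neg_neg])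

theorem phi_neg_simple (hb : (b : t.Label) = .x (-t.simpleRoot j)) :
    t.thetaCrystal.phi j b = 0 := by
  rw [← eps_dualVertex]; exact W.eps_simple (by rw [dualVertex_x hb, neg_neg])

/-- For `μ` off the line through `α_j` the string never meets `y_j`, so it subtracts `α_j` until it
first leaves the set of weights. -/
theorem phi_spec (n : ℕ) : ∀ (b : t.vertices) (μ : t.Weight), (b : t.Label) = .x μ →
    (∀ c : ℚ, μ ≠ c • t.simpleRoot j) → t.thetaCrystal.phi j b = n →
    t.IsWeight (μ - (n : ℚ) • t.simpleRoot j) ∧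
      ¬ t.IsWeight (μ - ((n : ℚ) + 1) • t.simpleRoot j) := by
  induction n with
  | zero =>
    intro b μ hb hμ hn
    have h1 := W.regular.eq_none_of_phi hn
    refine ⟨by simpa using W.isWeight_of_eq hb, fun h => ?_⟩
    obtain ⟨c, hc, -⟩ := W.f_sub (j := j) hb (by simpa using hμ 1) (by simpa using h)
    rw [h1] at hc; cases hc
  | succ n ih =>
    intro b μ hb hμ hn
    obtain ⟨c, hc⟩ := Regular.exists_of_phi (C := t.thetaCrystal) (i := j) (b := b) (by omega)
    have h1 : t.IsWeight (μ - t.simpleRoot j) := by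
      by_contra h
      rw [W.f_none hb h] at hc; cases hc
    obtain ⟨c', hc', hc2⟩ := W.f_sub (j := j) hb (by simpa using hμ 1) h1
    rw [hc] at hc'
    cases hc'
    have h2 := W.regular.phi_eq hc
    have h3 := ih c _ hc2 (fun r hr => hμ (r + 1) (by
      rw [add_smul, one_smul, ← hr, sub_add_cancel])) (by omega)
    push_cast
    have e1 : μ - ((n : ℚ) + 1) • t.simpleRoot j =
        μ - t.simpleRoot j - (n : ℚ) • t.simpleRoot j := by module
    have e2 : μ - ((n : ℚ) + 1 + 1) • t.simpleRoot j =
        μ - t.simpleRoot j - ((n : ℚ) + 1) • t.simpleRoot j := by module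
    rwa [e1, e2]

theorem eps_spec (n : ℕ) (b : t.vertices) (μ : t.Weight) (hb : (b : t.Label) = .x μ)
    (hμ : ∀ c : ℚ, μ ≠ c • t.simpleRoot j) (hn : t.thetaCrystal.eps j b = n) :
    t.IsWeight (μ + (n : ℚ) • t.simpleRoot j) ∧
      ¬ t.IsWeight (μ + ((n : ℚ) + 1) • t.simpleRoot j) := by
  have h := W.phi_spec (j := j) n (dualVertex b) (-μ) (dualVertex_x hb) (fun c hc => hμ (-c) (by
    rw [neg_smul, ← hc, neg_neg])) (by rw [phi_dualVertex, hn])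
  refine ⟨?_, fun h' => h.2 ?_⟩
  · have := W.neg _ h.1
    convert this using 1
    module
  · have := W.neg _ h'
    convert this using 1
    module

/-- On the line through `α_j` only the string `x_{α_j} → y_j → x_{-α_j}` occurs. Off the line, `p`
and `e` are the numbers of steps to the two ends of the string, and saturation at each end forces
the equality. -/
theorem phi_sub_eps_x (hb : (b : t.Label) = .x μ) :
    (t.thetaCrystal.phi j b : ℚ) - t.thetaCrystal.eps j b = t.pairing j μ := by
  by_cases hline : ∃ c : ℚ, μ = c • t.simpleRoot j
  · obtain ⟨c, rfl⟩ := hline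
    have hw := W.isWeight_of_eq hb
    have h1 := W.multiple j c hw
    have h2 := W.multiple j (-c) (by rw [neg_smul]; exact W.neg _ hw)
    obtain ⟨z, hz⟩ := W.integral _ hw j
    simp only [Pi.smul_apply, simpleRoot_self, smul_eq_mul, mul_one] at hz
    subst hz
    have h0 : z ≠ 0 := fun h => W.ne_zero_of_eq hb (by simp [h])
    have h3 : z ≤ 1 := by exact_mod_cast h1
    have h4 : -z ≤ 1 := by exact_mod_cast h2
    rw [pairing_smul, W.pairing_simpleRoot_self]
    rcases (by omega : z = 1 ∨ z = -1) with h | h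
    · subst h
      have hb' : (b : t.Label) = .x (t.simpleRoot j) := by simpa using hb
      rw [W.phi_simple hb', W.eps_simple hb']; norm_num
    · subst h
      have hb' : (b : t.Label) = .x (-t.simpleRoot j) := by simpa using hb
      rw [W.phi_neg_simple hb', W.eps_neg_simple hb']; norm_num
  · push Not at hline
    obtain ⟨h1, h2⟩ := W.phi_spec (j := j) _ b μ hb hline rfl
    obtain ⟨h3, h4⟩ := W.eps_spec (j := j) _ b μ hb hline rfl
    set p := t.thetaCrystal.phi j b
    set e := t.thetaCrystal.eps j b
    obtain ⟨z, hz⟩ := (W.integral _ (W.isWeight_of_eq hb)).pairing j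
    -- If `p - e > z`, the lower end pairs to `z - 2p ≤ -(p + e + 1)`; its string upwards then
    -- contains `μ + (e + 1) α_j`, one step beyond the upper end. The other inequality is symmetric.
    have h5 : (p : ℤ) - e ≤ z := by
      by_contra hcon
      push Not at hcon
      have hp : t.pairing j (μ - (p : ℚ) • t.simpleRoot j) = z - 2 * p := by
        rw [pairing_sub, pairing_smul, W.pairing_simpleRoot_self, hz]; ring
      have hc : (z : ℚ) + e + 1 ≤ p := by exact_mod_cast (by omega : z + e + 1 ≤ p)
      apply h4
      have := h1.add_smul (j := j) (p + e + 1) (by rw [hp]; push_cast; linarith)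
      convert this using 1
      push_cast
      module
    have h6 : z ≤ (p : ℤ) - e := by
      by_contra hcon
      push Not at hcon
      have hp : t.pairing j (μ + (e : ℚ) • t.simpleRoot j) = z + 2 * e := by
        rw [pairing_add, pairing_smul, W.pairing_simpleRoot_self, hz]; ring
      have hc : (p : ℚ) + 1 ≤ z + e := by exact_mod_cast (by omega : (p : ℤ) + 1 ≤ z + e)
      apply h2
      have := h3.sub_smul (j := j) (p + e + 1) (by rw [hp]; push_cast; linarith)
      convert this using 1
      push_cast
      module
    rw [hz]
    exact_mod_cast le_antisymm h5 h6

theorem phi_le_one (hb : (b : t.Label) = .x μ) (hμ : μ ≠ t.simpleRoot j)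
    (h : ¬ t.IsWeight (μ - t.simpleRoot j - t.simpleRoot j)) : t.thetaCrystal.phi j b ≤ 1 := by
  by_cases h1 : t.IsWeight (μ - t.simpleRoot j)
  · obtain ⟨c, hc, hc'⟩ := W.f_sub hb hμ h1
    rw [W.regular.phi_eq hc, phi_eq_zero (W.f_none hc' h)]
  · rw [phi_eq_zero (W.f_none hb h1)]; exact Nat.zero_le _

theorem phi_pos (hb : (b : t.Label) = .x μ) (h : t.IsWeight (μ - t.simpleRoot j)) :
    1 ≤ t.thetaCrystal.phi j b := by
  by_cases hμ : μ = t.simpleRoot j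
  · subst hμ; rw [W.phi_simple hb]; norm_num
  · obtain ⟨c, hc, -⟩ := W.f_sub hb hμ h
    rw [W.regular.phi_eq hc]; exact Nat.le_add_left _ _

theorem phi_zero (hb : (b : t.Label) = .x μ) (h : ¬ t.IsWeight (μ - t.simpleRoot j)) :
    t.thetaCrystal.phi j b = 0 := phi_eq_zero (W.f_none hb h)

theorem eps_zero (hb : (b : t.Label) = .x μ) (h : ¬ t.IsWeight (μ + t.simpleRoot j)) :
    t.thetaCrystal.eps j b = 0 := eps_eq_zero (W.e_none hb h)

theorem isWeight_of_phi (hb : (b : t.Label) = .x μ) (h : t.thetaCrystal.phi j b ≠ 0) :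
    t.IsWeight (μ - t.simpleRoot j) := by
  by_contra h1
  exact h (W.phi_zero hb h1)

theorem isWeight_of_eps (hb : (b : t.Label) = .x μ) (h : t.thetaCrystal.eps j b ≠ 0) :
    t.IsWeight (μ + t.simpleRoot j) := by
  by_contra h1
  exact h (W.eps_zero hb h1)

/-! ### Connectedness -/

/-- Every vertex except `x_θ` admits some `e_j`: `climb` provides it at `x_μ`, and `y_k` is raised
by `e_k`. Each such arrow reduces the height of `θ` minus the weight by one. -/
theorem mem_component (b : t.vertices) : b ∈ t.thetaCrystal.component t.xTheta := by
  have step : ∀ b : t.vertices, b ≠ t.xTheta → ∃ j c, t.thetaCrystal.e j b = some c := by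
    intro b hb
    rcases hl : (b : t.Label) with μ | k
    · have hne : μ ≠ t.theta := fun h => hb (Subtype.ext (by rw [hl, h]; rfl))
      obtain ⟨j, hj⟩ := W.climb μ (W.isWeight_of_eq hl) hne
      by_cases h0 : μ = -t.simpleRoot j
      · subst h0
        obtain ⟨c, hc, -⟩ := W.e_simple hl
        exact ⟨j, c, hc⟩
      · obtain ⟨c, hc, -⟩ := W.e_add hl h0 hj
        exact ⟨j, c, hc⟩
    · obtain ⟨c, hc, -⟩ := W.e_y_self hl
      exact ⟨k, c, hc⟩
  have key : ∀ (N : ℕ) (b : t.vertices), ∑ k, (t.theta k - t.thetaCrystal.wt b k) < N →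
      b ∈ t.thetaCrystal.component t.xTheta := by
    intro N
    induction N with
    | zero =>
      intro b hb
      exact absurd hb (not_lt.2 (by
        rw [Nat.cast_zero]
        exact Finset.sum_nonneg fun k _ => sub_nonneg.2 (W.le_theta _ (W.isWeight_wt b) k)))
    | succ N ih =>
      intro b hb
      by_cases hx : b = t.xTheta
      · rw [hx]; exact .refl _
      · obtain ⟨j, c, hc⟩ := step b hx
        have hf := (W.f_eq_some_iff j c b).2 hc
        refine .trans _ c _ (ih c ?_) (.rel _ _ ⟨j, hf⟩)
        have h1 : ∑ k, t.simpleRoot j k = 1 := by simp [simpleRoot]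
        have h2 : ∑ k, (t.theta k - t.thetaCrystal.wt c k) =
            ∑ k, (t.theta k - t.thetaCrystal.wt b k) - 1 := by
          rw [wt_f hf, ← h1, ← Finset.sum_sub_distrib]
          exact Finset.sum_congr rfl fun k _ => by simp only [Pi.add_apply]; ring
        rw [h2]
        push_cast at hb
        linarith
  obtain ⟨N, hN⟩ := exists_nat_gt (∑ k, (t.theta k - t.thetaCrystal.wt b k))
  exact key N b hN

end WeightData

end AffineType


namespace AffineType

open Crystal

variable {t : AffineType}

/-! ### Sums of simple roots along paths -/

/-- `α` is the sum of the simple roots along a path from `j` to `i`. -/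
inductive PathTo (t : AffineType) (i : Fin t.rank) : Fin t.rank → t.Weight → Prop
  | nil : PathTo t i i (t.simpleRoot i)
  | cons {j j' : Fin t.rank} {α : t.Weight} (hne : j ≠ j') (hadj : t.finCartan j j' ≠ 0)
      (h : PathTo t i j' α) (h0 : α j = 0) : PathTo t i j (t.simpleRoot j + α)

namespace PathTo

variable {i j : Fin t.rank} {α : t.Weight}

theorem start (h : PathTo t i j α) : α j = 1 := by
  cases h with
  | nil => exact simpleRoot_self i
  | cons _ _ _ h0 => simp [simpleRoot_self, h0]

theorem zero_or_one (h : PathTo t i j α) (v : Fin t.rank) : α v = 0 ∨ α v = 1 := by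
  induction h with
  | nil =>
    by_cases hv : v = i
    · subst hv; exact Or.inr (simpleRoot_self v)
    · exact Or.inl (simpleRoot_of_ne hv)
  | @cons j j' α _ _ _ h0 ih =>
    by_cases hv : v = j
    · subst hv; exact Or.inr (by simp [simpleRoot_self, h0])
    · simpa [simpleRoot_of_ne hv] using ih

theorem nonneg (h : PathTo t i j α) : 0 ≤ α := fun v => by
  rcases h.zero_or_one v with h | h <;> simp [h]

theorem target (h : PathTo t i j α) : α i = 1 := by
  induction h with
  | nil => exact simpleRoot_self i
  | @cons j j' α _ _ _ h0 ih =>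
    have : i ≠ j := fun h => by subst h; rw [h0] at ih; norm_num at ih
    simp [simpleRoot_of_ne this, ih]

theorem eq_simpleRoot (h : PathTo t i i α) : α = t.simpleRoot i := by
  cases h with
  | nil => rfl
  | cons _ _ h h0 => rw [h.target] at h0; norm_num at h0

theorem ne_zero (h : PathTo t i j α) : α ≠ 0 := fun h0 => by
  have := h.start
  simp [h0] at this

end PathTo

/-- A path sum from `j` to `i` outside the support of `γ`, with `j` joined to that support. -/
structure Linked (t : AffineType) (i j : Fin t.rank) (γ α : t.Weight) : Prop where
  path : PathTo t i j α
  disjoint : ∀ v, α v ≠ 0 → γ v = 0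
  joined : ∃ k, γ k ≠ 0 ∧ t.finCartan j k ≠ 0

theorem Linked.apply_start {i j : Fin t.rank} {γ α : t.Weight} (h : Linked t i j γ α) :
    γ j = 0 := h.disjoint j (by rw [h.path.start]; norm_num)

theorem Linked.apply_target {i j : Fin t.rank} {γ α : t.Weight} (h : Linked t i j γ α) :
    γ i = 0 := h.disjoint i (by rw [h.path.target]; norm_num)

/-- The induction step for linked paths: once the first vertex of the path has been absorbed into
`γ`, the rest of the path is linked to the result. -/
theorem linked_cons {i j j' : Fin t.rank} {γ α : t.Weight}
    (hadj' : t.finCartan j' j ≠ 0) (h : PathTo t i j' α) (h0 : α j = 0)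
    (hd : ∀ v, (t.simpleRoot j + α) v ≠ 0 → γ v = 0) :
    Linked t i j' (γ + t.simpleRoot j) α where
  path := h
  disjoint v hv := by
    have hvj : v ≠ j := fun h => hv (h ▸ h0)
    have := hd v (by simpa [simpleRoot_of_ne hvj] using hv)
    simp [this, simpleRoot_of_ne hvj]
  joined := by
    have hj : α j' = 1 := h.start
    refine ⟨j, ?_, hadj'⟩
    have h1 : γ j = 0 := hd j (by simp [simpleRoot_self, h0])
    simp [h1, simpleRoot_self]

namespace WeightData

variable (W : WeightData t)
include W

theorem term_nonpos {j : Fin t.rank} {η : t.Weight} (h : 0 ≤ η) (hj : η j = 0) (k : Fin t.rank) :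
    (t.finCartan j k : ℚ) * η k ≤ 0 := by
  by_cases hjk : j = k
  · subst hjk; simp [hj]
  · exact mul_nonpos_of_nonpos_of_nonneg (by exact_mod_cast W.nonpos j k hjk) (h k)

theorem pairing_nonpos {j : Fin t.rank} {η : t.Weight} (h : 0 ≤ η) (hj : η j = 0) :
    t.pairing j η ≤ 0 := by
  rw [pairing_eq]
  exact Finset.sum_nonpos fun k _ => W.term_nonpos h hj k

theorem pairing_neg_of_joined {j : Fin t.rank} {η : t.Weight} (h : 0 ≤ η) (hj : η j = 0)
    {k : Fin t.rank} (hk : η k ≠ 0) (ha : t.finCartan j k ≠ 0) : t.pairing j η < 0 := by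
  rw [pairing_eq]
  refine Finset.sum_neg' (fun k _ => W.term_nonpos h hj k) ⟨k, Finset.mem_univ k, ?_⟩
  refine lt_of_le_of_ne (W.term_nonpos h hj k) (mul_ne_zero ?_ hk)
  exact_mod_cast ha

theorem not_joined_of_pairing {j : Fin t.rank} {η : t.Weight} (h : 0 ≤ η) (hj : η j = 0)
    (hp : t.pairing j η = 0) {k : Fin t.rank} (hk : η k ≠ 0) : t.finCartan j k = 0 := by
  by_contra ha
  exact (W.pairing_neg_of_joined h hj hk ha).ne hp

theorem pairing_eq_zero_of_not_joined {μ : t.Weight} {k : Fin t.rank}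
    (h : ∀ v, μ v ≠ 0 → t.finCartan v k = 0) : t.pairing k μ = 0 := by
  rw [pairing_eq]
  refine Finset.sum_eq_zero fun v _ => ?_
  by_cases hv : μ v = 0
  · simp [hv]
  · simp [(W.zero_iff _ _).1 (h v hv)]

theorem cartan_le_neg_one {j k : Fin t.rank} (h : j ≠ k) (ha : t.finCartan j k ≠ 0) :
    (t.finCartan j k : ℚ) ≤ -1 := by
  have := lt_of_le_of_ne (W.nonpos j k h) ha
  exact_mod_cast (by omega : t.finCartan j k ≤ -1)

theorem cartan_nonpos {j k : Fin t.rank} (h : j ≠ k) : (t.finCartan j k : ℚ) ≤ 0 := by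
  exact_mod_cast W.nonpos j k h

theorem isWeight_add_simpleRoot {j k : Fin t.rank} {η : t.Weight} (hW : t.IsWeight η)
    (h : 0 ≤ η) (hj : η j = 0) (hk : η k ≠ 0) (ha : t.finCartan j k ≠ 0) :
    t.IsWeight (η + t.simpleRoot j) :=
  hW.add ((W.integral _ hW).pairing_le_neg_one (W.pairing_neg_of_joined h hj hk ha))

/-- The simple roots are added in the order of the path. Each new vertex is outside the support
reached so far and joined to it, so its pairing is negative and it can be added. -/
theorem isWeight_add_path {i j : Fin t.rank} {η α : t.Weight} (hW : t.IsWeight η) (h : 0 ≤ η)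
    (hl : Linked t i j η α) : t.IsWeight (η + α) := by
  obtain ⟨hp, hd, k, hk, ha⟩ := hl
  induction hp generalizing η k with
  | nil => exact W.isWeight_add_simpleRoot hW h (hd i (by simp [simpleRoot_self])) hk ha
  | @cons j j' α hne hadj hp h0 ih =>
    have hj : η j = 0 := hd j (by simp [simpleRoot_self, h0])
    have hl := linked_cons (fun h => hadj ((W.zero_iff _ _).1 h)) hp h0 hd
    obtain ⟨l, hl1, hl2⟩ := hl.joined
    rw [← add_assoc]
    exact ih (W.isWeight_add_simpleRoot hW h hj hk ha) (add_nonneg h (simpleRoot_nonneg j))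
      hl.disjoint l hl1 hl2

theorem isWeight_path {i j : Fin t.rank} {α : t.Weight} (hi : t.IsWeight (t.simpleRoot i))
    (hp : PathTo t i j α) : t.IsWeight α := by
  induction hp with
  | nil => exact hi
  | @cons j j' α hne hadj hp h0 ih =>
    rw [add_comm]
    exact W.isWeight_add_simpleRoot ih hp.nonneg h0 (by rw [hp.start]; norm_num) hadj

theorem not_isWeight_of_mixed {μ : t.Weight} {j k : Fin t.rank} (hj : 0 < μ j) (hk : μ k < 0) :
    ¬ t.IsWeight μ := fun h => by
  rcases W.sign μ h with h1 | h1
  · exact absurd (h1 k) (not_le.2 hk)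
  · exact absurd (h1 j) (not_le.2 hj)

theorem nonneg_of_pos {μ : t.Weight} (h : t.IsWeight μ) {j : Fin t.rank} (hj : 0 < μ j) :
    0 ≤ μ := by
  rcases W.sign μ h with h1 | h1
  · exact h1
  · exact absurd (h1 j) (not_le.2 hj)

end WeightData

/-! ### The graded case -/

/-- Facts on which the description of `Ψ` by the grading of `Λ⁺` depends. -/
structure GradedData (t : AffineType) (i : Fin t.rank) : Prop extends WeightData t where
  isWeight_i : t.IsWeight (t.simpleRoot i)
  pairing_theta_i : t.pairing i t.theta = 1
  pairing_theta : ∀ j, j ≠ i → t.pairing j t.theta = 0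
  theta_i : t.theta i = 2
  coeff_le : ∀ μ, t.IsWeight μ → μ i ≤ 2
  coeff_two : ∀ μ, t.IsWeight μ → μ i = 2 → μ = t.theta
  complement : ∀ μ, t.IsWeight μ → μ i = 1 → t.IsWeight (t.theta - μ)
  disconnected : ∀ μ ν : t.Weight, 0 ≤ μ → 0 ≤ ν → (∀ j, μ j = 0 ∨ ν j = 0) →
    (∀ j k, μ j ≠ 0 → ν k ≠ 0 → t.finCartan j k = 0) → μ ≠ 0 → ν ≠ 0 → ¬ t.IsWeight (μ + ν)
  connected : ∃ d : Fin t.rank → ℕ, ∀ k, k ≠ i → ∃ j, j ≠ k ∧ t.finCartan k j ≠ 0 ∧ d j < d k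

namespace GradedData

variable {i : Fin t.rank} (G : GradedData t i)
include G

theorem not_isWeight_of_coeff {μ : t.Weight} (h : 2 < μ i) : ¬ t.IsWeight μ := fun hW =>
  absurd (G.coeff_le μ hW) (not_le.2 h)

/-- A pairing of at most `-2` propagates along the path, since `η + 2α_j` is again a weight and its
pairing at the next vertex is again at most `-2`. At `i` it makes `η + 2α_i` a weight of degree two,
hence `θ`. Then `⟨h_i, θ⟩ = 1` gives `⟨h_i, η⟩ = -3`, and `η + 3α_i` would be a weight of degree
three. -/
theorem not_pairing_le_neg_two {j : Fin t.rank} {η α : t.Weight} (hp : PathTo t i j α)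
    (hW : t.IsWeight η) (h : 0 ≤ η) (hd : ∀ v, α v ≠ 0 → η v = 0) :
    ¬ t.pairing j η ≤ -2 := by
  induction hp generalizing η with
  | nil =>
    intro hle
    have hi : η i = 0 := hd i (by simp [simpleRoot_self])
    have h2 : t.IsWeight (η + (2 : ℚ) • t.simpleRoot i) := by
      have := hW.add_smul (j := i) 2 (by push_cast; linarith)
      exact_mod_cast this
    have h3 := G.coeff_two _ h2 (by simp [hi, simpleRoot_self])
    have h4 := G.pairing_theta_i
    rw [← h3, pairing_add, pairing_smul, G.pairing_simpleRoot_self] at h4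
    have h5 := hW.add_smul (j := i) 3 (by push_cast; linarith)
    exact G.not_isWeight_of_coeff (by simp [hi, simpleRoot_self]; norm_num) h5
  | @cons j j' α hne hadj hp h0 ih =>
    intro hle
    have hj : η j = 0 := hd j (by simp [simpleRoot_self, h0])
    have h2 : t.IsWeight (η + (2 : ℚ) • t.simpleRoot j) := by
      have := hW.add_smul (j := j) 2 (by push_cast; linarith)
      exact_mod_cast this
    have hd' : ∀ v, α v ≠ 0 → v ≠ j ∧ η v = 0 := fun v hv => by
      have hvj : v ≠ j := fun h => hv (h ▸ h0)
      exact ⟨hvj, hd v (by simpa [simpleRoot_of_ne hvj] using hv)⟩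
    refine ih h2 (fun v => ?_) (fun v hv => ?_) ?_
    · have h1 := h v
      have h2 := simpleRoot_nonneg (t := t) j v
      simp only [Pi.zero_apply, Pi.add_apply, Pi.smul_apply, smul_eq_mul] at *
      linarith
    · obtain ⟨h1, h2⟩ := hd' v hv
      simp [h2, simpleRoot_of_ne h1]
    · rw [pairing_add, pairing_smul, pairing_simpleRoot]
      have h1 := G.cartan_le_neg_one hne.symm (fun h => hadj ((G.zero_iff _ _).1 h))
      have h2 := G.pairing_nonpos h (hd' j' (by rw [hp.start]; norm_num)).2
      linarith

theorem pairing_linked {j : Fin t.rank} {η α : t.Weight} (hl : Linked t i j η α)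
    (hW : t.IsWeight η) (h : 0 ≤ η) : t.pairing j η = -1 := by
  obtain ⟨k, hk, ha⟩ := hl.joined
  have h1 := G.pairing_neg_of_joined h hl.apply_start hk ha
  have h2 := G.not_pairing_le_neg_two hl.path hW h hl.disjoint
  obtain ⟨z, hz⟩ := (G.integral _ hW).pairing j
  rw [hz] at h1 h2 ⊢
  have h3 : z < 0 := by exact_mod_cast h1
  have h4 : ¬ z ≤ -2 := fun h => h2 (by exact_mod_cast h)
  have : z = -1 := by omega
  rw [this]; norm_num

/-- For the second vertex `j'` of the path, `⟨h_{j'}, η + α_j⟩ = -1` is already accounted for by the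
edge to `j`, and `⟨h_{j'}, η⟩ ≤ 0`. Later vertices follow by induction. Thus only the first vertex
of a linked path touches the support of `η`. -/
theorem pairing_linked_zero {j : Fin t.rank} {η α : t.Weight} (hl : Linked t i j η α)
    (hW : t.IsWeight η) (h : 0 ≤ η) {v : Fin t.rank} (hv : α v ≠ 0) (hvj : v ≠ j) :
    t.pairing v η = 0 := by
  obtain ⟨hp, hd, k, hk, ha⟩ := hl
  induction hp generalizing η k with
  | nil => exact absurd (simpleRoot_of_ne hvj) hv
  | @cons j j' α hne hadj hp h0 ih =>
    have hj : η j = 0 := hd j (by simp [simpleRoot_self, h0])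
    have hl := linked_cons (fun h => hadj ((G.zero_iff _ _).1 h)) hp h0 hd
    have hW' := G.isWeight_add_simpleRoot hW h hj hk ha
    have hnn := add_nonneg h (simpleRoot_nonneg j)
    have hv0 : η v = 0 := hd v hv
    have h1 := G.pairing_nonpos h hv0
    have h2 := G.cartan_nonpos hvj
    have hv' : α v ≠ 0 := by simpa [simpleRoot_of_ne hvj] using hv
    by_cases hvj' : v = j'
    · subst hvj'
      have h3 := G.pairing_linked hl hW' hnn
      have h4 := G.cartan_le_neg_one hvj (fun h => hadj ((G.zero_iff _ _).1 h))
      rw [pairing_add, pairing_simpleRoot] at h3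
      linarith
    · obtain ⟨l, hl1, hl2⟩ := hl.joined
      have h3 := ih hW' hnn hv' hvj' hl.disjoint l hl1 hl2
      rw [pairing_add, pairing_simpleRoot] at h3
      linarith

theorem not_joined_linked {j : Fin t.rank} {η α : t.Weight} (hl : Linked t i j η α)
    (hW : t.IsWeight η) (h : 0 ≤ η) {v k : Fin t.rank} (hv : α v ≠ 0) (hvj : v ≠ j)
    (hk : η k ≠ 0) : t.finCartan v k = 0 :=
  G.not_joined_of_pairing h (hl.disjoint v hv) (G.pairing_linked_zero hl hW h hv hvj) hk

/-- Suppose that the starting points `j` and `j'` differ. Neither path contains the start of the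
other, because only first vertices are joined to `η`. So the second path is also linked to `η +
α_j`, and by induction it has the same sum as the tail of the first, which misses `j'`. For equal
starts one passes to the tails. -/
theorem linked_unique {j j' : Fin t.rank} {η α α' : t.Weight} (hW : t.IsWeight η) (h : 0 ≤ η)
    (hl : Linked t i j η α) (hl' : Linked t i j' η α') : α = α' := by
  obtain ⟨hp, hd, k, hk, ha⟩ := hl
  induction hp generalizing η k j' α' with
  | nil =>
    have hj' : i = j' := by
      by_contra hne
      exact ha (G.not_joined_linked hl' hW h (by rw [hl'.path.target]; norm_num) hne hk)
    subst hj'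
    exact hl'.path.eq_simpleRoot.symm
  | @cons j j₁ α hne hadj hp h0 ih =>
    have hl : Linked t i j η (t.simpleRoot j + α) := ⟨.cons hne hadj hp h0, hd, k, hk, ha⟩
    have hj : η j = 0 := hl.apply_start
    have hl₁ := linked_cons (fun h => hadj ((G.zero_iff _ _).1 h)) hp h0 hd
    have hW' := G.isWeight_add_simpleRoot hW h hj hk ha
    have hnn := add_nonneg h (simpleRoot_nonneg j)
    obtain ⟨l, hlk, hla⟩ := hl₁.joined
    by_cases hjj : j' = j
    · subst hjj
      obtain ⟨hp', hd', hk'⟩ := hl'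
      cases hp' with
      | nil => rw [hp.target] at h0; norm_num at h0
      | @cons _ j₂ α' hne' hadj' hp' h0' =>
        have hl₂ := linked_cons (fun h => hadj' ((G.zero_iff _ _).1 h)) hp' h0' hd'
        rw [ih hW' hnn hl₂ hl₁.disjoint l hlk hla]
    · exfalso
      obtain ⟨k', hk', ha'⟩ := hl'.joined
      have h1 : α' j = 0 := by
        by_contra h1
        exact ha (G.not_joined_linked hl' hW h h1 (Ne.symm hjj) hk)
      have h2 : (t.simpleRoot j + α) j' = 0 := by
        by_contra h2
        exact ha' (G.not_joined_linked hl hW h h2 hjj hk')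
      have hl₂ : Linked t i j' (η + t.simpleRoot j) α' :=
        ⟨hl'.path, fun v hv => by
          have hvj : v ≠ j := fun h => hv (h ▸ h1)
          simp [hl'.disjoint v hv, simpleRoot_of_ne hvj], k', by
          have := h k'
          have h3 := simpleRoot_nonneg (t := t) j k'
          simp only [Pi.zero_apply, Pi.add_apply] at *
          positivity, ha'⟩
      have h3 := ih hW' hnn hl₂ hl₁.disjoint l hlk hla
      rw [h3] at h2
      simp [simpleRoot_of_ne hjj, hl'.path.start] at h2

/-- Without `α_k` the support falls into the part up to `k`, nonzero because of `ξ`, and the part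
after `k`, nonzero because it contains `i`. The two parts are not joined. -/
theorem not_isWeight_removed {j k : Fin t.rank} {η α ξ : t.Weight} (hW : t.IsWeight η)
    (h : 0 ≤ η) (hl : Linked t i j η α) (hξ : 0 ≤ ξ) (hξ0 : ξ ≠ 0)
    (hsub : ∀ v, ξ v ≠ 0 → η v ≠ 0) (hk : α k ≠ 0) (hki : k ≠ i) :
    ¬ t.IsWeight (ξ + α - t.simpleRoot k) := by
  obtain ⟨hp, hd, m, hm, ha⟩ := hl
  induction hp generalizing η ξ m with
  | nil => exact absurd (simpleRoot_of_ne hki) hk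
  | @cons j j₁ α hne hadj hp h0 ih =>
    have hl : Linked t i j η (t.simpleRoot j + α) := ⟨.cons hne hadj hp h0, hd, m, hm, ha⟩
    have hj : η j = 0 := hl.apply_start
    have hl₁ := linked_cons (fun h => hadj ((G.zero_iff _ _).1 h)) hp h0 hd
    have hW' := G.isWeight_add_simpleRoot hW h hj hm ha
    have hnn := add_nonneg h (simpleRoot_nonneg j)
    obtain ⟨l, hlk, hla⟩ := hl₁.joined
    by_cases hkj : k = j
    · subst hkj
      rw [show ξ + (t.simpleRoot k + α) - t.simpleRoot k = ξ + α by abel]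
      have hα : ∀ v, α v ≠ 0 → v ≠ k ∧ (t.simpleRoot k + α) v ≠ 0 := fun v hv => by
        have hvj : v ≠ k := fun h => hv (h ▸ h0)
        exact ⟨hvj, by simpa [simpleRoot_of_ne hvj] using hv⟩
      refine G.disconnected ξ α hξ hp.nonneg (fun v => ?_) (fun v u hv hu => ?_) hξ0 hp.ne_zero
      · by_contra hcon
        push Not at hcon
        exact hsub v hcon.1 (hd v (hα v hcon.2).2)
      · exact (G.zero_iff _ _).1
          (G.not_joined_linked hl hW h (hα u hu).2 (hα u hu).1 (hsub v hv))
    · have hk' : α k ≠ 0 := by simpa [simpleRoot_of_ne hkj] using hk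
      rw [← add_assoc]
      refine ih hW' hnn (add_nonneg hξ (simpleRoot_nonneg j)) (fun h0 => ?_) (fun v hv => ?_)
        hk' hl₁.disjoint l hlk hla
      · have h1 := congrFun h0 j
        have h2 := hξ j
        simp only [Pi.add_apply, Pi.zero_apply, simpleRoot_self] at h1 h2
        linarith
      · by_cases hvj : v = j
        · subst hvj
          simp [hj, simpleRoot_self]
        · simp only [Pi.add_apply, simpleRoot_of_ne hvj, add_zero] at hv ⊢
          exact hsub v hv

theorem not_isWeight_path_removed {j k : Fin t.rank} {η α : t.Weight} (hW : t.IsWeight η)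
    (h : 0 ≤ η) (hl : Linked t i j η α) (hk : α k ≠ 0) (hkj : k ≠ j) (hki : k ≠ i) :
    ¬ t.IsWeight (α - t.simpleRoot k) := by
  obtain ⟨hp, hd, m, hm, ha⟩ := hl
  cases hp with
  | nil => exact absurd (simpleRoot_of_ne hki) hk
  | @cons j j₁ α hne hadj hp h0 =>
    have hj : η j = 0 := hd j (by simp [simpleRoot_self, h0])
    have hl₁ := linked_cons (fun h => hadj ((G.zero_iff _ _).1 h)) hp h0 hd
    have hW' := G.isWeight_add_simpleRoot hW h hj hm ha
    refine G.not_isWeight_removed hW' (add_nonneg h (simpleRoot_nonneg j)) hl₁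
      (simpleRoot_nonneg j) (simpleRoot_ne_zero j) (fun v hv => ?_)
      (by simpa [simpleRoot_of_ne hkj] using hk) hki
    have hvj : v = j := by
      by_contra hvj
      exact hv (simpleRoot_of_ne hvj)
    subst hvj
    simp [hj, simpleRoot_self]

/-- A converse to `isWeight_add_path`. The path is removed again from its end at `i` backwards.
Since `ξ` pairs with the path as `η` does, each simple root to be removed has pairing `-1 + 2 = 1`
and can be subtracted. -/
theorem isWeight_of_add_path {j : Fin t.rank} {η α ξ : t.Weight} (hW : t.IsWeight η)
    (h : 0 ≤ η) (hl : Linked t i j η α) (hξ : ∀ v, α v ≠ 0 → t.pairing v ξ = t.pairing v η)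
    (hs : t.IsWeight (ξ + α)) : t.IsWeight ξ := by
  obtain ⟨hp, hd, m, hm, ha⟩ := hl
  induction hp generalizing η ξ m with
  | nil =>
    have := hs.sub (j := i) (by
      rw [pairing_add, G.pairing_simpleRoot_self, hξ i (by simp [simpleRoot_self]),
        G.pairing_linked ⟨.nil, hd, m, hm, ha⟩ hW h]
      norm_num)
    simpa using this
  | @cons j j₁ α hne hadj hp h0 ih =>
    have hl : Linked t i j η (t.simpleRoot j + α) := ⟨.cons hne hadj hp h0, hd, m, hm, ha⟩
    have hj : η j = 0 := hl.apply_start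
    have hl₁ := linked_cons (fun h => hadj ((G.zero_iff _ _).1 h)) hp h0 hd
    have hW' := G.isWeight_add_simpleRoot hW h hj hm ha
    have hnn := add_nonneg h (simpleRoot_nonneg j)
    obtain ⟨l, hlk, hla⟩ := hl₁.joined
    have h1 : t.IsWeight (ξ + t.simpleRoot j) := by
      refine ih hW' hnn (fun v hv => ?_) (by rwa [add_assoc]) hl₁.disjoint l hlk hla
      have hvj : v ≠ j := fun h => hv (h ▸ h0)
      rw [pairing_add, pairing_add, hξ v (by simpa [simpleRoot_of_ne hvj] using hv)]
    have := h1.sub (j := j) (by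
      rw [pairing_add, G.pairing_simpleRoot_self, hξ j (by simp [simpleRoot_self, h0]),
        G.pairing_linked hl hW h]
      norm_num)
    simpa using this

theorem exists_path (k : Fin t.rank) : ∃ α, PathTo t i k α := by
  obtain ⟨d, hd⟩ := G.connected
  -- The path follows decreasing values of `d`; recording this excludes repeated vertices.
  suffices h : ∃ α, PathTo t i k α ∧ ∀ v, α v ≠ 0 → v = k ∨ d v < d k from
    ⟨h.choose, h.choose_spec.1⟩
  induction hN : d k using Nat.strong_induction_on generalizing k with
  | _ N ih =>
    by_cases hk : k = i
    · subst hk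
      exact ⟨_, .nil, fun v hv => Or.inl (by
        by_contra h
        exact hv (simpleRoot_of_ne h))⟩
    · obtain ⟨j, hj, ha, hlt⟩ := hd k hk
      obtain ⟨α, hp, hα⟩ := ih (d j) (hN ▸ hlt) j rfl
      have hα' : ∀ v, α v ≠ 0 → d v < d k := fun v hv => by
        rcases hα v hv with h | h
        · rw [h]; exact hlt
        · exact h.trans hlt
      refine ⟨_, .cons hj.symm ha hp (by
        by_contra h
        exact absurd (hα' k h) (lt_irrefl _)), fun v hv => ?_⟩
      by_cases hvk : v = k
      · exact Or.inl hvk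
      · exact Or.inr (hN ▸ hα' v (by simpa [simpleRoot_of_ne hvk] using hv))

/-- A path to `i` is followed from a vertex of the support. After the last vertex of the path that
lies in the support, the remainder is linked; it is not empty because `γ` vanishes at `i`. -/
theorem exists_linked {γ : t.Weight} (h0 : γ ≠ 0) (hi : γ i = 0) :
    ∃ j α, Linked t i j γ α := by
  obtain ⟨k, hk⟩ := Function.ne_iff.1 h0
  obtain ⟨α, hp⟩ := G.exists_path k
  have key : ∀ k α, PathTo t i k α → (∃ v, α v ≠ 0 ∧ γ v ≠ 0) → ∃ j α, Linked t i j γ α := by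
    intro k α hp
    induction hp with
    | nil =>
      rintro ⟨v, hv, hγ⟩
      have : v = i := by
        by_contra h
        exact hv (simpleRoot_of_ne h)
      subst this
      exact absurd hi hγ
    | @cons j j₁ α hne hadj hp h0 ih =>
      rintro ⟨v, hv, hγ⟩
      by_cases hex : ∃ v, α v ≠ 0 ∧ γ v ≠ 0
      · exact ih hex
      · push Not at hex
        have hvj : v = j := by
          by_contra hvj
          exact hγ (hex v (by simpa [simpleRoot_of_ne hvj] using hv))
        subst hvj
        exact ⟨j₁, α, hp, hex, v, hγ, fun h => hadj ((G.zero_iff _ _).1 h)⟩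
  exact key k α hp ⟨k, by rw [hp.start]; norm_num, hk⟩

end GradedData

end AffineType


namespace AffineType

open Crystal

variable {t : AffineType}

/-! ### Isomorphisms described by a self-dual relation -/

/-- The relation between `b` and `c₁ ⊗ c₂` on vertices induced by a relation between labels. -/
def PosRel (Q : t.Label → t.Label → t.Label → Prop) (b : t.vertices)
    (c : t.vertices × t.vertices) : Prop := Q b c.1 c.2

/-- The closure of `PosRel Q` under duality. -/
def FullRel (Q : t.Label → t.Label → t.Label → Prop) (b : t.vertices)
    (c : t.vertices × t.vertices) : Prop := PosRel Q b c ∨ PosRel Q (dualVertex b) (dualPair c)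

theorem FullRel.dual {Q : t.Label → t.Label → t.Label → Prop} {b : t.vertices}
    {c : t.vertices × t.vertices} (h : FullRel Q b c) :
    FullRel Q (dualVertex b) (dualPair c) := by
  rcases h with h | h
  · exact Or.inr (by rwa [dualVertex_dualVertex, dualPair_dualPair])
  · exact Or.inl h

theorem rel_map_dual {Q : t.Label → t.Label → t.Label → Prop} {o : Option t.vertices}
    {o' : Option (t.vertices × t.vertices)} (h : Option.Rel (FullRel Q) o o') :
    Option.Rel (FullRel Q) (o.map dualVertex) (o'.map dualPair) := by
  cases h with
  | none => exact .none
  | some h => exact .some h.dual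

theorem rel_f_dual {Q : t.Label → t.Label → t.Label → Prop} {b : t.vertices}
    {c : t.vertices × t.vertices} {j : Fin t.rank} (h : Option.Rel (FullRel Q)
      (t.thetaCrystal.e j b) ((t.thetaCrystal.tensor t.thetaCrystal).e j c)) :
    Option.Rel (FullRel Q) (t.thetaCrystal.f j (dualVertex b))
      ((t.thetaCrystal.tensor t.thetaCrystal).f j (dualPair c)) := by
  rw [f_dualVertex, tensor_f_dualPair]; exact rel_map_dual h

theorem rel_e_dual {Q : t.Label → t.Label → t.Label → Prop} {b : t.vertices}
    {c : t.vertices × t.vertices} {j : Fin t.rank} (h : Option.Rel (FullRel Q)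
      (t.thetaCrystal.f j b) ((t.thetaCrystal.tensor t.thetaCrystal).f j c)) :
    Option.Rel (FullRel Q) (t.thetaCrystal.e j (dualVertex b))
      ((t.thetaCrystal.tensor t.thetaCrystal).e j (dualPair c)) := by
  rw [e_dualVertex, tensor_e_dualPair]; exact rel_map_dual h

/-- A relation between labels `b` of nonnegative weight and pairs of labels `c₁ ⊗ c₂` that is the
graph of a morphism of crystals, after extension by duality. -/
structure CrystalRel (t : AffineType) (i : Fin t.rank)
    (Q : t.Label → t.Label → t.Label → Prop) : Prop where
  functional : ∀ b c d c' d', Q b c d → Q b c' d' → c = c' ∧ d = d'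
  nonneg : ∀ γ c d, Q (.x γ) c d → 0 ≤ γ
  y_self : ∀ j c d, Q (.y j) c d → c = d.dual
  total_x : ∀ γ, t.IsWeight γ → γ ≠ 0 → 0 ≤ γ → ∃ c d : t.vertices, Q (.x γ) c d
  total_y : ∀ j, t.IsWeight (t.simpleRoot j) → ∃ c d : t.vertices, Q (.y j) c d
  weight : ∀ b c d, Q b c d →
    t.labelCrystal.wt b = t.labelCrystal.wt c + t.labelCrystal.wt d
  top : Q (.x t.theta) (.x t.theta) (.y i)
  step : ∀ j (b : t.vertices) (c : t.vertices × t.vertices), PosRel Q b c →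
    Option.Rel (FullRel Q) (t.thetaCrystal.f j b)
      ((t.thetaCrystal.tensor t.thetaCrystal).f j c) ∧
    Option.Rel (FullRel Q) (t.thetaCrystal.e j b)
      ((t.thetaCrystal.tensor t.thetaCrystal).e j c)

theorem Label.dual_injective {b c : t.Label} (h : b.dual = c.dual) : b = c := by
  rw [← b.dual_dual, h, c.dual_dual]

namespace CrystalRel

variable {i : Fin t.rank} {Q : t.Label → t.Label → t.Label → Prop}

/-- The relation and its dual overlap only at the `y_j`, since a nonzero weight and its negative are
not both nonnegative. At `y_j` the related pair has the form `d* ⊗ d` and is fixed by duality. -/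
theorem fullRel_functional (H : CrystalRel t i Q) (W : WeightData t) {b : t.vertices}
    {c c' : t.vertices × t.vertices} (h : FullRel Q b c) (h' : FullRel Q b c') : c = c' := by
  have hmix : ∀ c c', PosRel Q b c → PosRel Q (dualVertex b) (dualPair c') → c = c' := by
    intro c c' h h'
    rcases hl : (b : t.Label) with γ | j
    · exfalso
      rw [PosRel, hl] at h
      rw [PosRel, dualVertex_x hl] at h'
      refine W.ne_zero_of_eq hl (le_antisymm ?_ (H.nonneg _ _ _ h))
      exact neg_nonneg.1 (H.nonneg _ _ _ h')
    · rw [PosRel, hl] at h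
      rw [PosRel, dualVertex_y hl] at h'
      obtain ⟨h1, h2⟩ := H.functional _ _ _ _ _ h h'
      have h3 := H.y_self _ _ _ h
      refine Prod.ext (Subtype.ext ?_) (Subtype.ext ?_)
      · rw [h3, h2]; exact Label.dual_dual _
      · apply Label.dual_injective
        rw [← h3, h1]; rfl
  rcases h with h | h <;> rcases h' with h' | h'
  · obtain ⟨h1, h2⟩ := H.functional _ _ _ _ _ h h'
    exact Prod.ext (Subtype.ext h1) (Subtype.ext h2)
  · exact hmix _ _ h h'
  · exact (hmix _ _ h' h).symm
  · obtain ⟨h1, h2⟩ := H.functional _ _ _ _ _ h h'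
    exact Prod.ext (Subtype.ext (Label.dual_injective h2)) (Subtype.ext (Label.dual_injective h1))

theorem fullRel_total (H : CrystalRel t i Q) (W : WeightData t) (b : t.vertices) :
    ∃ c, FullRel Q b c := by
  rcases hl : (b : t.Label) with γ | j
  · rcases W.sign γ (W.isWeight_of_eq hl) with h | h
    · obtain ⟨c, d, hcd⟩ := H.total_x γ (W.isWeight_of_eq hl) (W.ne_zero_of_eq hl) h
      exact ⟨(c, d), Or.inl (by rw [PosRel, hl]; exact hcd)⟩
    · obtain ⟨c, d, hcd⟩ := H.total_x (-γ) (W.neg _ (W.isWeight_of_eq hl))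
        (neg_ne_zero.2 (W.ne_zero_of_eq hl)) (by simpa using h)
      exact ⟨dualPair (c, d), Or.inr (by
        rw [PosRel, dualVertex_x hl, dualPair_dualPair]; exact hcd)⟩
  · obtain ⟨c, d, hcd⟩ := H.total_y j (WeightData.isWeight_simpleRoot_of_eq hl)
    exact ⟨(c, d), Or.inl (by rw [PosRel, hl]; exact hcd)⟩

theorem wt_dualVertex (b : t.vertices) :
    t.thetaCrystal.wt (dualVertex b) = -t.thetaCrystal.wt b := by
  obtain ⟨b, hb⟩ := b
  change t.labelCrystal.wt b.dual = -t.labelCrystal.wt b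
  cases b <;> simp [Label.dual, labelCrystal]

theorem fullRel_weight (H : CrystalRel t i Q) {b : t.vertices} {c : t.vertices × t.vertices}
    (h : FullRel Q b c) :
    (t.thetaCrystal.tensor t.thetaCrystal).wt c = t.thetaCrystal.wt b := by
  rcases h with h | h
  · exact (H.weight _ _ _ h).symm
  · have h1 : t.thetaCrystal.wt (dualVertex b) =
        t.thetaCrystal.wt (dualVertex c.2) + t.thetaCrystal.wt (dualVertex c.1) :=
      H.weight _ _ _ h
    rw [wt_dualVertex, wt_dualVertex, wt_dualVertex] at h1
    rw [← neg_inj, h1]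
    simp only [tensor]
    abel

theorem fullRel_step (H : CrystalRel t i Q) (j : Fin t.rank) {b : t.vertices}
    {c : t.vertices × t.vertices} (h : FullRel Q b c) :
    Option.Rel (FullRel Q) (t.thetaCrystal.f j b)
      ((t.thetaCrystal.tensor t.thetaCrystal).f j c) ∧
    Option.Rel (FullRel Q) (t.thetaCrystal.e j b)
      ((t.thetaCrystal.tensor t.thetaCrystal).e j c) := by
  rcases h with h | h
  · exact H.step j b c h
  · obtain ⟨h1, h2⟩ := H.step j _ _ h
    have h3 := rel_f_dual h2
    have h4 := rel_e_dual h1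
    rw [dualVertex_dualVertex, dualPair_dualPair] at h3 h4
    exact ⟨h3, h4⟩

theorem sends_of_rel (H : CrystalRel t i Q) (W : WeightData t)
    {Φ : t.vertices → t.vertices × t.vertices} (hΦ : ∀ b, FullRel Q b (Φ b)) {b : t.Label}
    {c : t.Label × t.Label} (hb : b ∈ t.vertices) (h : Q b c.1 c.2) : Sends Φ b c := by
  have hex : ∃ c d : t.vertices, Q b c d := by
    rcases b with γ | j
    · obtain ⟨h1, h2⟩ := W.mem_vertices_x.1 hb
      exact H.total_x γ h1 h2 (H.nonneg _ _ _ h)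
    · exact H.total_y j (WeightData.mem_vertices_y.1 hb)
  obtain ⟨d, e, hde⟩ := hex
  obtain ⟨h2, h3⟩ := H.functional _ _ _ _ _ hde h
  refine ⟨⟨b, hb⟩, rfl, ?_⟩
  rw [H.fullRel_functional W (hΦ ⟨b, hb⟩) (Or.inl hde : FullRel Q ⟨b, hb⟩ (d, e))]
  exact Prod.ext h2 h3

theorem negativeFormula (H : CrystalRel t i Q) (W : WeightData t)
    {Φ : t.vertices → t.vertices × t.vertices} (hΦ : ∀ b, FullRel Q b (Φ b)) :
    t.NegativeFormula Φ := by
  rintro γ - b c ⟨v, hv, hvc⟩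
  refine ⟨dualVertex v, dualVertex_x hv, ?_⟩
  rw [H.fullRel_functional W (hΦ _) (hΦ v).dual]
  rw [Prod.mk.injEq] at hvc
  rw [← hvc.1, ← hvc.2]
  rfl

theorem exists_iso (H : CrystalRel t i Q) (W : WeightData t)
    (hi : t.simpleRoot i ∈ t.positiveWeights) :
    ∃ Ψ : Crystal.Iso t.thetaCrystal
        ((t.thetaCrystal.tensor t.thetaCrystal).componentCrystal (t.xTheta, t.yVertex i hi)),
      (∀ b, FullRel Q b (Ψ.toEquiv b)) ∧
      Crystal.IsStrictMorphism (t.thetaCrystal.tensor t.thetaCrystal) t.thetaCrystal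
        Ψ.inverseByZero := by
  obtain ⟨Φ, hΦ, hf, he⟩ := exists_map_of_rel (C := t.thetaCrystal)
    (D := t.thetaCrystal.tensor t.thetaCrystal) (FullRel Q) (H.fullRel_total W)
    (fun b c c' => H.fullRel_functional W) (fun j b c h => (H.fullRel_step j h).1)
    (fun j b c h => (H.fullRel_step j h).2)
  -- The weight of the image determines a vertex `x_μ`. The vertices `y_j` all have weight zero, but
  -- `e_j` is defined on `y_j` and on no other `y_k`.
  have hinj : Function.Injective Φ := by
    intro b b' hbb
    have hwt : t.thetaCrystal.wt b = t.thetaCrystal.wt b' := by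
      rw [← H.fullRel_weight (hΦ b), ← H.fullRel_weight (hΦ b'), hbb]
    change t.labelCrystal.wt b = t.labelCrystal.wt b' at hwt
    apply Subtype.ext
    rcases hl : (b : t.Label) with γ | j <;> rcases hl' : (b' : t.Label) with γ' | k
    · rw [hl, hl'] at hwt
      exact congrArg Label.x hwt
    · rw [hl, hl'] at hwt
      exact absurd hwt (W.ne_zero_of_eq hl)
    · rw [hl, hl'] at hwt
      exact absurd hwt.symm (W.ne_zero_of_eq hl')
    · by_contra hne
      have hkj : k ≠ j := fun h => hne (by rw [h])
      obtain ⟨c, hc, -⟩ := W.e_y_self hl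
      have h1 := he j b
      rw [hbb, he, WeightData.e_y_ne hl' hkj, hc] at h1
      cases h1
  obtain ⟨Ψ, hΨ, hm⟩ := exists_iso_component hinj (W.regular.tensor_inv W.regular)
    (fun b => H.fullRel_weight (hΦ b)) hf he t.xTheta W.mem_component
    (H.fullRel_functional W (hΦ t.xTheta)
      (Or.inl H.top : FullRel Q t.xTheta (t.xTheta, t.yVertex i hi)))
  exact ⟨Ψ, fun b => by rw [hΨ]; exact hΦ b, hm⟩

end CrystalRel

end AffineType


/-! ### The graded relation: arrows of colour `k ≠ i` in degree zero -/

namespace AffineType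

open Crystal

variable {t : AffineType}

/-- The values of `Ψ` on vertices of nonnegative weight in the graded case. -/
inductive GradedRel (t : AffineType) (i : Fin t.rank) : t.Label → t.Label → t.Label → Prop
  | top : GradedRel t i (.x t.theta) (.x t.theta) (.y i)
  | one (γ : t.Weight) (hW : t.IsWeight γ) (hi : γ i = 1) :
      GradedRel t i (.x γ) (.x t.theta) (.x (-(t.theta - γ)))
  | zero (γ α : t.Weight) (j : Fin t.rank) (hW : t.IsWeight γ) (h0 : 0 ≤ γ) (hne : γ ≠ 0)
      (hl : Linked t i j γ α) :
      GradedRel t i (.x γ) (.x (t.theta - α)) (.x (-(t.theta - (γ + α))))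
  | y (j : Fin t.rank) (α : t.Weight) (hj : t.IsWeight (t.simpleRoot j)) (hp : PathTo t i j α) :
      GradedRel t i (.y j) (.x (t.theta - α)) (.x (-(t.theta - α)))

theorem rel_none {Q : t.Label → t.Label → t.Label → Prop} {o : Option t.vertices}
    {o' : Option (t.vertices × t.vertices)} (h : o = none) (h' : o' = none) :
    Option.Rel (FullRel Q) o o' := by
  subst h h'; exact .none

theorem rel_some {Q : t.Label → t.Label → t.Label → Prop} {o : Option t.vertices}
    {o' : Option (t.vertices × t.vertices)} {b c d : t.vertices} (h : o = some b)
    (h' : o' = some (c, d)) (hQ : Q b c d) : Option.Rel (FullRel Q) o o' := by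
  subst h h'; exact .some (Or.inl hQ)

namespace WeightData

variable (W : WeightData t)
include W

theorem not_isWeight_sub {μ : t.Weight} {k : Fin t.rank} (h : 0 ≤ μ) (h0 : μ ≠ 0)
    (hk : μ k = 0) : ¬ t.IsWeight (μ - t.simpleRoot k) := by
  obtain ⟨v, hv⟩ := Function.ne_iff.1 h0
  have hvk : v ≠ k := fun h => hv (h ▸ hk)
  refine W.not_isWeight_of_mixed (j := v) (k := k) ?_ ?_
  · simp only [Pi.sub_apply, simpleRoot_of_ne hvk, sub_zero]
    exact lt_of_le_of_ne (h v) (Ne.symm hv)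
  · simp [hk, simpleRoot_self]

end WeightData

namespace GradedData

variable {i : Fin t.rank} (G : GradedData t i)
include G

theorem isWeight_complement_iff {μ : t.Weight} (h : μ i = 1) :
    t.IsWeight (t.theta - μ) ↔ t.IsWeight μ := by
  refine ⟨fun hW => ?_, fun hW => G.complement μ hW h⟩
  have := G.complement _ hW (by simp [G.theta_i, h]; norm_num)
  simpa using this

theorem not_isWeight_add_of_pairing {γ : t.Weight} {k : Fin t.rank} (h : 0 ≤ γ) (h0 : γ ≠ 0)
    (hk : γ k = 0) (hp : t.pairing k γ = 0) : ¬ t.IsWeight (γ + t.simpleRoot k) := by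
  refine G.disconnected γ _ h (simpleRoot_nonneg k) (fun v => ?_) (fun v u hv hu => ?_) h0
    (simpleRoot_ne_zero k)
  · by_cases hv : v = k
    · exact Or.inl (hv ▸ hk)
    · exact Or.inr (simpleRoot_of_ne hv)
  · have huk : u = k := by
      by_contra h
      exact hu (simpleRoot_of_ne h)
    subst huk
    exact (G.zero_iff _ _).1 (G.not_joined_of_pairing h hk hp hv)

section Dichotomy

variable {k : Fin t.rank} {c : t.vertices} {μ : t.Weight}

/-- In degree one, subtracting `α_k` from `θ - μ` amounts to adding it to `μ`, and complements of
weights are weights. Degree one also rules out `±α_k`, so no `y_k` interferes. The three companions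
are this one read upwards and through duality. -/
theorem f_complement (hki : k ≠ i) (hμ : μ i = 1) (hc : (c : t.Label) = .x (t.theta - μ)) :
    (t.thetaCrystal.phi k c = 0 ∧ t.thetaCrystal.f k c = none ∧
      ¬ t.IsWeight (μ + t.simpleRoot k)) ∨
    (t.thetaCrystal.phi k c ≠ 0 ∧ t.IsWeight (μ + t.simpleRoot k) ∧
      ∃ c', t.thetaCrystal.f k c = some c' ∧
        (c' : t.Label) = .x (t.theta - (μ + t.simpleRoot k))) := by
  have h1 : (μ + t.simpleRoot k) i = 1 := by simp [hμ, simpleRoot_of_ne hki.symm]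
  have h2 : t.theta - μ - t.simpleRoot k = t.theta - (μ + t.simpleRoot k) := by abel
  by_cases hW : t.IsWeight (μ + t.simpleRoot k)
  · have h3 : t.IsWeight (t.theta - μ - t.simpleRoot k) := by
      rwa [h2, G.isWeight_complement_iff h1]
    obtain ⟨c', hc', hl⟩ := G.f_sub hc (fun h => by
      have := congrFun h i
      simp [G.theta_i, hμ, simpleRoot_of_ne hki.symm] at this
      norm_num at this) h3
    refine Or.inr ⟨?_, hW, c', hc', by rw [hl, h2]⟩
    rw [G.regular.phi_eq hc']; omega
  · have h3 : ¬ t.IsWeight (t.theta - μ - t.simpleRoot k) := by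
      rwa [h2, G.isWeight_complement_iff h1]
    exact Or.inl ⟨G.phi_zero hc h3, G.f_none hc h3, hW⟩

theorem e_complement (hki : k ≠ i) (hμ : μ i = 1) (hc : (c : t.Label) = .x (t.theta - μ)) :
    (t.thetaCrystal.eps k c = 0 ∧ t.thetaCrystal.e k c = none ∧
      ¬ t.IsWeight (μ - t.simpleRoot k)) ∨
    (t.thetaCrystal.eps k c ≠ 0 ∧ t.IsWeight (μ - t.simpleRoot k) ∧
      ∃ c', t.thetaCrystal.e k c = some c' ∧
        (c' : t.Label) = .x (t.theta - (μ - t.simpleRoot k))) := by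
  have h1 : (μ - t.simpleRoot k) i = 1 := by simp [hμ, simpleRoot_of_ne hki.symm]
  have h2 : t.theta - μ + t.simpleRoot k = t.theta - (μ - t.simpleRoot k) := by abel
  by_cases hW : t.IsWeight (μ - t.simpleRoot k)
  · have h3 : t.IsWeight (t.theta - μ + t.simpleRoot k) := by
      rwa [h2, G.isWeight_complement_iff h1]
    obtain ⟨c', hc', hl⟩ := G.e_add hc (fun h => by
      have := congrFun h i
      simp [G.theta_i, hμ, simpleRoot_of_ne hki.symm] at this
      norm_num at this) h3
    refine Or.inr ⟨?_, hW, c', hc', by rw [hl, h2]⟩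
    rw [G.regular.eps_eq hc']; omega
  · have h3 : ¬ t.IsWeight (t.theta - μ + t.simpleRoot k) := by
      rwa [h2, G.isWeight_complement_iff h1]
    exact Or.inl ⟨G.eps_zero hc h3, G.e_none hc h3, hW⟩

theorem f_neg_complement (hki : k ≠ i) (hμ : μ i = 1)
    (hc : (c : t.Label) = .x (-(t.theta - μ))) :
    (t.thetaCrystal.phi k c = 0 ∧ t.thetaCrystal.f k c = none ∧
      ¬ t.IsWeight (μ - t.simpleRoot k)) ∨
    (t.thetaCrystal.phi k c ≠ 0 ∧ t.IsWeight (μ - t.simpleRoot k) ∧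
      ∃ c', t.thetaCrystal.f k c = some c' ∧
        (c' : t.Label) = .x (-(t.theta - (μ - t.simpleRoot k)))) := by
  have hd : (dualVertex c : t.Label) = .x (t.theta - μ) := by rw [dualVertex_x hc, neg_neg]
  have hf : t.thetaCrystal.f k c = (t.thetaCrystal.e k (dualVertex c)).map dualVertex := by
    rw [← f_dualVertex, dualVertex_dualVertex]
  rw [← eps_dualVertex, hf]
  rcases G.e_complement hki hμ hd with ⟨h1, h2, h3⟩ | ⟨h1, h2, c', h3, h4⟩
  · exact Or.inl ⟨h1, by rw [h2]; rfl, h3⟩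
  · exact Or.inr ⟨h1, h2, dualVertex c', by rw [h3]; rfl, dualVertex_x h4⟩

theorem e_neg_complement (hki : k ≠ i) (hμ : μ i = 1)
    (hc : (c : t.Label) = .x (-(t.theta - μ))) :
    (t.thetaCrystal.eps k c = 0 ∧ t.thetaCrystal.e k c = none ∧
      ¬ t.IsWeight (μ + t.simpleRoot k)) ∨
    (t.thetaCrystal.eps k c ≠ 0 ∧ t.IsWeight (μ + t.simpleRoot k) ∧
      ∃ c', t.thetaCrystal.e k c = some c' ∧
        (c' : t.Label) = .x (-(t.theta - (μ + t.simpleRoot k)))) := by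
  have hd : (dualVertex c : t.Label) = .x (t.theta - μ) := by rw [dualVertex_x hc, neg_neg]
  have he : t.thetaCrystal.e k c = (t.thetaCrystal.f k (dualVertex c)).map dualVertex := by
    rw [← e_dualVertex, dualVertex_dualVertex]
  rw [← phi_dualVertex, he]
  rcases G.f_complement hki hμ hd with ⟨h1, h2, h3⟩ | ⟨h1, h2, c', h3, h4⟩
  · exact Or.inl ⟨h1, by rw [h2]; rfl, h3⟩
  · exact Or.inr ⟨h1, h2, dualVertex c', by rw [h3]; rfl, dualVertex_x h4⟩

/-- As `⟨h_k, θ⟩ = 0` for `k ≠ i`, the complement only changes the sign of the pairing. Together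
with the next lemma this compares `φ_k(c₁)` with `ε_k(c₂)` as soon as `ε_k(c₁)` and `φ_k(c₂)` are
known. -/
theorem phi_sub_eps_complement (hki : k ≠ i) (hc : (c : t.Label) = .x (t.theta - μ)) :
    (t.thetaCrystal.phi k c : ℚ) - t.thetaCrystal.eps k c = -t.pairing k μ := by
  rw [G.phi_sub_eps_x hc, pairing_sub, G.pairing_theta k hki, zero_sub]

theorem phi_sub_eps_neg_complement (hki : k ≠ i) (hc : (c : t.Label) = .x (-(t.theta - μ))) :
    (t.thetaCrystal.phi k c : ℚ) - t.thetaCrystal.eps k c = t.pairing k μ := by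
  rw [G.phi_sub_eps_x hc, pairing_neg, pairing_sub, G.pairing_theta k hki, zero_sub, neg_neg]

end Dichotomy

theorem gradedRel_zero {γ α : t.Weight} {j : Fin t.rank} {b c d : t.vertices}
    (hb : (b : t.Label) = .x γ) (hl : Linked t i j γ α) (h0 : 0 ≤ γ) (hne : γ ≠ 0)
    (hc : (c : t.Label) = .x (t.theta - α))
    (hd : (d : t.Label) = .x (-(t.theta - (γ + α)))) : GradedRel t i b c d := by
  have hW := G.isWeight_of_eq hb
  rw [hb, hc, hd]
  exact .zero γ α j hW h0 hne hl

omit G in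
theorem linked_add {γ α : t.Weight} {j k : Fin t.rank} (hl : Linked t i j γ α) (h0 : 0 ≤ γ)
    (hk : α k = 0) : Linked t i j (γ + t.simpleRoot k) α := by
  obtain ⟨hp, hd, l, hl, ha⟩ := hl
  refine ⟨hp, fun v hv => ?_, l, ?_, ha⟩
  · have hvk : v ≠ k := fun h => hv (h ▸ hk)
    simp [hd v hv, simpleRoot_of_ne hvk]
  · have h1 := h0 l
    have h2 := simpleRoot_nonneg (t := t) k l
    simp only [Pi.zero_apply, Pi.add_apply] at *
    positivity

omit G in
theorem add_simpleRoot_ne_zero {γ : t.Weight} {k : Fin t.rank} (h0 : 0 ≤ γ) :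
    γ + t.simpleRoot k ≠ 0 := fun h => by
  have h1 := congrFun h k
  have h2 := h0 k
  simp only [Pi.add_apply, simpleRoot_self, Pi.zero_apply] at h1 h2
  linarith

section StepZero

variable {γ α : t.Weight} {j k : Fin t.rank} {b c₁ c₂ : t.vertices}

/-- The colour lies on the path. Lowering `b` is impossible, and `φ_k(c₂) = 0` because removing
`α_k` disconnects `γ + α`. At the start of the path `ε_k(c₁) = 1` and `⟨h_k, γ⟩ = -1`; at later
vertices both are `0`. Either way `φ_k(c₁) = ε_k(c₂)`, so `e_k` acts on the left. At the start it
moves the first vertex of the path into `γ`; elsewhere both sides vanish. -/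
theorem step_zero_path (hl : Linked t i j γ α) (h0 : 0 ≤ γ) (hki : k ≠ i) (hk : α k ≠ 0)
    (hb : (b : t.Label) = .x γ) (h1 : (c₁ : t.Label) = .x (t.theta - α))
    (h2 : (c₂ : t.Label) = .x (-(t.theta - (γ + α)))) :
    Option.Rel (FullRel (GradedRel t i)) (t.thetaCrystal.f k b)
      ((t.thetaCrystal.tensor t.thetaCrystal).f k (c₁, c₂)) ∧
    Option.Rel (FullRel (GradedRel t i)) (t.thetaCrystal.e k b)
      ((t.thetaCrystal.tensor t.thetaCrystal).e k (c₁, c₂)) := by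
  have hW := G.isWeight_of_eq hb
  have hne := G.ne_zero_of_eq hb
  have hγk : γ k = 0 := hl.disjoint k hk
  have hα1 : α i = 1 := hl.path.target
  have hμ1 : (γ + α) i = 1 := by simp [hl.apply_target, hα1]
  have hfb := G.f_none hb (G.not_isWeight_sub h0 hne hγk)
  have hp1 := G.phi_sub_eps_complement hki h1
  have hp2 := G.phi_sub_eps_neg_complement hki h2
  rw [pairing_add] at hp2
  have hf2 : ¬ t.IsWeight (γ + α - t.simpleRoot k) :=
    G.not_isWeight_removed hW h0 hl h0 hne (fun _ h => h) hk hki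
  obtain ⟨hφ2, hfc2, -⟩ | ⟨-, hbad, -⟩ := G.f_neg_complement hki hμ1 h2
  swap
  · exact absurd hbad hf2
  by_cases hkj : k = j
  · subst hkj
    have hpair := G.pairing_linked hl hW h0
    obtain ⟨hp, hd, m, hm, ha⟩ := hl
    cases hp with
    | nil => exact absurd rfl hki
    | @cons _ j' α' hne' hadj hp hz =>
      have hl' := linked_cons (fun h => hadj ((G.zero_iff _ _).1 h)) hp hz hd
      have hα' : t.simpleRoot k + α' - t.simpleRoot k = α' := by abel
      obtain ⟨-, -, hbad⟩ | ⟨-, -, d, hd1, hd2⟩ := G.e_complement hki hα1 h1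
      · rw [hα'] at hbad
        exact absurd (G.isWeight_path G.isWeight_i hp) hbad
      rw [hα'] at hd2
      have heps : t.thetaCrystal.eps k c₁ = 1 := by
        rw [G.regular.eps_eq hd1]
        obtain ⟨h, -, -⟩ | ⟨-, hbad, -⟩ := G.e_complement hki hp.target hd2
        · rw [h]
        · exact absurd hbad (G.not_isWeight_sub hp.nonneg hp.ne_zero hz)
      have hle : t.thetaCrystal.phi k c₁ = t.thetaCrystal.eps k c₂ := by
        rw [heps] at hp1
        rw [hφ2] at hp2
        push_cast at hp1 hp2
        have : (t.thetaCrystal.phi k c₁ : ℚ) = t.thetaCrystal.eps k c₂ := by linarith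
        exact_mod_cast this
      refine ⟨rel_none hfb (by rw [tensor_f_right hle.le hfc2]; rfl), ?_⟩
      obtain ⟨b', hb', hbl⟩ := G.e_add hb (fun h => by
        have := congrFun h k
        simp [hγk, simpleRoot_self] at this) (G.isWeight_add_simpleRoot hW h0 hγk hm ha)
      refine rel_some hb' (by rw [tensor_e_left hle.ge hd1]; rfl) ?_
      exact G.gradedRel_zero hbl hl' (add_nonneg h0 (simpleRoot_nonneg k))
        (add_simpleRoot_ne_zero h0) hd2 (by rw [h2, add_assoc])
  · have hpair := G.pairing_linked_zero hl hW h0 hk hkj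
    obtain ⟨hε1, hec1, -⟩ | ⟨-, hbad, -⟩ := G.e_complement hki hα1 h1
    swap
    · exact absurd hbad (G.not_isWeight_path_removed hW h0 hl hk hkj hki)
    have hle : t.thetaCrystal.phi k c₁ = t.thetaCrystal.eps k c₂ := by
      rw [hε1] at hp1
      rw [hφ2] at hp2
      push_cast at hp1 hp2
      have : (t.thetaCrystal.phi k c₁ : ℚ) = t.thetaCrystal.eps k c₂ := by linarith
      exact_mod_cast this
    exact ⟨rel_none hfb (by rw [tensor_f_right hle.le hfc2]; rfl),
      rel_none (G.e_none hb (G.not_isWeight_add_of_pairing h0 hne hγk hpair))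
        (by rw [tensor_e_left hle.ge hec1]; rfl)⟩

/-- Here `ε_k(c₁) = φ_k(c₂) = 0`, so `ε_k(c₂) - φ_k(c₁) = -⟨h_k, γ⟩ ≥ 0`. The difference is positive
exactly when `k` is joined to the support of `γ`, which is when `α_k` can be added to `γ`; then
`e_k` acts on the right. -/
theorem step_zero_outside (hl : Linked t i j γ α) (h0 : 0 ≤ γ) (hki : k ≠ i) (hk : α k = 0)
    (hγk : γ k = 0) (hb : (b : t.Label) = .x γ) (h1 : (c₁ : t.Label) = .x (t.theta - α))
    (h2 : (c₂ : t.Label) = .x (-(t.theta - (γ + α)))) :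
    Option.Rel (FullRel (GradedRel t i)) (t.thetaCrystal.f k b)
      ((t.thetaCrystal.tensor t.thetaCrystal).f k (c₁, c₂)) ∧
    Option.Rel (FullRel (GradedRel t i)) (t.thetaCrystal.e k b)
      ((t.thetaCrystal.tensor t.thetaCrystal).e k (c₁, c₂)) := by
  have hW := G.isWeight_of_eq hb
  have hne := G.ne_zero_of_eq hb
  have hα1 : α i = 1 := hl.path.target
  have hμ1 : (γ + α) i = 1 := by simp [hl.apply_target, hα1]
  have hfb := G.f_none hb (G.not_isWeight_sub h0 hne hγk)
  have hp1 := G.phi_sub_eps_complement hki h1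
  have hp2 := G.phi_sub_eps_neg_complement hki h2
  rw [pairing_add] at hp2
  obtain ⟨hφ2, hfc2, -⟩ | ⟨-, hbad, -⟩ := G.f_neg_complement hki hμ1 h2
  swap
  · exact absurd hbad (G.not_isWeight_sub (add_nonneg h0 hl.path.nonneg) (fun h => by
      rw [h] at hμ1; norm_num at hμ1) (by simp [hk, hγk]))
  obtain ⟨hε1, hec1, -⟩ | ⟨-, hbad, -⟩ := G.e_complement hki hα1 h1
  swap
  · exact absurd hbad (G.not_isWeight_sub hl.path.nonneg hl.path.ne_zero hk)
  rw [hε1] at hp1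
  rw [hφ2] at hp2
  push_cast at hp1 hp2
  have hnp := G.pairing_nonpos h0 hγk
  have hle : t.thetaCrystal.phi k c₁ ≤ t.thetaCrystal.eps k c₂ := by
    have : (t.thetaCrystal.phi k c₁ : ℚ) ≤ t.thetaCrystal.eps k c₂ := by linarith
    exact_mod_cast this
  refine ⟨rel_none hfb (by rw [tensor_f_right hle hfc2]; rfl), ?_⟩
  by_cases hpair : t.pairing k γ = 0
  · have hge : t.thetaCrystal.eps k c₂ ≤ t.thetaCrystal.phi k c₁ := by
      have : (t.thetaCrystal.eps k c₂ : ℚ) ≤ t.thetaCrystal.phi k c₁ := by linarith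
      exact_mod_cast this
    exact rel_none (G.e_none hb (G.not_isWeight_add_of_pairing h0 hne hγk hpair))
      (by rw [tensor_e_left hge hec1]; rfl)
  · have hneg := lt_of_le_of_ne hnp hpair
    have hlt : t.thetaCrystal.phi k c₁ < t.thetaCrystal.eps k c₂ := by
      have : (t.thetaCrystal.phi k c₁ : ℚ) < t.thetaCrystal.eps k c₂ := by linarith
      exact_mod_cast this
    obtain ⟨h, -, -⟩ | ⟨-, -, d, hd1, hd2⟩ := G.e_neg_complement hki hμ1 h2
    · omega
    obtain ⟨b', hb', hbl⟩ := G.e_add hb (fun h => by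
      have := congrFun h k
      simp [hγk, simpleRoot_self] at this) (hW.add ((G.integral _ hW).pairing_le_neg_one hneg))
    refine rel_some hb' (by rw [tensor_e_right hlt hd1]; rfl) ?_
    exact G.gradedRel_zero hbl (linked_add hl h0 hk) (add_nonneg h0 (simpleRoot_nonneg k))
      (add_simpleRoot_ne_zero h0) h1 (by rw [hd2]; congr 3; abel)

/-- No vertex of the path sees `α_k`, so `φ_k(c₁) = ε_k(c₁) = 0` and only the right factor can move.
The path stays linked when `γ` changes by `α_k`, and `γ ± α_k` is a weight exactly when `γ + α ±
α_k` is one. -/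
theorem step_zero_support (hl : Linked t i j γ α) (h0 : 0 ≤ γ) (hki : k ≠ i)
    (hγk : γ k ≠ 0) (hadj : ∀ v, α v ≠ 0 → t.finCartan v k = 0)
    (hb : (b : t.Label) = .x γ) (h1 : (c₁ : t.Label) = .x (t.theta - α))
    (h2 : (c₂ : t.Label) = .x (-(t.theta - (γ + α)))) :
    Option.Rel (FullRel (GradedRel t i)) (t.thetaCrystal.f k b)
      ((t.thetaCrystal.tensor t.thetaCrystal).f k (c₁, c₂)) ∧
    Option.Rel (FullRel (GradedRel t i)) (t.thetaCrystal.e k b)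
      ((t.thetaCrystal.tensor t.thetaCrystal).e k (c₁, c₂)) := by
  have hW := G.isWeight_of_eq hb
  have hα1 : α i = 1 := hl.path.target
  have hμ1 : (γ + α) i = 1 := by simp [hl.apply_target, hα1]
  have hk : α k = 0 := by
    by_contra h
    exact hγk (hl.disjoint k h)
  obtain ⟨hε1, hec1, -⟩ | ⟨-, hbad, -⟩ := G.e_complement hki hα1 h1
  swap
  · exact absurd hbad (G.not_isWeight_sub hl.path.nonneg hl.path.ne_zero hk)
  obtain ⟨hφ1, -, -⟩ | ⟨-, hbad, -⟩ := G.f_complement hki hα1 h1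
  swap
  · exact absurd hbad (G.not_isWeight_add_of_pairing hl.path.nonneg hl.path.ne_zero hk
      (G.pairing_eq_zero_of_not_joined hadj))
  obtain ⟨l, hl1, hl2⟩ := hl.joined
  have hlk : l ≠ k := fun h => hl2 (by
    rw [h]; exact hadj j (by rw [hl.path.start]; norm_num))
  have hladd := linked_add hl h0 hk
  have hlsub : Linked t i j (γ - t.simpleRoot k) α := by
    refine ⟨hl.path, fun v hv => ?_, l, by simpa [simpleRoot_of_ne hlk] using hl1, hl2⟩
    have hvk : v ≠ k := fun h => hv (h ▸ hk)
    simp [hl.disjoint v hv, simpleRoot_of_ne hvk]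
  have hsubpos : 0 < (γ - t.simpleRoot k) l := by
    simp only [Pi.sub_apply, simpleRoot_of_ne hlk, sub_zero]
    exact lt_of_le_of_ne (h0 l) (Ne.symm hl1)
  have hpairing : ∀ v, α v ≠ 0 → t.pairing v (t.simpleRoot k) = 0 := fun v hv => by
    rw [pairing_simpleRoot, hadj v hv, Int.cast_zero]
  constructor
  · have hle : t.thetaCrystal.phi k c₁ ≤ t.thetaCrystal.eps k c₂ := by rw [hφ1]; omega
    obtain ⟨-, hfc2, hbad⟩ | ⟨-, hgood, d, hd1, hd2⟩ := G.f_neg_complement hki hμ1 h2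
    · refine rel_none (G.f_none hb fun h => hbad ?_) (by rw [tensor_f_right hle hfc2]; rfl)
      have := G.isWeight_add_path h (G.nonneg_of_pos h hsubpos) hlsub
      rwa [sub_add_eq_add_sub] at this
    · have h3 : t.IsWeight (γ - t.simpleRoot k) :=
        G.isWeight_of_add_path hW h0 hl (fun v hv => by
          rw [pairing_sub, hpairing v hv, sub_zero]) (by rwa [sub_add_eq_add_sub])
      obtain ⟨b', hb', hbl⟩ := G.f_sub hb (fun h => by
        rw [h] at hl1
        exact hl1 (simpleRoot_of_ne hlk)) h3
      refine rel_some hb' (by rw [tensor_f_right hle hd1]; rfl) ?_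
      exact G.gradedRel_zero hbl hlsub (G.nonneg_of_pos h3 hsubpos)
        (fun h => by rw [h] at hsubpos; exact lt_irrefl _ hsubpos) h1
        (by rw [hd2, sub_add_eq_add_sub])
  · obtain ⟨hε2, -, hbad⟩ | ⟨hε2, hgood, d, hd1, hd2⟩ := G.e_neg_complement hki hμ1 h2
    · refine rel_none (G.e_none hb fun h => hbad ?_)
        (by rw [tensor_e_left (by omega) hec1]; rfl)
      have := G.isWeight_add_path h (add_nonneg h0 (simpleRoot_nonneg k)) hladd
      rwa [add_right_comm] at this
    · have h3 : t.IsWeight (γ + t.simpleRoot k) :=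
        G.isWeight_of_add_path hW h0 hl (fun v hv => by
          rw [pairing_add, hpairing v hv, add_zero]) (by rwa [add_right_comm])
      obtain ⟨b', hb', hbl⟩ := G.e_add hb (fun h => by
        rw [h] at hl1
        exact hl1 (by simp [simpleRoot_of_ne hlk])) h3
      refine rel_some hb' (by rw [tensor_e_right (by omega) hd1]; rfl) ?_
      exact G.gradedRel_zero hbl hladd (add_nonneg h0 (simpleRoot_nonneg k))
        (add_simpleRoot_ne_zero h0) h1 (by rw [hd2, add_right_comm])

/-- The colour is the vertex at which the path meets the support. Since `⟨h_j, γ⟩ = -1`, the edge to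
`k` exhausts this pairing: `γ_k = 1`, the entry is `-1`, and the rest `η = γ - α_k` is not joined to
the path. Lowering by `α_k` therefore lengthens the path by `k`. -/
theorem step_zero_joined (hl : Linked t i j γ α) (h0 : 0 ≤ γ) (hki : k ≠ i)
    (hγk : γ k ≠ 0) (hadj : t.finCartan j k ≠ 0)
    (hb : (b : t.Label) = .x γ) (h1 : (c₁ : t.Label) = .x (t.theta - α))
    (h2 : (c₂ : t.Label) = .x (-(t.theta - (γ + α)))) :
    Option.Rel (FullRel (GradedRel t i)) (t.thetaCrystal.f k b)
      ((t.thetaCrystal.tensor t.thetaCrystal).f k (c₁, c₂)) ∧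
    Option.Rel (FullRel (GradedRel t i)) (t.thetaCrystal.e k b)
      ((t.thetaCrystal.tensor t.thetaCrystal).e k (c₁, c₂)) := by
  have hW := G.isWeight_of_eq hb
  have hα1 : α i = 1 := hl.path.target
  have hμ1 : (γ + α) i = 1 := by simp [hl.apply_target, hα1]
  have hk : α k = 0 := by
    by_contra h
    exact hγk (hl.disjoint k h)
  have hkj : k ≠ j := fun h => hγk (by rw [h]; exact hl.apply_start)
  have hpj := G.pairing_linked hl hW h0
  have hcar := G.cartan_le_neg_one hkj.symm hadj
  have hγ1 : 1 ≤ γ k :=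
    (G.integral _ hW).one_le (lt_of_le_of_ne (h0 k) (Ne.symm hγk))
  have hrest : t.pairing j (γ - γ k • t.simpleRoot k) ≤ 0 := by
    refine G.pairing_nonpos (fun v => ?_) (by simp [hl.apply_start, simpleRoot_of_ne hkj.symm])
    by_cases hv : v = k
    · subst hv; simp [simpleRoot_self]
    · simpa [simpleRoot_of_ne hv] using h0 v
  rw [pairing_sub, pairing_smul, pairing_simpleRoot, hpj] at hrest
  have hγk1 : γ k = 1 := by nlinarith
  have hcar1 : (t.finCartan j k : ℚ) = -1 := by rw [hγk1] at hrest; linarith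
  set η := γ - t.simpleRoot k with hη
  have hγη : γ = t.simpleRoot k + η := by rw [hη]; abel
  have hηk : η k = 0 := by simp [hη, hγk1, simpleRoot_self]
  have hηv : ∀ v, v ≠ k → η v = γ v := fun v hv => by simp [hη, simpleRoot_of_ne hv]
  have hη0 : 0 ≤ η := fun v => by
    by_cases hv : v = k
    · rw [hv, hηk]; exact le_rfl
    · rw [hηv v hv]; exact h0 v
  have hpath : PathTo t i k (t.simpleRoot k + α) :=
    .cons hkj (fun h => hadj ((G.zero_iff _ _).1 h)) hl.path hk
  obtain ⟨hε1, hec1, -⟩ | ⟨-, hbad, -⟩ := G.e_complement hki hα1 h1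
  swap
  · exact absurd hbad (G.not_isWeight_sub hl.path.nonneg hl.path.ne_zero hk)
  have hp1 := G.phi_sub_eps_complement hki h1
  have hp2 := G.phi_sub_eps_neg_complement hki h2
  rw [pairing_add] at hp2
  rw [hε1] at hp1
  push_cast at hp1
  -- If `γ = α_k`, then `φ_k(c₂) = 1` and `φ_k(c₁) = ε_k(c₂) + 1`: the left factor is lowered, and
  -- the image is that of `y_k`.
  by_cases hηz : η = 0
  · have hγs : γ = t.simpleRoot k := by rw [hγη, hηz, add_zero]
    have hφ2 : t.thetaCrystal.phi k c₂ = 1 := by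
      obtain ⟨-, -, hbad⟩ | ⟨-, -, d, hd1, hd2⟩ := G.f_neg_complement hki hμ1 h2
      · rw [hγs, add_sub_cancel_left] at hbad
        exact absurd (G.isWeight_path G.isWeight_i hl.path) hbad
      rw [hγs, add_sub_cancel_left] at hd2
      rw [G.regular.phi_eq hd1]
      obtain ⟨h, -, -⟩ | ⟨-, hbad, -⟩ := G.f_neg_complement hki hα1 hd2
      · rw [h]
      · exact absurd hbad (G.not_isWeight_sub hl.path.nonneg hl.path.ne_zero hk)
    have hlt : t.thetaCrystal.phi k c₁ = t.thetaCrystal.eps k c₂ + 1 := by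
      rw [hφ2, hγs, G.pairing_simpleRoot_self] at hp2
      push_cast at hp2
      have : (t.thetaCrystal.phi k c₁ : ℚ) = t.thetaCrystal.eps k c₂ + 1 := by linarith
      exact_mod_cast this
    obtain ⟨h, -, -⟩ | ⟨-, -, d, hd1, hd2⟩ := G.f_complement hki hα1 h1
    · omega
    constructor
    · obtain ⟨b', hb', hbl⟩ := G.f_simple (j := k) (by rw [hb, hγs])
      refine rel_some hb' (by rw [tensor_f_left (by omega) hd1]; rfl) ?_
      rw [hbl, hd2, h2, hγs, add_comm α]
      exact .y k _ (hγs ▸ hW) hpath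
    · refine rel_none (G.e_none hb ?_) (by rw [tensor_e_left (by omega) hec1]; rfl)
      rw [hγs]
      exact G.not_isWeight_simple_add
  · have hηj : η j = 0 := by rw [hηv j hkj.symm]; exact hl.apply_start
    have hpη : t.pairing j η = 0 := by
      rw [hη, pairing_sub, pairing_simpleRoot, hpj, hcar1]; norm_num
    have hηsub : ∀ v, η v ≠ 0 → v ≠ k ∧ γ v ≠ 0 := fun v hv => by
      have hvk : v ≠ k := fun h => hv (h ▸ hηk)
      exact ⟨hvk, by rwa [← hηv v hvk]⟩
    have hf2 : ¬ t.IsWeight (γ + α - t.simpleRoot k) := by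
      rw [show γ + α - t.simpleRoot k = η + α by rw [hη]; abel]
      refine G.disconnected η α hη0 hl.path.nonneg (fun v => ?_) (fun v u hv hu => ?_) hηz
        hl.path.ne_zero
      · by_contra hcon
        push Not at hcon
        exact (hηsub v hcon.1).2 (hl.disjoint v hcon.2)
      · rw [G.zero_iff]
        by_cases huj : u = j
        · subst huj
          exact G.not_joined_of_pairing hη0 hηj hpη hv
        · exact G.not_joined_linked hl hW h0 hu huj (hηsub v hv).2
    obtain ⟨hφ2, hfc2, -⟩ | ⟨-, hbad, -⟩ := G.f_neg_complement hki hμ1 h2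
    swap
    · exact absurd hbad hf2
    rw [hφ2] at hp2
    push_cast at hp2
    have hpb := G.phi_sub_eps_x (j := k) hb
    -- If `η` is a weight, the lengthened path is linked to it, so `⟨h_k, η⟩ = -1`, `⟨h_k, γ⟩ = 1`
    -- and `φ_k(c₁) = ε_k(c₂) + 1`. If not, `b` cannot be lowered and `φ_k(c₁) + ε_k(b) = ε_k(c₂)`,
    -- so `e_k` acts on the right precisely when it acts on `b`.
    by_cases hWη : t.IsWeight η
    · have hlη : Linked t i k η (t.simpleRoot k + α) := by
        refine ⟨hpath, fun v hv => ?_, ?_⟩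
        · by_cases hvk : v = k
          · rw [hvk]; exact hηk
          · rw [hηv v hvk]
            exact hl.disjoint v (by simpa [simpleRoot_of_ne hvk] using hv)
        · by_contra hcon
          push Not at hcon
          have hcon' : t.pairing k η = 0 := by
            refine G.pairing_eq_zero_of_not_joined fun v hv => ?_
            exact (G.zero_iff _ _).1 (hcon v hv)
          refine G.not_isWeight_add_of_pairing hη0 hηz hηk hcon' ?_
          rwa [add_comm, ← hγη]
      have hpkη := G.pairing_linked hlη hWη hη0
      have hpkγ : t.pairing k γ = 1 := by
        rw [hγη, pairing_add, hpkη, G.pairing_simpleRoot_self]; norm_num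
      have hlt : t.thetaCrystal.phi k c₁ = t.thetaCrystal.eps k c₂ + 1 := by
        have : (t.thetaCrystal.phi k c₁ : ℚ) = t.thetaCrystal.eps k c₂ + 1 := by linarith
        exact_mod_cast this
      obtain ⟨h, -, -⟩ | ⟨-, -, d, hd1, hd2⟩ := G.f_complement hki hα1 h1
      · omega
      have hγs : γ ≠ t.simpleRoot k := fun h => hηz (by rw [hη, h, sub_self])
      constructor
      · obtain ⟨b', hb', hbl⟩ := G.f_sub hb hγs hWη
        refine rel_some hb' (by rw [tensor_f_left (by omega) hd1]; rfl) ?_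
        refine G.gradedRel_zero hbl hlη hη0 hηz (by rw [hd2, add_comm α]) ?_
        rw [h2]
        congr 3
        abel
      · have h3 := G.phi_le_one hb hγs (G.not_isWeight_sub hη0 hηz hηk)
        have h4 : t.thetaCrystal.eps k b = 0 := by
          rw [hpkγ] at hpb
          have : (t.thetaCrystal.phi k b : ℚ) = t.thetaCrystal.eps k b + 1 := by linarith
          have : t.thetaCrystal.phi k b = t.thetaCrystal.eps k b + 1 := by exact_mod_cast this
          omega
        exact rel_none (G.regular.eq_none_of_eps h4)
          (by rw [tensor_e_left (by omega) hec1]; rfl)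
    · have hφb := G.phi_zero hb hWη
      rw [hφb] at hpb
      push_cast at hpb
      have hsum : t.thetaCrystal.phi k c₁ + t.thetaCrystal.eps k b =
          t.thetaCrystal.eps k c₂ := by
        have : (t.thetaCrystal.phi k c₁ : ℚ) + t.thetaCrystal.eps k b =
          t.thetaCrystal.eps k c₂ := by linarith
        exact_mod_cast this
      refine ⟨rel_none (G.f_none hb hWη) (by rw [tensor_f_right (by omega) hfc2]; rfl), ?_⟩
      by_cases hεb : t.thetaCrystal.eps k b = 0
      · exact rel_none (G.regular.eq_none_of_eps hεb)
          (by rw [tensor_e_left (by omega) hec1]; rfl)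
      · obtain ⟨h, -, -⟩ | ⟨-, -, d, hd1, hd2⟩ := G.e_neg_complement hki hμ1 h2
        · omega
        obtain ⟨b', hb', hbl⟩ := G.e_add hb (fun h => by
          have := congrFun h k
          simp only [hγk1, Pi.neg_apply, simpleRoot_self] at this
          norm_num at this) (G.isWeight_of_eps hb hεb)
        refine rel_some hb' (by rw [tensor_e_right (by omega) hd1]; rfl) ?_
        exact G.gradedRel_zero hbl (linked_add hl h0 hk) (add_nonneg h0 (simpleRoot_nonneg k))
          (add_simpleRoot_ne_zero h0) h1 (by rw [hd2, add_right_comm])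

theorem step_zero_ne (hl : Linked t i j γ α) (h0 : 0 ≤ γ) (hki : k ≠ i)
    (hb : (b : t.Label) = .x γ) (h1 : (c₁ : t.Label) = .x (t.theta - α))
    (h2 : (c₂ : t.Label) = .x (-(t.theta - (γ + α)))) :
    Option.Rel (FullRel (GradedRel t i)) (t.thetaCrystal.f k b)
      ((t.thetaCrystal.tensor t.thetaCrystal).f k (c₁, c₂)) ∧
    Option.Rel (FullRel (GradedRel t i)) (t.thetaCrystal.e k b)
      ((t.thetaCrystal.tensor t.thetaCrystal).e k (c₁, c₂)) := by
  by_cases hk : α k = 0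
  · by_cases hγk : γ k = 0
    · exact G.step_zero_outside hl h0 hki hk hγk hb h1 h2
    · by_cases hadj : ∀ v, α v ≠ 0 → t.finCartan v k = 0
      · exact G.step_zero_support hl h0 hki hγk hadj hb h1 h2
      · push Not at hadj
        obtain ⟨v, hv, ha⟩ := hadj
        have hvj : v = j := by
          by_contra hvj
          exact ha (G.not_joined_linked hl (G.isWeight_of_eq hb) h0 hv hvj hγk)
        subst hvj
        exact G.step_zero_joined hl h0 hki hγk ha hb h1 h2
  · exact G.step_zero_path hl h0 hki hk hb h1 h2

end StepZero

end GradedData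

end AffineType


/-! ### The graded relation: colour `i`, zero weights, positive degrees -/

namespace AffineType

open Crystal

variable {t : AffineType}

/-- The Kashiwara operators of colour `k` respect the relation at `b` and `c`. -/
abbrev StepRel (Q : t.Label → t.Label → t.Label → Prop) (k : Fin t.rank) (b : t.vertices)
    (c : t.vertices × t.vertices) : Prop :=
  Option.Rel (FullRel Q) (t.thetaCrystal.f k b)
    ((t.thetaCrystal.tensor t.thetaCrystal).f k c) ∧
  Option.Rel (FullRel Q) (t.thetaCrystal.e k b)
    ((t.thetaCrystal.tensor t.thetaCrystal).e k c)

/-- For self-dual vertices it suffices to consider one of the two operators. -/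
theorem stepRel_of_dual {Q : t.Label → t.Label → t.Label → Prop} {k : Fin t.rank}
    {b : t.vertices} {c : t.vertices × t.vertices} (hb : dualVertex b = b) (hc : dualPair c = c)
    (h : Option.Rel (FullRel Q) (t.thetaCrystal.e k b)
      ((t.thetaCrystal.tensor t.thetaCrystal).e k c)) : StepRel Q k b c := by
  refine ⟨?_, h⟩
  have := rel_f_dual h
  rwa [hb, hc] at this

theorem dualVertex_of_y {b : t.vertices} {j : Fin t.rank} (hb : (b : t.Label) = .y j) :
    dualVertex b = b := Subtype.ext (by rw [dualVertex_y hb, hb])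

namespace GradedData

variable {i : Fin t.rank} (G : GradedData t i)
include G

section

variable {γ α : t.Weight} {j k : Fin t.rank} {b c₁ c₂ : t.vertices}

/-- The right factor cannot be lowered: the result would have degree `-2` and be `-θ`, leaving no
room for `γ`. If the path is just `i`, the factor `x_{θ - α_i}` is raised to `x_θ`, which is the
formula in degree one. Otherwise raising it would give `θ` too, contradicting the coefficient at the
start of the path, so both sides vanish. -/
theorem step_zero_i (hl : Linked t i j γ α) (h0 : 0 ≤ γ)
    (hb : (b : t.Label) = .x γ) (h1 : (c₁ : t.Label) = .x (t.theta - α))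
    (h2 : (c₂ : t.Label) = .x (-(t.theta - (γ + α)))) :
    StepRel (GradedRel t i) i b (c₁, c₂) := by
  have hW := G.isWeight_of_eq hb
  have hne := G.ne_zero_of_eq hb
  have hα1 : α i = 1 := hl.path.target
  have hγi : γ i = 0 := hl.apply_target
  have hfb := G.f_none hb (G.not_isWeight_sub h0 hne hγi)
  have hf2 : ¬ t.IsWeight (-(t.theta - (γ + α)) - t.simpleRoot i) := fun h => by
    have h3 := G.coeff_two _ (G.neg _ h) (by
      simp [G.theta_i, hγi, hα1, simpleRoot_self])
    obtain ⟨v, hv⟩ := Function.ne_iff.1 hne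
    have hvi : v ≠ i := fun h => hv (h ▸ hγi)
    have h4 := congrFun h3 v
    have h5 := hl.path.nonneg v
    have h6 := lt_of_le_of_ne (h0 v) (Ne.symm hv)
    simp only [Pi.neg_apply, Pi.sub_apply, Pi.add_apply, simpleRoot_of_ne hvi,
      Pi.zero_apply] at h4 h5 h6
    linarith
  have hfc2 := G.f_none h2 hf2
  have hp1 := G.phi_sub_eps_x (j := i) h1
  have hp2 := G.phi_sub_eps_x (j := i) h2
  rw [phi_eq_zero hfc2, pairing_neg, pairing_sub, pairing_add, G.pairing_theta_i] at hp2
  rw [pairing_sub, G.pairing_theta_i] at hp1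
  push_cast at hp2
  by_cases hji : j = i
  · subst hji
    obtain ⟨m, hm, ha⟩ := hl.joined
    have hpair := G.pairing_linked hl hW h0
    have hα := hl.path.eq_simpleRoot
    subst hα
    rw [G.pairing_simpleRoot_self, hpair] at hp2
    rw [G.pairing_simpleRoot_self] at hp1
    have hε2 : t.thetaCrystal.eps j c₂ = 0 := by
      have : (t.thetaCrystal.eps j c₂ : ℚ) = 0 := by linarith
      exact_mod_cast this
    obtain ⟨d, hd1, hd2⟩ := G.e_add h1 (j := j) (fun h => by
      have := congrFun h j
      simp [G.theta_i, simpleRoot_self] at this) (by rw [sub_add_cancel]; exact .highest)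
    rw [sub_add_cancel] at hd2
    have hε1 : t.thetaCrystal.eps j c₁ = 1 := by
      rw [G.regular.eps_eq hd1, eps_eq_zero (G.e_none hd2 (G.not_isWeight_of_coeff (by
        simp [G.theta_i, simpleRoot_self])))]
    have hφ1 : t.thetaCrystal.phi j c₁ = 0 := by
      rw [hε1] at hp1
      have : (t.thetaCrystal.phi j c₁ : ℚ) = 0 := by push_cast at hp1; linarith
      exact_mod_cast this
    refine ⟨rel_none hfb (by rw [tensor_f_right (by omega) hfc2]; rfl), ?_⟩
    obtain ⟨b', hb', hbl⟩ := G.e_add hb (fun h => by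
      have := congrFun h j
      simp [hγi, simpleRoot_self] at this) (G.isWeight_add_simpleRoot hW h0 hγi hm ha)
    refine rel_some hb' (by rw [tensor_e_left (by omega) hd1]; rfl) ?_
    rw [hbl, hd2, h2]
    exact .one _ (G.isWeight_of_eq hbl) (by simp [hγi, simpleRoot_self])
  · have hij : i ≠ j := Ne.symm hji
    have hpair := G.pairing_linked_zero hl hW h0 (by rw [hα1]; norm_num) hij
    have he1 : ¬ t.IsWeight (t.theta - α + t.simpleRoot i) := fun h => by
      have h3 := G.coeff_two _ h (by simp [G.theta_i, hα1, simpleRoot_self])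
      have h4 := congrFun h3 j
      simp [hl.path.start, simpleRoot_of_ne hji] at h4
    have hec1 := G.e_none h1 he1
    have hle : t.thetaCrystal.phi i c₁ = t.thetaCrystal.eps i c₂ := by
      rw [eps_eq_zero hec1] at hp1
      have : (t.thetaCrystal.phi i c₁ : ℚ) = t.thetaCrystal.eps i c₂ := by
        push_cast at hp1; linarith
      exact_mod_cast this
    exact ⟨rel_none hfb (by rw [tensor_f_right hle.le hfc2]; rfl),
      rel_none (G.e_none hb (G.not_isWeight_add_of_pairing h0 hne hγi hpair))
        (by rw [tensor_e_left hle.ge hec1]; rfl)⟩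

/-- The factors are dual to each other, so `ε_k(c₂) = φ_k(c₁)` and `e_k` acts on the left; `f_k`
then follows by duality. For `k = j` the first vertex of the path is removed from `α`. For any other
`k` it must be seen that `c₁` cannot be raised. -/
theorem step_y (hp : PathTo t i j α) (hb : (b : t.Label) = .y j)
    (h1 : (c₁ : t.Label) = .x (t.theta - α)) (h2 : (c₂ : t.Label) = .x (-(t.theta - α))) :
    StepRel (GradedRel t i) k b (c₁, c₂) := by
  have hd : c₂ = dualVertex c₁ := Subtype.ext (by rw [dualVertex_x h1, h2])
  have hW := WeightData.isWeight_simpleRoot_of_eq hb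
  refine stepRel_of_dual (dualVertex_of_y hb) (by
    rw [hd, dualPair, dualVertex_dualVertex]) ?_
  have hle : t.thetaCrystal.eps k c₂ = t.thetaCrystal.phi k c₁ := by rw [hd, eps_dualVertex]
  rw [tensor_e_left hle.le rfl]
  by_cases hki : k = i
  · subst hki
    by_cases hjk : j = k
    · subst hjk
      have hα := hp.eq_simpleRoot
      subst hα
      obtain ⟨d, hd1, hd2⟩ := G.e_add h1 (j := j) (fun h => by
        have := congrFun h j
        simp [G.theta_i, simpleRoot_self] at this) (by rw [sub_add_cancel]; exact .highest)
      rw [sub_add_cancel] at hd2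
      obtain ⟨b', hb', hbl⟩ := G.e_y_self hb
      refine rel_some hb' (by rw [hd1]; rfl) ?_
      rw [hbl, hd2, h2]
      exact .one _ hW (simpleRoot_self j)
    · refine rel_none (WeightData.e_y_ne hb hjk) ?_
      rw [G.e_none h1 fun h => ?_]
      · rfl
      have h3 := G.coeff_two _ h (by simp [G.theta_i, hp.target, simpleRoot_self])
      have h4 := congrFun h3 j
      simp [hp.start, simpleRoot_of_ne hjk] at h4
  · by_cases hjk : j = k
    · subst hjk
      cases hp with
      | nil => exact absurd rfl hki
      | @cons _ j' α' hne' hadj hp hz =>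
        have hα' : t.simpleRoot j + α' - t.simpleRoot j = α' := by abel
        obtain ⟨-, -, hbad⟩ | ⟨-, -, d, hd1, hd2⟩ :=
          G.e_complement hki (by simp [hp.target, simpleRoot_of_ne (Ne.symm hki)]) h1
        · rw [hα'] at hbad
          exact absurd (G.isWeight_path G.isWeight_i hp) hbad
        rw [hα'] at hd2
        obtain ⟨b', hb', hbl⟩ := G.e_y_self hb
        refine rel_some hb' (by rw [hd1]; rfl) ?_
        refine G.gradedRel_zero hbl ⟨hp, fun v hv => ?_, j, ?_, fun h =>
          hadj ((G.zero_iff _ _).1 h)⟩ (simpleRoot_nonneg j) (simpleRoot_ne_zero j) hd2 h2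
        · exact simpleRoot_of_ne fun h => hv (h ▸ hz)
        · rw [simpleRoot_self]; norm_num
    · refine rel_none (WeightData.e_y_ne hb hjk) ?_
      obtain ⟨-, h, -⟩ | ⟨-, hbad, -⟩ := G.e_complement hki hp.target h1
      · rw [h]; rfl
      exfalso
      by_cases hαk : α k = 0
      · exact G.not_isWeight_sub hp.nonneg hp.ne_zero hαk hbad
      cases hp with
      | nil => exact hαk (simpleRoot_of_ne hki)
      | @cons _ j' α' hne' hadj hp hz =>
        have hl : Linked t i j' (t.simpleRoot j) α' :=
          ⟨hp, fun v hv => simpleRoot_of_ne fun h => hv (h ▸ hz), j,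
            by rw [simpleRoot_self]; norm_num, fun h => hadj ((G.zero_iff _ _).1 h)⟩
        exact G.not_isWeight_removed hW (simpleRoot_nonneg j) hl (simpleRoot_nonneg j)
          (simpleRoot_ne_zero j) (fun _ h => h)
          (by simpa [simpleRoot_of_ne (Ne.symm hjk)] using hαk) hki hbad

theorem theta_ne_simpleRoot (k : Fin t.rank) : t.theta ≠ t.simpleRoot k := fun h => by
  have := congrFun h i
  rw [G.theta_i] at this
  by_cases hk : i = k
  · subst hk; rw [simpleRoot_self] at this; norm_num at this
  · rw [simpleRoot_of_ne hk] at this; norm_num at this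

theorem theta_add_none (hc : (c₁ : t.Label) = .x t.theta) :
    t.thetaCrystal.e k c₁ = none := by
  refine G.e_none hc fun h => ?_
  by_cases hki : k = i
  · subst hki
    exact G.not_isWeight_of_coeff (by simp [G.theta_i, simpleRoot_self]) h
  · have h3 := G.coeff_two _ h (by simp [G.theta_i, simpleRoot_of_ne (Ne.symm hki)])
    exact simpleRoot_ne_zero k (by simpa using h3)

theorem phi_theta_ne (hki : k ≠ i) (hc : (c₁ : t.Label) = .x t.theta) :
    t.thetaCrystal.phi k c₁ = 0 := by
  have h := G.phi_sub_eps_x (j := k) hc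
  rw [eps_eq_zero (G.theta_add_none hc), G.pairing_theta k hki] at h
  have : (t.thetaCrystal.phi k c₁ : ℚ) = 0 := by push_cast at h; linarith
  exact_mod_cast this

theorem phi_theta_i (hc : (c₁ : t.Label) = .x t.theta) : t.thetaCrystal.phi i c₁ = 1 := by
  have h := G.phi_sub_eps_x (j := i) hc
  rw [eps_eq_zero (G.theta_add_none hc), G.pairing_theta_i] at h
  have : (t.thetaCrystal.phi i c₁ : ℚ) = 1 := by push_cast at h; linarith
  exact_mod_cast this

theorem isWeight_theta_sub : t.IsWeight (t.theta - t.simpleRoot i) :=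
  IsWeight.highest.sub (by rw [G.pairing_theta_i])

theorem step_top (hb : (b : t.Label) = .x t.theta) (h1 : (c₁ : t.Label) = .x t.theta)
    (h2 : (c₂ : t.Label) = .y i) : StepRel (GradedRel t i) k b (c₁, c₂) := by
  refine ⟨?_, rel_none (G.theta_add_none hb) ?_⟩
  · by_cases hki : k = i
    · subst hki
      obtain ⟨d, hd1, hd2⟩ := G.f_y_self h2
      obtain ⟨b', hb', hbl⟩ := G.f_sub hb (G.theta_ne_simpleRoot k) G.isWeight_theta_sub
      refine rel_some hb' (by
        rw [tensor_f_right (by rw [G.phi_theta_i h1, G.eps_y h2]) hd1]; rfl) ?_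
      rw [hbl, h1, hd2]
      have := GradedRel.one (i := k) _ (G.isWeight_of_eq hbl)
        (by simp [G.theta_i, simpleRoot_self]; norm_num)
      rwa [sub_sub_cancel] at this
    · refine rel_none (G.regular.eq_none_of_phi (G.phi_theta_ne hki hb)) ?_
      rw [tensor_f_right (by rw [G.phi_theta_ne hki h1]; omega)
        (WeightData.f_y_ne h2 (Ne.symm hki))]
      rfl
  · by_cases hki : k = i
    · subst hki
      rw [tensor_e_left (by rw [G.phi_theta_i h1, G.eps_y h2]) (G.theta_add_none h1)]; rfl
    · rw [tensor_e_left (by rw [WeightData.eps_y_ne h2 (Ne.symm hki)]; omega)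
        (G.theta_add_none h1)]; rfl

theorem step_one_ne (hγ : γ i = 1) (hki : k ≠ i) (hb : (b : t.Label) = .x γ)
    (h1 : (c₁ : t.Label) = .x t.theta) (h2 : (c₂ : t.Label) = .x (-(t.theta - γ))) :
    StepRel (GradedRel t i) k b (c₁, c₂) := by
  have hφ := G.phi_theta_ne hki h1
  constructor
  · rcases G.f_neg_complement hki hγ h2 with ⟨-, h3, h4⟩ | ⟨-, h4, d, hd1, hd2⟩
    · exact rel_none (G.f_none hb h4) (by rw [tensor_f_right (by omega) h3]; rfl)
    · have hs : (γ - t.simpleRoot k) i = 1 := by simp [hγ, simpleRoot_of_ne (Ne.symm hki)]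
      obtain ⟨b', hb', hbl⟩ := G.f_sub hb (fun h => by
        rw [h, sub_self] at hs; norm_num at hs) h4
      refine rel_some hb' (by rw [tensor_f_right (by omega) hd1]; rfl) ?_
      rw [hbl, h1, hd2]
      exact .one _ h4 hs
  · rcases G.e_neg_complement hki hγ h2 with ⟨h5, -, h4⟩ | ⟨h5, h4, d, hd1, hd2⟩
    · exact rel_none (G.e_none hb h4)
        (by rw [tensor_e_left (by omega) (G.theta_add_none h1)]; rfl)
    · have hs : (γ + t.simpleRoot k) i = 1 := by simp [hγ, simpleRoot_of_ne (Ne.symm hki)]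
      obtain ⟨b', hb', hbl⟩ := G.e_add hb (fun h => by
        rw [h, neg_add_cancel] at hs; norm_num at hs) h4
      refine rel_some hb' (by rw [tensor_e_right (by omega) hd1]; rfl) ?_
      rw [hbl, h1, hd2]
      exact .one _ h4 hs

/-- Three cases: `γ = θ - α_i`, where `c₂ = x_{-α_i}` is raised to `y_i`; `γ = α_i`, where the image
of `y_i` is reached; and all other `γ`, where neither `e_i b` nor `f_i c₂` exists. -/
theorem step_one_i (hγ : γ i = 1) (hb : (b : t.Label) = .x γ)
    (h1 : (c₁ : t.Label) = .x t.theta) (h2 : (c₂ : t.Label) = .x (-(t.theta - γ))) :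
    StepRel (GradedRel t i) i b (c₁, c₂) := by
  have hW := G.isWeight_of_eq hb
  have h0 := G.nonneg_of_pos hW (by rw [hγ]; norm_num)
  have hφ := G.phi_theta_i h1
  have he1 : t.thetaCrystal.e i c₁ = none := G.theta_add_none h1
  obtain ⟨d, hd1, hd2⟩ := G.f_sub h1 (G.theta_ne_simpleRoot i) G.isWeight_theta_sub
  by_cases htop : γ = t.theta - t.simpleRoot i
  · have h2' : (c₂ : t.Label) = .x (-t.simpleRoot i) := by rw [h2, htop, sub_sub_cancel]
    have hε := G.eps_neg_simple h2'
    obtain ⟨d', hd1', hd2'⟩ := G.e_simple h2'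
    obtain ⟨b', hb', hbl⟩ := G.e_add (j := i) hb (fun h => by
      rw [h, Pi.neg_apply, simpleRoot_self] at hγ
      norm_num at hγ) (by rw [htop, sub_add_cancel]; exact .highest)
    rw [htop, sub_add_cancel] at hbl
    have hεb : t.thetaCrystal.eps i b = 1 := by
      rw [G.regular.eps_eq hb', eps_eq_zero (G.theta_add_none hbl)]
    have hpb := G.phi_sub_eps_x (j := i) hb
    rw [htop, pairing_sub, G.pairing_theta_i, G.pairing_simpleRoot_self, hεb] at hpb
    have hφb : t.thetaCrystal.phi i b = 0 := by
      have : (t.thetaCrystal.phi i b : ℚ) = 0 := by push_cast at hpb; linarith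
      exact_mod_cast this
    refine ⟨rel_none (G.regular.eq_none_of_phi hφb) ?_,
      rel_some hb' (by rw [tensor_e_right (by omega) hd1']; rfl) ?_⟩
    · rw [tensor_f_right (by omega) (G.regular.eq_none_of_phi (G.phi_neg_simple h2'))]; rfl
    · rw [hbl, h1, hd2']
      exact .top
  have hεb : t.thetaCrystal.e i b = none := by
    refine G.e_none hb fun h => htop ?_
    rw [← G.coeff_two _ h (by simp [hγ, simpleRoot_self]; norm_num)]; abel
  by_cases hs : γ = t.simpleRoot i
  · subst hs
    obtain ⟨b', hb', hbl⟩ := G.f_simple hb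
    have hdual : c₂ = dualVertex d := Subtype.ext (by rw [dualVertex_x hd2, h2])
    have hε2 : t.thetaCrystal.eps i c₂ = 0 := by
      have := G.regular.phi_eq hd1
      rw [hdual, eps_dualVertex]
      omega
    refine ⟨rel_some hb' (by rw [tensor_f_left (by omega) hd1]; rfl) ?_,
      rel_none hεb (by rw [tensor_e_left (by omega) he1]; rfl)⟩
    rw [hbl, hd2, h2]
    exact .y i _ G.isWeight_i .nil
  have hφ2 : t.thetaCrystal.f i c₂ = none := by
    refine G.f_none h2 fun h => hs ?_
    have h3 := G.coeff_two _ (G.neg _ h) (by simp [G.theta_i, hγ, simpleRoot_self])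
    have h4 : t.theta = t.theta - γ + t.simpleRoot i := h3.symm.trans (by abel)
    rw [sub_add, eq_comm, sub_eq_self, sub_eq_zero] at h4
    exact h4
  have hp2 := G.phi_sub_eps_x (j := i) h2
  have hpb := G.phi_sub_eps_x (j := i) hb
  rw [phi_eq_zero hφ2, pairing_neg, pairing_sub, G.pairing_theta_i] at hp2
  rw [eps_eq_zero hεb] at hpb
  push_cast at hp2 hpb
  -- Since `⟨h_i, θ⟩ = 1`, the numbers `ε_i(c₂) = 1 - ⟨h_i, γ⟩` and `φ_i(b) = ⟨h_i, γ⟩` add up to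
  -- `φ_i(c₁) = 1`, so `f_i` acts on the left exactly when it acts on `b`. The new path is the
  -- single vertex `i`.
  have hsum : t.thetaCrystal.eps i c₂ + t.thetaCrystal.phi i b = 1 := by
    have : (t.thetaCrystal.eps i c₂ : ℚ) + t.thetaCrystal.phi i b = 1 := by linarith
    exact_mod_cast this
  refine ⟨?_, rel_none hεb (by rw [tensor_e_left (by omega) he1]; rfl)⟩
  by_cases hφb : t.thetaCrystal.phi i b = 0
  · exact rel_none (G.regular.eq_none_of_phi hφb)
      (by rw [tensor_f_right (by omega) hφ2]; rfl)
  have hpair : t.pairing i γ = 1 := by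
    rw [show t.thetaCrystal.phi i b = 1 by omega] at hpb
    push_cast at hpb
    linarith
  obtain ⟨b', hb', hbl⟩ := G.f_sub hb hs (G.isWeight_of_phi hb hφb)
  refine rel_some hb' (by rw [tensor_f_left (by omega) hd1]; rfl) ?_
  refine G.gradedRel_zero hbl ⟨.nil, fun v hv => ?_, ?_⟩ (fun v => ?_) (sub_ne_zero.2 hs) hd2
    (by rw [h2, sub_add_cancel])
  · have hvi : v = i := by
      by_contra h
      exact hv (simpleRoot_of_ne h)
    simp [hvi, hγ, simpleRoot_self]
  · by_contra hcon
    push Not at hcon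
    have := G.pairing_eq_zero_of_not_joined (μ := γ - t.simpleRoot i) (k := i)
      fun v hv => (G.zero_iff _ _).1 (hcon v hv)
    rw [pairing_sub, hpair, G.pairing_simpleRoot_self] at this
    norm_num at this
  · by_cases hvi : v = i
    · simp [hvi, hγ, simpleRoot_self]
    · simpa [simpleRoot_of_ne hvi] using h0 v

theorem crystalRel : CrystalRel t i (GradedRel t i) where
  functional b c d c' d' h h' := by
    have hti := G.theta_i
    cases h with
    | top =>
      cases h' with
      | top => exact ⟨rfl, rfl⟩
      | one _ _ hi => rw [hti] at hi; norm_num at hi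
      | zero _ _ _ _ _ _ hl => rw [hl.apply_target] at hti; norm_num at hti
    | one _ _ hi =>
      cases h' with
      | top => rw [hti] at hi; norm_num at hi
      | one _ _ hi => exact ⟨rfl, rfl⟩
      | zero _ _ _ _ _ _ hl => rw [hl.apply_target] at hi; norm_num at hi
    | zero _ _ _ hW h0 _ hl =>
      cases h' with
      | top => rw [hl.apply_target] at hti; norm_num at hti
      | one _ _ hi => rw [hl.apply_target] at hi; norm_num at hi
      | zero _ _ _ _ _ _ hl' => rw [G.linked_unique hW h0 hl hl']; exact ⟨rfl, rfl⟩
    | y j α hj hp =>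
      cases h' with
      | y _ α' _ hp' =>
        have : α = α' := by
          cases hp with
          | nil => exact hp'.eq_simpleRoot.symm
          | @cons _ j₁ α hne hadj hp hz =>
            cases hp' with
            | nil => rw [hp.target] at hz; norm_num at hz
            | @cons _ j₂ α' hne' hadj' hp' hz' =>
              have key : ∀ {j' β}, t.finCartan j j' ≠ 0 → PathTo t i j' β → β j = 0 →
                  Linked t i j' (t.simpleRoot j) β := fun ha hp hz =>
                ⟨hp, fun v hv => simpleRoot_of_ne fun h => hv (h ▸ hz), j,
                  by rw [simpleRoot_self]; norm_num, fun h => ha ((G.zero_iff _ _).1 h)⟩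
              rw [G.linked_unique hj (simpleRoot_nonneg j) (key hadj hp hz)
                (key hadj' hp' hz')]
        rw [this]
        exact ⟨rfl, rfl⟩
  nonneg γ c d h := by
    cases h with
    | top => exact t.theta_mem_positiveWeights.2.2
    | one _ hW hi => exact G.nonneg_of_pos hW (by rw [hi]; norm_num)
    | zero _ _ _ _ h0 => exact h0
  y_self j c d h := by
    cases h
    simp [Label.dual]
  total_x γ hW hne h0 := by
    obtain ⟨z, hz⟩ := G.integral γ hW i
    have h1 := G.coeff_le γ hW
    have h2 : (0 : ℚ) ≤ γ i := h0 i
    rw [hz] at h1 h2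
    have h3 : 0 ≤ z := by exact_mod_cast h2
    have h4 : z ≤ 2 := by exact_mod_cast h1
    interval_cases z
    · obtain ⟨j, α, hl⟩ := G.exists_linked hne (by simpa using hz)
      have hα := hl.path.target
      have hγi := hl.apply_target
      obtain ⟨c, hc⟩ := G.exists_x (G.complement α (G.isWeight_path G.isWeight_i hl.path) hα)
        (fun h => by
          have := congrFun h i
          simp [G.theta_i, hα] at this
          norm_num at this)
      obtain ⟨d, hd⟩ := G.exists_x (G.neg _ (G.complement (γ + α)
        (G.isWeight_add_path hW h0 hl) (by simp [hα, hγi])))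
        (fun h => by
          have := congrFun h i
          simp [G.theta_i, hα, hγi] at this
          norm_num at this)
      exact ⟨c, d, by rw [hc, hd]; exact .zero γ α j hW h0 hne hl⟩
    · have hγi : γ i = 1 := by simpa using hz
      obtain ⟨d, hd⟩ := G.exists_x (G.neg _ (G.complement γ hW hγi)) (fun h => by
          have := congrFun h i
          simp [G.theta_i, hγi] at this
          norm_num at this)
      exact ⟨t.xTheta, d, by rw [hd]; exact .one γ hW hγi⟩
    · rw [G.coeff_two γ hW (by simpa using hz)]
      obtain ⟨d, hd⟩ := WeightData.exists_y G.isWeight_i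
      exact ⟨t.xTheta, d, by rw [hd]; exact .top⟩
  total_y j hj := by
    obtain ⟨α, hp⟩ := G.exists_path j
    have hW := G.complement α (G.isWeight_path G.isWeight_i hp) hp.target
    have hne : t.theta - α ≠ 0 := fun h => by
      have := congrFun h i
      simp [G.theta_i, hp.target] at this
      norm_num at this
    obtain ⟨c, hc⟩ := G.exists_x hW hne
    obtain ⟨d, hd⟩ := G.exists_x (G.neg _ hW) (neg_ne_zero.2 hne)
    exact ⟨c, d, by rw [hc, hd]; exact .y j α hj hp⟩
  weight b c d h := by
    cases h <;> simp only [labelCrystal] <;> abel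
  top := .top
  step k b c h := by
    obtain ⟨c₁, c₂⟩ := c
    rcases hb : (b : t.Label) with γ | j <;> rcases h1 : (c₁ : t.Label) with μ | l <;>
      rcases h2 : (c₂ : t.Label) with ν | m <;>
      rw [PosRel, hb, h1, h2] at h
    · cases h with
      | one _ _ hi =>
        by_cases hki : k = i
        · subst hki; exact G.step_one_i hi hb h1 h2
        · exact G.step_one_ne hi hki hb h1 h2
      | zero _ α j _ h0 _ hl =>
        by_cases hki : k = i
        · subst hki; exact G.step_zero_i hl h0 hb h1 h2
        · exact G.step_zero_ne hl h0 hki hb h1 h2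
    · cases h
      exact G.step_top hb h1 h2
    · cases h
    · cases h
    · cases h with
      | y _ α hj hp => exact G.step_y hp hb h1 h2
    · cases h
    · cases h
    · cases h

end

end GradedData

/-! ### Walks in the diagram -/

theorem sum_simpleRoot_apply_of_notMem {l : List (Fin t.rank)} {v : Fin t.rank} (h : v ∉ l) :
    (l.map t.simpleRoot).sum v = 0 := by
  induction l with
  | nil => simp
  | cons a l ih =>
    rw [List.mem_cons, not_or] at h
    simp [simpleRoot_of_ne h.1, ih h.2]

namespace WeightData

variable (W : WeightData t)
include W

theorem diagram_adj {j k : Fin t.rank} :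
    t.diagram.Adj j k ↔ j ≠ k ∧ t.finCartan j k ≠ 0 := by
  rw [diagram, SimpleGraph.fromRel_adj]
  have := W.zero_iff j k
  change j ≠ k ∧ (t.finCartan j k ≠ 0 ∨ t.finCartan k j ≠ 0) ↔ _
  tauto

theorem pathTo_of_walk {i j : Fin t.rank} (p : t.diagram.Walk j i) (hp : p.IsPath) :
    PathTo t i j (p.support.map t.simpleRoot).sum := by
  induction p with
  | nil => simpa using PathTo.nil
  | cons h p ih =>
    rw [SimpleGraph.Walk.cons_isPath_iff] at hp
    obtain ⟨h1, h2⟩ := W.diagram_adj.1 h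
    rw [SimpleGraph.Walk.support_cons, List.map_cons, List.sum_cons]
    exact .cons h1 h2 (ih hp.1) (sum_simpleRoot_apply_of_notMem hp.2)

theorem exists_walk {i j : Fin t.rank} {α : t.Weight} (h : PathTo t i j α) :
    ∃ p : t.diagram.Walk j i, p.IsPath ∧ (∀ v ∈ p.support, α v ≠ 0) ∧
      α = (p.support.map t.simpleRoot).sum := by
  induction h with
  | nil => exact ⟨.nil, .nil, by simp [simpleRoot_self], by simp⟩
  | @cons j j' α hne hadj h h0 ih =>
    obtain ⟨p, hp, hv, hα⟩ := ih
    refine ⟨.cons (W.diagram_adj.2 ⟨hne, hadj⟩) p, ?_, fun v => ?_, ?_⟩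
    · rw [SimpleGraph.Walk.cons_isPath_iff]
      exact ⟨hp, fun h => hv j h h0⟩
    · rw [SimpleGraph.Walk.support_cons, List.mem_cons]
      rintro (rfl | h1)
      · simp [simpleRoot_self, h0]
      · have hvj : v ≠ j := fun h => hv v h1 (h ▸ h0)
        simpa [simpleRoot_of_ne hvj] using hv v h1
    · rw [SimpleGraph.Walk.support_cons, List.map_cons, List.sum_cons, ← hα]

theorem isLinkingSum_iff {i : Fin t.rank} {γ α : t.Weight} :
    t.IsLinkingSum i γ α ↔ ∃ j, Linked t i j γ α := by
  constructor
  · rintro ⟨j, p, hp, hd, ⟨k, hk, ha⟩, rfl⟩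
    refine ⟨j, W.pathTo_of_walk p hp, fun v hv => hd v ?_, k, hk,
      (W.diagram_adj.1 ha.symm).2⟩
    by_contra h
    exact hv (sum_simpleRoot_apply_of_notMem h)
  · rintro ⟨j, hp, hd, k, hk, ha⟩
    obtain ⟨p, h1, h2, h3⟩ := W.exists_walk hp
    refine ⟨j, p, h1, fun v hv => hd v (h2 v hv), ⟨k, hk, W.diagram_adj.2 ⟨?_, ?_⟩⟩, h3⟩
    · rintro rfl
      exact hk (hd k (by rw [hp.start]; norm_num))
    · exact fun h => ha ((W.zero_iff _ _).1 h)

/-- The walks start at `i`, whereas path sums are built towards `i`; reversing a walk keeps the sum.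
-/
theorem isPathSum_iff {i j : Fin t.rank} {α : t.Weight} :
    t.IsPathSum i j α ↔ PathTo t i j α := by
  constructor
  · rintro ⟨p, hp, rfl⟩
    have := W.pathTo_of_walk p.reverse hp.reverse
    rwa [SimpleGraph.Walk.support_reverse, List.map_reverse, List.sum_reverse] at this
  · intro h
    obtain ⟨p, h1, -, h3⟩ := W.exists_walk h
    refine ⟨p.reverse, h1.reverse, ?_⟩
    rwa [SimpleGraph.Walk.support_reverse, List.map_reverse, List.sum_reverse]

end WeightData

namespace GradedData

variable {i : Fin t.rank} (G : GradedData t i)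
include G

theorem gradedFormula {Φ : t.vertices → t.vertices × t.vertices}
    (hΦ : ∀ b, FullRel (GradedRel t i) b (Φ b)) : t.GradedFormula i Φ where
  grading γ hγ := by
    obtain ⟨z, hz⟩ := G.integral γ hγ.1 i
    have h1 := G.coeff_le γ hγ.1
    have h2 : (0 : ℚ) ≤ γ i := hγ.2.2 i
    rw [hz] at h1 h2 ⊢
    have h3 : 0 ≤ z := by exact_mod_cast h2
    have h4 : z ≤ 2 := by exact_mod_cast h1
    interval_cases z <;> simp
  degree_two γ hγ := ⟨G.coeff_two γ hγ.1, fun h => h ▸ G.theta_i⟩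
  x_theta := G.crystalRel.sends_of_rel G.toWeightData hΦ t.xTheta.2 .top
  x_one γ hγ h := G.crystalRel.sends_of_rel G.toWeightData hΦ (Or.inl hγ) (.one γ hγ.1 h)
  exists_linking γ hγ h := by
    obtain ⟨j, α, hl⟩ := G.exists_linked hγ.2.1 h
    exact ⟨α, G.isLinkingSum_iff.2 ⟨j, hl⟩⟩
  x_zero γ hγ h α hα := by
    obtain ⟨j, hl⟩ := G.isLinkingSum_iff.1 hα
    rw [sub_sub]
    exact G.crystalRel.sends_of_rel G.toWeightData hΦ (Or.inl hγ)
      (.zero γ α j hγ.1 hγ.2.2 hγ.2.1 hl)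
  exists_path j _ := by
    obtain ⟨α, hp⟩ := G.exists_path j
    exact ⟨α, G.isPathSum_iff.2 hp⟩
  y j hj α hα := G.crystalRel.sends_of_rel G.toWeightData hΦ hj
    (.y j α hj.1 (G.isPathSum_iff.1 hα))
  negative := G.crystalRel.negativeFormula G.toWeightData hΦ

end GradedData

end AffineType


/-! ### The chain relation for types `A` and `C` -/

namespace AffineType

open Crystal

variable {t : AffineType}

theorem Integral.eq_one_or_two_le {γ : t.Weight} (h : Integral γ) (h0 : 0 ≤ γ) {k : Fin t.rank}
    (hk : γ k ≠ 0) : γ k = 1 ∨ 2 ≤ γ k := by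
  have h1 := h.one_le (lt_of_le_of_ne (h0 k) (Ne.symm hk))
  obtain ⟨z, hz⟩ := h k
  rw [hz] at h1 ⊢
  have h2 : 1 ≤ z := by exact_mod_cast h1
  rcases h2.eq_or_lt with h3 | h3
  · exact Or.inl (by rw [← h3]; norm_num)
  · exact Or.inr (by exact_mod_cast h3)

/-- The sum of the simple roots at the positions below the position of `m`. -/
def prefixRoot (t : AffineType) (pos : Fin t.rank → ℕ) (m : Fin t.rank) : t.Weight :=
  fun v => if pos v < pos m then 1 else 0

/-- The values of `Ψ` on vertices of nonnegative weight for diagrams that are chains starting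
at `i`. -/
inductive ChainRel (t : AffineType) (i : Fin t.rank) (pos : Fin t.rank → ℕ) :
    t.Label → t.Label → t.Label → Prop
  | first (γ : t.Weight) (h0 : 0 ≤ γ) (hi : γ i ≠ 0) : ChainRel t i pos (.x γ) (.x γ) (.y i)
  | other (γ : t.Weight) (m : Fin t.rank) (h0 : 0 ≤ γ) (hm : γ m ≠ 0)
      (hz : ∀ v, pos v < pos m → γ v = 0) (hmi : m ≠ i) :
      ChainRel t i pos (.x γ) (.x (γ + t.prefixRoot pos m)) (.x (-t.prefixRoot pos m))
  | y (j : Fin t.rank) (hji : j ≠ i) :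
      ChainRel t i pos (.y j) (.x (t.prefixRoot pos j)) (.x (-t.prefixRoot pos j))
  | y_first : ChainRel t i pos (.y i) (.y i) (.y i)

/-- Facts on which the description of `Ψ` for chains depends. -/
structure ChainData (t : AffineType) (i : Fin t.rank) (pos : Fin t.rank → ℕ) : Prop
    extends WeightData t where
  injective : Function.Injective pos
  pos_i : pos i = 0
  exists_pos : ∀ m d, d ≤ pos m → ∃ u, pos u = d
  isWeight_simpleRoot : ∀ j, t.IsWeight (t.simpleRoot j)
  joined_iff : ∀ j k, j ≠ k → (t.finCartan j k ≠ 0 ↔ pos j + 1 = pos k ∨ pos k + 1 = pos j)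
  simple_edge : ∀ j k m, pos j < pos m → pos k < pos m → pos j + 1 = pos k ∨ pos k + 1 = pos j →
    t.finCartan j k = -1
  remove : ∀ γ u, t.IsWeight γ → 0 ≤ γ → γ u ≠ 0 → (∀ v, pos v < pos u → γ v = 0) →
    γ ≠ t.simpleRoot u → t.IsWeight (γ - t.simpleRoot u)
  no_gap : ∀ γ u v w, t.IsWeight γ → pos u < pos v → pos v < pos w → γ u ≠ 0 → γ w ≠ 0 → γ v ≠ 0
  theta_i : t.theta i ≠ 0

namespace ChainData

variable {i : Fin t.rank} {pos : Fin t.rank → ℕ} (H : ChainData t i pos)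
include H

theorem pos_pos {m : Fin t.rank} (h : m ≠ i) : 0 < pos m := by
  refine Nat.pos_of_ne_zero fun h0 => h (H.injective ?_)
  rw [h0, H.pos_i]

theorem ne_i {m : Fin t.rank} (h : 0 < pos m) : m ≠ i := fun hm => by
  rw [hm, H.pos_i] at h
  exact lt_irrefl _ h

theorem eq_of_pos_zero {m : Fin t.rank} (h : pos m = 0) : m = i :=
  H.injective (h.trans H.pos_i.symm)

theorem exists_pred {m : Fin t.rank} (h : m ≠ i) : ∃ u, pos u + 1 = pos m := by
  obtain ⟨u, hu⟩ := H.exists_pos m (pos m - 1) (Nat.sub_le _ _)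
  have := H.pos_pos h
  exact ⟨u, by omega⟩

omit H in
theorem prefixRoot_nonneg (m : Fin t.rank) : 0 ≤ t.prefixRoot pos m := fun v => by
  simp only [prefixRoot, Pi.zero_apply]
  split_ifs <;> norm_num

omit H in
theorem prefixRoot_of_lt {v m : Fin t.rank} (h : pos v < pos m) : t.prefixRoot pos m v = 1 :=
  if_pos h

omit H in
theorem prefixRoot_of_le {v m : Fin t.rank} (h : pos m ≤ pos v) : t.prefixRoot pos m v = 0 :=
  if_neg (not_lt.2 h)

theorem prefixRoot_succ {m m' : Fin t.rank} (h : pos m + 1 = pos m') :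
    t.prefixRoot pos m' = t.prefixRoot pos m + t.simpleRoot m := by
  funext v
  by_cases hv : v = m
  · subst hv
    simp [prefixRoot, simpleRoot_self, show pos v < pos m' by omega]
  · have : pos v ≠ pos m := fun h => hv (H.injective h)
    simp [prefixRoot, simpleRoot_of_ne hv, show pos v < pos m' ↔ pos v < pos m by omega]

theorem prefixRoot_i : t.prefixRoot pos i = 0 := by
  funext v
  simp [prefixRoot, H.pos_i]

theorem prefixRoot_one {m : Fin t.rank} (h : pos m = 1) :
    t.prefixRoot pos m = t.simpleRoot i := by
  rw [H.prefixRoot_succ (m := i) (by rw [H.pos_i, h]), H.prefixRoot_i, zero_add]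

theorem prefixRoot_ne_zero {m : Fin t.rank} (h : m ≠ i) : t.prefixRoot pos m ≠ 0 := fun h0 => by
  have := congrFun h0 i
  rw [prefixRoot_of_lt (by rw [H.pos_i]; exact H.pos_pos h)] at this
  norm_num at this

/-- The prefix below `m` is the path from the predecessor `j` of `m` back to `i`, so the results on
linked paths apply to prefixes. -/
theorem pathTo {j m : Fin t.rank} (h : pos j + 1 = pos m) :
    PathTo t i j (t.prefixRoot pos m) := by
  induction hd : pos j generalizing j m with
  | zero =>
    have := H.eq_of_pos_zero hd
    subst this
    rw [H.prefixRoot_one (by omega)]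
    exact .nil
  | succ d ih =>
    obtain ⟨u, hu⟩ := H.exists_pred (H.ne_i (m := j) (by omega))
    have hne : j ≠ u := by rintro rfl; omega
    rw [H.prefixRoot_succ h, add_comm]
    exact .cons hne ((H.joined_iff _ _ hne).2 (Or.inr hu)) (ih hu (by omega))
      (prefixRoot_of_le le_rfl)

theorem isWeight_prefixRoot {m : Fin t.rank} (h : m ≠ i) : t.IsWeight (t.prefixRoot pos m) := by
  obtain ⟨u, hu⟩ := H.exists_pred h
  exact H.isWeight_path (H.isWeight_simpleRoot i) (H.pathTo hu)

section

variable {γ : t.Weight} {m k : Fin t.rank}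

theorem linked {j : Fin t.rank} (h : pos j + 1 = pos m) (hm : γ m ≠ 0)
    (hz : ∀ v, pos v < pos m → γ v = 0) : Linked t i j γ (t.prefixRoot pos m) where
  path := H.pathTo h
  disjoint v hv := by
    by_contra hcon
    refine hv (prefixRoot_of_le ?_)
    by_contra h
    exact hcon (hz v (not_le.1 h))
  joined := ⟨m, hm, (H.joined_iff _ _ (by rintro rfl; omega)).2 (Or.inl h)⟩

/-- A prefix is added as a linked path. To remove it, the simple roots are stripped from `i`
upwards; at every stage the one removed is the first of the support, as `remove` requires. -/
theorem isWeight_add_prefixRoot_iff (h0 : 0 ≤ γ) (hm : γ m ≠ 0)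
    (hz : ∀ v, pos v < pos m → γ v = 0) (hmi : m ≠ i) :
    t.IsWeight (γ + t.prefixRoot pos m) ↔ t.IsWeight γ := by
  constructor
  · intro hW
    have key : ∀ d u, pos u = d → d ≤ pos m →
        t.IsWeight (γ + t.prefixRoot pos m - t.prefixRoot pos u) := by
      intro d
      induction d with
      | zero =>
        intro u hu _
        rw [H.eq_of_pos_zero hu, H.prefixRoot_i, sub_zero]
        exact hW
      | succ d ih =>
        intro u hu hle
        obtain ⟨w, hw⟩ := H.exists_pred (H.ne_i (m := u) (by omega))
        rw [H.prefixRoot_succ hw, ← sub_sub]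
        have hval : ∀ v, (γ + t.prefixRoot pos m - t.prefixRoot pos w) v =
            γ v + if pos v < pos m ∧ ¬ pos v < pos w then 1 else 0 := fun v => by
          simp only [Pi.sub_apply, Pi.add_apply, prefixRoot]
          by_cases h1 : pos v < pos w
          · simp [h1, show pos v < pos m by omega]
          · simp [h1]
        refine H.remove _ w (ih w (by omega) (by omega)) (fun v => ?_) ?_ (fun v hv => ?_)
          fun h => ?_
        · rw [hval]
          have := h0 v
          split_ifs <;> simp only [Pi.zero_apply] at * <;> linarith
        · rw [hval, hz w (by omega), if_pos (by omega)]
          norm_num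
        · rw [hval, hz v (by omega), if_neg (by omega)]
          norm_num
        · have := congrFun h m
          rw [hval, if_neg (by omega), simpleRoot_of_ne (by rintro rfl; omega), add_zero] at this
          exact hm this
    have := key _ m rfl le_rfl
    rwa [add_sub_cancel_right] at this
  · intro hW
    obtain ⟨u, hu⟩ := H.exists_pred hmi
    exact H.isWeight_add_path hW h0 (H.linked hu hm hz)

omit H in
theorem pairing_congr {μ ν : t.Weight} (h : ∀ v, t.finCartan k v ≠ 0 → μ v = ν v) :
    t.pairing k μ = t.pairing k ν := by
  rw [pairing_eq, pairing_eq]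
  refine Finset.sum_congr rfl fun v _ => ?_
  by_cases hv : t.finCartan k v = 0
  · simp [hv]
  · rw [h v hv]

/-- Edges below `m` are simple, so a prefix with at least two vertices pairs like a chain of type
`A`: `2 - 1 = 1` at either end, and `2 - 1 - 1 = 0` in between. -/
theorem pairing_prefixRoot_i (h : 1 < pos m) : t.pairing i (t.prefixRoot pos m) = 1 := by
  obtain ⟨u, hu⟩ := H.exists_pos m 1 h.le
  have hiu : u ≠ i := H.ne_i (by omega)
  have hi := H.pos_i
  rw [pairing_congr (ν := t.simpleRoot i + t.simpleRoot u), pairing_add,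
    H.pairing_simpleRoot_self, pairing_simpleRoot,
    H.simple_edge i u m (by omega) (by omega) (by omega)]
  · norm_num
  · intro v hv
    by_cases hvi : v = i
    · subst hvi
      simp [simpleRoot_self, simpleRoot_of_ne hiu.symm, prefixRoot_of_lt (show pos v < pos m by omega)]
    · have := (H.joined_iff i v (Ne.symm hvi)).1 hv
      have hvu : v = u := H.injective (by omega)
      subst hvu
      simp [simpleRoot_self, simpleRoot_of_ne hvi, prefixRoot_of_lt (show pos v < pos m by omega)]

theorem pairing_prefixRoot_last (hki : k ≠ i) (h : pos k + 1 = pos m) :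
    t.pairing k (t.prefixRoot pos m) = 1 := by
  obtain ⟨u, hu⟩ := H.exists_pred hki
  have hku : u ≠ k := by rintro rfl; omega
  rw [pairing_congr (ν := t.simpleRoot k + t.simpleRoot u), pairing_add,
    H.pairing_simpleRoot_self, pairing_simpleRoot,
    H.simple_edge k u m (by omega) (by omega) (by omega)]
  · norm_num
  · intro v hv
    by_cases hvk : v = k
    · subst hvk
      simp [simpleRoot_self, simpleRoot_of_ne hku.symm, prefixRoot_of_lt (show pos v < pos m by omega)]
    · rcases (H.joined_iff k v (Ne.symm hvk)).1 hv with h1 | h1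
      · have hvm : v = m := H.injective (by omega)
        subst hvm
        rw [prefixRoot_of_le le_rfl]
        simp [simpleRoot_of_ne hvk, simpleRoot_of_ne (show v ≠ u by rintro rfl; omega)]
      · have hvu : v = u := H.injective (by omega)
        subst hvu
        simp [simpleRoot_self, simpleRoot_of_ne hvk, prefixRoot_of_lt (show pos v < pos m by omega)]

theorem pairing_prefixRoot_inner (hki : k ≠ i) (h : pos k + 1 < pos m) :
    t.pairing k (t.prefixRoot pos m) = 0 := by
  obtain ⟨w, hw⟩ := H.exists_pos m (pos k + 1) h.le
  have hwk : w ≠ k := by rintro rfl; omega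
  rw [pairing_congr (ν := t.prefixRoot pos w + t.simpleRoot w), pairing_add,
    H.pairing_prefixRoot_last hki hw.symm, pairing_simpleRoot,
    H.simple_edge k w m (by omega) (by omega) (by omega)]
  · norm_num
  · intro v hv
    by_cases hvw : v = w
    · subst hvw
      simp [simpleRoot_self, prefixRoot_of_le, prefixRoot_of_lt (show pos v < pos m by omega)]
    · have hlt : pos v < pos w := by
        by_cases hvk : v = k
        · subst hvk; omega
        · have h1 : pos v ≠ pos w := fun h => hvw (H.injective h)
          have := (H.joined_iff k v (Ne.symm hvk)).1 hv
          omega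
      simp [simpleRoot_of_ne hvw, prefixRoot_of_lt hlt,
        prefixRoot_of_lt (show pos v < pos m by omega)]

theorem phi_prefixRoot_inner {c : t.vertices} (hki : k ≠ i) (h : pos k + 1 < pos m)
    (hc : (c : t.Label) = .x (t.prefixRoot pos m)) : t.thetaCrystal.phi k c = 0 := by
  refine H.phi_zero hc fun hW => ?_
  have hi := H.pos_i
  have hk := H.pos_pos hki
  obtain ⟨w, hw⟩ := H.exists_pos m (pos k + 1) h.le
  refine H.no_gap _ i k w hW (by omega) (by omega) ?_ ?_ ?_
  · rw [Pi.sub_apply, prefixRoot_of_lt (by omega), simpleRoot_of_ne (Ne.symm hki)]; norm_num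
  · rw [Pi.sub_apply, prefixRoot_of_lt (by omega), simpleRoot_of_ne (by rintro rfl; omega)]
    norm_num
  · rw [Pi.sub_apply, prefixRoot_of_lt (by omega), simpleRoot_self]; norm_num

theorem phi_prefixRoot_of_le {c : t.vertices} (hmi : m ≠ i) (h : pos m ≤ pos k)
    (hc : (c : t.Label) = .x (t.prefixRoot pos m)) : t.thetaCrystal.phi k c = 0 :=
  H.phi_zero hc (H.not_isWeight_sub (prefixRoot_nonneg m) (H.prefixRoot_ne_zero hmi)
    (prefixRoot_of_le h))

omit H in
theorem eps_of_phi {W : WeightData t} {c : t.vertices} {μ : t.Weight} {a : ℕ}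
    (hc : (c : t.Label) = .x μ) (hphi : t.thetaCrystal.phi k c = a)
    (hp : t.pairing k μ = a) : t.thetaCrystal.eps k c = 0 := by
  have := W.phi_sub_eps_x (j := k) hc
  rw [hp, hphi] at this
  have : (t.thetaCrystal.eps k c : ℚ) = 0 := by linarith
  exact_mod_cast this

omit H in
theorem ne_simpleRoot {μ : t.Weight} {u : Fin t.rank} (hu : u ≠ k) (h : μ u ≠ 0) :
    μ ≠ t.simpleRoot k := by
  rintro rfl
  exact h (simpleRoot_of_ne hu)

theorem phi_prefixRoot_last {c : t.vertices} (hki : k ≠ i) (h : pos k + 1 = pos m)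
    (hc : (c : t.Label) = .x (t.prefixRoot pos m)) : t.thetaCrystal.phi k c = 1 := by
  have h1 : t.prefixRoot pos m - t.simpleRoot k = t.prefixRoot pos k := by
    rw [H.prefixRoot_succ h, add_sub_cancel_right]
  have h2 := H.phi_pos hc (by rw [h1]; exact H.isWeight_prefixRoot hki)
  have h3 := H.phi_le_one hc (j := k) (by
    rw [Ne, ← sub_eq_zero, h1]
    exact H.prefixRoot_ne_zero hki) (by
    rw [h1]
    exact H.not_isWeight_sub (prefixRoot_nonneg k) (H.prefixRoot_ne_zero hki)
      (prefixRoot_of_le le_rfl))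
  omega

section Steps

variable {b c₁ c₂ : t.vertices}

omit H in
theorem chainRel_other {d e : t.vertices} {μ : t.Weight} (hb : (b : t.Label) = .x μ)
    (h0 : 0 ≤ μ) (hm : μ m ≠ 0) (hz : ∀ v, pos v < pos m → μ v = 0) (hmi : m ≠ i)
    (hd : (d : t.Label) = .x (μ + t.prefixRoot pos m))
    (he : (e : t.Label) = .x (-t.prefixRoot pos m)) : ChainRel t i pos b d e := by
  rw [hb, hd, he]
  exact .other μ m h0 hm hz hmi

omit H in
theorem add_apply_ne_zero (h0 : 0 ≤ γ) (hm : γ m ≠ 0) : (γ + t.simpleRoot k) m ≠ 0 := by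
  have h1 := lt_of_le_of_ne (h0 m) (Ne.symm hm)
  have h2 := simpleRoot_nonneg (t := t) k m
  simp only [Pi.zero_apply, Pi.add_apply] at *
  positivity

omit H in
theorem ne_neg_simpleRoot {μ : t.Weight} (h0 : 0 ≤ μ) : μ ≠ -t.simpleRoot k := fun h => by
  have := h0 k
  rw [h, Pi.neg_apply, simpleRoot_self] at this
  norm_num at this

/-- The colour and its successor both lie below the support of `γ`, so `b` is killed: adding `α_k`
would leave a gap and subtracting it would mix signs. In the tensor product `φ_k(c₁) = ε_k(c₂)`,
both `1` at `k = i` and `0` elsewhere, while `ε_k(c₁) = φ_k(c₂) = 0`. -/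
theorem step_inner (h0 : 0 ≤ γ) (hm : γ m ≠ 0) (hz : ∀ v, pos v < pos m → γ v = 0)
    (hk : pos k + 1 < pos m) (hb : (b : t.Label) = .x γ)
    (h1 : (c₁ : t.Label) = .x (γ + t.prefixRoot pos m))
    (h2 : (c₂ : t.Label) = .x (-t.prefixRoot pos m)) :
    StepRel (ChainRel t i pos) k b (c₁, c₂) := by
  have hne := H.ne_zero_of_eq hb
  have hmi : m ≠ i := H.ne_i (by omega)
  have hi := H.pos_i
  have hγk : γ k = 0 := hz k (by omega)
  obtain ⟨w, hw⟩ := H.exists_pos m (pos k + 1) hk.le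
  have hwk : w ≠ k := by rintro rfl; omega
  have hmk : m ≠ k := by rintro rfl; omega
  have hpγ : t.pairing k γ = 0 := by
    refine H.pairing_eq_zero_of_not_joined fun v hv => ?_
    by_contra ha
    have hvk : v ≠ k := by rintro rfl; exact hv hγk
    refine hv (hz v ?_)
    have := (H.joined_iff v k hvk).1 ha
    omega
  have heb : t.thetaCrystal.e k b = none := by
    refine H.e_none hb fun h => H.no_gap _ k w m h (by omega) (by omega) ?_ ?_ ?_
    · simp [hγk, simpleRoot_self]
    · exact add_apply_ne_zero h0 hm
    · simp [hz w (by omega), simpleRoot_of_ne hwk]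
  have hfb := H.f_none hb (H.not_isWeight_sub h0 hne hγk)
  have h2' : (dualVertex c₂ : t.Label) = .x (t.prefixRoot pos m) := by
    rw [dualVertex_x h2, neg_neg]
  have hε2 := phi_dualVertex k c₂
  have hφ2 := eps_dualVertex k c₂
  have hf2 : t.thetaCrystal.phi k c₂ = 0 → t.thetaCrystal.f k c₂ = none :=
    H.regular.eq_none_of_phi
  by_cases hki : k = i
  · subst hki
    have hpair := H.pairing_prefixRoot_i (show 1 < pos m by omega)
    have hrem : t.IsWeight (t.prefixRoot pos m - t.simpleRoot k) :=
      H.remove _ _ (H.isWeight_prefixRoot hmi) (prefixRoot_nonneg m)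
        (by rw [prefixRoot_of_lt (by omega)]; norm_num) (fun v hv => by omega)
        (ne_simpleRoot hwk (by rw [prefixRoot_of_lt (by omega)]; norm_num))
    have hmix : ∀ μ : t.Weight, μ k = 1 → 0 < μ w → ¬ t.IsWeight (μ - t.simpleRoot k -
        t.simpleRoot k) := fun μ hμ hμw => H.not_isWeight_of_mixed (j := w) (k := k)
      (by simpa [simpleRoot_of_ne hwk] using hμw)
      (by simp only [Pi.sub_apply, hμ, simpleRoot_self]; norm_num)
    have hφd : t.thetaCrystal.phi k (dualVertex c₂) = 1 := by
      have h3 := H.phi_pos h2' hrem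
      have h4 := H.phi_le_one h2' (j := k)
        (ne_simpleRoot hwk (by rw [prefixRoot_of_lt (by omega)]; norm_num))
        (hmix _ (prefixRoot_of_lt (by omega)) (by rw [prefixRoot_of_lt (by omega)]; norm_num))
      omega
    have hεd := eps_of_phi (W := H.toWeightData) h2' hφd (by rw [hpair]; norm_num)
    have hγw : (γ + t.prefixRoot pos m) w = 1 := by
      rw [Pi.add_apply, hz w (by omega), prefixRoot_of_lt (by omega), zero_add]
    have hγk1 : (γ + t.prefixRoot pos m) k = 1 := by
      rw [Pi.add_apply, hγk, prefixRoot_of_lt (by omega), zero_add]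
    have hφ1 : t.thetaCrystal.phi k c₁ = 1 := by
      have h3 := H.phi_pos h1 (H.remove _ k (H.isWeight_of_eq h1)
        (add_nonneg h0 (prefixRoot_nonneg m)) (by rw [hγk1]; norm_num) (fun v hv => by omega)
        (ne_simpleRoot hwk (by rw [hγw]; norm_num)))
      have h4 := H.phi_le_one h1 (j := k) (ne_simpleRoot hwk (by rw [hγw]; norm_num))
        (hmix _ hγk1 (by rw [hγw]; norm_num))
      omega
    have hε1 := eps_of_phi (W := H.toWeightData) h1 hφ1 (by
      rw [pairing_add, hpγ, hpair]; norm_num)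
    exact ⟨rel_none hfb (by rw [tensor_f_right (by omega) (hf2 (by omega))]; rfl),
      rel_none heb (by
        rw [tensor_e_left (by omega) (H.regular.eq_none_of_eps hε1)]; rfl)⟩
  · have hpair := H.pairing_prefixRoot_inner hki hk
    have hφd := H.phi_prefixRoot_inner hki hk h2'
    have hεd := eps_of_phi (W := H.toWeightData) h2' hφd (by rw [hpair]; norm_num)
    have hk0 := H.pos_pos hki
    have hφ1 : t.thetaCrystal.phi k c₁ = 0 := by
      refine H.phi_zero h1 fun h => H.no_gap _ i k w h (by omega) (by omega) ?_ ?_ ?_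
      · simp [hz i (by omega), prefixRoot_of_lt (show pos i < pos m by omega),
          simpleRoot_of_ne (Ne.symm hki)]
      · simp [hz w (by omega), prefixRoot_of_lt (show pos w < pos m by omega),
          simpleRoot_of_ne hwk]
      · simp [hγk, prefixRoot_of_lt (show pos k < pos m by omega), simpleRoot_self]
    have hε1 := eps_of_phi (W := H.toWeightData) h1 hφ1 (by
      rw [pairing_add, hpγ, hpair]; norm_num)
    exact ⟨rel_none hfb (by rw [tensor_f_right (by omega) (hf2 (by omega))]; rfl),
      rel_none heb (by
        rw [tensor_e_left (by omega) (H.regular.eq_none_of_eps hε1)]; rfl)⟩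

/-- Raising by the predecessor of `m` moves the start of the support down by one, and `α_k` passes
from the prefix to `γ`: the sum `γ + prefix` is unchanged, so the right factor must move. For `k =
i` it is `x_{-α_i}` with `ε_i = 2`, and it is raised to `y_i`. -/
theorem step_last (h0 : 0 ≤ γ) (hm : γ m ≠ 0) (hz : ∀ v, pos v < pos m → γ v = 0)
    (hk : pos k + 1 = pos m) (hb : (b : t.Label) = .x γ)
    (h1 : (c₁ : t.Label) = .x (γ + t.prefixRoot pos m))
    (h2 : (c₂ : t.Label) = .x (-t.prefixRoot pos m)) :
    StepRel (ChainRel t i pos) k b (c₁, c₂) := by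
  have hW := H.isWeight_of_eq hb
  have hne := H.ne_zero_of_eq hb
  have hi := H.pos_i
  have hγk : γ k = 0 := hz k (by omega)
  have hmk : m ≠ k := by rintro rfl; omega
  have hfb := H.f_none hb (H.not_isWeight_sub h0 hne hγk)
  have h2' : (dualVertex c₂ : t.Label) = .x (t.prefixRoot pos m) := by
    rw [dualVertex_x h2, neg_neg]
  have hε2 := phi_dualVertex k c₂
  have hφ2 := eps_dualVertex k c₂
  have hf2 : t.thetaCrystal.phi k c₂ = 0 → t.thetaCrystal.f k c₂ = none :=
    H.regular.eq_none_of_phi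
  obtain ⟨b', hb', hbl⟩ := H.e_add (j := k) hb (ne_neg_simpleRoot h0)
    (H.isWeight_add_simpleRoot hW h0 hγk hm ((H.joined_iff k m hmk.symm).2 (Or.inl hk)))
  have hb0 : 0 ≤ γ + t.simpleRoot k := add_nonneg h0 (simpleRoot_nonneg k)
  by_cases hki : k = i
  · subst hki
    have hpre := H.prefixRoot_one (m := m) (by omega)
    rw [hpre] at h1 h2 h2'
    have hε := H.eps_neg_simple h2
    have hφ1 : t.thetaCrystal.phi k c₁ ≤ 1 := by
      refine H.phi_le_one h1 (by rw [Ne, add_eq_right]; exact hne) ?_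
      rw [add_sub_cancel_right]
      exact H.not_isWeight_sub h0 hne hγk
    obtain ⟨d, hd1, hd2⟩ := H.e_simple h2
    refine ⟨rel_none hfb (by
      rw [tensor_f_right (by omega) (hf2 (H.phi_neg_simple h2))]; rfl),
      rel_some hb' (by rw [tensor_e_right (by omega) hd1]; rfl) ?_⟩
    rw [hbl, h1, hd2]
    exact .first _ hb0 (by simp [hγk, simpleRoot_self])
  · have hsucc := H.prefixRoot_succ hk
    have hφd := H.phi_prefixRoot_last hki hk h2'
    have hεd := eps_of_phi (W := H.toWeightData) h2' hφd (by
      rw [H.pairing_prefixRoot_last hki hk]; norm_num)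
    have hk0 := H.pos_pos hki
    have hφ1 : t.thetaCrystal.phi k c₁ = 0 := by
      refine H.phi_zero h1 fun h => H.no_gap _ i k m h (by omega) (by omega) ?_ ?_ ?_
      · simp [hz i (by omega), prefixRoot_of_lt (show pos i < pos m by omega),
          simpleRoot_of_ne (Ne.symm hki)]
      · simp [prefixRoot_of_le, simpleRoot_of_ne hmk, hm]
      · simp [hγk, prefixRoot_of_lt (show pos k < pos m by omega), simpleRoot_self]
    obtain ⟨d, hd1, hd2⟩ := H.e_add h2 (j := k) (by
      rw [Ne, neg_inj, hsucc, add_eq_right]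
      exact H.prefixRoot_ne_zero hki) (by
      rw [hsucc, neg_add, neg_add_cancel_right]
      exact H.neg _ (H.isWeight_prefixRoot hki))
    refine ⟨rel_none hfb (by
      rw [tensor_f_right (by omega) (hf2 (by omega))]; rfl),
      rel_some hb' (by rw [tensor_e_right (by omega) hd1]; rfl) ?_⟩
    refine chainRel_other hbl hb0 (m := k) ?_ (fun v hv => ?_) hki ?_ ?_
    · simp [hγk, simpleRoot_self]
    · simp [hz v (by omega), simpleRoot_of_ne (show v ≠ k by rintro rfl; omega)]
    · rw [h1, hsucc]; congr 1; abel
    · rw [hd2, hsucc]; congr 1; abel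

/-- The prefix ends before `k`, so `ε_k(c₂) = 0` and `e_k` always acts on the left, where it acts as
on `γ`. -/
theorem e_rel_of_le (h0 : 0 ≤ γ) (hm : γ m ≠ 0) (hz : ∀ v, pos v < pos m → γ v = 0)
    (hmi : m ≠ i) (hk : pos m ≤ pos k) (hb : (b : t.Label) = .x γ)
    (h1 : (c₁ : t.Label) = .x (γ + t.prefixRoot pos m))
    (h2 : (c₂ : t.Label) = .x (-t.prefixRoot pos m)) :
    Option.Rel (FullRel (ChainRel t i pos)) (t.thetaCrystal.e k b)
      ((t.thetaCrystal.tensor t.thetaCrystal).e k (c₁, c₂)) := by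
  have h2' : (dualVertex c₂ : t.Label) = .x (t.prefixRoot pos m) := by
    rw [dualVertex_x h2, neg_neg]
  have hε2 := phi_dualVertex k c₂
  rw [H.phi_prefixRoot_of_le hmi hk h2'] at hε2
  have h0' : 0 ≤ γ + t.simpleRoot k := add_nonneg h0 (simpleRoot_nonneg k)
  have hm' : (γ + t.simpleRoot k) m ≠ 0 := add_apply_ne_zero h0 hm
  have hz' : ∀ v, pos v < pos m → (γ + t.simpleRoot k) v = 0 := fun v hv => by
    simp [hz v hv, simpleRoot_of_ne (show v ≠ k by rintro rfl; omega)]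
  have hiff := H.isWeight_add_prefixRoot_iff h0' hm' hz' hmi
  rw [tensor_e_left (by omega) rfl]
  by_cases hW : t.IsWeight (γ + t.simpleRoot k)
  · obtain ⟨b', hb', hbl⟩ := H.e_add hb (ne_neg_simpleRoot h0) hW
    obtain ⟨d, hd1, hd2⟩ := H.e_add h1 (j := k)
      (ne_neg_simpleRoot (add_nonneg h0 (prefixRoot_nonneg m)))
      (by rw [add_right_comm]; exact hiff.2 hW)
    refine rel_some hb' (by rw [hd1]; rfl) ?_
    exact chainRel_other hbl h0' hm' hz' hmi (by rw [hd2, add_right_comm]) h2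
  · refine rel_none (H.e_none hb hW) ?_
    rw [H.e_none h1 (by rw [add_right_comm]; exact fun h => hW (hiff.1 h))]
    rfl

/-- Removing `α_k` while the first position stays in the support. -/
theorem f_rel_of_ne_zero (h0 : 0 ≤ γ) (hz : ∀ v, pos v < pos m → γ v = 0)
    (hm : (γ - t.simpleRoot k) m ≠ 0) (hγm : γ m ≠ 0)
    (hmi : m ≠ i) (hk : pos m ≤ pos k) (hb : (b : t.Label) = .x γ)
    (h1 : (c₁ : t.Label) = .x (γ + t.prefixRoot pos m))
    (h2 : (c₂ : t.Label) = .x (-t.prefixRoot pos m))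
    (hmk : m = k → 2 ≤ γ m) :
    Option.Rel (FullRel (ChainRel t i pos)) (t.thetaCrystal.f k b)
      ((t.thetaCrystal.tensor t.thetaCrystal).f k (c₁, c₂)) := by
  have h2' : (dualVertex c₂ : t.Label) = .x (t.prefixRoot pos m) := by
    rw [dualVertex_x h2, neg_neg]
  have hε2 := phi_dualVertex k c₂
  rw [H.phi_prefixRoot_of_le hmi hk h2'] at hε2
  have hmpos : 0 < (γ - t.simpleRoot k) m := by
    by_cases h : m = k
    · have := hmk h
      subst h
      simp only [Pi.sub_apply, simpleRoot_self]
      linarith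
    · simp only [Pi.sub_apply, simpleRoot_of_ne h, sub_zero]
      exact lt_of_le_of_ne (h0 m) (Ne.symm hγm)
  have hi := H.pos_i
  have hm0 := H.pos_pos hmi
  have hz' : ∀ v, pos v < pos m → (γ - t.simpleRoot k) v = 0 := fun v hv => by
    simp [hz v hv, simpleRoot_of_ne (show v ≠ k by rintro rfl; omega)]
  have hnn : t.IsWeight (γ - t.simpleRoot k + t.prefixRoot pos m) →
      0 ≤ γ - t.simpleRoot k := fun hW v => by
    by_cases hv : pos v < pos m
    · rw [hz' v hv]; exact le_rfl
    · have := H.nonneg_of_pos hW (j := m) (by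
        rw [Pi.add_apply, prefixRoot_of_le le_rfl, add_zero]; exact hmpos) v
      rwa [Pi.add_apply, prefixRoot_of_le (not_lt.1 hv), add_zero] at this
  have hne : γ ≠ t.simpleRoot k := fun h => hm (by rw [h, sub_self]; rfl)
  by_cases hW : t.IsWeight (γ - t.simpleRoot k)
  · have h0' := H.nonneg_of_pos hW hmpos
    have hW' := (H.isWeight_add_prefixRoot_iff h0' hm hz' hmi).2 hW
    obtain ⟨b', hb', hbl⟩ := H.f_sub hb hne hW
    obtain ⟨d, hd1, hd2⟩ := H.f_sub h1 (j := k) (fun h => by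
      have h3 := congrFun h i
      rw [Pi.add_apply, hz i (by omega), prefixRoot_of_lt (by omega),
        simpleRoot_of_ne (by rintro rfl; omega)] at h3
      norm_num at h3) (by rwa [add_sub_right_comm])
    have hφ := H.regular.phi_eq hd1
    refine rel_some hb' (by rw [tensor_f_left (by omega) hd1]; rfl) ?_
    exact chainRel_other hbl h0' hm hz' hmi (by rw [hd2, add_sub_right_comm]) h2
  · have hf1 : t.thetaCrystal.f k c₁ = none := by
      refine H.f_none h1 fun h => hW ?_
      rw [add_sub_right_comm] at h
      exact (H.isWeight_add_prefixRoot_iff (hnn h) hm hz' hmi).1 h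
    -- When `γ - α_k` is not a weight, `k` is not the start of the support, by `remove`. For `k`
    -- beyond `m`, lowering the right factor would leave a gap at `m`.
    have hmk' : m ≠ k := by
      rintro rfl
      exact hW (H.remove _ _ (H.isWeight_of_eq hb) h0 hγm hz hne)
    have hlt : pos m < pos k := lt_of_le_of_ne hk fun h => hmk' (H.injective h)
    have hφ2 : t.thetaCrystal.f k c₂ = none := by
      refine H.f_none h2 fun h => H.no_gap _ i m k h (by omega) hlt ?_ ?_ ?_
      · simp [prefixRoot_of_lt (show pos i < pos m by omega),
          simpleRoot_of_ne (show i ≠ k by rintro rfl; omega)]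
      · simp [prefixRoot_of_le hlt.le, simpleRoot_self]
      · simp [prefixRoot_of_le, simpleRoot_of_ne hmk']
    refine rel_none (H.f_none hb hW) ?_
    rw [tensor_f_right (by rw [phi_eq_zero hf1]; omega) hφ2]; rfl

/-- The arrow of colour `m` at a vertex whose support starts at `m`. -/
theorem f_rel_start (h0 : 0 ≤ γ) (hm : γ m ≠ 0) (hz : ∀ v, pos v < pos m → γ v = 0)
    (hmi : m ≠ i) (hb : (b : t.Label) = .x γ)
    (h1 : (c₁ : t.Label) = .x (γ + t.prefixRoot pos m))
    (h2 : (c₂ : t.Label) = .x (-t.prefixRoot pos m)) :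
    Option.Rel (FullRel (ChainRel t i pos)) (t.thetaCrystal.f m b)
      ((t.thetaCrystal.tensor t.thetaCrystal).f m (c₁, c₂)) := by
  have hW := H.isWeight_of_eq hb
  have h2' : (dualVertex c₂ : t.Label) = .x (t.prefixRoot pos m) := by
    rw [dualVertex_x h2, neg_neg]
  have hε2 := phi_dualVertex m c₂
  rw [H.phi_prefixRoot_of_le hmi le_rfl h2'] at hε2
  have hi := H.pos_i
  have hm0 := H.pos_pos hmi
  rcases (H.integral γ hW).eq_one_or_two_le h0 hm with h | h
  swap
  · exact H.f_rel_of_ne_zero h0 hz (by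
      rw [Pi.sub_apply, simpleRoot_self]; intro h'; linarith) hm hmi le_rfl hb h1 h2 fun _ => h
  by_cases hs : γ = t.simpleRoot m
  · subst hs
    obtain ⟨b', hb', hbl⟩ := H.f_simple hb
    obtain ⟨d, hd1, hd2⟩ := H.f_sub h1 (j := m) (by
      rw [Ne, add_eq_left]; exact H.prefixRoot_ne_zero hmi) (by
      rw [add_sub_cancel_left]; exact H.isWeight_prefixRoot hmi)
    rw [add_sub_cancel_left] at hd2
    have hφ := H.regular.phi_eq hd1
    refine rel_some hb' (by rw [tensor_f_left (by omega) hd1]; rfl) ?_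
    rw [hbl, hd2, h2]
    exact .y m hmi
  -- The coefficient at `m` is `1` and `γ` continues beyond `m`, so the support of `γ - α_m` starts
  -- at the successor `u`. The left factor cannot lose `α_m` without a gap between `i` and `u`; the
  -- right factor takes it into its prefix.
  · have hW' := H.remove γ m hW h0 hm hz hs
    obtain ⟨b', hb', hbl⟩ := H.f_sub hb hs hW'
    have hsub : (γ - t.simpleRoot m) m = 0 := by
      rw [Pi.sub_apply, simpleRoot_self, h, sub_self]
    obtain ⟨w, hw⟩ := Function.ne_iff.1 (sub_ne_zero.2 hs)
    rw [Pi.zero_apply] at hw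
    have hwm : w ≠ m := by rintro rfl; exact hw hsub
    have hγw : γ w ≠ 0 := by simpa [simpleRoot_of_ne hwm] using hw
    have hlt : pos m < pos w := by
      refine lt_of_le_of_ne ?_ fun h => hwm (H.injective h.symm)
      by_contra h
      exact hγw (hz w (not_le.1 h))
    obtain ⟨u, hu⟩ := H.exists_pos w (pos m + 1) hlt
    have hum : u ≠ m := by rintro rfl; omega
    have hui : u ≠ i := H.ne_i (by omega)
    have hγu : γ u ≠ 0 := by
      by_cases huw : u = w
      · rwa [huw]
      · have : pos u ≠ pos w := fun h => huw (H.injective h)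
        exact H.no_gap γ m u w hW (by omega) (by omega) hm hγw
    have hsucc := H.prefixRoot_succ hu.symm
    have hφ1 : t.thetaCrystal.phi m c₁ = 0 := by
      refine H.phi_zero h1 fun h' => H.no_gap _ i m u h' (by omega) (by omega) ?_ ?_ ?_
      · simp [hz i (by omega), prefixRoot_of_lt (show pos i < pos m by omega),
          simpleRoot_of_ne (Ne.symm hmi)]
      · simpa [prefixRoot_of_le (show pos m ≤ pos u by omega), simpleRoot_of_ne hum] using hγu
      · simp [h, prefixRoot_of_le, simpleRoot_self]
    obtain ⟨d, hd1, hd2⟩ := H.f_sub h2 (j := m) (fun h' => by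
      have h3 := congrFun h' m
      rw [Pi.neg_apply, prefixRoot_of_le le_rfl, simpleRoot_self] at h3
      norm_num at h3) (by
      rw [← neg_add', ← hsucc]; exact H.neg _ (H.isWeight_prefixRoot hui))
    refine rel_some hb' (by rw [tensor_f_right (by omega) hd1]; rfl) ?_
    refine chainRel_other (m := u) hbl (fun v => ?_) ?_ (fun v hv => ?_) hui ?_ ?_
    · by_cases hv : v = m
      · rw [hv, hsub]; exact le_rfl
      · simpa [simpleRoot_of_ne hv] using h0 v
    · simpa [simpleRoot_of_ne hum] using hγu
    · by_cases hvm : v = m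
      · rw [hvm, hsub]
      · have : pos v ≠ pos m := fun h => hvm (H.injective h)
        simp [hz v (by omega), simpleRoot_of_ne hvm]
    · rw [h1, hsucc]; congr 1; abel
    · rw [hd2, hsucc]; congr 1; abel

theorem step_other (h0 : 0 ≤ γ) (hm : γ m ≠ 0) (hz : ∀ v, pos v < pos m → γ v = 0)
    (hmi : m ≠ i) (hb : (b : t.Label) = .x γ)
    (h1 : (c₁ : t.Label) = .x (γ + t.prefixRoot pos m))
    (h2 : (c₂ : t.Label) = .x (-t.prefixRoot pos m)) :
    StepRel (ChainRel t i pos) k b (c₁, c₂) := by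
  rcases lt_trichotomy (pos k) (pos m) with h | h | h
  · rcases Nat.lt_or_ge (pos k + 1) (pos m) with h' | h'
    · exact H.step_inner h0 hm hz h' hb h1 h2
    · exact H.step_last h0 hm hz (by omega) hb h1 h2
  · have := H.injective h
    subst this
    exact ⟨H.f_rel_start h0 hm hz hmi hb h1 h2, H.e_rel_of_le h0 hm hz hmi le_rfl hb h1 h2⟩
  · have hmk : m ≠ k := by rintro rfl; omega
    exact ⟨H.f_rel_of_ne_zero h0 hz (by simpa [simpleRoot_of_ne hmk] using hm) hm hmi h.le
      hb h1 h2 fun h => absurd h hmk, H.e_rel_of_le h0 hm hz hmi h.le hb h1 h2⟩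

/-- As in the graded case the factors are dual, and only `e_k` on the left factor matters. For `k ≠
j` it vanishes: beyond `j` it would leave a gap at `j`, and on the prefix itself `φ_k(c₁)` already
equals the pairing, apart from the prefix `α_i`. -/
theorem step_y {j : Fin t.rank} (hji : j ≠ i) (hb : (b : t.Label) = .y j)
    (h1 : (c₁ : t.Label) = .x (t.prefixRoot pos j))
    (h2 : (c₂ : t.Label) = .x (-t.prefixRoot pos j)) :
    StepRel (ChainRel t i pos) k b (c₁, c₂) := by
  have hd : c₂ = dualVertex c₁ := Subtype.ext (by rw [dualVertex_x h1, h2])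
  refine stepRel_of_dual (dualVertex_of_y hb) (by
    rw [hd, dualPair, dualVertex_dualVertex]) ?_
  have hle : t.thetaCrystal.eps k c₂ = t.thetaCrystal.phi k c₁ := by rw [hd, eps_dualVertex]
  rw [tensor_e_left hle.le rfl]
  have hi := H.pos_i
  by_cases hjk : j = k
  · subst hjk
    obtain ⟨u, hu⟩ := H.exists_pred hji
    obtain ⟨b', hb', hbl⟩ := H.e_y_self hb
    obtain ⟨d, hd1, hd2⟩ := H.e_add h1 (j := j) (ne_neg_simpleRoot (prefixRoot_nonneg j))
      (H.isWeight_add_simpleRoot (k := u) (H.isWeight_prefixRoot hji) (prefixRoot_nonneg j)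
        (prefixRoot_of_le le_rfl) (by rw [prefixRoot_of_lt (by omega)]; norm_num)
        ((H.joined_iff _ _ (by rintro rfl; omega)).2 (Or.inr hu)))
    refine rel_some hb' (by rw [hd1]; rfl) ?_
    refine chainRel_other hbl (simpleRoot_nonneg j) (by rw [simpleRoot_self]; norm_num)
      (fun v hv => simpleRoot_of_ne (by rintro rfl; omega)) hji ?_ h2
    rw [hd2, add_comm]
  · refine rel_none (WeightData.e_y_ne hb hjk) ?_
    suffices h : t.thetaCrystal.e k c₁ = none by rw [h]; rfl
    have hpos : pos j ≠ pos k := fun h => hjk (H.injective h)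
    rcases lt_or_gt_of_ne hpos with h | h
    · refine H.e_none h1 fun hW => H.no_gap _ i j k hW (by have := H.pos_pos hji; omega) h
        ?_ ?_ ?_
      · simp [prefixRoot_of_lt (show pos i < pos j by have := H.pos_pos hji; omega),
          simpleRoot_of_ne (show i ≠ k by rintro rfl; omega)]
      · simp [prefixRoot_of_le h.le, simpleRoot_self]
      · simp [prefixRoot_of_le, simpleRoot_of_ne hjk]
    · by_cases hki : k = i
      · subst hki
        rcases Nat.lt_or_ge 1 (pos j) with h' | h'
        · obtain ⟨w, hw⟩ := H.exists_pos j 1 h'.le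
          have hwk : w ≠ k := by rintro rfl; omega
          have h3 := H.phi_pos h1 (j := k) (H.remove _ _ (H.isWeight_of_eq h1)
            (prefixRoot_nonneg j) (by rw [prefixRoot_of_lt h]; norm_num) (fun v hv => by omega)
            (ne_simpleRoot hwk (by rw [prefixRoot_of_lt (by omega)]; norm_num)))
          have h4 := H.phi_le_one h1 (j := k)
            (ne_simpleRoot hwk (by rw [prefixRoot_of_lt (by omega)]; norm_num))
            (H.not_isWeight_of_mixed (j := w) (k := k)
              (by simp [simpleRoot_of_ne hwk, prefixRoot_of_lt (show pos w < pos j by omega)])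
              (by simp [simpleRoot_self, prefixRoot_of_lt h]))
          exact H.regular.eq_none_of_eps (eps_of_phi (W := H.toWeightData) (a := 1) h1
            (by omega) (by rw [H.pairing_prefixRoot_i h']; norm_num))
        · rw [H.prefixRoot_one (by omega)] at h1
          exact H.e_none h1 H.not_isWeight_simple_add
      · rcases Nat.lt_or_ge (pos k + 1) (pos j) with h' | h'
        · exact H.regular.eq_none_of_eps (eps_of_phi (W := H.toWeightData) h1
            (H.phi_prefixRoot_inner hki h' h1) (by
              rw [H.pairing_prefixRoot_inner hki h']; norm_num))
        · have h'' : pos k + 1 = pos j := by omega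
          exact H.regular.eq_none_of_eps (eps_of_phi (W := H.toWeightData) h1
            (H.phi_prefixRoot_last hki h'' h1) (by
              rw [H.pairing_prefixRoot_last hki h'']; norm_num))

theorem step_y_first (hb : (b : t.Label) = .y i) (h1 : (c₁ : t.Label) = .y i)
    (h2 : (c₂ : t.Label) = .y i) : StepRel (ChainRel t i pos) k b (c₁, c₂) := by
  refine stepRel_of_dual (dualVertex_of_y hb) (by
    rw [dualPair, dualVertex_of_y h1, dualVertex_of_y h2, Subtype.ext (h1.trans h2.symm)]) ?_
  by_cases hki : k = i
  · subst hki
    obtain ⟨b', hb', hbl⟩ := H.e_y_self hb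
    obtain ⟨d, hd1, hd2⟩ := H.e_y_self h1
    refine rel_some hb' (by
      rw [tensor_e_left (by rw [H.phi_y h1, H.eps_y h2]) hd1]; rfl) ?_
    rw [hbl, hd2, h2]
    exact .first _ (simpleRoot_nonneg k) (by rw [simpleRoot_self]; norm_num)
  · refine rel_none (WeightData.e_y_ne hb (Ne.symm hki)) ?_
    rw [tensor_e_left (by rw [WeightData.eps_y_ne h2 (Ne.symm hki)]; omega)
      (WeightData.e_y_ne h1 (Ne.symm hki))]
    rfl

/-- Since `ε_k(y_i)` is `1` for `k = i` and `0` otherwise, while `φ_i(x_γ) ≥ 1`, the operator `e_k`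
always acts on the left. So does `f_k` when it acts on `b`, except when `k = i` and `φ_i(x_γ) = 1`.
This exception occurs for `γ_i = 1`, `γ ≠ α_i`, when the support moves off `i` and `y_i` turns into
`x_{-α_i}`. -/
theorem step_first (h0 : 0 ≤ γ) (hγ : γ i ≠ 0) (hb : (b : t.Label) = .x γ)
    (h1 : (c₁ : t.Label) = .x γ) (h2 : (c₂ : t.Label) = .y i) :
    StepRel (ChainRel t i pos) k b (c₁, c₂) := by
  have hc : c₁ = b := Subtype.ext (h1.trans hb.symm)
  subst hc
  have hW := H.isWeight_of_eq hb
  have hi := H.pos_i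
  have hε2 : t.thetaCrystal.eps k c₂ = if k = i then 1 else 0 := by
    split_ifs with h
    · rw [h, H.eps_y h2]
    · exact WeightData.eps_y_ne h2 (Ne.symm h)
  have hφi : 1 ≤ t.thetaCrystal.phi i c₁ := by
    refine H.phi_pos hb ?_
    by_cases hs : γ = t.simpleRoot i
    · rw [hs, sub_self]; exact H.isWeight_zero_of_simpleRoot (H.isWeight_simpleRoot i)
    · exact H.remove γ i hW h0 hγ (fun v hv => by omega) hs
  have hle : t.thetaCrystal.eps k c₂ ≤ t.thetaCrystal.phi k c₁ := by
    rw [hε2]; split_ifs with h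
    · rw [h]; exact hφi
    · exact Nat.zero_le _
  have hleft : ∀ b', t.thetaCrystal.f k c₁ = some b' →
      t.thetaCrystal.eps k c₂ < t.thetaCrystal.phi k c₁ →
      (b' : t.Label) = .x (γ - t.simpleRoot k) → (γ - t.simpleRoot k) i ≠ 0 →
      0 ≤ γ - t.simpleRoot k →
      Option.Rel (FullRel (ChainRel t i pos)) (t.thetaCrystal.f k c₁)
      ((t.thetaCrystal.tensor t.thetaCrystal).f k (c₁, c₂)) := by
    intro b' hb' hlt hbl hne hnn
    refine rel_some hb' (by rw [tensor_f_left hlt hb']; rfl) ?_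
    rw [hbl, h2]
    exact .first _ hnn hne
  constructor
  · by_cases hki : k = i
    · subst hki
      rw [if_pos rfl] at hε2
      by_cases hs : γ = t.simpleRoot k
      · subst hs
        obtain ⟨b', hb', hbl⟩ := H.f_simple hb
        have := H.phi_simple hb
        refine rel_some hb' (by rw [tensor_f_left (by omega) hb']; rfl) ?_
        rw [hbl, h2]
        exact .y_first
      · have hW' := H.remove γ k hW h0 hγ (fun v hv => by omega) hs
        obtain ⟨b', hb', hbl⟩ := H.f_sub hb hs hW'
        rcases (H.integral γ hW).eq_one_or_two_le h0 hγ with h | h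
        · have hsub : (γ - t.simpleRoot k) k = 0 := by
            rw [Pi.sub_apply, simpleRoot_self, h, sub_self]
          have hnn : 0 ≤ γ - t.simpleRoot k := fun v => by
            by_cases hv : v = k
            · rw [hv, hsub]; exact le_rfl
            · simpa [simpleRoot_of_ne hv] using h0 v
          have hφ := H.phi_le_one hb hs (H.not_isWeight_sub hnn (sub_ne_zero.2 hs) hsub)
          obtain ⟨w, hw⟩ := Function.ne_iff.1 (sub_ne_zero.2 hs)
          rw [Pi.zero_apply] at hw
          have hwk : w ≠ k := by rintro rfl; exact hw hsub
          have hγw : γ w ≠ 0 := by simpa [simpleRoot_of_ne hwk] using hw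
          have hlt := H.pos_pos hwk
          obtain ⟨u, hu⟩ := H.exists_pos w 1 hlt
          have huk : u ≠ k := H.ne_i (by omega)
          have hγu : γ u ≠ 0 := by
            by_cases huw : u = w
            · rwa [huw]
            · have : pos u ≠ pos w := fun h => huw (H.injective h)
              exact H.no_gap γ k u w hW (by omega) (by omega) hγ hγw
          obtain ⟨d, hd1, hd2⟩ := H.f_y_self h2
          have hpre := H.prefixRoot_one hu
          refine rel_some hb' (by rw [tensor_f_right (by omega) hd1]; rfl) ?_
          refine chainRel_other hbl hnn (m := u) (by simpa [simpleRoot_of_ne huk] using hγu)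
            (fun v hv => ?_) huk (by rw [hb, hpre, sub_add_cancel]) (by rw [hd2, hpre])
          rw [H.eq_of_pos_zero (m := v) (by omega), hsub]
        · have hne : (γ - t.simpleRoot k) k ≠ 0 := by
            rw [Pi.sub_apply, simpleRoot_self]; intro h'; linarith
          have hnn := H.nonneg_of_pos hW' (j := k) (by
            rw [Pi.sub_apply, simpleRoot_self]; linarith)
          refine hleft b' hb' ?_ hbl hne hnn
          have h3 : 1 ≤ t.thetaCrystal.phi k b' := by
            refine H.phi_pos hbl (H.remove _ _ hW' hnn hne (fun v hv => by omega) fun h' => ?_)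
            rw [sub_eq_iff_eq_add] at h'
            exact H.not_isWeight_simple_add (h' ▸ hW)
          have := H.regular.phi_eq hb'
          omega
    · rw [if_neg hki] at hε2
      cases hf : t.thetaCrystal.f k c₁ with
      | none =>
        refine rel_none rfl ?_
        rw [tensor_f_right (by rw [phi_eq_zero hf]; omega)
          (WeightData.f_y_ne h2 (Ne.symm hki))]
        rfl
      | some b' =>
        have hφ := H.regular.phi_eq hf
        have hW' := H.isWeight_of_phi hb (j := k) (by omega)
        have hsub : (γ - t.simpleRoot k) i = γ i := by simp [simpleRoot_of_ne (Ne.symm hki)]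
        obtain ⟨b'', hb'', hbl⟩ := H.f_sub hb (ne_simpleRoot (Ne.symm hki) hγ) hW'
        rw [← hf]
        exact hleft b'' hb'' (by omega) hbl (by rwa [hsub])
          (H.nonneg_of_pos hW' (j := i) (by
            rw [hsub]; exact lt_of_le_of_ne (h0 i) (Ne.symm hγ)))
  · cases he : t.thetaCrystal.e k c₁ with
    | none => exact rel_none rfl (by rw [tensor_e_left hle he]; rfl)
    | some b' =>
      have hε := H.regular.eps_eq he
      obtain ⟨b'', hb'', hbl⟩ := H.e_add hb (ne_neg_simpleRoot h0)
        (H.isWeight_of_eps hb (j := k) (by omega))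
      rw [← he]
      refine rel_some hb'' (by rw [tensor_e_left hle hb'']; rfl) ?_
      rw [hbl, h2]
      exact .first _ (add_nonneg h0 (simpleRoot_nonneg k)) (add_apply_ne_zero h0 hγ)

end Steps

end

theorem crystalRel : CrystalRel t i (ChainRel t i pos) where
  functional b c d c' d' h h' := by
    have hi := H.pos_i
    cases h with
    | first _ _ hγ =>
      cases h' with
      | first => exact ⟨rfl, rfl⟩
      | other _ m _ _ hz hmi => exact absurd (hz i (hi ▸ H.pos_pos hmi)) hγ
    | other _ m _ hm hz hmi =>
      cases h' with
      | first _ _ hγ => exact absurd (hz i (hi ▸ H.pos_pos hmi)) hγ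
      | other _ m' _ hm' hz' =>
        have : m = m' := H.injective (le_antisymm (not_lt.1 fun h => hm' (hz _ h))
          (not_lt.1 fun h => hm (hz' _ h)))
        subst this
        exact ⟨rfl, rfl⟩
    | y j hji =>
      cases h' with
      | y => exact ⟨rfl, rfl⟩
      | y_first => exact absurd rfl hji
    | y_first =>
      cases h' with
      | y _ hji => exact absurd rfl hji
      | y_first => exact ⟨rfl, rfl⟩
  nonneg γ c d h := by
    cases h <;> assumption
  y_self j c d h := by
    cases h <;> simp [Label.dual]
  total_x γ hW hne h0 := by
    by_cases hγ : γ i = 0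
    · obtain ⟨v, hv⟩ := Function.ne_iff.1 hne
      obtain ⟨m, hm, hmin⟩ := Finset.exists_min_image (Finset.univ.filter fun v => γ v ≠ 0) pos
        ⟨v, by simpa using hv⟩
      have hm : γ m ≠ 0 := by simpa using hm
      have hz : ∀ v, pos v < pos m → γ v = 0 := fun v hv => by
        by_contra h
        exact absurd (hmin v (by simpa using h)) (not_le.2 hv)
      have hmi : m ≠ i := by rintro rfl; exact hm hγ
      obtain ⟨c, hc⟩ := H.exists_x ((H.isWeight_add_prefixRoot_iff h0 hm hz hmi).2 hW)
        (fun h => by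
          have := congrFun h m
          rw [Pi.add_apply, prefixRoot_of_le le_rfl, add_zero] at this
          exact hm this)
      obtain ⟨d, hd⟩ := H.exists_x (H.neg _ (H.isWeight_prefixRoot hmi))
        (neg_ne_zero.2 (H.prefixRoot_ne_zero hmi))
      exact ⟨c, d, by rw [hc, hd]; exact .other γ m h0 hm hz hmi⟩
    · obtain ⟨c, hc⟩ := H.exists_x hW hne
      obtain ⟨d, hd⟩ := WeightData.exists_y (H.isWeight_simpleRoot i)
      exact ⟨c, d, by rw [hc, hd]; exact .first γ h0 hγ⟩
  total_y j hj := by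
    by_cases hji : j = i
    · subst hji
      obtain ⟨d, hd⟩ := WeightData.exists_y hj
      exact ⟨d, d, by rw [hd]; exact .y_first⟩
    · obtain ⟨c, hc⟩ := H.exists_x (H.isWeight_prefixRoot hji) (H.prefixRoot_ne_zero hji)
      obtain ⟨d, hd⟩ := H.exists_x (H.neg _ (H.isWeight_prefixRoot hji))
        (neg_ne_zero.2 (H.prefixRoot_ne_zero hji))
      exact ⟨c, d, by rw [hc, hd]; exact .y j hji⟩
  weight b c d h := by
    cases h <;> simp [labelCrystal]
  top := .first _ t.theta_mem_positiveWeights.2.2 H.theta_i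
  step k b c h := by
    obtain ⟨c₁, c₂⟩ := c
    rcases hb : (b : t.Label) with γ | j <;> rcases h1 : (c₁ : t.Label) with μ | l <;>
      rcases h2 : (c₂ : t.Label) with ν | m <;>
      rw [PosRel, hb, h1, h2] at h
    · cases h with
      | other _ m h0 hm hz hmi => exact H.step_other h0 hm hz hmi hb h1 h2
    · cases h with
      | first _ h0 hi => exact H.step_first h0 hi hb h1 h2
    · cases h
    · cases h
    · cases h with
      | y _ hji => exact H.step_y hji hb h1 h2
    · cases h
    · cases h
    · cases h
      exact H.step_y_first hb h1 h2

end ChainData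

end AffineType


namespace AffineType

open Crystal

variable {t : AffineType}

/-! ### Sign coherence -/

namespace FormData

variable {i : Fin t.rank} {s : Fin t.rank → ℤ}

/-- Adding `z_k α_k` to a partial sum with pairing `p` at `k` changes the squared length by `2 s_k
z_k (z_k + p)`, a multiple of `m`. It is used with `m = 2`, which always applies, and with `m = 4`
for vectors supported on simple roots with `s_k = 2`. -/
theorem form_dvd (D : FormData t i s) (m : ℤ) {μ : t.Weight} (z : Fin t.rank → ℤ)
    (hz : ∀ k, μ k = z k) (h : ∀ k, m ∣ 2 * s k * z k) : ∃ c : ℤ, form s μ μ = m * c := by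
  have key : ∀ S : Finset (Fin t.rank), ∃ c : ℤ,
      form s (∑ k ∈ S, (z k : ℚ) • t.simpleRoot k) (∑ k ∈ S, (z k : ℚ) • t.simpleRoot k) =
        m * c := by
    intro S
    induction S using Finset.induction_on with
    | empty => exact ⟨0, by simp [form]⟩
    | insert k S hk ih =>
      obtain ⟨c, hc⟩ := ih
      have hint : Integral (∑ k ∈ S, (z k : ℚ) • t.simpleRoot k) := by
        refine Finset.sum_induction _ Integral (fun _ _ => Integral.add) (fun _ => ⟨0, by simp⟩)
          fun k _ => (integral_simpleRoot k).zsmul _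
      obtain ⟨p, hp⟩ := hint.pairing k
      obtain ⟨d, hd⟩ := h k
      have hd' : (2 : ℚ) * s k * z k = m * d := by exact_mod_cast hd
      refine ⟨c + d * p + d * z k, ?_⟩
      rw [Finset.sum_insert hk, D.form_add_self, hc, form_smul_left, D.form_smul_right,
        form_simpleRoot_left, form_smul_left, form_simpleRoot_left, D.pairing_simpleRoot_self, hp]
      push_cast
      linear_combination (p + z k : ℚ) * hd'
  have hμ : μ = ∑ k, (z k : ℚ) • t.simpleRoot k := by
    funext v
    rw [hz v, Finset.sum_apply, Finset.sum_eq_single v]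
    · simp [simpleRoot_self]
    · intro k _ hk
      simp [simpleRoot_of_ne hk.symm]
    · simp
  rw [hμ]
  exact key _

theorem two_le_form (D : FormData t i s) {μ : t.Weight} (hμ : Integral μ) (h : μ ≠ 0) :
    2 ≤ form s μ μ := by
  choose z hz using hμ
  obtain ⟨c, hc⟩ := D.form_dvd 2 z hz fun k => ⟨s k * z k, by ring⟩
  have h1 := D.form_self_pos h
  rw [hc] at h1 ⊢
  have h2 : 0 < c := by
    have : (0 : ℚ) < c := by push_cast at h1; linarith
    exact_mod_cast this
  have : (1 : ℚ) ≤ c := by exact_mod_cast h2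
  push_cast
  linarith

/-- A vector that is not sign coherent is the difference of two nonzero disjoint vectors. -/
theorem exists_parts (D : FormData t i s) {μ : t.Weight} (hμ : Integral μ)
    (h : ¬ (0 ≤ μ ∨ μ ≤ 0)) : ∃ ν ξ : t.Weight, Integral ν ∧ Integral ξ ∧ 0 ≤ ν ∧ 0 ≤ ξ ∧
      ν ≠ 0 ∧ ξ ≠ 0 ∧ (∀ j, ν j = 0 ∨ ξ j = 0) ∧ form s ν ξ ≤ 0 ∧
      form s μ μ = form s ν ν - 2 * form s ν ξ + form s ξ ξ := by
  rw [not_or, Pi.le_def, Pi.le_def] at h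
  push Not at h
  obtain ⟨⟨j, hj⟩, k, hk⟩ := h
  rw [Pi.zero_apply] at hj hk
  have hν : (0 : t.Weight) ≤ fun v => max (μ v) 0 := fun v => le_max_right _ _
  have hξ : (0 : t.Weight) ≤ fun v => max (-μ v) 0 := fun v => le_max_right _ _
  have hd : ∀ v, max (μ v) 0 = 0 ∨ max (-μ v) 0 = 0 := fun v => by
    rcases le_total (μ v) 0 with h | h
    · exact Or.inl (max_eq_right h)
    · exact Or.inr (max_eq_right (by linarith))
  refine ⟨_, _, fun v => ?_, fun v => ?_, hν, hξ, fun h => ?_, fun h => ?_, hd,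
    D.form_le_zero hν hξ hd, ?_⟩
  · obtain ⟨z, hz⟩ := hμ v
    exact ⟨max z 0, by simp [hz]⟩
  · obtain ⟨z, hz⟩ := hμ v
    exact ⟨max (-z) 0, by simp [hz]⟩
  · have := congrFun h k
    simp only [Pi.zero_apply, max_eq_left hk.le] at this
    linarith
  · have := congrFun h j
    simp only [Pi.zero_apply, max_eq_left (show 0 ≤ -μ j by linarith)] at this
    linarith
  · rw [← D.form_sub_self]
    have : μ = (fun v => max (μ v) 0) - fun v => max (-μ v) 0 := by
      funext v
      simp only [Pi.sub_apply]
      rcases le_total (μ v) 0 with h | h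
      · rw [max_eq_right h, max_eq_left (by linarith)]; ring
      · rw [max_eq_left h, max_eq_right (by linarith)]; ring
    rw [← this]

/-- Two nonzero parts have squared length at least `2` each, and their mixed term only adds, so a
mixed vector has squared length at least `4`. -/
theorem signProperty_of_lt (D : FormData t i s) (h : form s t.theta t.theta < 4) :
    SignProperty t s := by
  intro μ hμ hle
  by_contra hcon
  obtain ⟨ν, ξ, hν, hξ, -, -, hν0, hξ0, -, h1, h2⟩ := D.exists_parts hμ hcon
  have h3 := D.two_le_form hν hν0
  have h4 := D.two_le_form hξ hξ0
  linarith

theorem exists_short (D : FormData t i s) (hs : ∀ j, s j = 1 ∨ s j = 2) {μ : t.Weight}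
    (hμ : Integral μ) (h : form s μ μ = 2) : ∃ j, s j = 1 ∧ μ j ≠ 0 := by
  by_contra hcon
  push Not at hcon
  choose z hz using hμ
  obtain ⟨c, hc⟩ := D.form_dvd 4 z hz fun k => by
    rcases hs k with h | h
    · have h1 : (z k : ℚ) = 0 := by rw [← hz, hcon k h]
      have h2 : z k = 0 := by exact_mod_cast h1
      exact ⟨0, by rw [h2]; ring⟩
    · exact ⟨z k, by rw [h]; ring⟩
  rw [h] at hc
  have : (2 : ℤ) = 4 * c := by exact_mod_cast hc
  omega

/-- At the bound `4` a mixed vector needs two parts of squared length exactly `2` that are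
orthogonal. Each part involves a simple root with `s = 1`, by divisibility by `4`. These two simple
roots are joined, which makes the form of the parts strictly negative. -/
theorem signProperty_of_short (D : FormData t i s) (h : form s t.theta t.theta = 4)
    (hs : ∀ j, s j = 1 ∨ s j = 2)
    (hadj : ∀ j k, j ≠ k → s j = 1 → s k = 1 → t.finCartan j k ≠ 0) : SignProperty t s := by
  intro μ hμ hle
  by_contra hcon
  obtain ⟨ν, ξ, hν, hξ, hν1, hξ1, hν0, hξ0, hd, h1, h2⟩ := D.exists_parts hμ hcon
  have h3 := D.two_le_form hν hν0
  have h4 := D.two_le_form hξ hξ0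
  obtain ⟨j, hj, hj'⟩ := D.exists_short hs hν (by linarith)
  obtain ⟨k, hk, hk'⟩ := D.exists_short hs hξ (by linarith)
  have hjk : j ≠ k := by
    rintro rfl
    exact (hd j).elim hj' hk'
  have := D.form_lt_zero hν1 hξ1 hd hj' hk' (hadj j k hjk hj hk)
  linarith

theorem form_theta (D : FormData t i s) (hp : t.pairing i t.theta = 1)
    (hp0 : ∀ j, j ≠ i → t.pairing j t.theta = 0) (μ : t.Weight) :
    form s t.theta μ = s i * μ i := by
  rw [D.form_comm, form, Finset.sum_eq_single i (fun j _ hj => by rw [hp0 j hj, mul_zero])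
    (by simp), hp, mul_one]

/-- Everything is read off from `(θ, μ) = s_i μ_i`, in particular `(θ, θ) = 2 s_i`. In degree two
`|θ - μ|² = |μ|² - 2 s_i ≤ 0`, and in degree one `|θ - μ|² = |μ|²`. -/
theorem gradedData (D : FormData t i s) (hsign : SignProperty t s) (hθ : t.theta i = 2)
    (hp : t.pairing i t.theta = 1) (hp0 : ∀ j, j ≠ i → t.pairing j t.theta = 0)
    (hsi : s i < 4) : GradedData t i := by
  have hf := D.form_theta hp hp0
  have hs : (0 : ℚ) < s i := by exact_mod_cast D.s_pos i
  have hhalf : ∀ μ : t.Weight, Integral μ → 0 < form s t.theta μ →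
      form s t.theta t.theta ≤ 2 * form s t.theta μ := fun μ hμ h => by
    rw [hf] at h
    have := hμ.one_le (j := i) (pos_of_mul_pos_right h hs.le)
    rw [hf, hf, hθ]
    nlinarith
  have hiff := D.isWeight_iff hsign hhalf
  have W := D.weightData hsign hhalf (by
    rw [hf, hθ]
    have : (s i : ℚ) < 4 := by exact_mod_cast hsi
    linarith)
  refine { W with
    isWeight_i := ?_
    pairing_theta_i := hp
    pairing_theta := hp0
    theta_i := hθ
    coeff_le := fun μ h => hθ ▸ W.le_theta μ h i
    coeff_two := fun μ h hi => ?_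
    complement := fun μ h hi => ?_
    disconnected := fun μ ν hμ hν hd ha hμ0 hν0 => D.not_isWeight_add hsign hμ hν hd ha hμ0 hν0
    connected := D.connected }
  · rw [hiff, form_simpleRoot_left, D.pairing_simpleRoot_self, hf, hθ]
    exact ⟨integral_simpleRoot i, le_rfl⟩
  · by_contra hne
    have h1 := D.form_self_pos (sub_ne_zero.2 (Ne.symm hne))
    have h2 := D.form_self_le h
    rw [D.form_sub_self, hf μ, hi, hf, hθ] at h1
    rw [hf, hθ] at h2
    linarith
  · rw [hiff] at h ⊢
    refine ⟨D.theta_integral.sub h.1, ?_⟩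
    rw [D.form_sub_self, hf μ, hi, hf, hθ]
    have := h.2
    rw [hf, hθ] at this
    linarith

end FormData

/-! ### The coefficients of `θ` and its pairings -/

theorem theta_eq (h : t.mark 0 = 1) (k : Fin t.rank) : t.theta k = t.mark (k + 1) := by
  simp [theta, h]

theorem mark_pos (t : AffineType) (k : ℕ) (hk : k ≤ t.rank) : 0 < t.mark k := by
  cases t <;> simp only [mark, rank] at * <;>
    first | omega | (split_ifs <;> omega) | (interval_cases k <;> decide)

theorem pairing_theta_eq (h : t.mark 0 = 1) (j : Fin t.rank) :
    t.pairing j t.theta = ((∑ k : Fin t.rank, t.finCartan j k * t.mark (k + 1) : ℤ) : ℚ) := by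
  rw [pairing_eq]
  push_cast
  exact Finset.sum_congr rfl fun k _ => by rw [theta_eq h]

/-- The part of `FormData` that concerns the Cartan matrix of the finite-dimensional algebra,
together with the pairings with `θ`. -/
theorem formData_of {i : Fin t.rank} {s : Fin t.rank → ℤ} (hm : t.mark 0 = 1)
    (s_pos : ∀ j, 0 < s j) (diag : ∀ j, t.finCartan j j = 2)
    (nonpos : ∀ j k, j ≠ k → t.finCartan j k ≤ 0)
    (symm : ∀ j k, s j * t.finCartan j k = s k * t.finCartan k j)
    (hi : 0 < ∑ k : Fin t.rank, t.finCartan i k * t.mark (k + 1))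
    (hθ : ∀ j, 0 ≤ ∑ k : Fin t.rank, t.finCartan j k * t.mark (k + 1))
    (connected : ∃ d : Fin t.rank → ℕ, ∀ k, k ≠ i → ∃ j, j ≠ k ∧ t.finCartan k j ≠ 0 ∧ d j < d k) :
    FormData t i s where
  s_pos := s_pos
  diag := diag
  nonpos := nonpos
  symm := symm
  theta_pos j := by
    rw [theta_eq hm]
    exact_mod_cast t.mark_pos _ j.2
  theta_integral j := ⟨t.mark (j + 1), by rw [theta_eq hm]; rfl⟩
  theta_dominant j := by
    rw [pairing_theta_eq hm]
    exact_mod_cast hθ j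
  theta_i := by
    rw [pairing_theta_eq hm]
    exact_mod_cast hi
  connected := connected

/-- The two alternatives for `s` at `i` are `|θ|² = 2` and `|θ|² = 4`; the second needs the finer
sign argument and occurs for `B` and `F_4`. -/
theorem gradedData_of {i : Fin t.rank} {s : Fin t.rank → ℤ} (hm : t.mark 0 = 1)
    (s_pos : ∀ j, 0 < s j) (diag : ∀ j, t.finCartan j j = 2)
    (nonpos : ∀ j k, j ≠ k → t.finCartan j k ≤ 0)
    (symm : ∀ j k, s j * t.finCartan j k = s k * t.finCartan k j)
    (hi : ∀ j, ∑ k : Fin t.rank, t.finCartan j k * t.mark (k + 1) = if j = i then 1 else 0)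
    (connected : ∃ d : Fin t.rank → ℕ, ∀ k, k ≠ i → ∃ j, j ≠ k ∧ t.finCartan k j ≠ 0 ∧ d j < d k)
    (hmi : t.mark (i + 1) = 2)
    (hs : s i = 1 ∨ (s i = 2 ∧ (∀ j, s j = 1 ∨ s j = 2) ∧
      ∀ j k, j ≠ k → s j = 1 → s k = 1 → t.finCartan j k ≠ 0)) : GradedData t i := by
  have D : FormData t i s := formData_of hm s_pos diag nonpos symm (by rw [hi, if_pos rfl]; norm_num)
    (fun j => by rw [hi]; split_ifs <;> norm_num) connected
  have hθ : t.theta i = 2 := by rw [theta_eq hm, hmi]; norm_num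
  have hp : t.pairing i t.theta = 1 := by rw [pairing_theta_eq hm, hi, if_pos rfl]; norm_num
  have hp0 : ∀ j, j ≠ i → t.pairing j t.theta = 0 := fun j hj => by
    rw [pairing_theta_eq hm, hi, if_neg hj]; norm_num
  have hf := D.form_theta hp hp0 t.theta
  rw [hθ] at hf
  rcases hs with h | ⟨h, h1, h2⟩
  · exact D.gradedData (D.signProperty_of_lt (by rw [hf, h]; norm_num)) hθ hp hp0 (by omega)
  · exact D.gradedData (D.signProperty_of_short (by rw [hf, h]; norm_num) h1 h2) hθ hp hp0
      (by omega)

/-! ### The exceptional types -/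

theorem gradedData_E6 : GradedData E6 ⟨5, by decide⟩ :=
  gradedData_of (s := fun _ => 1) rfl (by decide) (by decide) (by decide)
    -- The list gives the distances to `i` in the finite diagram; index `k` stands for vertex `k +
    -- 1`.
    (by decide) (by decide) ⟨fun k => [3, 2, 1, 2, 3, 0].getD k 0, by decide⟩ rfl
    (Or.inl rfl)

theorem gradedData_E7 : GradedData E7 ⟨0, by decide⟩ :=
  gradedData_of (s := fun _ => 1) rfl (by decide) (by decide) (by decide)
    (by decide) (by decide) ⟨fun k => [0, 1, 2, 3, 4, 5, 3].getD k 0, by decide⟩ rfl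
    (Or.inl rfl)

theorem gradedData_E8 : GradedData E8 ⟨0, by decide⟩ :=
  gradedData_of (s := fun _ => 1) rfl (by decide) (by decide) (by decide)
    (by decide) (by decide) ⟨fun k => [0, 1, 2, 3, 4, 5, 6, 5].getD k 0, by decide⟩ rfl
    (Or.inl rfl)

theorem gradedData_F4 : GradedData F4 ⟨0, by decide⟩ :=
  gradedData_of (s := fun k => [2, 2, 1, 1].getD k 1) rfl (by decide) (by decide) (by decide)
    (by decide) (by decide) ⟨fun k => [0, 1, 2, 3].getD k 0, by decide⟩ rfl
    (Or.inr ⟨rfl, by decide, by decide⟩)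

theorem gradedData_E62 : GradedData E62 ⟨0, by decide⟩ :=
  gradedData_of (s := fun k => [1, 1, 2, 2].getD k 1) rfl (by decide) (by decide) (by decide)
    (by decide) (by decide) ⟨fun k => [0, 1, 2, 3].getD k 0, by decide⟩ rfl
    (Or.inl rfl)

theorem gradedData_D43 : GradedData D43 ⟨0, by decide⟩ :=
  gradedData_of (s := fun k => [1, 3].getD k 1) rfl (by decide) (by decide) (by decide)
    (by decide) (by decide) ⟨fun k => [0, 1].getD k 0, by decide⟩ rfl
    (Or.inl rfl)

/-- The two vertices of the finite diagram in type `G_2`. -/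
def vertexG2 (k : Fin 2) : Fin G2.rank := k

/-- Here `|θ|² = 6`, beyond the general sign arguments. For coefficients `a`, `b` of opposite signs
half the squared length, `3a² - 3ab + b²`, is at least `7`, while vectors no longer than `θ` have at
most `3`. -/
theorem gradedData_G2 : GradedData G2 (vertexG2 0) := by
  have D : FormData G2 (vertexG2 0) (fun k => [3, 1].getD k 1) :=
    formData_of rfl (by decide) (by decide) (by decide) (by decide) (by decide)
      (by decide) ⟨fun k => [0, 1].getD k 0, by decide⟩
  have h00 : G2.finCartan (vertexG2 0) (vertexG2 0) = 2 := by decide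
  have h01 : G2.finCartan (vertexG2 0) (vertexG2 1) = -1 := by decide
  have h10 : G2.finCartan (vertexG2 1) (vertexG2 0) = -3 := by decide
  have h11 : G2.finCartan (vertexG2 1) (vertexG2 1) = 2 := by decide
  have hpair : ∀ (j : Fin G2.rank) (μ : Weight G2), pairing G2 j μ =
      (G2.finCartan j (vertexG2 0) : ℚ) * μ (vertexG2 0) +
        (G2.finCartan j (vertexG2 1) : ℚ) * μ (vertexG2 1) := fun j μ => Fin.sum_univ_two _
  have hform : ∀ μ : Weight G2, form (t := G2) (fun k => [3, 1].getD k 1) μ μ =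
      6 * μ (vertexG2 0) ^ 2 - 6 * μ (vertexG2 0) * μ (vertexG2 1) +
        2 * μ (vertexG2 1) ^ 2 := by
    intro μ
    have h1 : form (t := G2) (fun k => [3, 1].getD k 1) μ μ =
        ((3 : ℤ) : ℚ) * μ (vertexG2 0) * pairing G2 (vertexG2 0) μ +
          ((1 : ℤ) : ℚ) * μ (vertexG2 1) * pairing G2 (vertexG2 1) μ := Fin.sum_univ_two _
    rw [h1, hpair, hpair, h00, h01, h10, h11]
    push_cast
    ring
  have hθ0 : theta G2 (vertexG2 0) = 2 := by rw [theta_eq rfl]; norm_num [mark, vertexG2]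
  have hθ1 : theta G2 (vertexG2 1) = 3 := by rw [theta_eq rfl]; norm_num [mark, vertexG2]
  have hp : pairing G2 (vertexG2 0) (theta G2) = 1 := by
    rw [hpair, hθ0, hθ1, h00, h01]; norm_num
  have hcases : ∀ k, k = vertexG2 0 ∨ k = vertexG2 1 := by decide
  refine D.gradedData ?_ hθ0 hp (fun j hj => ?_) (by decide)
  swap
  · rw [(hcases j).resolve_left hj, hpair, hθ0, hθ1, h10, h11]; norm_num
  intro μ hμ hle
  rw [hform, hform, hθ0, hθ1] at hle
  obtain ⟨a, ha⟩ := hμ (vertexG2 0)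
  obtain ⟨b, hb⟩ := hμ (vertexG2 1)
  have h1 : 3 * a ^ 2 - 3 * a * b + b ^ 2 ≤ 3 := by
    rw [ha, hb] at hle
    have : (3 * a ^ 2 - 3 * a * b + b ^ 2 : ℚ) ≤ 3 := by linarith
    exact_mod_cast this
  have h2 : 0 ≤ a ∧ 0 ≤ b ∨ a ≤ 0 ∧ b ≤ 0 := by
    by_contra hcon
    rcases lt_trichotomy a 0 with h | h | h
    · have : 0 < b := by by_contra; exact hcon (Or.inr (by omega))
      nlinarith
    · omega
    · have : b < 0 := by by_contra; exact hcon (Or.inl (by omega))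
      nlinarith
  refine h2.imp (fun h k => ?_) fun h k => ?_
  · change (0 : ℚ) ≤ μ k
    rcases hcases k with rfl | rfl
    · rw [ha]; exact_mod_cast h.1
    · rw [hb]; exact_mod_cast h.2
  · change μ k ≤ (0 : ℚ)
    rcases hcases k with rfl | rfl
    · rw [ha]; exact_mod_cast h.1
    · rw [hb]; exact_mod_cast h.2

end AffineType


namespace AffineType

open Crystal

/-! ### The classical families in the graded case -/

/-- A row of a chain-like Cartan matrix has `2` on the diagonal, `u` after it and `d` before it. The
extra entry `e` at column `c` serves the fork of type `D` and is `0` in the other types. -/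
theorem sum_chain {R : Type*} [CommRing R] {n : ℕ} {a : Fin n → R} (m : ℕ → R) (j c : ℕ)
    (hj : j < n) (hc : c < n) (u d e : R) (h : ∀ k : Fin n, a k = (if (k : ℕ) = j then 2 else 0) +
      (if (k : ℕ) = j + 1 then u else 0) + (if (k : ℕ) + 1 = j then d else 0) +
      (if (k : ℕ) = c then e else 0)) :
    ∑ k : Fin n, a k * m k = 2 * m j + (if j + 1 < n then u * m (j + 1) else 0) +
      (if 1 ≤ j then d * m (j - 1) else 0) + e * m c := by
  simp only [h]
  rw [Fin.sum_univ_eq_sum_range (fun k => ((if k = j then 2 else 0) +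
      (if k = j + 1 then u else 0) + (if k + 1 = j then d else 0) +
      (if k = c then e else 0)) * m k) n]
  simp only [add_mul, ite_mul, zero_mul, Finset.sum_add_distrib, Finset.sum_ite_eq',
    Finset.mem_range, hj, hc, if_true]
  congr 2
  rcases j with _ | j
  · simp
  · simp [show j < n by omega]

theorem finCartan_B (n : ℕ) (hn : 3 ≤ n) (j k : Fin (B n hn).rank) :
    (B n hn).finCartan j k =
      if (j : ℕ) + 1 = n ∧ (k : ℕ) + 2 = n then -2 else chainEntry j k := by
  have hj : (j : ℕ) < n := j.2
  have hk : (k : ℕ) < n := k.2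
  simp only [finCartan, cartan, entry, forkEntry, chainEntry, Matrix.of_apply, Fin.val_succ,
    Nat.add_eq_zero_iff, one_ne_zero, false_and, and_false, or_false, if_false]
  split_ifs <;> omega

theorem finCartan_A2Odd (n : ℕ) (hn : 3 ≤ n) (j k : Fin (A2Odd n hn).rank) :
    (A2Odd n hn).finCartan j k =
      if (j : ℕ) + 2 = n ∧ (k : ℕ) + 1 = n then -2 else chainEntry j k := by
  have hj : (j : ℕ) < n := j.2
  have hk : (k : ℕ) < n := k.2
  simp only [finCartan, cartan, entry, forkEntry, chainEntry, Matrix.of_apply, Fin.val_succ,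
    Nat.add_eq_zero_iff, one_ne_zero, false_and, and_false, or_false, if_false]
  split_ifs <;> omega

theorem finCartan_D (n : ℕ) (hn : 4 ≤ n) (j k : Fin (D n hn).rank) :
    (D n hn).finCartan j k =
      if j = k then 2
      else if ((j : ℕ) + 1 = n ∧ (k : ℕ) + 3 = n) ∨ ((k : ℕ) + 1 = n ∧ (j : ℕ) + 3 = n) then -1
      else if (j : ℕ) + 1 = n ∨ (k : ℕ) + 1 = n then 0
      else chainEntry j k := by
  have hj : (j : ℕ) < n := j.2
  have hk : (k : ℕ) < n := k.2
  simp only [finCartan, cartan, entry, forkEntry, chainEntry, Matrix.of_apply, Fin.val_succ,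
    Nat.add_eq_zero_iff, one_ne_zero, false_and, and_false, or_false, if_false,
    Fin.ext_iff]
  split_ifs <;> omega

theorem gradedData_B (n : ℕ) (hn : 3 ≤ n) :
    GradedData (B n hn) ⟨1, by simp only [rank]; omega⟩ := by
  have hr : (B n hn).rank = n := rfl
  refine gradedData_of (s := fun k => if (k : ℕ) + 1 = n then 1 else 2) rfl (fun j => ?_)
    (fun j => ?_) (fun j k hjk => ?_) (fun j k => ?_) (fun j => ?_)
    -- The distance to index `1`, that is to vertex `2`, split so that the subtraction does not
    -- truncate.
    ⟨fun k => if (k : ℕ) ≤ 1 then 1 - k else k - 1, fun k hk => ?_⟩ ?_ (Or.inr ⟨?_, fun j => ?_,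
      fun j k hjk hj hk => ?_⟩)
  · split_ifs <;> norm_num
  · simp only [finCartan_B, chainEntry]; split_ifs <;> omega
  · have := Fin.val_ne_of_ne hjk
    simp only [finCartan_B, chainEntry]; split_ifs <;> omega
  · simp only [finCartan_B, chainEntry]
    split_ifs <;> omega
  · rw [sum_chain (fun k => ((B n hn).mark (k + 1) : ℤ)) j j j.2 j.2 (-1)
        (if (j : ℕ) + 1 = n then -2 else -1) 0 fun k => by
          rw [finCartan_B]; simp only [chainEntry]; split_ifs <;> omega]
    simp only [mark, Fin.ext_iff]
    split_ifs <;> omega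
  · have hk1 : (k : ℕ) ≠ 1 := fun h => hk (Fin.ext h)
    by_cases h0 : (k : ℕ) = 0
    · refine ⟨⟨1, by omega⟩, fun h => hk1 (congrArg Fin.val h.symm), ?_, ?_⟩
      · simp only [finCartan_B, chainEntry]; split_ifs <;> omega
      · simp [h0]
    · refine ⟨⟨k - 1, by omega⟩, fun h => ?_, ?_, ?_⟩
      · have := congrArg Fin.val h; simp only at this; omega
      · simp only [finCartan_B, chainEntry]; split_ifs <;> omega
      · dsimp only; split_ifs <;> omega
  · simp [mark]
  · exact if_neg (by simp only; omega)
  · split_ifs <;> norm_num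
  · exfalso
    split_ifs at hj hk <;> omega

theorem gradedData_A2Odd (n : ℕ) (hn : 3 ≤ n) :
    GradedData (A2Odd n hn) ⟨1, by simp only [rank]; omega⟩ := by
  have hr : (A2Odd n hn).rank = n := rfl
  refine gradedData_of (s := fun k => if (k : ℕ) + 1 = n then 2 else 1) rfl (fun j => ?_)
    (fun j => ?_) (fun j k hjk => ?_) (fun j k => ?_) (fun j => ?_)
    ⟨fun k => if (k : ℕ) ≤ 1 then 1 - k else k - 1, fun k hk => ?_⟩ ?_ (Or.inl ?_)
  · split_ifs <;> norm_num
  · simp only [finCartan_A2Odd, chainEntry]; split_ifs <;> omega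
  · have := Fin.val_ne_of_ne hjk
    simp only [finCartan_A2Odd, chainEntry]; split_ifs <;> omega
  · simp only [finCartan_A2Odd, chainEntry]
    split_ifs <;> omega
  · rw [sum_chain (fun k => ((A2Odd n hn).mark (k + 1) : ℤ)) j j j.2 j.2
        (if (j : ℕ) + 2 = n then -2 else -1) (-1) 0 fun k => by
          rw [finCartan_A2Odd]; simp only [chainEntry]; split_ifs <;> omega]
    simp only [mark, Fin.ext_iff]
    split_ifs <;> omega
  · have hk1 : (k : ℕ) ≠ 1 := fun h => hk (Fin.ext h)
    by_cases h0 : (k : ℕ) = 0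
    · refine ⟨⟨1, by omega⟩, fun h => hk1 (congrArg Fin.val h.symm), ?_, ?_⟩
      · simp only [finCartan_A2Odd, chainEntry]; split_ifs <;> omega
      · simp [h0]
    · refine ⟨⟨k - 1, by omega⟩, fun h => ?_, ?_, ?_⟩
      · have := congrArg Fin.val h; simp only at this; omega
      · simp only [finCartan_A2Odd, chainEntry]; split_ifs <;> omega
      · dsimp only; split_ifs <;> omega
  · simp only [mark]; exact if_neg (by omega)
  · exact if_neg (by simp only; omega)

theorem sum_mark_D (n : ℕ) (hn : 4 ≤ n) (j : Fin (D n hn).rank) :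
    ∑ k : Fin (D n hn).rank, (D n hn).finCartan j k * ((D n hn).mark (k + 1) : ℤ) =
      if j = ⟨1, by simp only [rank]; omega⟩ then 1 else 0 := by
  have hr : (D n hn).rank = n := rfl
  have key : ∀ c < (D n hn).rank, ∀ u d e : ℤ, _ :=
    fun c hc => sum_chain (a := (D n hn).finCartan j) (fun k => ((D n hn).mark (k + 1) : ℤ)) j c
      j.2 hc
  simp only [Fin.ext_iff]
  -- The last vertex is joined only to the one two before it, the last but one only to its
  -- predecessor, and the branching vertex to both of them; the remaining rows are those of a chain.
  by_cases h1 : (j : ℕ) + 1 = n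
  · rw [key (j - 2) (by omega) 0 0 (-1) fun k => by
      rw [finCartan_D]; simp only [chainEntry, Fin.ext_iff]; split_ifs <;> omega]
    simp only [mark]
    split_ifs <;> omega
  by_cases h2 : (j : ℕ) + 2 = n
  · rw [key j (by omega) 0 (-1) 0 fun k => by
      rw [finCartan_D]; simp only [chainEntry, Fin.ext_iff]; split_ifs <;> omega]
    simp only [mark]
    split_ifs <;> omega
  by_cases h3 : (j : ℕ) + 3 = n
  · rw [key (j + 2) (by omega) (-1) (-1) (-1) fun k => by
      rw [finCartan_D]; simp only [chainEntry, Fin.ext_iff]; split_ifs <;> omega]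
    simp only [mark]
    split_ifs <;> omega
  · rw [key j (by omega) (-1) (-1) 0 fun k => by
      rw [finCartan_D]; simp only [chainEntry, Fin.ext_iff]; split_ifs <;> omega]
    simp only [mark]
    split_ifs <;> omega

theorem gradedData_D (n : ℕ) (hn : 4 ≤ n) :
    GradedData (D n hn) ⟨1, by simp only [rank]; omega⟩ := by
  have hr : (D n hn).rank = n := rfl
  refine gradedData_of (s := fun _ => 1) rfl (fun j => one_pos)
    (fun j => ?_) (fun j k hjk => ?_) (fun j k => ?_) (fun j => ?_)
    ⟨fun k => if (k : ℕ) ≤ 1 then 1 - k else k - 1, fun k hk => ?_⟩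
    ?_ (Or.inl rfl)
  · simp only [finCartan_D, if_true]
  · have := Fin.val_ne_of_ne hjk
    simp only [finCartan_D, chainEntry, Fin.ext_iff]; split_ifs <;> omega
  · simp only [finCartan_D, chainEntry, Fin.ext_iff]
    split_ifs <;> omega
  · exact sum_mark_D n hn j
  · have hk1 : (k : ℕ) ≠ 1 := fun h => hk (Fin.ext h)
    by_cases h0 : (k : ℕ) = 0
    · refine ⟨⟨1, by omega⟩, fun h => hk1 (congrArg Fin.val h.symm), ?_, ?_⟩
      · simp only [finCartan_D, chainEntry, Fin.ext_iff]; split_ifs <;> omega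
      · simp [h0]
    -- The last vertex hangs on the branching vertex, two indices below.
    by_cases h1 : (k : ℕ) + 1 = n
    · refine ⟨⟨k - 2, by omega⟩, fun h => ?_, ?_, ?_⟩
      · have := congrArg Fin.val h; simp only at this; omega
      · simp only [finCartan_D, chainEntry, Fin.ext_iff]; split_ifs <;> omega
      · dsimp only; split_ifs <;> omega
    · refine ⟨⟨k - 1, by omega⟩, fun h => ?_, ?_, ?_⟩
      · have := congrArg Fin.val h; simp only at this; omega
      · simp only [finCartan_D, chainEntry, Fin.ext_iff]; split_ifs <;> omega
      · dsimp only; split_ifs <;> omega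
  · simp only [mark]; exact if_neg (by omega)

end AffineType


namespace AffineType

open Crystal

/-! ### Type `A` -/

section Chains

variable {t : AffineType}

/-- The coefficients of a weight, extended by zero. -/
def coeff (μ : t.Weight) (k : ℕ) : ℚ := if h : k < t.rank then μ ⟨k, h⟩ else 0

theorem coeff_val (μ : t.Weight) (k : Fin t.rank) : coeff μ k = μ k := by
  simp [coeff, k.2]

theorem coeff_of_le (μ : t.Weight) {k : ℕ} (h : t.rank ≤ k) : coeff μ k = 0 :=
  dif_neg (not_lt.2 h)

theorem pairing_chain (μ : t.Weight) (j : Fin t.rank) (u d : ℤ)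
    (h : ∀ k : Fin t.rank, t.finCartan j k = (if (k : ℕ) = j then 2 else 0) +
      (if (k : ℕ) = j + 1 then u else 0) + (if (k : ℕ) + 1 = j then d else 0)) :
    t.pairing j μ = 2 * μ j + u * coeff μ (j + 1) +
      if 1 ≤ (j : ℕ) then d * coeff μ (j - 1) else 0 := by
  have key := sum_chain (n := t.rank) (a := fun k => (t.finCartan j k : ℚ)) (coeff μ) j j j.2 j.2
    (u : ℚ) d 0 fun k => by
      rw [h k]; push_cast; simp
  simp only [coeff_val] at key
  rw [pairing_eq, key]
  by_cases hj : (j : ℕ) + 1 < t.rank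
  · simp [hj]
  · simp [hj, coeff_of_le μ (not_lt.1 hj)]

theorem isWeight_seg (W : WeightData t) (hs : ∀ j, t.IsWeight (t.simpleRoot j))
    (ha : ∀ j k : Fin t.rank, (j : ℕ) + 1 = k → t.finCartan k j ≠ 0) {j k : ℕ} (hj : 1 ≤ j)
    (hjk : j ≤ k) (hk : k ≤ t.rank) : t.IsWeight (t.seg j k) := by
  induction k, hjk using Nat.le_induction with
  | base =>
    convert hs ⟨j - 1, by omega⟩ using 1
    funext l
    by_cases hl : (l : ℕ) = j - 1
    · rw [show l = ⟨j - 1, by omega⟩ from Fin.ext hl, simpleRoot_self]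
      exact if_pos (by simp only; omega)
    · rw [simpleRoot_of_ne fun h => hl (congrArg Fin.val h)]
      exact if_neg (by omega)
  | succ k hjk ih =>
    have h1 := W.isWeight_add_simpleRoot (j := ⟨k, by omega⟩) (k := ⟨k - 1, by omega⟩)
      (ih (by omega)) (fun l => by
        simp only [seg, Pi.zero_apply]; split_ifs <;> norm_num)
      (if_neg (by simp)) (by
        rw [seg, if_pos (by simp only; omega)]; norm_num) (ha _ _ (by simp only; omega))
    convert h1 using 1
    funext l
    by_cases hl : (l : ℕ) = k
    · rw [show l = ⟨k, by omega⟩ from Fin.ext hl, Pi.add_apply, simpleRoot_self]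
      simp only [seg]
      rw [if_pos (by omega), if_neg (by omega), zero_add]
    · rw [Pi.add_apply, simpleRoot_of_ne fun h => hl (congrArg Fin.val h), add_zero]
      simp only [seg]
      congr 1
      rw [eq_iff_iff]
      omega

/-- Weights have no gaps in their support along a chain. -/
theorem FormData.no_gap {i : Fin t.rank} {s : Fin t.rank → ℤ} (D : FormData t i s)
    (W : WeightData t) (hsign : SignProperty t s) {pos : Fin t.rank → ℕ}
    (hinj : Function.Injective pos)
    (hadj : ∀ j k, j ≠ k → (t.finCartan j k ≠ 0 ↔ pos j + 1 = pos k ∨ pos k + 1 = pos j))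
    (γ : t.Weight) (u v w : Fin t.rank) (hW : t.IsWeight γ) (huv : pos u < pos v)
    (hvw : pos v < pos w) (hu : γ u ≠ 0) (hw : γ w ≠ 0) : γ v ≠ 0 := by
  intro hv
  have key : ∀ γ : t.Weight, 0 ≤ γ → γ u ≠ 0 → γ w ≠ 0 → γ v = 0 → ¬ t.IsWeight γ := by
    intro γ h0 hu hw hv hW
    -- A zero at `v` splits `γ` into the parts before and after `v`, which are not joined along a
    -- chain.
    have hsum : γ = (fun l => if pos l < pos v then γ l else 0) +
        fun l => if pos v < pos l then γ l else 0 := by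
      funext l
      rw [Pi.add_apply]
      rcases lt_trichotomy (pos l) (pos v) with h | h | h
      · rw [if_pos h, if_neg h.le.not_gt, add_zero]
      · rw [hinj h, hv]; simp
      · rw [if_pos h, if_neg h.le.not_gt, zero_add]
    rw [hsum] at hW
    refine D.not_isWeight_add hsign (fun l => ?_) (fun l => ?_) (fun l => ?_)
      (fun l m hl hm => ?_) (fun h => hu ?_) (fun h => hw ?_) hW
    · dsimp only; split_ifs
      exacts [h0 l, le_rfl]
    · dsimp only; split_ifs
      exacts [h0 l, le_rfl]
    · by_cases h : pos l < pos v
      · exact Or.inr (if_neg h.le.not_gt)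
      · exact Or.inl (if_neg h)
    · have h1 : pos l < pos v := by
        by_contra h
        exact hl (if_neg h)
      have h2 : pos v < pos m := by
        by_contra h
        exact hm (if_neg h)
      by_contra h
      have := (hadj l m (by rintro rfl; omega)).1 h
      omega
    · have := congrFun h u
      simpa [huv] using this
    · have := congrFun h w
      simpa [hvw] using this
  rcases W.sign γ hW with h | h
  · exact key γ h hu hw hv hW
  · exact key (-γ) (neg_nonneg.2 h) (neg_ne_zero.2 hu) (neg_ne_zero.2 hw)
      (by rw [Pi.neg_apply, hv, neg_zero]) (W.neg γ hW)

namespace ChainData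

variable {i : Fin t.rank} {pos : Fin t.rank → ℕ} (H : ChainData t i pos)
  {Φ : t.vertices → t.vertices × t.vertices} (hΦ : ∀ b, FullRel (ChainRel t i pos) b (Φ b))
include H hΦ

theorem sends_other {γ μ ν : t.Weight} (m : Fin t.rank) (hW : t.IsWeight γ) (h0 : 0 ≤ γ)
    (hm : γ m ≠ 0) (hz : ∀ v, pos v < pos m → γ v = 0) (hmi : m ≠ i)
    (hμ : μ = γ + t.prefixRoot pos m) (hν : ν = t.prefixRoot pos m) :
    Sends Φ (.x γ) (.x μ, .x (-ν)) := by
  rw [hμ, hν]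
  exact H.crystalRel.sends_of_rel H.toWeightData hΦ
    (H.mem_vertices_x.2 ⟨hW, fun h => hm (by rw [h]; rfl)⟩) (.other γ m h0 hm hz hmi)

theorem sends_first {γ : t.Weight} (hW : t.IsWeight γ) (h0 : 0 ≤ γ) (hi : γ i ≠ 0) :
    Sends Φ (.x γ) (.x γ, .y i) :=
  H.crystalRel.sends_of_rel H.toWeightData hΦ
    (H.mem_vertices_x.2 ⟨hW, fun h => hi (by rw [h]; rfl)⟩) (.first γ h0 hi)

theorem sends_y {ν : t.Weight} (j : Fin t.rank) (hji : j ≠ i) (hν : ν = t.prefixRoot pos j) :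
    Sends Φ (.y j) (.x ν, .x (-ν)) := by
  rw [hν]
  exact H.crystalRel.sends_of_rel H.toWeightData hΦ
    (WeightData.mem_vertices_y.2 (H.isWeight_simpleRoot j)) (.y j hji)

theorem sends_y_first : Sends Φ (.y i) (.y i, .y i) :=
  H.crystalRel.sends_of_rel H.toWeightData hΦ
    (WeightData.mem_vertices_y.2 (H.isWeight_simpleRoot i)) .y_first

end ChainData

theorem seg_nonneg (j k : ℕ) : 0 ≤ t.seg j k := fun l => by
  simp only [seg, Pi.zero_apply]; split_ifs <;> norm_num

end Chains

section TypeA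

variable (n : ℕ) (hn : 1 ≤ n)

theorem finCartan_A (j k : Fin (A n hn).rank) : (A n hn).finCartan j k = chainEntry j k := by
  have hj : (j : ℕ) < n := j.2
  have hk : (k : ℕ) < n := k.2
  simp only [finCartan, cartan, entry, chainEntry, Matrix.of_apply, Fin.val_succ,
    Nat.add_eq_zero_iff, one_ne_zero, false_and, and_false, or_false, if_false]
  split_ifs <;> omega

/-- The two ends are counted separately, so that `n = 1`, where they coincide, gives `2`. -/
theorem sum_mark_A (j : Fin (A n hn).rank) :
    ∑ k : Fin (A n hn).rank, (A n hn).finCartan j k * ((A n hn).mark (k + 1) : ℤ) =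
      (if (j : ℕ) = 0 then 1 else 0) + if (j : ℕ) = n - 1 then 1 else 0 := by
  have hr : (A n hn).rank = n := rfl
  rw [sum_chain (fun k => ((A n hn).mark (k + 1) : ℤ)) j j j.2 j.2 (-1) (-1) 0 fun k => by
    rw [finCartan_A]; simp only [chainEntry]; split_ifs <;> omega]
  simp only [mark]
  split_ifs <;> omega

theorem pairing_A (μ : (A n hn).Weight) (j : Fin (A n hn).rank) :
    (A n hn).pairing j μ = 2 * μ j - coeff μ (j + 1) -
      if 1 ≤ (j : ℕ) then coeff μ (j - 1) else 0 := by
  rw [pairing_chain μ j (-1) (-1) fun k => by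
    rw [finCartan_A]; simp only [chainEntry]; split_ifs <;> omega]
  split_ifs <;> push_cast <;> ring

/-- The positions `0, …, n - 1` along the chain, counted from one of its ends. -/
structure IsChainPos (i : Fin (A n hn).rank) (pos : Fin (A n hn).rank → ℕ) : Prop where
  pos_i : pos i = 0
  eq : (∀ k, pos k = k) ∨ ∀ k, pos k = n - 1 - k

variable {n hn} {i : Fin (A n hn).rank} {pos : Fin (A n hn).rank → ℕ}

theorem IsChainPos.joined_iff (hpos : IsChainPos n hn i pos) (j k : Fin (A n hn).rank)
    (hjk : j ≠ k) :
    (A n hn).finCartan j k ≠ 0 ↔ pos j + 1 = pos k ∨ pos k + 1 = pos j := by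
  have hr : (A n hn).rank = n := rfl
  have := Fin.val_ne_of_ne hjk
  rw [finCartan_A, chainEntry]
  rcases hpos.eq with h | h <;> rw [h, h] <;> split_ifs <;> simp <;> omega

theorem IsChainPos.formData (hpos : IsChainPos n hn i pos) :
    FormData (A n hn) i fun _ => 1 := by
  have hr : (A n hn).rank = n := rfl
  refine formData_of rfl (fun j => one_pos) (fun j => ?_) (fun j k hjk => ?_) (fun j k => ?_) ?_
    (fun j => ?_) ⟨pos, fun k hk => ?_⟩
  · simp [finCartan_A, chainEntry]
  · have := Fin.val_ne_of_ne hjk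
    simp only [finCartan_A, chainEntry]; split_ifs <;> omega
  · simp only [finCartan_A, chainEntry]
    split_ifs <;> omega
  · rw [sum_mark_A]
    have := hpos.pos_i
    rcases hpos.eq with h | h <;> rw [h] at this <;> split_ifs <;> omega
  · rw [sum_mark_A]; split_ifs <;> norm_num
  · have h0 := hpos.pos_i
    have hki := Fin.val_ne_of_ne hk
    have hkn : (k : ℕ) < n := k.2
    have hin : (i : ℕ) < n := i.2
    rcases hpos.eq with h | h
    · rw [h] at h0
      refine ⟨⟨k - 1, by omega⟩, fun h => ?_, ?_, ?_⟩
      · have := congrArg Fin.val h; simp only at this; omega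
      · simp only [finCartan_A, chainEntry]; split_ifs <;> omega
      · rw [h, h]; simp only; omega
    · rw [h] at h0
      have hk1 : (k : ℕ) + 1 < n := by omega
      refine ⟨⟨k + 1, hk1⟩, fun h => ?_, ?_, ?_⟩
      · have := congrArg Fin.val h; simp only at this; omega
      · rw [finCartan_A, chainEntry, if_neg (by simp), if_pos (Or.inl rfl)]; norm_num
      · rw [h, h]; simp only; omega

theorem form_theta_A : form (t := A n hn) (fun _ => 1) (theta (A n hn)) (theta (A n hn)) = 2 := by
  have hr : (A n hn).rank = n := rfl
  simp only [form, pairing_theta_eq (t := A n hn) rfl, sum_mark_A, theta_eq (t := A n hn) rfl]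
  push_cast
  rw [Finset.sum_congr rfl (g := fun k : Fin (A n hn).rank =>
    (fun k : ℕ => (if k = 0 then (1 : ℚ) else 0) + if k = n - 1 then 1 else 0) k)
    fun k _ => by simp [mark],
    Fin.sum_univ_eq_sum_range (fun k : ℕ => (if k = 0 then (1 : ℚ) else 0) +
      if k = n - 1 then 1 else 0) (A n hn).rank, Finset.sum_add_distrib, Finset.sum_ite_eq',
    Finset.sum_ite_eq', if_pos (Finset.mem_range.2 (by omega)),
    if_pos (Finset.mem_range.2 (by omega))]
  norm_num

theorem IsChainPos.chainData (hpos : IsChainPos n hn i pos) : ChainData (A n hn) i pos := by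
  have hr : (A n hn).rank = n := rfl
  have D := hpos.formData
  have hsign := D.signProperty_of_lt (by rw [form_theta_A]; norm_num)
  -- As `|θ|² = 2`, it is enough that `(θ, μ)`, the sum of all pairings of `μ`, is an integer.
  have hhalf : ∀ μ : (A n hn).Weight, Integral μ → 0 < form (t := A n hn) (fun _ => 1)
      (theta (A n hn)) μ → form (t := A n hn) (fun _ => 1) (theta (A n hn)) (theta (A n hn)) ≤
        2 * form (t := A n hn) (fun _ => 1) (theta (A n hn)) μ := fun μ hμ h => by
    have : ∃ z : ℤ, form (t := A n hn) (fun _ => 1) (theta (A n hn)) μ = z := by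
      choose p hp using hμ.pairing
      refine ⟨∑ j, p j, ?_⟩
      simp [form, hp, theta_eq (t := A n hn) rfl, mark]
    obtain ⟨z, hz⟩ := this
    rw [form_theta_A, hz]
    rw [hz] at h
    have : (1 : ℚ) ≤ z := by exact_mod_cast h
    linarith
  have W := D.weightData hsign hhalf (by rw [form_theta_A]; norm_num)
  have hinj : Function.Injective pos := fun j k hjk => by
    have hj := j.2
    have hk := k.2
    rcases hpos.eq with h | h <;> rw [h, h] at hjk <;> exact Fin.ext (by omega)
  have hle : ∀ μ, (A n hn).IsWeight μ → ∀ k, coeff μ k ≤ 1 := fun μ hμ k => by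
    rw [coeff]
    split_ifs with hk
    · refine (W.le_theta μ hμ _).trans ?_
      rw [theta_eq rfl]
      norm_num [mark]
    · norm_num
  refine { W with
    injective := hinj
    pos_i := hpos.pos_i
    exists_pos := fun m d hd => ?_
    isWeight_simpleRoot := fun j => ?_
    joined_iff := hpos.joined_iff
    simple_edge := fun j k m _ _ h => ?_
    remove := fun γ u hW h0 hu hz _ => hW.sub ?_
    no_gap := D.no_gap W hsign hinj hpos.joined_iff
    theta_i := ?_ }
  · have hm := m.2
    rcases hpos.eq with h | h
    · rw [h] at hd
      exact ⟨⟨d, by omega⟩, h _⟩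
    · rw [h] at hd
      exact ⟨⟨n - 1 - d, by omega⟩, by rw [h]; simp only; omega⟩
  · rw [D.isWeight_iff hsign hhalf, form_simpleRoot_left, D.pairing_simpleRoot_self,
      form_theta_A]
    exact ⟨integral_simpleRoot j, by norm_num⟩
  · rw [finCartan_A, chainEntry]
    rcases hpos.eq with h' | h' <;> rw [h', h'] at h <;> split_ifs <;> omega
  -- At the start of the support the coefficient is at least `1`, the neighbour before it
  -- contributes `0` and the one after it at most `1`, so the pairing is at least `2 - 1`.
  · have hu1 := (W.integral γ hW).one_le (lt_of_le_of_ne (h0 u) (Ne.symm hu))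
    have hulow : ∀ k : ℕ, (∀ h : k < n, pos ⟨k, h⟩ < pos u) → coeff γ k = 0 := fun k hk => by
      rw [coeff]
      split_ifs with h
      exacts [hz _ (hk h), rfl]
    have h1 := hle γ hW (u + 1)
    have h2 := hle γ hW (u - 1)
    rw [pairing_A]
    rcases hpos.eq with h | h
    · split_ifs with hu0
      · rw [hulow (u - 1) fun h' => by rw [h, h]; simp only; omega]
        linarith
      · linarith
    · rw [hulow (u + 1) fun h' => by rw [h, h]; simp only; omega]
      split_ifs with hu0 <;> linarith
  · rw [theta_eq rfl]
    norm_num [mark]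

theorem ChainData.isWeight_seg (H : ChainData (A n hn) i pos) {j k : ℕ} (hj : 1 ≤ j)
    (hjk : j ≤ k) (hk : k ≤ (A n hn).rank) : (A n hn).IsWeight (seg (A n hn) j k) :=
  AffineType.isWeight_seg H.toWeightData H.isWeight_simpleRoot (fun j k h => by
    rw [finCartan_A, chainEntry, if_neg (by omega), if_pos (Or.inr h)]; norm_num) hj hjk hk

theorem typeAFirstFormula (hi : (i : ℕ) = 0) {Φ : (A n hn).vertices → (A n hn).vertices ×
    (A n hn).vertices} (H : ChainData (A n hn) i fun k => k)
    (hΦ : ∀ b, FullRel (ChainRel (A n hn) i fun k => k) b (Φ b)) :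
    TypeAFirstFormula (A n hn) i Φ where
  x j k hj hjk hk := by
    refine H.sends_other hΦ ⟨j - 1, by omega⟩ (H.isWeight_seg (by omega) hjk hk)
      (seg_nonneg j k) ?_ (fun v hv => ?_) (fun h => ?_) (funext fun l => ?_) (funext fun l => ?_)
    · rw [seg, if_pos (by simp only; omega)]; norm_num
    · exact if_neg (by simp only at hv; omega)
    · have := congrArg Fin.val h; simp only at this; omega
    · simp only [seg, prefixRoot, Pi.add_apply]; split_ifs <;> first | omega | norm_num
    · simp only [seg, prefixRoot]; split_ifs <;> first | omega | norm_num
  x_first k hk hkn := H.sends_first hΦ (H.isWeight_seg le_rfl hk hkn) (seg_nonneg 1 k) (by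
    rw [seg, if_pos (by omega)]; norm_num)
  y j hji := H.sends_y hΦ j hji (funext fun l => by
    simp only [seg, prefixRoot]; split_ifs <;> first | omega | norm_num)
  y_first := H.sends_y_first hΦ
  negative := H.crystalRel.negativeFormula H.toWeightData hΦ

theorem typeALastFormula (hi : (i : ℕ) + 1 = n) {Φ : (A n hn).vertices → (A n hn).vertices ×
    (A n hn).vertices} (H : ChainData (A n hn) i fun k => n - 1 - k)
    (hΦ : ∀ b, FullRel (ChainRel (A n hn) i fun k => n - 1 - k) b (Φ b)) :
    TypeALastFormula (A n hn) i Φ where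
  x j k hj hjk hk := by
    have hr : (A n hn).rank = n := rfl
    refine H.sends_other hΦ ⟨k - 1, by omega⟩ (H.isWeight_seg hj hjk (by omega))
      (seg_nonneg j k) ?_ (fun v hv => ?_) (fun h => ?_) (funext fun l => ?_) (funext fun l => ?_)
    · rw [seg, if_pos (by simp only; omega)]; norm_num
    · exact if_neg (by simp only at hv; omega)
    · have := congrArg Fin.val h; simp only at this; omega
    · have hl := l.2
      simp only [seg, prefixRoot, Pi.add_apply]; split_ifs <;> first | omega | norm_num
    · have hl := l.2
      simp only [seg, prefixRoot]; split_ifs <;> first | omega | norm_num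
  x_last j hj hjn := H.sends_first hΦ (H.isWeight_seg hj hjn le_rfl) (seg_nonneg j _) (by
    have hr : (A n hn).rank = n := rfl
    rw [seg, if_pos (by omega)]; norm_num)
  y j hji := H.sends_y hΦ j hji (funext fun l => by
    have hr : (A n hn).rank = n := rfl
    have hl := l.2
    have hj := j.2
    simp only [seg, prefixRoot]; split_ifs <;> first | omega | norm_num)
  y_last := H.sends_y_first hΦ
  negative := H.crystalRel.negativeFormula H.toWeightData hΦ

end TypeA

end AffineType


namespace AffineType

open Crystal

/-! ### Type `C` -/

section TypeC

variable {n : ℕ} {hn : 2 ≤ n}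

theorem finCartan_C (j k : Fin (C n hn).rank) : (C n hn).finCartan j k =
    if (j : ℕ) + 2 = n ∧ (k : ℕ) + 1 = n then -2 else chainEntry j k := by
  have hj : (j : ℕ) < n := j.2
  have hk : (k : ℕ) < n := k.2
  simp only [finCartan, cartan, entry, chainEntry, Matrix.of_apply, Fin.val_succ,
    Nat.add_eq_zero_iff, one_ne_zero, and_false, false_or]
  split_ifs <;> omega

theorem formData_C {i : Fin (C n hn).rank} (hi : (i : ℕ) = 0) :
    FormData (C n hn) i fun k => if (k : ℕ) + 1 = n then 2 else 1 := by
  have hr : (C n hn).rank = n := rfl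
  have hsum : ∀ j : Fin (C n hn).rank, ∑ k : Fin (C n hn).rank,
      (C n hn).finCartan j k * ((C n hn).mark (k + 1) : ℤ) = if (j : ℕ) = 0 then 2 else 0 := by
    intro j
    have hj : (j : ℕ) < n := j.2
    rw [sum_chain (fun k => ((C n hn).mark (k + 1) : ℤ)) j j j.2 j.2
      (if (j : ℕ) + 2 = n then -2 else -1) (-1) 0 fun k => by
        rw [finCartan_C]; simp only [chainEntry]; split_ifs <;> omega]
    simp only [mark, Nat.add_eq_zero_iff, one_ne_zero, and_false, false_or]
    split_ifs <;> omega
  refine formData_of rfl (fun j => ?_) (fun j => ?_) (fun j k hjk => ?_) (fun j k => ?_) ?_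
    (fun j => ?_) ⟨fun k => k, fun k hk => ?_⟩
  · split_ifs <;> norm_num
  · simp only [finCartan_C, chainEntry]; split_ifs <;> omega
  · have := Fin.val_ne_of_ne hjk
    simp only [finCartan_C, chainEntry]; split_ifs <;> omega
  · simp only [finCartan_C, chainEntry]
    split_ifs <;> omega
  · rw [hsum, if_pos hi]; norm_num
  · rw [hsum]; split_ifs <;> norm_num
  · have hki := Fin.val_ne_of_ne hk
    refine ⟨⟨k - 1, by omega⟩, fun h => ?_, ?_, ?_⟩
    · have := congrArg Fin.val h; simp only at this; omega
    · simp only [finCartan_C, chainEntry]; split_ifs <;> omega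
    · simp only; omega

/-- The sum of the first `k` coordinates of a weight in the orthogonal basis `ε_1, …, ε_n`. -/
def partialSum (μ : (C n hn).Weight) (k : ℕ) : ℚ :=
  if k = 0 then 0 else if k < n then coeff μ (k - 1) else 2 * coeff μ (n - 1)

/-- The coordinates of a weight in the orthogonal basis `ε_1, …, ε_n`, numbered from `0`. -/
def coord (μ : (C n hn).Weight) (l : ℕ) : ℚ := partialSum μ (l + 1) - partialSum μ l

/-- The sum of the absolute values of the coordinates. -/
def taxicab (μ : (C n hn).Weight) : ℚ := ∑ l ∈ Finset.range n, |coord μ l|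

theorem partialSum_zero (μ : (C n hn).Weight) : partialSum μ 0 = 0 := rfl

theorem partialSum_add_one (μ : (C n hn).Weight) (k : ℕ) :
    partialSum μ (k + 1) = if k + 1 < n then coeff μ k else 2 * coeff μ (n - 1) :=
  if_neg (Nat.succ_ne_zero k)

theorem partialSum_succ (μ : (C n hn).Weight) (k : Fin (C n hn).rank) (h : (k : ℕ) + 1 < n) :
    partialSum μ (k + 1) = μ k := by
  rw [partialSum, if_neg (by omega), if_pos h, Nat.add_sub_cancel, coeff_val]

/-- With `α_k = ε_k - ε_{k+1}` for `k < n` and `α_n = 2ε_n`, the coefficient at `α_k` is the sum of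
the first `k` coordinates, except that the last one is half of the total. -/
theorem partialSum_last (μ : (C n hn).Weight) (k : Fin (C n hn).rank) (h : (k : ℕ) + 1 = n) :
    partialSum μ (k + 1) = 2 * μ k := by
  rw [partialSum, if_neg (by omega), if_neg (by omega), ← coeff_val μ k,
    show n - 1 = (k : ℕ) by omega]

theorem coeff_add (μ ν : (C n hn).Weight) (k : ℕ) : coeff (μ + ν) k = coeff μ k + coeff ν k := by
  simp only [coeff]; split_ifs <;> simp

theorem coeff_neg (μ : (C n hn).Weight) (k : ℕ) : coeff (-μ) k = -coeff μ k := by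
  simp only [coeff]; split_ifs <;> simp

theorem coeff_smul (c : ℚ) (μ : (C n hn).Weight) (k : ℕ) : coeff (c • μ) k = c * coeff μ k := by
  simp only [coeff]; split_ifs <;> simp

theorem coord_sub_smul (μ ν : (C n hn).Weight) (c : ℚ) (l : ℕ) :
    coord (μ - c • ν) l = coord μ l - c * coord ν l := by
  rw [sub_eq_add_neg]
  simp only [coord, partialSum, coeff_add, coeff_neg, coeff_smul]
  split_ifs <;> ring

theorem coord_neg (μ : (C n hn).Weight) (l : ℕ) : coord (-μ) l = -coord μ l := by
  simp only [coord, partialSum, coeff_neg]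
  split_ifs <;> ring

theorem taxicab_neg (μ : (C n hn).Weight) : taxicab (-μ) = taxicab μ := by
  simp only [taxicab, coord_neg, abs_neg]

theorem coeff_simpleRoot (j : Fin (C n hn).rank) (k : ℕ) :
    coeff ((C n hn).simpleRoot j) k = if k = j then 1 else 0 := by
  have hj : (j : ℕ) < (C n hn).rank := j.2
  rw [coeff]
  split_ifs with h h' h'
  · rw [show (⟨k, h⟩ : Fin (C n hn).rank) = j from Fin.ext h', simpleRoot_self]
  · exact simpleRoot_of_ne fun h => h' (congrArg Fin.val h)
  · omega
  · rfl

theorem coord_simpleRoot (j : Fin (C n hn).rank) {l : ℕ} (hl : l < n) :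
    coord ((C n hn).simpleRoot j) l = (if l = j then if (j : ℕ) + 1 = n then 2 else 1 else 0) -
      if l = j + 1 then 1 else 0 := by
  have hj : (j : ℕ) < n := j.2
  rw [coord, partialSum_add_one]
  simp only [partialSum, coeff_simpleRoot]
  split_ifs <;> first | omega | norm_num

theorem pairing_C (μ : (C n hn).Weight) (j : Fin (C n hn).rank) (h : (j : ℕ) + 1 < n) :
    (C n hn).pairing j μ = coord μ j - coord μ (j + 1) := by
  rw [pairing_chain μ j (if (j : ℕ) + 2 = n then -2 else -1) (-1) fun k => by
    rw [finCartan_C]; simp only [chainEntry]; split_ifs <;> omega]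
  simp only [coord, partialSum_add_one, ← coeff_val μ j]
  simp only [partialSum]
  by_cases h1 : (j : ℕ) + 2 = n
  · rw [show n - 1 = (j : ℕ) + 1 by omega]
    split_ifs <;> first | omega | (push_cast; ring)
  · split_ifs <;> first | omega | (push_cast; ring)

theorem pairing_C_last (μ : (C n hn).Weight) (j : Fin (C n hn).rank) (h : (j : ℕ) + 1 = n) :
    (C n hn).pairing j μ = coord μ j := by
  rw [pairing_chain μ j (-1) (-1) fun k => by
    have hk : (k : ℕ) < n := k.2
    rw [finCartan_C]; simp only [chainEntry]; split_ifs <;> omega]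
  rw [coeff_of_le μ (k := j + 1) h.ge]
  rw [coord, partialSum_add_one, ← coeff_val μ j, partialSum]
  rw [show n - 1 = (j : ℕ) by omega]
  split_ifs <;> first | omega | (push_cast; ring)

theorem taxicab_sub (μ : (C n hn).Weight) (c : ℚ) (j : Fin (C n hn).rank)
    (h : (j : ℕ) + 1 < n) :
    taxicab (μ - c • (C n hn).simpleRoot j) - taxicab μ =
      |coord μ j - c| - |coord μ j| + (|coord μ (j + 1) + c| - |coord μ (j + 1)|) := by
  rw [taxicab, taxicab, ← Finset.sum_sub_distrib,
    Finset.sum_eq_add_of_mem (j : ℕ) (j + 1) (Finset.mem_range.2 (by omega))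
      (Finset.mem_range.2 h) (by omega)]
  · rw [coord_sub_smul, coord_sub_smul, coord_simpleRoot j h, coord_simpleRoot j (by omega)]
    simp [h.ne]
  · intro l hl hne
    rw [coord_sub_smul, coord_simpleRoot j (Finset.mem_range.1 hl), if_neg hne.1, if_neg hne.2]
    simp

theorem taxicab_sub_last (μ : (C n hn).Weight) (c : ℚ) (j : Fin (C n hn).rank)
    (h : (j : ℕ) + 1 = n) :
    taxicab (μ - c • (C n hn).simpleRoot j) - taxicab μ =
      |coord μ j - 2 * c| - |coord μ j| := by
  rw [taxicab, taxicab, ← Finset.sum_sub_distrib,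
    Finset.sum_eq_single_of_mem (j : ℕ) (Finset.mem_range.2 (by omega))]
  · rw [coord_sub_smul, coord_simpleRoot j (by omega)]
    simp [h, mul_comm, show (j : ℕ) ≠ n by omega]
  · intro l hl hne
    rw [coord_sub_smul, coord_simpleRoot j (Finset.mem_range.1 hl), if_neg hne,
      if_neg (by have := Finset.mem_range.1 hl; omega)]
    simp

/-- A reflection swaps two adjacent coordinates or changes the sign of the last one, so it preserves
the `ℓ¹`-norm. By convexity the points between a vector and its reflection have no larger norm. -/
theorem taxicab_string (μ : (C n hn).Weight) (c : ℚ) (j : Fin (C n hn).rank)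
    (hc : (0 ≤ c ∧ c ≤ (C n hn).pairing j μ) ∨ (c ≤ 0 ∧ (C n hn).pairing j μ ≤ c)) :
    taxicab (μ - c • (C n hn).simpleRoot j) ≤ taxicab μ := by
  have hj : (j : ℕ) < n := j.2
  rcases Nat.lt_or_ge ((j : ℕ) + 1) n with h | h
  · have key := taxicab_sub μ c j h
    rw [pairing_C μ j h] at hc
    have : |coord μ j - c| + |coord μ (j + 1) + c| ≤ |coord μ j| + |coord μ (j + 1)| := by
      rcases abs_cases (coord μ j - c) with h1 | h1 <;>
        rcases abs_cases (coord μ (j + 1) + c) with h2 | h2 <;>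
        rcases abs_cases (coord μ j) with h3 | h3 <;>
        rcases abs_cases (coord μ (j + 1)) with h4 | h4 <;>
        rcases hc with hc | hc <;> linarith
    linarith
  · have h : (j : ℕ) + 1 = n := by omega
    have key := taxicab_sub_last μ c j h
    rw [pairing_C_last μ j h] at hc
    have : |coord μ j - 2 * c| ≤ |coord μ j| := by
      rcases abs_cases (coord μ j - 2 * c) with h1 | h1 <;>
        rcases abs_cases (coord μ j) with h3 | h3 <;>
        rcases hc with hc | hc <;> linarith
    linarith

theorem abs_partialSum_sub_le (μ : (C n hn).Weight) {a b : ℕ} (h : a ≤ b) :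
    |partialSum μ b - partialSum μ a| ≤ ∑ l ∈ Finset.Ico a b, |coord μ l| := by
  have : partialSum μ b - partialSum μ a = ∑ l ∈ Finset.Ico a b, coord μ l :=
    (Finset.sum_Ico_sub _ h).symm
  rw [this]
  exact Finset.abs_sum_le_sum_abs _ _

/-- The `ℓ¹`-norm of the coordinates is the total variation of the partial sums. With the bound `2`
on weights, this limits how often coefficients can leave and return to zero. -/
theorem variation_le_taxicab (μ : (C n hn).Weight) {a b d : ℕ} (hab : a ≤ b) (hbd : b ≤ d)
    (hd : d ≤ n) : |partialSum μ a| + |partialSum μ b - partialSum μ a| +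
      |partialSum μ d - partialSum μ b| ≤ taxicab μ := by
  have h1 := abs_partialSum_sub_le μ (Nat.zero_le a)
  have h2 := abs_partialSum_sub_le μ hab
  have h3 := abs_partialSum_sub_le μ hbd
  rw [partialSum_zero, sub_zero] at h1
  have h4 : ∑ l ∈ Finset.Ico 0 d, |coord μ l| ≤ taxicab μ := by
    rw [taxicab, Finset.range_eq_Ico]
    exact Finset.sum_le_sum_of_subset_of_nonneg (Finset.Ico_subset_Ico_right hd)
      fun _ _ _ => abs_nonneg _
  rw [← Finset.sum_Ico_consecutive _ (Nat.zero_le b) hbd,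
    ← Finset.sum_Ico_consecutive _ (Nat.zero_le a) hab] at h4
  linarith

theorem abs_partialSum_le (μ : (C n hn).Weight) {a : ℕ} (h : a ≤ n) :
    |partialSum μ a| ≤ taxicab μ := by
  have := variation_le_taxicab μ le_rfl le_rfl h
  simpa using this

theorem theta_C (k : Fin (C n hn).rank) :
    theta (C n hn) k = if (k : ℕ) + 1 = n then 1 else 2 := by
  rw [theta_eq rfl]
  simp only [mark, Nat.add_eq_zero_iff, one_ne_zero, and_false, false_or]
  split_ifs <;> norm_num

theorem taxicab_of_monotone {μ : (C n hn).Weight} (h : ∀ l < n, 0 ≤ coord μ l) :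
    taxicab μ = partialSum μ n := by
  have h1 : ∑ l ∈ Finset.range n, coord μ l = partialSum μ n - partialSum μ 0 :=
    Finset.sum_range_sub _ n
  rw [partialSum_zero, sub_zero] at h1
  rw [← h1]
  exact Finset.sum_congr rfl fun l hl => abs_of_nonneg (h l (Finset.mem_range.1 hl))

theorem doubleSeg_apply {j k : ℕ} (hj : 1 ≤ j) (hjk : j ≤ k) (hk : k + 1 ≤ n)
    (l : Fin (C n hn).rank) : doubleSeg (C n hn) j k l =
      if (l : ℕ) + 1 < j then 0 else if (l : ℕ) + 1 < k ∨ (l : ℕ) + 1 = n then 1 else 2 := by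
  have hr : (C n hn).rank = n := rfl
  have hl : (l : ℕ) < n := l.2
  simp only [doubleSeg, seg, Pi.add_apply, Pi.smul_apply, smul_eq_mul]
  split_ifs <;> first | omega | norm_num

theorem partialSum_doubleSeg {j k : ℕ} (hj : 1 ≤ j) (hjk : j ≤ k) (hk : k + 1 ≤ n) {l : ℕ}
    (hl : l ≤ n) : partialSum (doubleSeg (C n hn) j k) l =
      if l < j then 0 else if l < k then 1 else 2 := by
  rcases l with _ | l
  · rw [partialSum_zero, if_pos (by omega)]
  · rcases hl.eq_or_lt with h | h
    · rw [show l = ((⟨l, hl⟩ : Fin (C n hn).rank) : ℕ) from rfl, partialSum_last _ _ h,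
        doubleSeg_apply hj hjk hk]
      simp only
      split_ifs <;> first | omega | norm_num
    · rw [show l = ((⟨l, hl⟩ : Fin (C n hn).rank) : ℕ) from rfl, partialSum_succ _ _ h,
        doubleSeg_apply hj hjk hk]
      simp only
      split_ifs <;> first | omega | norm_num

theorem taxicab_doubleSeg {j k : ℕ} (hj : 1 ≤ j) (hjk : j ≤ k) (hk : k + 1 ≤ n) :
    taxicab (doubleSeg (C n hn) j k) = 2 := by
  rw [taxicab_of_monotone fun l hl => ?_, partialSum_doubleSeg hj hjk hk le_rfl,
    if_neg (by omega), if_neg (by omega)]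
  rw [coord, partialSum_doubleSeg hj hjk hk hl, partialSum_doubleSeg hj hjk hk hl.le]
  split_ifs <;> first | omega | norm_num

theorem theta_eq_doubleSeg : theta (C n hn) = doubleSeg (C n hn) 1 1 := by
  funext l
  rw [doubleSeg_apply le_rfl le_rfl hn, theta_C, if_neg (show ¬(l : ℕ) + 1 < 1 by omega)]
  split_ifs <;> first | omega | rfl

/-- The condition is stable under reflections, and each partial sum is bounded by the norm, so every
vector satisfying it lies below `θ`. No separate argument for dominant vectors is needed. -/
theorem isWeight_C_iff (μ : (C n hn).Weight) :
    (C n hn).IsWeight μ ↔ Integral μ ∧ taxicab μ ≤ 2 := by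
  have hr : (C n hn).rank = n := rfl
  have D : FormData (C n hn) ⟨0, by omega⟩ _ := formData_C rfl
  have hle : ∀ μ : (C n hn).Weight, Integral μ ∧ taxicab μ ≤ 2 → μ ≤ theta (C n hn) := by
    intro μ h k
    have h1 := (abs_partialSum_le μ (show (k : ℕ) + 1 ≤ n from k.2)).trans h.2
    have h2 := (le_abs_self _).trans h1
    rw [theta_C]
    split_ifs with hk
    · rw [partialSum_last μ k hk] at h2; linarith
    · rwa [partialSum_succ μ k (by have := k.2; omega)] at h2
  refine ⟨fun h => ⟨h.integral D.theta_integral, ?_⟩, fun h => (D.isWeight_of_closed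
    (S := fun μ => Integral μ ∧ taxicab μ ≤ 2) (fun μ h => h.1) (fun μ j h hp => ⟨?_, ?_⟩)
    ⟨∑ k, theta (C n hn) k, fun μ h => Finset.sum_le_sum fun k _ => hle μ h k⟩
    (fun μ h _ => hle μ h) h).1⟩
  · induction h with
    | highest => rw [theta_eq_doubleSeg, taxicab_doubleSeg le_rfl le_rfl hn]
    | string μ j k _ hk ih => exact (taxicab_string μ k j (by exact_mod_cast hk)).trans ih
  · obtain ⟨z, hz⟩ := h.1.pairing j
    rw [hz]
    exact h.1.sub ((integral_simpleRoot j).zsmul z)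
  · exact (taxicab_string μ _ j (Or.inr ⟨hp.le, le_rfl⟩)).trans h.2

theorem Integral.one_le_abs {t : AffineType} {μ : t.Weight} (h : Integral μ) {k : Fin t.rank}
    (hk : μ k ≠ 0) : 1 ≤ |μ k| := by
  rcases lt_or_gt_of_ne hk with h1 | h1
  · have := h.neg.one_le (j := k) (by rw [Pi.neg_apply]; linarith)
    rw [abs_of_neg h1]; exact this
  · rw [abs_of_pos h1]; exact h.one_le h1

theorem exists_partialSum_eq (μ : (C n hn).Weight) (k : Fin (C n hn).rank) :
    ∃ c : ℚ, 1 ≤ c ∧ partialSum μ (k + 1) = c * μ k := by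
  have hk : (k : ℕ) < n := k.2
  rcases Nat.lt_or_ge ((k : ℕ) + 1) n with h | h
  · exact ⟨1, le_rfl, by rw [partialSum_succ μ k h, one_mul]⟩
  · exact ⟨2, by norm_num, partialSum_last μ k (by omega)⟩

/-- A positive and a negative coefficient would make the partial sums reach absolute value `1` and
then travel at least `2` further, a variation of at least `3`. The multiple `c α_j` has norm `2|c|`.
-/
theorem weightData_C : WeightData (C n hn) := by
  have hr : (C n hn).rank = n := rfl
  have D : FormData (C n hn) ⟨0, by omega⟩ _ := formData_C rfl
  have hsign : ∀ μ : (C n hn).Weight, (C n hn).IsWeight μ → ∀ j k, 0 < μ j → μ k < 0 →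
      False := by
    intro μ hμ j k hj hk
    rw [isWeight_C_iff] at hμ
    have h1 := hμ.1.one_le hj
    have h2 := hμ.1.neg.one_le (j := k) (by rw [Pi.neg_apply]; linarith)
    rw [Pi.neg_apply] at h2
    obtain ⟨c, hc, hc'⟩ := exists_partialSum_eq μ j
    obtain ⟨d, hd, hd'⟩ := exists_partialSum_eq μ k
    have h3 : 1 ≤ partialSum μ (j + 1) := by rw [hc']; nlinarith
    have h4 : partialSum μ (k + 1) ≤ -1 := by rw [hd']; nlinarith
    have hj' : (j : ℕ) < n := j.2
    have hk' : (k : ℕ) < n := k.2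
    rcases le_total (j : ℕ) k with h | h
    · have h5 := variation_le_taxicab μ (Nat.succ_le_succ h) le_rfl hk'
      have h6 := le_abs_self (partialSum μ (j + 1))
      have h7 := neg_le_abs (partialSum μ (k + 1) - partialSum μ (j + 1))
      simp only [Nat.succ_eq_add_one, sub_self, abs_zero, add_zero] at h5
      linarith
    · have h5 := variation_le_taxicab μ (Nat.succ_le_succ h) le_rfl hj'
      have h6 := neg_le_abs (partialSum μ (k + 1))
      have h7 := le_abs_self (partialSum μ (j + 1) - partialSum μ (k + 1))
      simp only [Nat.succ_eq_add_one, sub_self, abs_zero, add_zero] at h5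
      linarith
  refine D.weightData_of (fun μ hμ => ?_) (fun μ hμ => ?_) (fun j c h => ?_) (fun μ hμ k => ?_)
  · rw [isWeight_C_iff] at hμ ⊢
    exact ⟨hμ.1.neg, by rw [taxicab_neg]; exact hμ.2⟩
  · by_contra hcon
    rw [not_or, Pi.le_def, Pi.le_def] at hcon
    push Not at hcon
    obtain ⟨⟨j, hj⟩, k, hk⟩ := hcon
    exact hsign μ hμ k j hk hj
  · have hj : (j : ℕ) < n := j.2
    have h2 := ((isWeight_C_iff _).1 h).2
    rcases Nat.lt_or_ge ((j : ℕ) + 1) n with h | h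
    · have h3 := variation_le_taxicab (c • (C n hn).simpleRoot j) (Nat.le_succ (j + 1)) le_rfl h
      have h4 : partialSum (c • (C n hn).simpleRoot j) (j + 1) = c := by
        rw [partialSum_succ _ _ h, Pi.smul_apply, simpleRoot_self, smul_eq_mul, mul_one]
      have h5 : partialSum (c • (C n hn).simpleRoot j) (j + 2) = 0 := by
        obtain ⟨d, -, hd⟩ := exists_partialSum_eq (c • (C n hn).simpleRoot j) ⟨j + 1, h⟩
        rw [hd, Pi.smul_apply, simpleRoot_of_ne (fun h => by
          have := congrArg Fin.val h; simp only at this; omega)]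
        simp
      simp only [Nat.succ_eq_add_one, add_assoc, Nat.reduceAdd] at h3
      rw [h4, h5, zero_sub, abs_neg, sub_self, abs_zero] at h3
      linarith [le_abs_self c]
    · have h3 := (le_abs_self _).trans
        ((abs_partialSum_le (c • (C n hn).simpleRoot j) (show (j : ℕ) + 1 ≤ n from hj)).trans h2)
      rw [partialSum_last _ _ (by omega), Pi.smul_apply, simpleRoot_self, smul_eq_mul,
        mul_one] at h3
      linarith
  · have h := (isWeight_C_iff μ).1 hμ
    have h1 := (abs_partialSum_le μ (show (k : ℕ) + 1 ≤ n from k.2)).trans h.2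
    have h2 := (le_abs_self _).trans h1
    rw [theta_C]
    split_ifs with hk
    · rw [partialSum_last μ k hk] at h2; linarith
    · rwa [partialSum_succ μ k (by have := k.2; omega)] at h2

theorem chainData_C {i : Fin (C n hn).rank} (hi : (i : ℕ) = 0) :
    ChainData (C n hn) i fun k => k := by
  have hr : (C n hn).rank = n := rfl
  have W : WeightData (C n hn) := weightData_C
  refine { W with
    injective := Fin.val_injective
    pos_i := hi
    exists_pos := fun m d hd => ⟨⟨d, hd.trans_lt m.2⟩, rfl⟩
    isWeight_simpleRoot := fun j => ?_
    joined_iff := fun j k hjk => ?_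
    simple_edge := fun j k m hj hk h => ?_
    remove := fun γ u hW h0 hu hz _ => ?_
    no_gap := fun γ u v w hW huv hvw hu hw hv => ?_
    theta_i := ?_ }
  · rw [isWeight_C_iff]
    refine ⟨integral_simpleRoot j, ?_⟩
    have hj : (j : ℕ) < n := j.2
    have h0 : ∀ l, coord (0 : (C n hn).Weight) l = 0 := fun l => by
      simp [coord, partialSum, coeff]
    have h1 : taxicab (0 : (C n hn).Weight) = 0 := by simp [taxicab, h0]
    rw [← taxicab_neg]
    rcases Nat.lt_or_ge ((j : ℕ) + 1) n with h | h
    · have := taxicab_sub 0 1 j h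
      simp only [h0, h1] at this
      norm_num at this
      rw [this]
    · have := taxicab_sub_last 0 1 j (by omega)
      simp only [h0, h1] at this
      norm_num at this
      rw [this]
  · have := Fin.val_ne_of_ne hjk
    simp only [finCartan_C, chainEntry]; split_ifs <;> simp <;> omega
  · have hm := m.2
    simp only [finCartan_C, chainEntry]; split_ifs <;> omega
  -- The partial sum before `u` vanishes, so the coordinate at `u` is `γ_u ≥ 1`, or `2γ_u` at the
  -- end. Subtracting `α_u` lowers it by `1`, respectively `2`, and adds at most `1` to the absolute
  -- value of the next coordinate, which exists only in the first case.
  · rw [isWeight_C_iff] at hW ⊢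
    refine ⟨hW.1.sub (integral_simpleRoot u), le_trans ?_ hW.2⟩
    have hun : (u : ℕ) < n := u.2
    have hu1 := hW.1.one_le (lt_of_le_of_ne (h0 u) (Ne.symm hu))
    have hp : partialSum γ u = 0 := by
      rcases Nat.eq_zero_or_pos (u : ℕ) with h | h
      · rw [h, partialSum_zero]
      · have h1 : (u : ℕ) - 1 < n := by omega
        have h2 := partialSum_succ γ ⟨u - 1, h1⟩ (by simp only; omega)
        rw [hz _ (by simp only; omega)] at h2
        rwa [Nat.sub_add_cancel h] at h2
    rcases Nat.lt_or_ge ((u : ℕ) + 1) n with h | h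
    · have key := taxicab_sub γ 1 u h
      have hc : coord γ u = γ u := by rw [coord, hp, partialSum_succ γ u h, sub_zero]
      rw [one_smul, hc, abs_of_nonneg (show 0 ≤ γ u - 1 by linarith),
        abs_of_nonneg (show 0 ≤ γ u by linarith)] at key
      have := abs_add_le (coord γ (u + 1)) 1
      rw [abs_one] at this
      linarith
    · have key := taxicab_sub_last γ 1 u (by omega)
      have hc : coord γ u = 2 * γ u := by
        rw [coord, hp, partialSum_last γ u (by omega), sub_zero]
      rw [one_smul, hc, abs_of_nonneg (show 0 ≤ 2 * γ u - 2 * 1 by linarith),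
        abs_of_nonneg (show 0 ≤ 2 * γ u by linarith)] at key
      linarith
  -- With a gap the partial sums go from `0` to absolute value at least `1`, back to `0` and out
  -- again: a variation of at least `3`.
  · rw [isWeight_C_iff] at hW
    have hle := hW.2
    have hle' := variation_le_taxicab γ (Nat.succ_le_succ huv.le) (Nat.succ_le_succ hvw.le) w.2
    obtain ⟨c, hc, hc'⟩ := exists_partialSum_eq γ u
    obtain ⟨d, -, hd'⟩ := exists_partialSum_eq γ v
    obtain ⟨e, he, he'⟩ := exists_partialSum_eq γ w
    have h1 := hW.1.one_le_abs hu
    have h2 := hW.1.one_le_abs hw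
    simp only [Nat.succ_eq_add_one] at hle'
    rw [hc', hd', he', hv, mul_zero, zero_sub, sub_zero, abs_neg, abs_mul, abs_mul,
      abs_of_pos (show 0 < c by linarith), abs_of_pos (show 0 < e by linarith)] at hle'
    nlinarith
  · rw [theta_C]
    split_ifs <;> norm_num

theorem isWeight_doubleSeg {j k : ℕ} (hj : 1 ≤ j) (hjk : j ≤ k) (hk : k + 1 ≤ n) :
    (C n hn).IsWeight (doubleSeg (C n hn) j k) := by
  refine (isWeight_C_iff _).2 ⟨fun l => ?_, (taxicab_doubleSeg hj hjk hk).le⟩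
  rw [doubleSeg_apply hj hjk hk]
  split_ifs
  exacts [⟨0, by norm_num⟩, ⟨1, by norm_num⟩, ⟨2, by norm_num⟩]

theorem doubleSeg_nonneg {j k : ℕ} (hj : 1 ≤ j) (hjk : j ≤ k) (hk : k + 1 ≤ n) :
    0 ≤ doubleSeg (C n hn) j k := fun l => by
  rw [doubleSeg_apply hj hjk hk, Pi.zero_apply]
  split_ifs <;> norm_num

theorem typeCFormula {i : Fin (C n hn).rank} (hi : (i : ℕ) = 0)
    {Φ : (C n hn).vertices → (C n hn).vertices × (C n hn).vertices}
    (hΦ : ∀ b, FullRel (ChainRel (C n hn) i fun k => k) b (Φ b)) :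
    TypeCFormula (C n hn) i Φ := by
  have hr : (C n hn).rank = n := rfl
  have H := chainData_C hi
  have hseg : ∀ {j k : ℕ}, 1 ≤ j → j ≤ k → k ≤ n → (C n hn).IsWeight (seg (C n hn) j k) :=
    isWeight_seg H.toWeightData H.isWeight_simpleRoot fun j k h => by
      rw [finCartan_C, if_neg (by omega), chainEntry, if_neg (by omega), if_pos (Or.inr h)]
      norm_num
  exact {
    x_double := fun j k hj hjk hk => by
      rw [hr] at hk
      refine H.sends_other hΦ ⟨j - 1, by omega⟩ (isWeight_doubleSeg (by omega) hjk hk)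
        (doubleSeg_nonneg (by omega) hjk hk) ?_ (fun v hv => ?_) (fun h => ?_)
        (funext fun l => ?_) (funext fun l => ?_)
      · rw [doubleSeg_apply (by omega) hjk hk, if_neg (by simp only; omega)]
        split_ifs <;> norm_num
      · rw [doubleSeg_apply (by omega) hjk hk]
        exact if_pos (by simp only at hv; omega)
      · have := congrArg Fin.val h; simp only at this; omega
      · rw [Pi.add_apply, doubleSeg_apply (by omega) hjk hk,
          doubleSeg_apply le_rfl (by omega) hk]
        simp only [prefixRoot]; split_ifs <;> first | omega | norm_num
      · simp only [seg, prefixRoot]; split_ifs <;> first | omega | norm_num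
    x_double_first := fun k hk hkn => by
      rw [hr] at hkn
      refine H.sends_first hΦ (isWeight_doubleSeg le_rfl hk hkn)
        (doubleSeg_nonneg le_rfl hk hkn) ?_
      rw [doubleSeg_apply le_rfl hk hkn, if_neg (by omega)]
      split_ifs <;> norm_num
    x := fun j k hj hjk hk => by
      refine H.sends_other hΦ ⟨j - 1, by omega⟩ (hseg (by omega) hjk hk)
        (seg_nonneg j k) ?_ (fun v hv => ?_) (fun h => ?_) (funext fun l => ?_)
        (funext fun l => ?_)
      · rw [seg, if_pos (by simp only; omega)]; norm_num
      · exact if_neg (by simp only at hv; omega)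
      · have := congrArg Fin.val h; simp only at this; omega
      · simp only [seg, prefixRoot, Pi.add_apply]; split_ifs <;> first | omega | norm_num
      · simp only [seg, prefixRoot]; split_ifs <;> first | omega | norm_num
    x_first := fun k hk hkn => H.sends_first hΦ (hseg le_rfl hk hkn) (seg_nonneg 1 k) (by
      rw [seg, if_pos (by omega)]; norm_num)
    y := fun j hji => H.sends_y hΦ j hji (funext fun l => by
      simp only [seg, prefixRoot]; split_ifs <;> first | omega | norm_num)
    y_first := H.sends_y_first hΦ
    negative := H.crystalRel.negativeFormula H.toWeightData hΦ }

end TypeC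

end AffineType


open AffineType Crystal

namespace AffineType

/-! ### The two types without weights that are simple roots at the vertices joined to `0` -/

/-- The coefficient of `θ` at `α_n` is `1/2`, and strings change it by integers, so no weight is
integral. -/
theorem A2Even.not_isWeight_simpleRoot {n : ℕ} {hn : 1 ≤ n} (i : Fin (A2Even n hn).rank) :
    ¬ (A2Even n hn).IsWeight ((A2Even n hn).simpleRoot i) := by
  obtain ⟨l, hl⟩ : ∃ l : Fin (A2Even n hn).rank, (l : ℕ) + 1 = n :=
    ⟨⟨n - 1, Nat.sub_lt hn one_pos⟩, Nat.sub_add_cancel hn⟩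
  have key : ∀ μ : (A2Even n hn).Weight, (A2Even n hn).IsWeight μ →
      ∃ z : ℤ, μ l = z + 1 / 2 := by
    intro μ hμ
    induction hμ with
    | highest =>
      refine ⟨0, ?_⟩
      simp only [theta, mark]
      rw [if_pos hl, if_neg (by omega)]
      norm_num
    | string μ j k _ _ ih =>
      obtain ⟨z, hz⟩ := ih
      obtain ⟨w, hw⟩ := integral_simpleRoot j l
      refine ⟨z - k * w, ?_⟩
      rw [Pi.sub_apply, Pi.smul_apply, smul_eq_mul, hz, hw]
      push_cast
      ring
  intro h
  obtain ⟨z, hz⟩ := key _ h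
  obtain ⟨w, hw⟩ := integral_simpleRoot i l
  rw [hw] at hz
  have : 2 * w = 2 * z + 1 := by
    have : (2 * w : ℚ) = 2 * z + 1 := by linarith
    exact_mod_cast this
  omega

theorem finCartan_D2 (n : ℕ) (hn : 2 ≤ n) (j k : Fin (D2 n hn).rank) :
    (D2 n hn).finCartan j k =
      if (j : ℕ) + 1 = n ∧ (k : ℕ) + 2 = n then -2 else chainEntry j k := by
  have hj : (j : ℕ) < n := j.2
  have hk : (k : ℕ) < n := k.2
  simp only [finCartan, cartan, entry, chainEntry, Matrix.of_apply, Fin.val_succ,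
    Nat.add_eq_zero_iff, one_ne_zero, and_false, false_and, false_or]
  split_ifs <;> omega

/-- The simple root at `i` is too long: its squared length is `4`, whereas `θ` has `(θ, θ) = s_i θ_i
= 2`. -/
theorem D2.not_isWeight_simpleRoot {n : ℕ} {hn : 2 ≤ n} {i : Fin (D2 n hn).rank}
    (hi : (i : ℕ) = 0) : ¬ (D2 n hn).IsWeight ((D2 n hn).simpleRoot i) := by
  have hr : (D2 n hn).rank = n := rfl
  have hsum : ∀ j : Fin (D2 n hn).rank, ∑ k : Fin (D2 n hn).rank,
      (D2 n hn).finCartan j k * ((D2 n hn).mark (k + 1) : ℤ) = if j = i then 1 else 0 := by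
    intro j
    rw [sum_chain (fun k => ((D2 n hn).mark (k + 1) : ℤ)) j j j.2 j.2 (-1)
      (if (j : ℕ) + 1 = n then -2 else -1) 0 fun k => by
        rw [finCartan_D2]; simp only [chainEntry]; split_ifs <;> omega]
    have hj : (j : ℕ) < n := j.2
    simp only [mark, Fin.ext_iff, hi]
    split_ifs <;> omega
  have D : FormData (D2 n hn) i fun k => if (k : ℕ) + 1 = n then 1 else 2 := by
    refine formData_of rfl (fun j => ?_) (fun j => ?_) (fun j k hjk => ?_) (fun j k => ?_) ?_
      (fun j => ?_) ⟨fun k => k, fun k hk => ?_⟩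
    · split_ifs <;> norm_num
    · simp only [finCartan_D2, chainEntry]; split_ifs <;> omega
    · have := Fin.val_ne_of_ne hjk
      simp only [finCartan_D2, chainEntry]; split_ifs <;> omega
    · simp only [finCartan_D2, chainEntry]
      split_ifs <;> omega
    · rw [hsum, if_pos rfl]; norm_num
    · rw [hsum]; split_ifs <;> norm_num
    · have hki := Fin.val_ne_of_ne hk
      refine ⟨⟨k - 1, by omega⟩, fun h => ?_, ?_, ?_⟩
      · have := congrArg Fin.val h; simp only at this; omega
      · simp only [finCartan_D2, chainEntry]; split_ifs <;> omega
      · simp only; omega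
  intro h
  have h1 := D.form_self_le h
  rw [form_simpleRoot_left, D.pairing_simpleRoot_self,
    D.form_theta (by rw [pairing_theta_eq rfl, hsum, if_pos rfl]; norm_num)
      (fun j hj => by rw [pairing_theta_eq rfl, hsum, if_neg hj]; norm_num),
    theta_eq rfl, if_neg (by omega)] at h1
  norm_num [mark] at h1

/-! ### Vertices joined to `0` -/

theorem cartan_zero_succ (t : AffineType) (i : Fin t.rank) :
    t.cartan 0 i.succ = t.entry 0 (i + 1) := rfl

variable {n : ℕ}

theorem val_eq_of_joined_A {hn : 1 ≤ n} {i : Fin (A n hn).rank}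
    (h : (A n hn).cartan 0 i.succ ≠ 0) : (i : ℕ) = 0 ∨ (i : ℕ) + 1 = n := by
  have hi : (i : ℕ) < n := i.2
  simp only [cartan_zero_succ, entry, chainEntry, true_and, and_false, or_false,
    Nat.add_eq_zero_iff, one_ne_zero] at h
  split_ifs at h <;> first | omega | contradiction

theorem val_eq_of_joined_B {hn : 3 ≤ n} {i : Fin (B n hn).rank}
    (h : (B n hn).cartan 0 i.succ ≠ 0) : (i : ℕ) = 1 := by
  simp only [cartan_zero_succ, entry, forkEntry, true_and, and_false, or_false,
    Nat.add_eq_zero_iff, one_ne_zero] at h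
  split_ifs at h <;> first | omega | contradiction

theorem val_eq_of_joined_C {hn : 2 ≤ n} {i : Fin (C n hn).rank}
    (h : (C n hn).cartan 0 i.succ ≠ 0) : (i : ℕ) = 0 := by
  simp only [cartan_zero_succ, entry, chainEntry, and_false, or_false, false_or,
    Nat.add_eq_zero_iff, one_ne_zero] at h
  split_ifs at h <;> first | omega | contradiction

theorem val_eq_of_joined_D {hn : 4 ≤ n} {i : Fin (D n hn).rank}
    (h : (D n hn).cartan 0 i.succ ≠ 0) : (i : ℕ) = 1 := by
  simp only [cartan_zero_succ, entry, forkEntry, true_and, and_false, or_false,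
    Nat.add_eq_zero_iff, one_ne_zero] at h
  split_ifs at h <;> first | omega | contradiction

theorem val_eq_of_joined_A2Odd {hn : 3 ≤ n} {i : Fin (A2Odd n hn).rank}
    (h : (A2Odd n hn).cartan 0 i.succ ≠ 0) : (i : ℕ) = 1 := by
  simp only [cartan_zero_succ, entry, forkEntry, true_and, and_false, or_false,
    Nat.add_eq_zero_iff, one_ne_zero] at h
  split_ifs at h <;> first | omega | contradiction

theorem val_eq_of_joined_D2 {hn : 2 ≤ n} {i : Fin (D2 n hn).rank}
    (h : (D2 n hn).cartan 0 i.succ ≠ 0) : (i : ℕ) = 0 := by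
  simp only [cartan_zero_succ, entry, chainEntry, true_and, and_false, or_false,
    Nat.add_eq_zero_iff, one_ne_zero] at h
  split_ifs at h <;> first | omega | contradiction

/-! ### The isomorphisms -/

/-- The conclusion of the main theorem. -/
def HasExplicitIso (t : AffineType) (i : Fin t.rank) : Prop :=
  ∀ hi : t.simpleRoot i ∈ t.positiveWeights,
    ∃ Ψ : Crystal.Iso t.thetaCrystal
        ((t.thetaCrystal.tensor t.thetaCrystal).componentCrystal (t.xTheta, t.yVertex i hi)),
      t.ExplicitFormula i (fun b => (Ψ.toEquiv b : t.vertices × t.vertices)) ∧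
      Crystal.IsStrictMorphism (t.thetaCrystal.tensor t.thetaCrystal) t.thetaCrystal
        Ψ.inverseByZero

theorem GradedData.hasExplicitIso {t : AffineType} {i j : Fin t.rank} (G : GradedData t j)
    (hij : i = j) (hA : ¬ t.IsTypeA) (hC : ¬ t.IsTypeC) : t.HasExplicitIso i := by
  subst hij
  intro hi
  obtain ⟨Ψ, hΨ, hstrict⟩ := G.crystalRel.exists_iso G.toWeightData hi
  exact ⟨Ψ, ⟨fun _ _ => G.gradedFormula hΨ, fun h => absurd h hA, fun h => absurd h hA,
    fun h => absurd h hC⟩, hstrict⟩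

theorem hasExplicitIso_A {hn : 1 ≤ n} {i : Fin (A n hn).rank} (h : (i : ℕ) = 0 ∨ (i : ℕ) + 1 = n) :
    (A n hn).HasExplicitIso i := by
  intro hi
  by_cases h0 : (i : ℕ) = 0
  · have H : ChainData (A n hn) i fun k => k :=
      IsChainPos.chainData ⟨h0, Or.inl fun _ => rfl⟩
    obtain ⟨Ψ, hΨ, hstrict⟩ := H.crystalRel.exists_iso H.toWeightData hi
    refine ⟨Ψ, ⟨fun h => absurd trivial h, fun _ _ => typeAFirstFormula h0 H hΨ,
      fun _ h1 => ?_, fun h => h.elim⟩, hstrict⟩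
    -- Only `n = 1` is left: the two ends of the chain coincide, and so do the two position
    -- functions.
    have h1 : (i : ℕ) + 1 = n := h1
    have hpos : (fun k => k : Fin (A n hn).rank → ℕ) =
        (fun k => n - 1 - k : Fin (A n hn).rank → ℕ) :=
      funext fun k => by
        have hk : (k : ℕ) < n := k.2
        omega
    rw [hpos] at H hΨ
    exact typeALastFormula h1 H hΨ
  · have h1 := h.resolve_left h0
    have H : ChainData (A n hn) i fun k => n - 1 - k :=
      IsChainPos.chainData ⟨by omega, Or.inr fun _ => rfl⟩
    obtain ⟨Ψ, hΨ, hstrict⟩ := H.crystalRel.exists_iso H.toWeightData hi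
    exact ⟨Ψ, ⟨fun h => absurd trivial h, fun _ h => absurd (Nat.succ_injective h) h0,
      fun _ _ => typeALastFormula h1 H hΨ, fun h => h.elim⟩, hstrict⟩

theorem hasExplicitIso_C {hn : 2 ≤ n} {i : Fin (C n hn).rank} (h0 : (i : ℕ) = 0) :
    (C n hn).HasExplicitIso i := by
  intro hi
  have H := chainData_C h0
  obtain ⟨Ψ, hΨ, hstrict⟩ := H.crystalRel.exists_iso H.toWeightData hi
  exact ⟨Ψ, ⟨fun _ h => absurd trivial h, fun h => h.elim, fun h => h.elim,
    fun _ => typeCFormula h0 hΨ⟩, hstrict⟩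

end AffineType

theorem proposition5p1 (t : AffineType) (i : Fin t.rank)
    (hadj : t.cartan 0 i.succ ≠ 0) (hi : t.simpleRoot i ∈ t.positiveWeights) :
    ∃ Ψ : Crystal.Iso t.thetaCrystal
        ((t.thetaCrystal.tensor t.thetaCrystal).componentCrystal (t.xTheta, t.yVertex i hi)),
      t.ExplicitFormula i (fun b => (Ψ.toEquiv b : t.vertices × t.vertices)) ∧
      Crystal.IsStrictMorphism (t.thetaCrystal.tensor t.thetaCrystal) t.thetaCrystal
        Ψ.inverseByZero := by
  suffices h : t.HasExplicitIso i from h hi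
  cases t with
  | A n hn => exact hasExplicitIso_A (val_eq_of_joined_A hadj)
  | B n hn => exact (gradedData_B n hn).hasExplicitIso (Fin.ext (val_eq_of_joined_B hadj)) id id
  | C n hn => exact hasExplicitIso_C (val_eq_of_joined_C hadj)
  | D n hn => exact (gradedData_D n hn).hasExplicitIso (Fin.ext (val_eq_of_joined_D hadj)) id id
  | E6 => exact gradedData_E6.hasExplicitIso ((show ∀ i : Fin E6.rank, E6.cartan 0 i.succ ≠ 0 →
      i = ⟨5, by decide⟩ by decide) i hadj) id id
  | E7 => exact gradedData_E7.hasExplicitIso ((show ∀ i : Fin E7.rank, E7.cartan 0 i.succ ≠ 0 →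
      i = ⟨0, by decide⟩ by decide) i hadj) id id
  | E8 => exact gradedData_E8.hasExplicitIso ((show ∀ i : Fin E8.rank, E8.cartan 0 i.succ ≠ 0 →
      i = ⟨0, by decide⟩ by decide) i hadj) id id
  | F4 => exact gradedData_F4.hasExplicitIso ((show ∀ i : Fin F4.rank, F4.cartan 0 i.succ ≠ 0 →
      i = ⟨0, by decide⟩ by decide) i hadj) id id
  | G2 => exact gradedData_G2.hasExplicitIso ((show ∀ i : Fin G2.rank, G2.cartan 0 i.succ ≠ 0 →
      i = vertexG2 0 by decide) i hadj) id id
  | A2Even n hn => exact absurd hi.1 (A2Even.not_isWeight_simpleRoot i)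
  | A2Odd n hn =>
    exact (gradedData_A2Odd n hn).hasExplicitIso (Fin.ext (val_eq_of_joined_A2Odd hadj)) id id
  | D2 n hn => exact absurd hi.1 (D2.not_isWeight_simpleRoot (val_eq_of_joined_D2 hadj))
  | E62 => exact gradedData_E62.hasExplicitIso ((show ∀ i : Fin E62.rank, E62.cartan 0 i.succ ≠ 0 →
      i = ⟨0, by decide⟩ by decide) i hadj) id id
  | D43 => exact gradedData_D43.hasExplicitIso ((show ∀ i : Fin D43.rank, D43.cartan 0 i.succ ≠ 0 →
      i = ⟨0, by decide⟩ by decide) i hadj) id id
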